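/- \textbf{Setting.} Let $\mathcal H(2,2)$ be the stratum of compact connected translation surfaces $(X,\omega)$ of genus $3$ whose one-form $\omega$ has exactly two zeros, both double. Let $\mathcal L\subset\mathcal H(2,2)$ be the hyperelliptic locus of the non-hyperelliptic component, i.e. the set of $(X,\omega)\in\mathcal H(2,2)$ having a hyperelliptic involution $\tau$ (an involution with $\tau^*\omega=-\omega$ and exactly $2g+2=8$ fixed points) that does not interchange the two zeros, so fixes both of them. The vertical direction is \emph{completely periodic} if every regular point of $X$ lies on a vertical cylinder (a maximal subset swept out by closed vertical geodesics) or on a vertical saddle connection. Cutting $X$ along its vertical saddle connections then yields the vertical cylinders; the \emph{configuration} of $(X,\omega)$ consists of the cyclic upward sequences of saddle connections on the left and the right boundary of every cylinder, together with the action of $\tau$ on cylinders and saddle connections, up to relabelling. A cylinder is \emph{fixed} if $\tau$ maps it to itself, and \emph{simple} if each of its two boundaries is a single saddle connection. \textbf{Theorem.} Let $(X,\omega)\in\mathcal L$ and assume that the vertical direction is completely periodic. Then there are at most four vertical cylinders, and if there are at least two, the configuration is exactly one of the following eleven. Conversely each of the eleven occurs for some $(X,\omega)\in\mathcal L$. Here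 the six saddle connections are $0,\dots,5$, and $(L\,|\,R)$ denotes a cylinder with left boundary $L$ and right boundary $R$, both read upwards in cyclic order. The involution $\tau$ acts on the saddle connections by the given permutation, reversing their orientation, and sends $(L\,|\,R)$ to the cylinder whose left boundary consists of the saddle connections $\tau(R)$ and whose right boundary consists of those in $\tau(L)$. \begin{enumerate} \item Four configurations with two cylinders. One has two exchanged cylinders, none simple: (h) $(0\,1\,2\,|\,3\,4\,5),\ (3\,5\,4\,|\,0\,2\,1)$, $\tau=\mathrm{id}$. Three have two fixed cylinders: (i) no simple cylinder: $(0\,1\,2\,|\,0\,3\,4),\ (3\,5\,4\,|\,1\,5\,2)$, $\tau=(1\,4)(2\,3)$; (j) no simple cylinder: $(0\,1\,|\,2\,3),\ (2\,4\,3\,5\,|\,0\,4\,1\,5)$, $\tau=(0\,3)(1\,2)$; (k) one simple cylinder: $(0\,|\,1),\ (1\,2\,3\,4\,5\,|\,0\,2\,4\,3\,5)$, $\tau=(0\,1)(2\,5)$. \item Four configurations with three cylinders. Two have exactly one fixed cylinder: (a) no simple cylinder: $(0\,|\,1\,2\,3),\ (1\,3\,2\,|\,4),\ (4\,5\,|\,0\,5)$,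 $\tau=(0\,4)$; (b) one simple cylinder, which is fixed: $(0\,|\,1),\ (1\,2\,|\,3\,4\,5),\ (3\,5\,4\,|\,0\,2)$, $\tau=(0\,1)$. Two have three fixed cylinders: (c) no simple cylinder: $(0\,1\,|\,2\,3),\ (2\,4\,|\,0\,5),\ (3\,5\,|\,1\,4)$, $\tau=(0\,2)(1\,3)(4\,5)$; (d) two simple cylinders: $(0\,|\,1),\ (1\,2\,3\,4\,|\,0\,2\,5\,4),\ (5\,|\,3)$, $\tau=(0\,1)(2\,4)(3\,5)$. \item Three configurations with four cylinders, all with exactly two fixed cylinders. Two have two simple cylinders: (e) the simple cylinders are exchanged: $(0\,|\,1),\ (1\,2\,|\,2\,3),\ (3\,|\,4),\ (4\,5\,|\,0\,5)$, $\tau=(0\,4)(1\,3)$; (f) the simple cylinders are fixed: $(0\,|\,1),\ (1\,2\,|\,3\,4),\ (3\,|\,5),\ (4\,5\,|\,0\,2)$, $\tau=(0\,1)(3\,5)$. One has exactly one simple cylinder, which is fixed: (g) $(0\,|\,1),\ (1\,2\,|\,3),\ (3\,4\,|\,4\,5),\ (5\,|\,0\,2)$, $\tau=(0\,1)(3\,5)$.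 \end{enumerate} -/

import Mathlib

open Topology

/-- A translation surface on the topological space `X`, i.e. an abelian differential `ω` in local
normal form: every point `p` has a complex coordinate `chart p`, centred at `p`, in which
`ω = d (z ^ (ord p + 1))`. Where `ord p = 0` the coordinate is a translation chart; the points with
`ord p ≠ 0` are the singularities (the zeros of `ω`, of multiplicity `ord p`, with cone angle
`2π (ord p + 1)`). The local primitives `z ^ (ord p + 1)` of `ω` differ by locally constant
functions on overlaps; in particular transition maps between translation charts are
translations. -/
structure TranslationSurface (X : Type*) [TopologicalSpace X] where
  ord : X → ℕ
  chart : X → OpenPartialHomeomorph X ℂ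
  mem_source : ∀ p, p ∈ (chart p).source
  chart_self : ∀ p, chart p p = 0
  compat : ∀ p q x, x ∈ (chart p).source → x ∈ (chart q).source →
    ∃ c : ℂ, ∀ᶠ y in 𝓝 x, chart p y ^ (ord p + 1) = chart q y ^ (ord q + 1) + c

/-- The open vertical strip `{0 < Re z < w}`. -/
def openStrip (w : ℝ) : Set ℂ := {z | 0 < z.re ∧ z.re < w}

/-- The closed vertical strip `{0 ≤ Re z ≤ w}`. -/
def closedStrip (w : ℝ) : Set ℂ := {z | 0 ≤ z.re ∧ z.re ≤ w}

/-- The combinatorics of a decomposition into vertical cylinders together with the action of an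
involution: `left j` (resp. `right j`) lists, in upward cyclic order, the saddle connections on the
left (resp. right) boundary of the `j`-th cylinder; `cylInv` and `sadInv` are the actions of the
involution on the cylinders and on the saddle connections. -/
structure Configuration where
  numCyl : ℕ
  numSad : ℕ
  left : Fin numCyl → List (Fin numSad)
  right : Fin numCyl → List (Fin numSad)
  cylInv : Fin numCyl → Fin numCyl
  sadInv : Fin numSad → Fin numSad

namespace Configuration

/-- The number of cylinders that are fixed by the involution. -/
def numFixed (K : Configuration) : ℕ :=
  (Finset.univ.filter fun j => K.cylInv j = j).card

/-- The number of simple cylinders: each boundary is a single saddle connection. -/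
def numSimple (K : Configuration) : ℕ :=
  (Finset.univ.filter fun j => (K.left j).length = 1 ∧ (K.right j).length = 1).card

/-- The number of simple cylinders that are fixed by the involution. -/
def numSimpleFixed (K : Configuration) : ℕ :=
  (Finset.univ.filter fun j =>
    K.cylInv j = j ∧ (K.left j).length = 1 ∧ (K.right j).length = 1).card

end Configuration

/-- `RunsAlong β γ ℓ a L`: from time `a` on, the path `β` runs successively along the paths
`γ e`, `0 ≤ t ≤ ℓ e`, for `e` in the list `L`. -/
def RunsAlong {X ι : Type*} (β : ℝ → X) (γ : ι → ℝ → X) (ℓ : ι → ℝ) : ℝ → List ι → Prop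
  | _, [] => True
  | a, e :: L => (∀ t ∈ Set.Icc 0 (ℓ e), β (a + t) = γ e t) ∧ RunsAlong β γ ℓ (a + ℓ e) L

namespace TranslationSurface

variable {X : Type*} [TopologicalSpace X] (S : TranslationSurface X)

/-- `S` lies in the stratum `H(2,2)`: exactly two singularities, both double zeros. -/
def InStratumTwoTwo : Prop :=
  ∃ p q : X, p ≠ q ∧ S.ord p = 2 ∧ S.ord q = 2 ∧ ∀ x, x ≠ p → x ≠ q → S.ord x = 0

/-- `τ` is the hyperelliptic involution of the surface `S` of genus `g`: an involution with
`τ^* ω = -ω` (so `τ` is holomorphic) that has exactly `2 g + 2` fixed points. -/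
def IsHyperellipticInvolution (g : ℕ) (τ : X → X) : Prop :=
  Continuous τ ∧ Function.Involutive τ ∧
  (∀ x, ∀ᶠ y in 𝓝 x,
    S.chart (τ x) (τ y) ^ (S.ord (τ x) + 1) = -(S.chart x y ^ (S.ord x + 1))) ∧
  (Function.fixedPoints τ).encard = 2 * g + 2

/-- `S`, with hyperelliptic involution `τ`, belongs to the hyperelliptic locus of the
non-hyperelliptic component of `H(2,2)` (genus `3`). The hyperelliptic component of `H(2,2)`
consists of the hyperelliptic surfaces whose involution interchanges the two zeros; so membership
in the other component means that `τ` fixes both zeros. -/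
def InLocusL (τ : X → X) : Prop :=
  S.InStratumTwoTwo ∧ S.IsHyperellipticInvolution 3 τ ∧ ∀ p, S.ord p ≠ 0 → τ p = p

/-- On the set `I` of times, `γ` is a vertical unit speed geodesic (upwards) through regular
points. -/
def IsVerticalOn (γ : ℝ → X) (I : Set ℝ) : Prop :=
  ∀ t ∈ I, S.ord (γ t) = 0 ∧ ∀ᶠ s in 𝓝 t,
    γ s ∈ (S.chart (γ t)).source ∧ S.chart (γ t) (γ s) = ((s - t : ℝ) : ℂ) * Complex.I

/-- `γ`, on `[0, ℓ]`, is a vertical saddle connection of length `ℓ`. -/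
def IsVerticalSaddle (γ : ℝ → X) (ℓ : ℝ) : Prop :=
  0 < ℓ ∧ ContinuousOn γ (Set.Icc 0 ℓ) ∧ S.ord (γ 0) ≠ 0 ∧ S.ord (γ ℓ) ≠ 0 ∧
    S.IsVerticalOn γ (Set.Ioo 0 ℓ)

/-- `f` induces an embedding, locally given by translations, of the open flat vertical cylinder
`{0 < Re z < w} / (z ∼ z + i h)` into the regular part of the surface. -/
def IsCylinderMap (f : ℂ → X) (w h : ℝ) : Prop :=
  0 < w ∧ 0 < h ∧
  (∀ z ∈ openStrip w, S.ord (f z) = 0 ∧ ∀ᶠ z' in 𝓝 z,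
    f z' ∈ (S.chart (f z)).source ∧ S.chart (f z) (f z') = z' - z) ∧
  ∀ z ∈ openStrip w, ∀ z' ∈ openStrip w,
    f z = f z' ↔ ∃ n : ℤ, z' = z + (n : ℂ) * ((h : ℂ) * Complex.I)

/-- An (open) vertical cylinder of the surface: a maximal subset swept out by closed vertical
geodesics. -/
def IsVerticalCylinder (C : Set X) : Prop :=
  Maximal (fun D : Set X => ∃ f w h, S.IsCylinderMap f w h ∧ D = f '' openStrip w) C

/-- The set of all vertical cylinders. -/
def verticalCylinders : Set (Set X) := {C | S.IsVerticalCylinder C}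

/-- The vertical direction is completely periodic: the surface decomposes completely into vertical
cylinders and vertical saddle connections. -/
def IsVerticallyCompletelyPeriodic : Prop :=
  ∀ p, S.ord p = 0 → (∃ C, S.IsVerticalCylinder C ∧ p ∈ C) ∨
    ∃ γ ℓ, S.IsVerticalSaddle γ ℓ ∧ p ∈ γ '' Set.Ioo 0 ℓ

/-- A geometric realization of the configuration `K` on the surface `S` with involution `τ`: the
surface, cut along the vertical saddle connections `saddle e`, is the disjoint union of the open
cylinders `cyl j`; the closed cylinders are glued along the saddle connections as `K` prescribes;
and `τ` permutes cylinders and saddle connections as `K` prescribes. -/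
structure Realization (τ : X → X) (K : Configuration) where
  saddle : Fin K.numSad → ℝ → X
  length : Fin K.numSad → ℝ
  cyl : Fin K.numCyl → ℂ → X
  width : Fin K.numCyl → ℝ
  height : Fin K.numCyl → ℝ
  twist : Fin K.numCyl → ℝ
  saddle_vertical : ∀ e, S.IsVerticalSaddle (saddle e) (length e)
  saddle_disjoint : ∀ e e', ∀ t ∈ Set.Ioo 0 (length e), ∀ t' ∈ Set.Ioo 0 (length e'),
    saddle e t = saddle e' t' → e = e' ∧ t = t'
  cyl_map : ∀ j, S.IsCylinderMap (cyl j) (width j) (height j)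
  cyl_continuous : ∀ j, ContinuousOn (cyl j) (closedStrip (width j))
  cyl_disjoint : ∀ j j', j ≠ j' →
    Disjoint (cyl j '' openStrip (width j)) (cyl j' '' openStrip (width j'))
  cover : ∀ p, S.ord p = 0 → (∃ j, p ∈ cyl j '' openStrip (width j)) ∨
    ∃ e, p ∈ saddle e '' Set.Ioo 0 (length e)
  left_height : ∀ j, ((K.left j).map length).sum = height j
  right_height : ∀ j, ((K.right j).map length).sum = height j
  left_runs : ∀ j, RunsAlong (fun y : ℝ => cyl j ((y : ℂ) * Complex.I))
    saddle length 0 (K.left j)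
  right_runs : ∀ j, RunsAlong (fun y : ℝ => cyl j ((width j : ℂ) + (y : ℂ) * Complex.I))
    saddle length (twist j) (K.right j)
  inv_cyl : ∀ j, τ '' (cyl j '' openStrip (width j)) =
    cyl (K.cylInv j) '' openStrip (width (K.cylInv j))
  inv_length : ∀ e, length (K.sadInv e) = length e
  inv_saddle : ∀ e, ∀ t ∈ Set.Icc 0 (length e),
    τ (saddle e t) = saddle (K.sadInv e) (length e - t)

/-- The vertical cylinder decomposition of `S`, with the action of `τ`, has configuration `K`. -/
def HasConfiguration (τ : X → X) (K : Configuration) : Prop :=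
  Nonempty (S.Realization τ K)

end TranslationSurface

/-- Names of the eleven configurations. -/
inductive ConfigType
  | a | b | c | d | e | f | g | h | i | j | k

/-- The eleven configurations; all of them have six saddle connections. -/
def ConfigType.config : ConfigType → Configuration
  | .a => { numCyl := 3, numSad := 6
            left := ![[0], [1, 3, 2], [4, 5]]
            right := ![[1, 2, 3], [4], [0, 5]]
            cylInv := ![1, 0, 2], sadInv := ![4, 1, 2, 3, 0, 5] }
  | .b => { numCyl := 3, numSad := 6
            left := ![[0], [1, 2], [3, 5, 4]]
            right := ![[1], [3, 4, 5], [0, 2]]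
            cylInv := ![0, 2, 1], sadInv := ![1, 0, 2, 3, 4, 5] }
  | .c => { numCyl := 3, numSad := 6
            left := ![[0, 1], [2, 4], [3, 5]]
            right := ![[2, 3], [0, 5], [1, 4]]
            cylInv := ![0, 1, 2], sadInv := ![2, 3, 0, 1, 5, 4] }
  | .d => { numCyl := 3, numSad := 6
            left := ![[0], [1, 2, 3, 4], [5]]
            right := ![[1], [0, 2, 5, 4], [3]]
            cylInv := ![0, 1, 2], sadInv := ![1, 0, 4, 5, 2, 3] }
  | .e => { numCyl := 4, numSad := 6
            left := ![[0], [1, 2], [3], [4, 5]]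
            right := ![[1], [2, 3], [4], [0, 5]]
            cylInv := ![2, 1, 0, 3], sadInv := ![4, 3, 2, 1, 0, 5] }
  | .f => { numCyl := 4, numSad := 6
            left := ![[0], [1, 2], [3], [4, 5]]
            right := ![[1], [3, 4], [5], [0, 2]]
            cylInv := ![0, 3, 2, 1], sadInv := ![1, 0, 2, 5, 4, 3] }
  | .g => { numCyl := 4, numSad := 6
            left := ![[0], [1, 2], [3, 4], [5]]
            right := ![[1], [3], [4, 5], [0, 2]]
            cylInv := ![0, 3, 2, 1], sadInv := ![1, 0, 2, 5, 4, 3] }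
  | .h => { numCyl := 2, numSad := 6
            left := ![[0, 1, 2], [3, 5, 4]]
            right := ![[3, 4, 5], [0, 2, 1]]
            cylInv := ![1, 0], sadInv := ![0, 1, 2, 3, 4, 5] }
  | .i => { numCyl := 2, numSad := 6
            left := ![[0, 1, 2], [3, 5, 4]]
            right := ![[0, 3, 4], [1, 5, 2]]
            cylInv := ![0, 1], sadInv := ![0, 4, 3, 2, 1, 5] }
  | .j => { numCyl := 2, numSad := 6
            left := ![[0, 1], [2, 4, 3, 5]]
            right := ![[2, 3], [0, 4, 1, 5]]
            cylInv := ![0, 1], sadInv := ![3, 2, 1, 0, 4, 5] }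
  | .k => { numCyl := 2, numSad := 6
            left := ![[0], [1, 2, 3, 4, 5]]
            right := ![[1], [0, 2, 4, 3, 5]]
            cylInv := ![0, 1], sadInv := ![1, 0, 5, 3, 4, 2] }

/-- Number of cylinders, of fixed cylinders, of simple cylinders and of fixed simple cylinders. -/
def ConfigType.profile (T : ConfigType) : ℕ × ℕ × ℕ × ℕ :=
  (T.config.numCyl, T.config.numFixed, T.config.numSimple, T.config.numSimpleFixed)

/-! At a double zero the local primitive `z ^ 3` of the differential has three branches, so three
vertical rays leave each zero upwards. This gives six separatrices, labelled by a zero and an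
element of `ZMod 3`. A geodesic that runs into a zero never meets a cylinder, so complete
periodicity turns every separatrix into a saddle connection. The half turn `τ` fixes the zeros and
is `ζ ↦ -ζ` in the charts there. As it reverses saddle connections, it induces an involution `t` on
the six separatrices. Let `ρ` be the rotation by `2π` about the zeros. Above the saddle connection
`e`, on the left boundary of the cylinder to its right, follows `ρ⁻¹ (t e) = ρ (ρ (t e))`. Hence the
maximal cylinders correspond to the cycles of this permutation
(`ClosedCylinderSystem.image_eq_iff`). The half turn permutes the cylinders by an involution `p`,
and the right boundary of `C` is the image of the left boundary of `τ C`. So `t` and `p` determine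
the configuration (`ClosedCylinderSystem.exists_realization`).

Two constraints restrict `t` and `p`. The eight fixed points of `τ` are the two zeros, the midpoints
of the fixed saddle connections and two points in each fixed cylinder
(`IsHalfTurn.encard_fixedPoints`); so the number of fixed saddle connections plus twice the number
of fixed cylinders is 6. Moreover a cylinder and its image have the same height, which is the sum of
the lengths along the left boundary, and `x` and `t x` have the same length. Therefore the numbers
of sides taken from the pairs `{x, t x}` cannot be dominated, with strict inequality somewhere, by
those of the image cylinder. A finite search (`searchInvol`, `exists_model`) shows that with at
least two cylinders these constraints leave eleven pairs, up to permutations that commute with `ρ`.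
The bound on the number of cylinders is then read off.

The configuration is unique because the cylinders of any realization are exactly the maximal ones,
and the number of saddle connections on a boundary is the number of zeros met by the boundary
circle. The resulting multiset `Configuration.lengths` separates the eleven types.

Conversely, each configuration is realized by an explicit square-tiled surface. Squares are cut into
quarters folded onto the unit square, so that all gluings become identities in the folded
coordinates. The charts are built on the stars of the corners, with a cube root at the two singular
vertices, and a finite check of permutations supplies the rest (`Origami.Tiling.realization`,
`Origami.Blueprint.occurs`). -/

set_option linter.unusedSectionVars false

/-- The open-and-closed argument behind the continuation arguments: a locally constant truth value
is constant on a preconnected set. -/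
theorem IsPreconnected.forall_of_eventually_iff {α : Type*} [TopologicalSpace α] {s : Set α}
    (hs : IsPreconnected s) {P : α → Prop} (h : ∀ x ∈ s, ∀ᶠ y in 𝓝[s] x, (P y ↔ P x))
    {a : α} (ha : a ∈ s) (hPa : P a) : ∀ x ∈ s, P x := by
  intro x hx
  have := hs.induction₂ (fun x y => (P y ↔ P x)) h (fun x y z _ _ _ h1 h2 => h2.trans h1)
    (fun x y _ _ h => h.symm) ha hx
  exact this.2 hPa

/-! ### Germs of translation maps and of vertical geodesics, and their behaviour under half turns -/

namespace TranslationSurface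

variable {X : Type*} [TopologicalSpace X] (S : TranslationSurface X)

/-- Near `z`, the map `f` is a translation into the regular part of the surface. -/
def IsTransAt (f : ℂ → X) (z : ℂ) : Prop :=
  S.ord (f z) = 0 ∧ ∀ᶠ z' in 𝓝 z,
    f z' ∈ (S.chart (f z)).source ∧ S.chart (f z) (f z') = z' - z

/-- Near `t`, the path `γ` is an upward vertical unit speed geodesic through regular points. -/
def IsVertAt (γ : ℝ → X) (t : ℝ) : Prop :=
  S.ord (γ t) = 0 ∧ ∀ᶠ s in 𝓝 t,
    γ s ∈ (S.chart (γ t)).source ∧ S.chart (γ t) (γ s) = ((s - t : ℝ) : ℂ) * Complex.I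

/-- A half turn of the surface, fixing all singularities. -/
structure IsHalfTurn (τ : X → X) : Prop where
  continuous : Continuous τ
  involutive : Function.Involutive τ
  anti : ∀ x, ∀ᶠ y in 𝓝 x,
    S.chart (τ x) (τ y) ^ (S.ord (τ x) + 1) = -(S.chart x y ^ (S.ord x + 1))
  fix : ∀ p, S.ord p ≠ 0 → τ p = p

variable {S}

theorem zero_mem_target (p : X) : (0 : ℂ) ∈ (S.chart p).target := by
  have := (S.chart p).map_source (S.mem_source p)
  rwa [S.chart_self] at this

theorem symm_zero (p : X) : (S.chart p).symm 0 = p := by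
  have := (S.chart p).left_inv (S.mem_source p)
  rwa [S.chart_self] at this

theorem continuousAt_symm_zero (p : X) : ContinuousAt (S.chart p).symm 0 :=
  (S.chart p).continuousAt_symm (zero_mem_target p)

theorem map_symm_nhds_zero (p : X) : Filter.map (S.chart p).symm (𝓝 0) = 𝓝 p := by
  rw [(S.chart p).symm.map_nhds_eq (zero_mem_target p)]
  simp [symm_zero]

theorem source_mem_nhds (p : X) : (S.chart p).source ∈ 𝓝 p :=
  (S.chart p).open_source.mem_nhds (S.mem_source p)

section Germs

variable {f g : ℂ → X} {z z' : ℂ}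

theorem IsTransAt.eventually_eq (hf : S.IsTransAt f z) :
    ∀ᶠ u in 𝓝 z, f u = (S.chart (f z)).symm (u - z) := by
  filter_upwards [hf.2] with u hu
  rw [← hu.2, (S.chart (f z)).left_inv hu.1]

theorem isTransAt_symm {p : X} (hp : S.ord p = 0) : S.IsTransAt (S.chart p).symm 0 := by
  refine ⟨by rwa [symm_zero], ?_⟩
  rw [symm_zero]
  filter_upwards [(S.chart p).open_target.mem_nhds (zero_mem_target p)] with u hu
  exact ⟨(S.chart p).map_target hu, by rw [(S.chart p).right_inv hu, sub_zero]⟩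

theorem IsTransAt.congr (hf : S.IsTransAt f z) (h : f =ᶠ[𝓝 z] g) : S.IsTransAt g z := by
  have hz : f z = g z := h.eq_of_nhds
  refine ⟨hz ▸ hf.1, ?_⟩
  filter_upwards [h, hf.2] with u h1 h2
  rwa [← hz, ← h1]

theorem IsTransAt.comp_add {c : ℂ} (hf : S.IsTransAt f (z + c)) :
    S.IsTransAt (fun u => f (u + c)) z := by
  refine ⟨hf.1, ?_⟩
  have : Filter.Tendsto (fun u => u + c) (𝓝 z) (𝓝 (z + c)) :=
    (continuous_id.add continuous_const).tendsto z
  filter_upwards [this.eventually hf.2] with u hu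
  exact ⟨hu.1, by rw [hu.2]; ring⟩

theorem IsTransAt.continuousAt (hf : S.IsTransAt f z) : ContinuousAt f z := by
  have h1 : ContinuousAt (fun u => (S.chart (f z)).symm (u - z)) z := by
    refine ContinuousAt.comp (f := fun u => u - z) ?_ (by fun_prop)
    simpa using continuousAt_symm_zero (f z)
  exact h1.congr (hf.eventually_eq.mono fun u hu => hu.symm)

theorem tendsto_add_zero {α : Type*} [TopologicalSpace α] [AddMonoid α] [ContinuousAdd α] (z : α) :
    Filter.Tendsto (fun u : α => z + u) (𝓝 0) (𝓝 z) := by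
  have : Continuous fun u : α => z + u := by fun_prop
  simpa using this.tendsto 0

theorem IsTransAt.map_nhds (hf : S.IsTransAt f z) : Filter.map f (𝓝 z) = 𝓝 (f z) := by
  rw [Filter.map_congr hf.eventually_eq, ← map_symm_nhds_zero (S := S) (f z)]
  have : (fun u => (S.chart (f z)).symm (u - z)) = (S.chart (f z)).symm ∘ (fun u => u - z) := rfl
  rw [this, ← Filter.map_map]
  congr 1
  simpa using (Homeomorph.subRight z).map_nhds_eq z

/-- Both germs are the inverse of the chart at the common value, up to a shift of the variable. -/
theorem IsTransAt.local_eq (hf : S.IsTransAt f z) (hg : S.IsTransAt g z') (h : f z = g z') :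
    ∀ᶠ u in 𝓝 (0 : ℂ), f (z + u) = g (z' + u) := by
  filter_upwards [(tendsto_add_zero z).eventually hf.eventually_eq,
    (tendsto_add_zero z').eventually hg.eventually_eq] with u h1 h2
  rw [h1, h2, h]; simp

/-- Nearby values are regular because the singular set is closed, and by `compat` the charts at two
regular points differ by a translation. -/
theorem IsTransAt.eventually (hS : IsClosed {x | S.ord x ≠ 0}) (hf : S.IsTransAt f z) :
    ∀ᶠ u in 𝓝 z, S.IsTransAt f u := by
  have hreg : ∀ᶠ u in 𝓝 z, S.ord (f u) = 0 := by
    have : {x | S.ord x ≠ 0}ᶜ ∈ 𝓝 (f z) := hS.isOpen_compl.mem_nhds (by simpa using hf.1)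
    filter_upwards [hf.continuousAt this] with u hu
    simpa using hu
  have hcont : ∀ᶠ u in 𝓝 z, ContinuousAt f u := by
    have h1 : ∀ᶠ u in 𝓝 z, u - z ∈ (S.chart (f z)).target := by
      have : Filter.Tendsto (fun u => u - z) (𝓝 z) (𝓝 0) := by
        have : Continuous fun u : ℂ => u - z := by fun_prop
        simpa using this.tendsto z
      exact this ((S.chart (f z)).open_target.mem_nhds (zero_mem_target (f z)))
    filter_upwards [hf.eventually_eq.eventually_nhds, h1] with u hu h1
    have h2 : ContinuousAt (fun u => (S.chart (f z)).symm (u - z)) u :=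
      ContinuousAt.comp (f := fun u => u - z) ((S.chart (f z)).continuousAt_symm h1) (by fun_prop)
    exact h2.congr (hu.mono fun _ h => h.symm)
  filter_upwards [hreg, hcont, hf.2.eventually_nhds] with u h1 h2 h3
  refine ⟨h1, ?_⟩
  obtain ⟨c, hc⟩ := S.compat (f z) (f u) (f u) h3.self_of_nhds.1 (S.mem_source _)
  rw [hf.1, h1] at hc
  simp only [zero_add, pow_one] at hc
  have hcu := hc.self_of_nhds
  rw [S.chart_self, h3.self_of_nhds.2] at hcu
  filter_upwards [h3, h2 (source_mem_nhds (f u)), h2.eventually hc] with v hv1 hv2 hv3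
  refine ⟨hv2, ?_⟩
  rw [hv1.2] at hv3
  linear_combination hcu - hv3

theorem IsTransAt.isVertAt {c : ℂ} {t : ℝ} (hf : S.IsTransAt f (c + t * Complex.I)) :
    S.IsVertAt (fun s : ℝ => f (c + s * Complex.I)) t := by
  refine ⟨hf.1, ?_⟩
  have : Continuous fun s : ℝ => c + s * Complex.I := by fun_prop
  filter_upwards [(this.tendsto t).eventually hf.2] with s hs
  exact ⟨hs.1, by rw [hs.2]; push_cast; ring⟩

theorem IsVertAt.eventually_eq {γ : ℝ → X} {t : ℝ} (hγ : S.IsVertAt γ t) :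
    ∀ᶠ s in 𝓝 t, γ s = (S.chart (γ t)).symm (((s - t : ℝ) : ℂ) * Complex.I) := by
  filter_upwards [hγ.2] with u hu
  rw [← hu.2, (S.chart (γ t)).left_inv hu.1]

theorem IsVertAt.comp_add {γ : ℝ → X} {t c : ℝ} (hγ : S.IsVertAt γ (t + c)) :
    S.IsVertAt (fun s => γ (s + c)) t := by
  refine ⟨hγ.1, ?_⟩
  have : Filter.Tendsto (fun u => u + c) (𝓝 t) (𝓝 (t + c)) :=
    (continuous_id.add continuous_const).tendsto t
  filter_upwards [this.eventually hγ.2] with u hu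
  exact ⟨hu.1, by rw [hu.2]; push_cast; ring⟩

theorem IsVertAt.local_eq {γ δ : ℝ → X} {t t' : ℝ} (hγ : S.IsVertAt γ t) (hδ : S.IsVertAt δ t')
    (h : γ t = δ t') : ∀ᶠ s in 𝓝 (0 : ℝ), γ (t + s) = δ (t' + s) := by
  filter_upwards [(tendsto_add_zero t).eventually hγ.eventually_eq,
    (tendsto_add_zero t').eventually hδ.eventually_eq] with u h1 h2
  rw [h1, h2, h]; simp

theorem IsVertAt.continuousAt {γ : ℝ → X} {t : ℝ} (hγ : S.IsVertAt γ t) : ContinuousAt γ t := by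
  have h1 : ContinuousAt (fun u : ℝ => (S.chart (γ t)).symm (((u - t : ℝ) : ℂ) * Complex.I)) t := by
    refine ContinuousAt.comp (f := fun u : ℝ => ((u - t : ℝ) : ℂ) * Complex.I) ?_ (by fun_prop)
    simpa using continuousAt_symm_zero (γ t)
  exact h1.congr (hγ.eventually_eq.mono fun u hu => hu.symm)

/-- Unique continuation: the coincidence set is open by `IsTransAt.local_eq`, and closed because the
surface is Hausdorff. -/
theorem IsTransAt.eqOn [T2Space X] {U : Set ℂ} (hU : IsPreconnected U)
    (hf : ∀ z ∈ U, S.IsTransAt f z) (hg : ∀ z ∈ U, S.IsTransAt g z) {z₀ : ℂ} (hz₀ : z₀ ∈ U)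
    (h : f z₀ = g z₀) : ∀ z ∈ U, f z = g z := by
  refine hU.forall_of_eventually_iff (fun z hz => ?_) hz₀ h
  by_cases hfg : f z = g z
  · have := (hf z hz).local_eq (hg z hz) hfg
    have h2 : Filter.Tendsto (fun u => u - z) (𝓝 z) (𝓝 0) := by
      have : Continuous fun u : ℂ => u - z := by fun_prop
      simpa using this.tendsto z
    filter_upwards [nhdsWithin_le_nhds (h2.eventually this)] with u hu
    simp only [add_sub_cancel] at hu
    simp [hu, hfg]
  · have h1 : ∀ᶠ u in 𝓝 z, f u ≠ g u :=
      ((hf z hz).continuousAt.prodMk (hg z hz).continuousAt).eventually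
        (isClosed_diagonal.isOpen_compl.mem_nhds hfg)
    filter_upwards [nhdsWithin_le_nhds h1] with u hu
    simp [hu, hfg]

theorem IsVertAt.eqOn [T2Space X] {γ δ : ℝ → X} {I : Set ℝ} (hI : IsPreconnected I)
    (hf : ∀ t ∈ I, S.IsVertAt γ t) (hg : ∀ t ∈ I, S.IsVertAt δ t) {t₀ : ℝ} (ht₀ : t₀ ∈ I)
    (h : γ t₀ = δ t₀) : ∀ t ∈ I, γ t = δ t := by
  refine hI.forall_of_eventually_iff (fun z hz => ?_) ht₀ h
  by_cases hfg : γ z = δ z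
  · have := (hf z hz).local_eq (hg z hz) hfg
    have h2 : Filter.Tendsto (fun u => u - z) (𝓝 z) (𝓝 0) := by
      have : Continuous fun u : ℝ => u - z := by fun_prop
      simpa using this.tendsto z
    filter_upwards [nhdsWithin_le_nhds (h2.eventually this)] with u hu
    simp only [add_sub_cancel] at hu
    simp [hu, hfg]
  · have h1 : ∀ᶠ u in 𝓝 z, γ u ≠ δ u :=
      ((hf z hz).continuousAt.prodMk (hg z hz).continuousAt).eventually
        (isClosed_diagonal.isOpen_compl.mem_nhds hfg)
    filter_upwards [nhdsWithin_le_nhds h1] with u hu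
    simp [hu, hfg]

end Germs

section HalfTurn

variable {τ : X → X} {f : ℂ → X} {z : ℂ}

/-- A regular point sent to a singularity would, by involutivity, be the image of that singularity,
which is fixed. -/
theorem IsHalfTurn.ord_eq (hτ : S.IsHalfTurn τ) (x : X) : S.ord (τ x) = S.ord x := by
  by_cases h : S.ord x = 0
  · by_contra h'
    have h1 : S.ord (τ x) ≠ 0 := by rwa [h] at h'
    have h2 := hτ.fix _ h1
    rw [hτ.involutive] at h2
    rw [← h2] at h1
    exact h1 h
  · rw [hτ.fix x h]

/-- In translation charts the half turn is `z ↦ -z` up to a constant; composing with a point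
reflection of the source gives a translation again. -/
theorem IsTransAt.anti (hτ : S.IsHalfTurn τ) {c : ℂ} (hf : S.IsTransAt f (c - z)) :
    S.IsTransAt (fun u => τ (f (c - u))) z := by
  have h0 : S.ord (τ (f (c - z))) = 0 := by rw [hτ.ord_eq]; exact hf.1
  refine ⟨h0, ?_⟩
  have hc : Filter.Tendsto (fun u => c - u) (𝓝 z) (𝓝 (c - z)) := by
    have : Continuous fun u : ℂ => c - u := by fun_prop
    exact this.tendsto z
  have h1 := hc.eventually (hf.continuousAt.eventually (hτ.anti (f (c - z))))
  have h2 := hc.eventually ((hτ.continuous.continuousAt.comp hf.continuousAt).eventually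
    (source_mem_nhds (S := S) (τ (f (c - z)))))
  filter_upwards [h1, h2, hc.eventually hf.2] with u h1 h2 h3
  refine ⟨h2, ?_⟩
  rw [h0, hf.1] at h1
  simp only [zero_add, pow_one] at h1
  rw [h1, h3.2]; ring

theorem IsVertAt.anti (hτ : S.IsHalfTurn τ) {γ : ℝ → X} {c t : ℝ} (hf : S.IsVertAt γ (c - t)) :
    S.IsVertAt (fun u => τ (γ (c - u))) t := by
  have h0 : S.ord (τ (γ (c - t))) = 0 := by rw [hτ.ord_eq]; exact hf.1
  refine ⟨h0, ?_⟩
  have hc : Filter.Tendsto (fun u => c - u) (𝓝 t) (𝓝 (c - t)) := by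
    have : Continuous fun u : ℝ => c - u := by fun_prop
    exact this.tendsto t
  have h1 := hc.eventually (hf.continuousAt.eventually (hτ.anti (γ (c - t))))
  have h2 := hc.eventually ((hτ.continuous.continuousAt.comp hf.continuousAt).eventually
    (source_mem_nhds (S := S) (τ (γ (c - t)))))
  filter_upwards [h1, h2, hc.eventually hf.2] with u h1 h2 h3
  refine ⟨h2, ?_⟩
  rw [h0, hf.1] at h1
  simp only [zero_add, pow_one] at h1
  rw [h1, h3.2]; push_cast; ring

end HalfTurn

end TranslationSurface

/-! ### Embedded cylinders: rigidity, unions, and disjointness of maximal cylinders -/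

theorem mem_openStrip {w : ℝ} {z : ℂ} : z ∈ openStrip w ↔ 0 < z.re ∧ z.re < w := Iff.rfl

theorem mem_closedStrip {w : ℝ} {z : ℂ} : z ∈ closedStrip w ↔ 0 ≤ z.re ∧ z.re ≤ w := Iff.rfl

theorem openStrip_subset_closedStrip (w : ℝ) : openStrip w ⊆ closedStrip w :=
  fun _ hz => ⟨hz.1.le, hz.2.le⟩

theorem isOpen_reStrip (a b : ℝ) : IsOpen {z : ℂ | a < z.re ∧ z.re < b} :=
  (isOpen_lt continuous_const Complex.continuous_re).inter
    (isOpen_lt Complex.continuous_re continuous_const)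

theorem isPreconnected_reStrip (a b : ℝ) : IsPreconnected {z : ℂ | a < z.re ∧ z.re < b} := by
  have : {z : ℂ | a < z.re ∧ z.re < b} = Complex.reLm ⁻¹' Set.Ioo a b := rfl
  rw [this]
  exact ((convex_Ioo a b).linear_preimage Complex.reLm).isPreconnected

theorem isOpen_openStrip (w : ℝ) : IsOpen (openStrip w) := isOpen_reStrip 0 w

namespace TranslationSurface

variable {X : Type*} [TopologicalSpace X] {S : TranslationSurface X}
  {f g F : ℂ → X} {w w' h h' : ℝ}

theorem IsCylinderMap.trans (hf : S.IsCylinderMap f w h) {z : ℂ} (hz : z ∈ openStrip w) :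
    S.IsTransAt f z := hf.2.2.1 z hz

theorem IsCylinderMap.isOpen_image (hf : S.IsCylinderMap f w h) :
    IsOpen (f '' openStrip w) := by
  rw [isOpen_iff_mem_nhds]
  rintro _ ⟨z, hz, rfl⟩
  rw [← (hf.trans hz).map_nhds]
  exact Filter.image_mem_map ((isOpen_openStrip w).mem_nhds hz)

theorem IsCylinderMap.re_eq (hf : S.IsCylinderMap f w h) {z z' : ℂ} (hz : z ∈ openStrip w)
    (hz' : z' ∈ openStrip w) (h0 : f z = f z') : z.re = z'.re := by
  obtain ⟨n, rfl⟩ := (hf.2.2.2 z hz z' hz').1 h0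
  simp

theorem add_period_mem {z : ℂ} (hz : z ∈ openStrip w) (n : ℤ) :
    z + (n : ℂ) * ((h : ℂ) * Complex.I) ∈ openStrip w := by
  simpa [mem_openStrip] using hz

theorem IsCylinderMap.periodic (hf : S.IsCylinderMap f w h) {z : ℂ} (hz : z ∈ openStrip w)
    (n : ℤ) : f (z + (n : ℂ) * ((h : ℂ) * Complex.I)) = f z :=
  ((hf.2.2.2 z hz _ (add_period_mem hz n)).2 ⟨n, rfl⟩).symm

/-- If the limit point `g b` were also `f z` with `z` inside, both germs would agree near it, and
points of the strip close to `b` would have the same images as points close to `z`. Injectivity up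
to the period forces equal real parts, but `b` lies on the edge. -/
theorem IsCylinderMap.boundary_notMem (hf : S.IsCylinderMap f w h) {b : ℂ}
    (hb : b.re = 0 ∨ b.re = w) (hg : S.IsTransAt g b)
    (hfg : ∀ᶠ z in 𝓝 b, z ∈ openStrip w → f z = g z) : g b ∉ f '' openStrip w := by
  rintro ⟨z, hz, hzb⟩
  have h1 := (hf.trans hz).local_eq hg hzb
  have h2 := (tendsto_add_zero b).eventually hfg
  have h3 := (tendsto_add_zero z).eventually ((isOpen_openStrip w).mem_nhds hz)
  obtain ⟨ε, hε, hball⟩ := Metric.eventually_nhds_iff.1 (h1.and (h2.and h3))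
  have hw := hf.1
  obtain ⟨u, hu, hbu⟩ : ∃ u : ℂ, dist u 0 < ε ∧ b + u ∈ openStrip w := by
    have hm : 0 < min (ε / 2) (w / 2) := by positivity
    have hm1 := min_le_left (ε / 2) (w / 2)
    have hm2 := min_le_right (ε / 2) (w / 2)
    set m := min (ε / 2) (w / 2)
    rcases hb with hb | hb
    · refine ⟨(m : ℝ), ?_, ?_⟩
      · simp only [dist_zero_right, Complex.norm_real, Real.norm_eq_abs, abs_of_pos hm]; linarith
      · rw [mem_openStrip]; simp [hb]; constructor <;> linarith
    · refine ⟨((-m : ℝ) : ℂ), ?_, ?_⟩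
      · simp only [dist_zero_right, Complex.norm_real, Real.norm_eq_abs, abs_neg, abs_of_pos hm]
        linarith
      · rw [mem_openStrip]; simp [hb]; constructor <;> linarith
  obtain ⟨h4, h5, h6⟩ := hball hu
  have h7 := hf.re_eq hbu h6 ((h5 hbu).trans h4.symm)
  simp only [Complex.add_re, add_left_inj] at h7
  rw [mem_openStrip, ← h7] at hz
  rcases hb with hb | hb <;> linarith [hz.1, hz.2]

/-- The period of `f` is a period of `g`, hence a positive integral multiple of `h'`. -/
theorem IsCylinderMap.height_dvd (hf : S.IsCylinderMap f w h) (hg : S.IsCylinderMap g w h')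
    {c : ℂ} (hc : c.re = 0) (hfg : ∀ z ∈ openStrip w, f z = g (z + c)) : h' ≤ h := by
  have hw := hf.1
  set z : ℂ := ((w / 2 : ℝ) : ℂ)
  have hz : z ∈ openStrip w := by rw [mem_openStrip]; simp [z]; linarith
  have hshift : ∀ u ∈ openStrip w, u + c ∈ openStrip w := by
    intro u hu; rw [mem_openStrip] at *; simpa [hc] using hu
  have h1 := hf.periodic hz 1
  have hz1 : z + ((1 : ℤ) : ℂ) * ((h : ℂ) * Complex.I) ∈ openStrip w := add_period_mem hz 1
  rw [hfg _ hz1, hfg _ hz] at h1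
  obtain ⟨n, hn⟩ := (hg.2.2.2 _ (hshift _ hz) _ (hshift _ hz1)).1 h1.symm
  have hn' := congrArg Complex.im hn
  simp at hn'
  have hn2 : h = n * h' := by linarith
  have hh := hf.2.1
  have hh' := hg.2.1
  have : 0 < (n : ℝ) := by
    by_contra hneg
    push Not at hneg
    nlinarith
  have : (1 : ℝ) ≤ n := by exact_mod_cast (by exact_mod_cast this : 0 < n)
  nlinarith

section T2

variable [T2Space X]

/-- The overlap of two vertical strips is again a strip, hence connected, so agreement at one point
continues to the whole overlap. -/
theorem IsCylinderMap.eq_shift (hf : S.IsCylinderMap f w h)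
    (hg : ∀ z ∈ openStrip w', S.IsTransAt g z) {z₀ z₀' : ℂ} (hz₀ : z₀ ∈ openStrip w)
    (hz₀' : z₀' ∈ openStrip w') (h0 : f z₀ = g z₀') {z : ℂ} (hz : z ∈ openStrip w)
    (hz' : z + (z₀' - z₀) ∈ openStrip w') : f z = g (z + (z₀' - z₀)) := by
  have hU : IsPreconnected {z : ℂ | max 0 (z₀.re - z₀'.re) < z.re ∧
      z.re < min w (w' + z₀.re - z₀'.re)} := isPreconnected_reStrip _ _
  have hmem : ∀ z : ℂ, (max 0 (z₀.re - z₀'.re) < z.re ∧ z.re < min w (w' + z₀.re - z₀'.re)) ↔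
      z ∈ openStrip w ∧ z + (z₀' - z₀) ∈ openStrip w' := by
    intro z
    simp only [mem_openStrip, max_lt_iff, lt_min_iff, Complex.add_re, Complex.sub_re]
    constructor
    · rintro ⟨⟨h1, h2⟩, h3, h4⟩; refine ⟨⟨h1, h3⟩, ?_, ?_⟩ <;> linarith
    · rintro ⟨⟨h1, h2⟩, h3, h4⟩; refine ⟨⟨h1, ?_⟩, h2, ?_⟩ <;> linarith
  refine IsTransAt.eqOn (S := S) (g := fun u => g (u + (z₀' - z₀))) hU
    (fun z hz => hf.trans ((hmem z).1 hz).1)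
    (fun z hz => (hg _ ((hmem z).1 hz).2).comp_add) (z₀ := z₀) ((hmem _).2 ⟨hz₀, by simpa using hz₀'⟩)
    (by simpa using h0) z ((hmem z).2 ⟨hz, hz'⟩)

/-- Otherwise an edge of the strip of `f`, moved to the strip of `g`, would lie in its interior, and
`g` would map it into the cylinder, against `boundary_notMem`. -/
theorem IsCylinderMap.re_le_of_subset (hf : S.IsCylinderMap f w h)
    (hg : ∀ z ∈ openStrip w', S.IsTransAt g z) (hsub : g '' openStrip w' ⊆ f '' openStrip w)
    {z₀ z₀' : ℂ} (hz₀ : z₀ ∈ openStrip w) (hz₀' : z₀' ∈ openStrip w') (h0 : f z₀ = g z₀') :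
    z₀'.re ≤ z₀.re ∧ w' - z₀'.re ≤ w - z₀.re := by
  have key : ∀ b : ℂ, (b.re = 0 ∨ b.re = w) → b + (z₀' - z₀) ∈ openStrip w' → False := by
    intro b hb hb'
    refine hf.boundary_notMem (g := fun u => g (u + (z₀' - z₀))) hb (hg _ hb').comp_add ?_
      (hsub ⟨_, hb', rfl⟩)
    have hc : ∀ᶠ z in 𝓝 b, z + (z₀' - z₀) ∈ openStrip w' := by
      have : Continuous fun z : ℂ => z + (z₀' - z₀) := by fun_prop
      exact (this.tendsto b).eventually ((isOpen_openStrip w').mem_nhds hb')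
    filter_upwards [hc] with z hz1 hz2
    exact hf.eq_shift hg hz₀ hz₀' h0 hz2 hz1
  rw [mem_openStrip] at hz₀ hz₀'
  constructor
  · by_contra hlt
    push Not at hlt
    refine key 0 (Or.inl rfl) ?_
    rw [mem_openStrip]; simp; constructor <;> linarith
  · by_contra hlt
    push Not at hlt
    refine key w (Or.inr (by simp)) ?_
    rw [mem_openStrip]; simp; constructor <;> linarith

/-- Two parametrizations of one cylinder differ by a vertical translation: the inclusions in both
directions fix the real parts, and the periods divide each other. -/
theorem IsCylinderMap.rigid (hf : S.IsCylinderMap f w h) (hg : S.IsCylinderMap g w' h')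
    (him : f '' openStrip w = g '' openStrip w') {z₀ z₀' : ℂ} (hz₀ : z₀ ∈ openStrip w)
    (hz₀' : z₀' ∈ openStrip w') (h0 : f z₀ = g z₀') :
    w = w' ∧ h = h' ∧ (z₀' - z₀).re = 0 ∧ ∀ z ∈ openStrip w, f z = g (z + (z₀' - z₀)) := by
  have h1 := hf.re_le_of_subset (fun z hz => hg.trans hz) him.ge hz₀ hz₀' h0
  have h2 := hg.re_le_of_subset (fun z hz => hf.trans hz) him.le hz₀' hz₀ h0.symm
  obtain rfl : w = w' := by linarith [h1.1, h1.2, h2.1, h2.2]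
  have hre : (z₀' - z₀).re = 0 := by simp; linarith [h1.1, h2.1]
  have hre' : (z₀ - z₀').re = 0 := by simp; linarith [h1.1, h2.1]
  have heq : ∀ z ∈ openStrip w, f z = g (z + (z₀' - z₀)) := fun z hz =>
    hf.eq_shift (fun z hz => hg.trans hz) hz₀ hz₀' h0 hz (by
      rw [mem_openStrip, Complex.add_re, hre, add_zero]; exact hz)
  refine ⟨rfl, le_antisymm ?_ ?_, hre, heq⟩
  · refine hg.height_dvd hf hre' fun z hz => ?_
    exact hg.eq_shift (fun z hz => hf.trans hz) hz₀' hz₀ h0.symm hz (by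
      rw [mem_openStrip, Complex.add_re, hre', add_zero]; exact hz)
  · exact hf.height_dvd hg hre heq

/-- A coincidence at different real parts makes `F` invariant under a transverse translation. The
closed band between the two points then has an image that is both open and compact, hence is the
whole connected surface. That surface would have no singularity. -/
theorem re_eq_of_periodic [CompactSpace X] [ConnectedSpace X] (hne : ∃ p, S.ord p ≠ 0) {α β : ℝ}
    (hF : ∀ z : ℂ, α < z.re → z.re < β → S.IsTransAt F z) (hh : 0 < h)
    (hper : ∀ z : ℂ, α < z.re → z.re < β → ∀ n : ℤ,
      F (z + (n : ℂ) * ((h : ℂ) * Complex.I)) = F z)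
    {z₁ z₂ : ℂ} (h₁ : α < z₁.re ∧ z₁.re < β) (h₂ : α < z₂.re ∧ z₂.re < β) (h0 : F z₁ = F z₂) :
    z₁.re = z₂.re := by
  wlog hlt : z₁.re < z₂.re generalizing z₁ z₂
  · rcases eq_or_lt_of_le (not_lt.1 hlt) with h3 | h3
    · exact h3.symm
    · exact (this h₂ h₁ h0.symm h3).symm
  exfalso
  obtain ⟨d, hd⟩ : ∃ d, d = z₂.re - z₁.re := ⟨_, rfl⟩
  have hdpos : 0 < d := by linarith
  have hshift : ∀ z : ℂ, α < z.re → z.re + d < β → F (z + (z₂ - z₁)) = F z := by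
    intro z hz hz'
    have := IsTransAt.eqOn (S := S) (f := F) (g := fun u => F (u + (z₂ - z₁)))
      (isPreconnected_reStrip α (β - d)) (fun z hz => hF z hz.1 (by linarith [hz.2]))
      (fun z hz => (hF _ (by simp; linarith [hz.1]) (by simp; linarith [hz.2])).comp_add)
      (z₀ := z₁) ⟨h₁.1, by linarith [h₂.2]⟩ (by simpa using h0) z ⟨hz, by linarith⟩
    exact this.symm
  set B : Set ℂ := {z | z₁.re ≤ z.re ∧ z.re ≤ z₂.re} with hB
  have hBF : ∀ z ∈ B, S.IsTransAt F z := fun z hz =>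
    hF z (lt_of_lt_of_le h₁.1 hz.1) (lt_of_le_of_lt hz.2 h₂.2)
  -- Points just outside the band are moved back into it by the shift, so the image is open at the
  -- two edges as well.
  have hopen : IsOpen (F '' B) := by
    rw [isOpen_iff_mem_nhds]
    rintro _ ⟨z, hz, rfl⟩
    rw [← (hBF z hz).map_nhds]
    have hN : {u : ℂ | max α (z₁.re - d) < u.re ∧ u.re < min β (z₂.re + d)} ∈ 𝓝 z := by
      refine (isOpen_reStrip _ _).mem_nhds ⟨max_lt ?_ ?_, lt_min ?_ ?_⟩ <;>
        linarith [hz.1, hz.2, h₁.1, h₂.2]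
    refine Filter.mem_of_superset (Filter.image_mem_map hN) ?_
    rintro _ ⟨u, ⟨hu1, hu2⟩, rfl⟩
    rw [max_lt_iff] at hu1
    rw [lt_min_iff] at hu2
    by_cases hc1 : u.re < z₁.re
    · refine ⟨u + (z₂ - z₁), ⟨?_, ?_⟩, hshift u hu1.1 (by linarith [h₂.2])⟩ <;> simp <;> linarith
    by_cases hc2 : z₂.re < u.re
    · refine ⟨u - (z₂ - z₁), ⟨?_, ?_⟩, ?_⟩
      · simp; linarith
      · simp; linarith
      · rw [← hshift (u - (z₂ - z₁)) (by simp; linarith) (by simp; linarith)]; simp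
    · exact ⟨u, ⟨not_lt.1 hc1, not_lt.1 hc2⟩, rfl⟩
  -- By periodicity a single rectangle of height `h` suffices, which is compact.
  have himg : F '' B = F '' (Set.Icc z₁.re z₂.re ×ℂ Set.Icc 0 h) := by
    apply Set.Subset.antisymm
    · rintro _ ⟨z, hz, rfl⟩
      refine ⟨z + ((-⌊z.im / h⌋ : ℤ) : ℂ) * ((h : ℂ) * Complex.I), ?_, hper z ?_ ?_ _⟩
      · rw [Complex.mem_reProdIm]
        have h3 := Int.floor_le (z.im / h)
        have h4 := Int.lt_floor_add_one (z.im / h)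
        rw [le_div_iff₀ hh] at h3
        rw [div_lt_iff₀ hh] at h4
        refine ⟨by simpa [hB] using hz, ?_⟩
        simp; constructor <;> linarith
      · linarith [hz.1, h₁.1]
      · linarith [hz.2, h₂.2]
    · apply Set.image_mono
      intro z hz
      exact (Complex.mem_reProdIm.1 hz).1
  have hclosed : IsClosed (F '' B) := by
    rw [himg]
    refine (IsCompact.image_of_continuousOn (isCompact_Icc.reProdIm isCompact_Icc) ?_).isClosed
    intro z hz
    exact (hBF z (Complex.mem_reProdIm.1 hz).1).continuousAt.continuousWithinAt
  have huniv : F '' B = Set.univ := IsClopen.eq_univ ⟨hclosed, hopen⟩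
    ⟨F z₁, z₁, ⟨le_rfl, hlt.le⟩, rfl⟩
  obtain ⟨p, hp⟩ := hne
  obtain ⟨z, hz, rfl⟩ : p ∈ F '' B := by rw [huniv]; trivial
  exact hp (hBF z hz).1

/-- The two parametrizations agree on the overlap of the strips and glue to a map on the union of
the strips, which inherits the period of `f` by continuation. Points with equal image have equal
real part by `re_eq_of_periodic`; their vertical difference then shifts `F` to itself and can be
compared with the period at a point of the strip of `f`. -/
theorem IsCylinderMap.exists_union [CompactSpace X] [ConnectedSpace X] (hne : ∃ p, S.ord p ≠ 0)
    (hf : S.IsCylinderMap f w h) (hg : S.IsCylinderMap g w' h') {z₀ z₀' : ℂ}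
    (hz₀ : z₀ ∈ openStrip w) (hz₀' : z₀' ∈ openStrip w') (h0 : f z₀ = g z₀') :
    ∃ F W, S.IsCylinderMap F W h ∧ f '' openStrip w ⊆ F '' openStrip W ∧
      g '' openStrip w' ⊆ F '' openStrip W := by
  classical
  set c : ℂ := z₀' - z₀ with hc
  have hcre : c.re = z₀'.re - z₀.re := by simp [hc]
  have hz1 := hz₀
  have hz2 := hz₀'
  rw [mem_openStrip] at hz1 hz2
  set α := min 0 (-c.re) with hα
  set β := max w (w' - c.re) with hβ
  have hw := hf.1
  have hw' := hg.1
  have hα0 : α ≤ 0 := min_le_left _ _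
  have hαc : α ≤ -c.re := min_le_right _ _
  have hβ0 : w ≤ β := le_max_left _ _
  have hβc : w' - c.re ≤ β := le_max_right _ _
  have hcov : ∀ z : ℂ, α < z.re → z.re < β → z ∈ openStrip w ∨ z + c ∈ openStrip w' := by
    intro z h1 h2
    rw [hα, min_lt_iff] at h1
    rw [hβ, lt_max_iff] at h2
    simp only [mem_openStrip, Complex.add_re]
    by_cases h3 : 0 < z.re <;> by_cases h4 : z.re < w
    · exact Or.inl ⟨h3, h4⟩
    · right
      have : z.re < w' - c.re := by tauto
      constructor <;> linarith
    · right
      have : -c.re < z.re := by tauto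
      constructor <;> linarith
    · exfalso; linarith
  set F : ℂ → X := fun z => if z ∈ openStrip w then f z else g (z + c) with hFdef
  have hFf : ∀ z ∈ openStrip w, F z = f z := fun z hz => by simp [hFdef, hz]
  have hFg : ∀ z : ℂ, z + c ∈ openStrip w' → F z = g (z + c) := by
    intro z hz
    by_cases hzw : z ∈ openStrip w
    · rw [hFf z hzw]; exact hf.eq_shift (fun z hz => hg.trans hz) hz₀ hz₀' h0 hzw hz
    · simp [hFdef, hzw]
  have hF : ∀ z : ℂ, α < z.re → z.re < β → S.IsTransAt F z := by
    intro z h1 h2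
    rcases hcov z h1 h2 with h3 | h3
    · refine (hf.trans h3).congr ?_
      filter_upwards [(isOpen_openStrip w).mem_nhds h3] with u hu using (hFf u hu).symm
    · refine (hg.trans h3).comp_add.congr ?_
      have : Continuous fun z : ℂ => z + c := by fun_prop
      filter_upwards [(this.tendsto z).eventually ((isOpen_openStrip w').mem_nhds h3)] with u hu
        using (hFg u hu).symm
  have hover : ∃ z : ℂ, z ∈ openStrip w ∧ z + c ∈ openStrip w' :=
    ⟨z₀, hz₀, by simpa [hc] using hz₀'⟩
  obtain ⟨y, hy, hyc⟩ := hover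
  have hhf := hf.2.1
  have hhg := hg.2.1
  have hadd : ∀ (z : ℂ) (v : ℂ) (W : ℝ), v.re = 0 → (z + v ∈ openStrip W ↔ z ∈ openStrip W) := by
    intro z v W hv; simp [mem_openStrip, hv]
  have hvre : ∀ (n : ℤ) (r : ℝ), ((n : ℂ) * ((r : ℂ) * Complex.I)).re = 0 := by
    intro n r; simp
  have hper : ∀ z : ℂ, α < z.re → z.re < β → ∀ n : ℤ,
      F (z + (n : ℂ) * ((h : ℂ) * Complex.I)) = F z := by
    intro z h1 h2 n
    refine IsTransAt.eqOn (S := S) (f := fun z => F (z + (n : ℂ) * ((h : ℂ) * Complex.I))) (g := F)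
      (isPreconnected_reStrip α β) (fun z hz => (hF _ ?_ ?_).comp_add)
      (fun z hz => hF z hz.1 hz.2) (z₀ := y) ?_ ?_ z ⟨h1, h2⟩
    · simpa using hz.1
    · simpa using hz.2
    · exact ⟨by linarith [hy.1], by linarith [hy.2]⟩
    · rw [hFf _ (add_period_mem hy n), hFf _ hy, hf.periodic hy]
  have hinj : ∀ z₁ z₂ : ℂ, α < z₁.re ∧ z₁.re < β → α < z₂.re ∧ z₂.re < β → F z₁ = F z₂ →
      ∃ n : ℤ, z₂ = z₁ + (n : ℂ) * ((h : ℂ) * Complex.I) := by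
    intro z₁ z₂ h1 h2 h12
    have hre := re_eq_of_periodic hne hF hhf hper h1 h2 h12
    have hy2 : y + (z₂ - z₁) ∈ openStrip w := (hadd _ _ _ (by simp [hre])).2 hy
    have h3 := IsTransAt.eqOn (S := S) (f := F) (g := fun u => F (u + (z₂ - z₁)))
      (isPreconnected_reStrip α β) (fun z hz => hF z hz.1 hz.2)
      (fun z hz => (hF _ (by simp [hre]; linarith [hz.1]) (by simp [hre]; linarith [hz.2])).comp_add)
      (z₀ := z₁) h1 (by simpa using h12) y ⟨by linarith [hy.1], by linarith [hy.2]⟩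
    change F y = F (y + (z₂ - z₁)) at h3
    rw [hFf y hy, hFf _ hy2] at h3
    obtain ⟨n, hn⟩ := (hf.2.2.2 y hy _ hy2).1 h3
    exact ⟨n, by linear_combination hn⟩
  refine ⟨fun z => F (z + α), β - α, ⟨by linarith, hhf, ?_, ?_⟩, ?_, ?_⟩
  · intro z hz
    rw [mem_openStrip] at hz
    exact (hF (z + α) (by simp; linarith [hz.1]) (by simp; linarith [hz.2])).comp_add
  · intro z hz z' hz'
    rw [mem_openStrip] at hz hz'
    constructor
    · intro h1
      obtain ⟨n, hn⟩ := hinj (z + α) (z' + α) (by simp; constructor <;> linarith [hz.1, hz.2])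
        (by simp; constructor <;> linarith [hz'.1, hz'.2]) h1
      exact ⟨n, by linear_combination hn⟩
    · rintro ⟨n, rfl⟩
      have := hper (z + α) (by simp; linarith [hz.1]) (by simp; linarith [hz.2]) n
      change F (z + α) = F (z + (n : ℂ) * ((h : ℂ) * Complex.I) + α)
      rw [← this]; congr 1; ring
  · rintro _ ⟨z, hz, rfl⟩
    refine ⟨z - α, ?_, ?_⟩
    · rw [mem_openStrip] at *; simp; constructor <;> linarith [hz.1, hz.2]
    · change F (z - α + α) = f z
      rw [sub_add_cancel, hFf z hz]
  · rintro _ ⟨z, hz, rfl⟩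
    refine ⟨z - c - α, ?_, ?_⟩
    · rw [mem_openStrip] at *; simp; constructor <;> linarith [hz.1, hz.2]
    · change F (z - c - α + α) = g z
      rw [sub_add_cancel, hFg (z - c) (by simpa using hz), sub_add_cancel]

theorem IsVerticalCylinder.eq_of_inter [CompactSpace X] [ConnectedSpace X]
    (hne : ∃ p, S.ord p ≠ 0) {C D : Set X} (hC : S.IsVerticalCylinder C)
    (hD : S.IsVerticalCylinder D) {x : X} (hxC : x ∈ C) (hxD : x ∈ D) : C = D := by
  obtain ⟨f, w, h, hf, rfl⟩ := hC.prop
  obtain ⟨g, w', h', hg, rfl⟩ := hD.prop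
  obtain ⟨z, hz, rfl⟩ := hxC
  obtain ⟨z', hz', hzz⟩ := hxD
  obtain ⟨F, W, hF, h1, h2⟩ := hf.exists_union hne hg hz hz' hzz.symm
  exact (hC.eq_of_subset ⟨F, W, _, hF, rfl⟩ h1).trans
    (hD.eq_of_subset ⟨F, W, _, hF, rfl⟩ h2).symm

end T2

end TranslationSurface

/-! ### Cube roots -/

/-- The principal cube root. -/
noncomputable def cubeRoot (z : ℂ) : ℂ := z ^ (3 : ℂ)⁻¹

/-- The cube roots of unity. -/
noncomputable def cubeUnit (k : ZMod 3) : ℂ := Complex.exp (2 * Real.pi * Complex.I / 3) ^ k.val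

theorem isPrimitiveRoot_three : IsPrimitiveRoot (Complex.exp (2 * Real.pi * Complex.I / 3)) 3 := by
  exact_mod_cast Complex.isPrimitiveRoot_exp 3 (by norm_num)

theorem cubeRoot_pow (z : ℂ) : cubeRoot z ^ 3 = z := by
  simp [cubeRoot]

theorem cubeUnit_pow (k : ZMod 3) : cubeUnit k ^ 3 = 1 := by
  rw [cubeUnit, ← pow_mul, mul_comm k.val, pow_mul, isPrimitiveRoot_three.pow_eq_one, one_pow]

theorem cubeUnit_ne_zero (k : ZMod 3) : cubeUnit k ≠ 0 := by
  intro h; have := cubeUnit_pow k; rw [h] at this; norm_num at this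

theorem cubeUnit_add_one (k : ZMod 3) :
    cubeUnit (k + 1) = cubeUnit k * Complex.exp (2 * Real.pi * Complex.I / 3) := by
  have h : k = 0 ∨ k = 1 ∨ k = 2 := by revert k; decide
  have h3 := isPrimitiveRoot_three.pow_eq_one
  rcases h with rfl | rfl | rfl
  · have : (0 + 1 : ZMod 3).val = 1 := by decide
    rw [cubeUnit, cubeUnit, this, ZMod.val_zero, pow_one, pow_zero, one_mul]
  · have : (1 + 1 : ZMod 3).val = 2 := by decide
    have h1 : (1 : ZMod 3).val = 1 := by decide
    rw [cubeUnit, cubeUnit, this, h1, pow_two, pow_one]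
  · have : (2 + 1 : ZMod 3).val = 0 := by decide
    have h1 : (2 : ZMod 3).val = 2 := by decide
    rw [cubeUnit, cubeUnit, this, h1, ← pow_succ, h3, pow_zero]

theorem cubeUnit_injective : Function.Injective cubeUnit := by
  intro k l h
  have := isPrimitiveRoot_three.pow_inj (ZMod.val_lt k) (ZMod.val_lt l) h
  exact ZMod.val_injective 3 this

theorem exists_cubeUnit_mul {x y : ℂ} (h : x ^ 3 = y ^ 3) : ∃ k, x = cubeUnit k * y := by
  by_cases hy : y = 0
  · subst hy
    have : x = 0 := by simpa using h
    exact ⟨0, by simp [this]⟩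
  · have h1 : (x / y) ^ 3 = 1 := by rw [div_pow, h, div_self (pow_ne_zero _ hy)]
    obtain ⟨i, hi, hi2⟩ := isPrimitiveRoot_three.eq_pow_of_pow_eq_one h1
    refine ⟨(i : ZMod 3), ?_⟩
    rw [cubeUnit, ZMod.val_natCast, Nat.mod_eq_of_lt hi, hi2, div_mul_cancel₀ _ hy]

theorem cubeRoot_zero : cubeRoot 0 = 0 := by
  have := cubeRoot_pow 0
  simpa using this

/-- The branch cut does no harm at the origin, since the norm of the root is the real cube root of
the norm. -/
theorem continuousAt_cubeRoot_zero : ContinuousAt cubeRoot 0 := by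
  have h : ContinuousAt (fun z : ℂ => ‖cubeRoot z‖) 0 := by
    have : (fun z : ℂ => ‖cubeRoot z‖) = fun z : ℂ => ‖z‖ ^ ((3 : ℝ)⁻¹) := by
      ext z
      have h1 : ‖z‖ = ‖cubeRoot z‖ ^ (3 : ℕ) := by rw [← norm_pow, cubeRoot_pow]
      rw [h1]
      exact (Real.pow_rpow_inv_natCast (norm_nonneg _) (by norm_num : (3 : ℕ) ≠ 0)).symm
    rw [this]
    exact continuousAt_id.norm.rpow_const (Or.inr (by norm_num))
  rw [ContinuousAt, cubeRoot_zero]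
  rw [ContinuousAt] at h
  simp only [cubeRoot_zero, norm_zero] at h
  exact tendsto_zero_iff_norm_tendsto_zero.2 h

theorem continuousAt_cubeRoot {z : ℂ} (hz : z ∈ Complex.slitPlane) : ContinuousAt cubeRoot z :=
  continuousAt_cpow_const hz

/-- The principal roots have arguments `-π/6` and `π/6`, and `-π/6` is `π + 2π/3 + π/6` modulo `2π`.
This is the relation that glues neighbouring sectors at a double zero along the imaginary axis. -/
theorem cubeRoot_neg_I {s : ℝ} (hs : 0 < s) :
    cubeRoot (-(s * Complex.I)) =
      -(Complex.exp (2 * Real.pi * Complex.I / 3) * cubeRoot (s * Complex.I)) := by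
  have hs0 : (s : ℂ) ≠ 0 := by exact_mod_cast hs.ne'
  have e1 : -((s : ℂ) * Complex.I) = s * (-Complex.I) := by ring
  rw [e1, cubeRoot, cubeRoot, Complex.cpow_def_of_ne_zero (by simp [hs0]),
    Complex.cpow_def_of_ne_zero (by simp [hs0]), Complex.log_ofReal_mul hs (by simp),
    Complex.log_ofReal_mul hs (by simp), Complex.log_I, Complex.log_neg_I, ← Complex.exp_add,
    ← neg_one_mul (Complex.exp _), ← Complex.exp_pi_mul_I, ← Complex.exp_add,
    Complex.exp_eq_exp_iff_exists_int]
  exact ⟨-1, by push_cast; ring⟩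

/-! ### The three sectors at a double zero and the half turn there -/

namespace TranslationSurface

variable {X : Type*} [TopologicalSpace X] {S : TranslationSurface X} {f : ℂ → X} {p : X}
  {τ : X → X}

/-- The inverse of the `k`-th branch of the local primitive `z ^ 3` of the differential at the
double zero `p`. -/
noncomputable def sector (S : TranslationSurface X) (p : X) (k : ZMod 3) (z : ℂ) : X :=
  (S.chart p).symm (cubeUnit k * cubeRoot z)

theorem sector_zero (p : X) (k : ZMod 3) : S.sector p k 0 = p := by
  simp [sector, cubeRoot_zero, symm_zero]

theorem tendsto_cubeUnit_mul (k : ZMod 3) :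
    Filter.Tendsto (fun z => cubeUnit k * cubeRoot z) (𝓝 0) (𝓝 0) := by
  simpa [cubeRoot_zero] using continuousAt_cubeRoot_zero.tendsto.const_mul (cubeUnit k)

theorem continuousAt_sector_zero (p : X) (k : ZMod 3) : ContinuousAt (S.sector p k) 0 := by
  refine ContinuousAt.comp_of_eq (continuousAt_symm_zero p) ?_ (by simp [cubeRoot_zero])
  simpa [ContinuousAt, cubeRoot_zero] using tendsto_cubeUnit_mul k

theorem isTransAt_of_pow {z c : ℂ} (hf : ContinuousAt f z) (h0 : S.ord (f z) = 0)
    (h : ∀ᶠ u in 𝓝 z, f u ∈ (S.chart p).source ∧ S.chart p (f u) ^ (S.ord p + 1) = u + c) :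
    S.IsTransAt f z := by
  refine ⟨h0, ?_⟩
  obtain ⟨d, hd⟩ := S.compat p (f z) (f z) h.self_of_nhds.1 (S.mem_source _)
  have hd0 := hd.self_of_nhds
  rw [h0, S.chart_self, h.self_of_nhds.2] at hd0
  filter_upwards [h, hf (source_mem_nhds (f z)), hf.eventually hd] with u h1 h2 h3
  refine ⟨h2, ?_⟩
  rw [h1.2, h0] at h3
  simp only [zero_add, pow_one] at h3 hd0
  linear_combination hd0 - h3

theorem IsVertAt.pow_eq {γ : ℝ → X} {t : ℝ} (hγ : S.IsVertAt γ t)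
    (ht : γ t ∈ (S.chart p).source) : ∀ᶠ s in 𝓝 t, S.chart p (γ s) ^ (S.ord p + 1) -
      s * Complex.I = S.chart p (γ t) ^ (S.ord p + 1) - t * Complex.I := by
  obtain ⟨d, hd⟩ := S.compat p (γ t) (γ t) ht (S.mem_source _)
  have hd0 := hd.self_of_nhds
  rw [hγ.1, S.chart_self] at hd0
  filter_upwards [hγ.2, hγ.continuousAt.eventually hd] with s h1 h2
  rw [h2, hd0, hγ.1, zero_add, pow_one, h1.2]
  push_cast; ring

theorem eventually_ord_eq_zero [T1Space X] (hS : {x | S.ord x ≠ 0}.Finite) (p : X) :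
    ∀ᶠ x in 𝓝[≠] p, S.ord x = 0 := by
  have h1 : ({x | S.ord x ≠ 0} \ {p})ᶜ ∈ 𝓝 p :=
    (hS.subset Set.sdiff_subset).isClosed.isOpen_compl.mem_nhds (by simp)
  filter_upwards [nhdsWithin_le_nhds h1, self_mem_nhdsWithin] with x hx hxp
  by_contra h
  exact hx ⟨h, hxp⟩

/-- One radius that serves all three branches. Away from the cut of the root the branch inverts the
primitive `z ^ 3`, so it is a translation at regular points. -/
theorem exists_sector_radius [T1Space X] (hS : {x | S.ord x ≠ 0}.Finite) (hp : S.ord p = 2) :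
    ∃ ε > 0, (∀ k z, ‖z‖ < ε → cubeUnit k * cubeRoot z ∈ (S.chart p).target) ∧
      (∀ k z, ‖z‖ < ε → z ≠ 0 → S.ord (S.sector p k z) = 0) ∧
      ∀ k z, ‖z‖ < ε → z ∈ Complex.slitPlane → S.IsTransAt (S.sector p k) z := by
  have h1 : ∀ᶠ z in 𝓝 (0 : ℂ), ∀ k, cubeUnit k * cubeRoot z ∈ (S.chart p).target := by
    rw [Filter.eventually_all]
    exact fun k => (tendsto_cubeUnit_mul k).eventually
      ((S.chart p).open_target.mem_nhds (zero_mem_target p))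
  have h2 : ∀ᶠ z in 𝓝 (0 : ℂ), ∀ k, S.sector p k z ≠ p → S.ord (S.sector p k z) = 0 := by
    rw [Filter.eventually_all]
    intro k
    have := eventually_nhdsWithin_iff.1 (eventually_ord_eq_zero hS p)
    have hc := continuousAt_sector_zero (S := S) p k
    rw [ContinuousAt, sector_zero] at hc
    exact hc.eventually this
  obtain ⟨ε, hε, h⟩ := Metric.eventually_nhds_iff.1 (h1.and h2)
  simp only [dist_zero_right] at h
  have hord : ∀ k z, ‖z‖ < ε → z ≠ 0 → S.ord (S.sector p k z) = 0 := by
    intro k z hz hz0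
    refine (h hz).2 k fun hpz => hz0 ?_
    have h3 := (S.chart p).right_inv ((h hz).1 k)
    rw [sector] at hpz
    rw [hpz, S.chart_self] at h3
    have := congrArg (· ^ 3) h3
    simp only [mul_pow, cubeUnit_pow, cubeRoot_pow] at this
    simpa using this.symm
  refine ⟨ε, hε, fun k z hz => (h hz).1 k, hord, fun k z hz hzs => ?_⟩
  have hcont : ContinuousAt (S.sector p k) z :=
    ContinuousAt.comp (g := (S.chart p).symm) ((S.chart p).continuousAt_symm ((h hz).1 k))
      (continuousAt_const.mul (continuousAt_cubeRoot hzs))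
  refine isTransAt_of_pow (p := p) (c := 0) hcont (hord k z hz (Complex.slitPlane_ne_zero hzs)) ?_
  have : ∀ᶠ u in 𝓝 z, ‖u‖ < ε := continuous_norm.continuousAt.eventually_lt continuousAt_const hz
  filter_upwards [this] with u hu
  refine ⟨(S.chart p).map_target ((h hu).1 k), ?_⟩
  rw [sector, (S.chart p).right_inv ((h hu).1 k), hp, mul_pow, cubeUnit_pow, cubeRoot_pow]
  ring

theorem isPreconnected_puncturedBall (r : ℝ) : IsPreconnected {z : ℂ | z ≠ 0 ∧ ‖z‖ < r} := by
  have : {z : ℂ | z ≠ 0 ∧ ‖z‖ < r} =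
      (fun q : ℝ × ℝ => (q.1 : ℂ) * Complex.exp (q.2 * Complex.I)) ''
        (Set.Ioo 0 r ×ˢ Set.univ) := by
    ext z
    constructor
    · rintro ⟨h1, h2⟩
      exact ⟨(‖z‖, z.arg), ⟨⟨norm_pos_iff.2 h1, h2⟩, trivial⟩, Complex.norm_mul_exp_arg_mul_I z⟩
    · rintro ⟨⟨a, b⟩, ⟨⟨h1, h2⟩, -⟩, rfl⟩
      dsimp only at h1 h2 ⊢
      refine ⟨mul_ne_zero (by exact_mod_cast h1.ne') (Complex.exp_ne_zero _), ?_⟩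
      simpa [Complex.norm_exp_ofReal_mul_I, abs_of_pos h1] using h2
  rw [this]
  refine ((convex_Ioo 0 r).prod convex_univ).isPreconnected.image _ ?_
  fun_prop

/-- In the chart the half turn is a map `N` with `N ζ ^ 3 = -ζ ^ 3`. The quotient `N ζ / ζ` is
continuous with finitely many values on a connected punctured disc, hence equals a constant
`-cubeUnit k`. As `N` is an involution, this root of unity has square and cube 1, so it is 1. -/
theorem IsHalfTurn.chart_eq_neg (hτ : S.IsHalfTurn τ) (hp : S.ord p = 2) :
    ∀ᶠ y in 𝓝 p, y ∈ (S.chart p).source ∧ τ y ∈ (S.chart p).source ∧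
      S.chart p (τ y) = -S.chart p y := by
  have hτp : τ p = p := hτ.fix p (by omega)
  have h1 : ∀ᶠ y in 𝓝 p, τ y ∈ (S.chart p).source := by
    have := hτ.continuous.continuousAt (x := p)
    rw [ContinuousAt, hτp] at this
    exact Filter.Tendsto.eventually this (source_mem_nhds (S := S) p)
  have h2 := hτ.anti p
  rw [hτp, hp] at h2
  have h3 := h1.and (Filter.Eventually.and (source_mem_nhds (S := S) p) h2)
  rw [← map_symm_nhds_zero (S := S) p, Filter.eventually_map] at h3
  obtain ⟨δ, hδ, hball⟩ := Metric.eventually_nhds_iff.1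
    (h3.and ((S.chart p).open_target.mem_nhds (zero_mem_target p)))
  simp only [dist_zero_right] at hball
  set N : ℂ → ℂ := fun ζ => S.chart p (τ ((S.chart p).symm ζ)) with hN
  have hN3 : ∀ ζ, ‖ζ‖ < δ → N ζ ^ 3 = -ζ ^ 3 := by
    intro ζ hζ
    have := (hball hζ).1.2.2
    rwa [(S.chart p).right_inv (hball hζ).2] at this
  have hNn : ∀ ζ, ‖ζ‖ < δ → ‖N ζ‖ = ‖ζ‖ := by
    intro ζ hζ
    have := congrArg norm (hN3 ζ hζ)
    rw [norm_neg, norm_pow, norm_pow] at this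
    exact (pow_left_inj₀ (norm_nonneg _) (norm_nonneg _) (by norm_num)).1 this
  have hNN : ∀ ζ, ‖ζ‖ < δ → N (N ζ) = ζ := by
    intro ζ hζ
    simp only [hN]
    rw [(S.chart p).left_inv (hball hζ).1.1, hτ.involutive, (S.chart p).right_inv (hball hζ).2]
  have hcont : ContinuousOn (fun ζ => N ζ / ζ) {z : ℂ | z ≠ 0 ∧ ‖z‖ < δ} := by
    intro ζ hζ
    refine ContinuousAt.continuousWithinAt (ContinuousAt.div ?_ continuousAt_id hζ.1)
    refine ((S.chart p).continuousAt (hball hζ.2).1.1).comp_of_eq ?_ rfl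
    exact hτ.continuous.continuousAt.comp ((S.chart p).continuousAt_symm (hball hζ.2).2)
  have hmaps : Set.MapsTo (fun ζ => N ζ / ζ) {z : ℂ | z ≠ 0 ∧ ‖z‖ < δ}
      (Set.range fun k => -cubeUnit k) := by
    intro ζ hζ
    have : (-N ζ) ^ 3 = ζ ^ 3 := by rw [Odd.neg_pow (by decide), hN3 ζ hζ.2, neg_neg]
    obtain ⟨k, hk⟩ := exists_cubeUnit_mul this
    refine ⟨k, ?_⟩
    simp only
    rw [eq_div_iff hζ.1, neg_mul, ← hk, neg_neg]
  have hfin : (Set.range fun k => -cubeUnit k).Finite := Set.finite_range _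
  obtain ⟨c, hc, hconst⟩ := (isPreconnected_puncturedBall δ).eqOn_const_of_mapsTo hfin.isDiscrete hcont hmaps
    ⟨_, ⟨0, rfl⟩⟩
  obtain ⟨k, rfl⟩ := hc
  have hval : ∀ ζ, ‖ζ‖ < δ → ζ ≠ 0 → N ζ = -cubeUnit k * ζ := by
    intro ζ hζ h0
    have := hconst ⟨h0, hζ⟩
    simp only [Function.const_apply] at this
    rwa [div_eq_iff h0] at this
  have hk1 : cubeUnit k = 1 := by
    set ζ : ℂ := ((δ / 2 : ℝ) : ℂ)
    have hζ : ‖ζ‖ < δ := by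
      simp only [ζ, Complex.norm_real, Real.norm_eq_abs, abs_of_pos (half_pos hδ)]; linarith
    have h0 : ζ ≠ 0 := by simp only [ζ]; exact_mod_cast (half_pos hδ).ne'
    have hn := hval ζ hζ h0
    have hn0 : N ζ ≠ 0 := by rw [hn]; exact mul_ne_zero (neg_ne_zero.2 (cubeUnit_ne_zero k)) h0
    have h4 := hNN ζ hζ
    rw [hval _ (by rwa [hNn ζ hζ]) hn0, hn] at h4
    have h5 : cubeUnit k ^ 2 = 1 := by
      apply mul_right_cancel₀ h0
      linear_combination h4
    have h6 := cubeUnit_pow k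
    calc cubeUnit k = cubeUnit k ^ 2 * cubeUnit k := by rw [h5, one_mul]
      _ = 1 := by rw [← h6]; ring
  have hfinal : ∀ᶠ ζ in 𝓝 (0 : ℂ), (S.chart p).symm ζ ∈ (S.chart p).source ∧
      τ ((S.chart p).symm ζ) ∈ (S.chart p).source ∧
      S.chart p (τ ((S.chart p).symm ζ)) = -S.chart p ((S.chart p).symm ζ) := by
    filter_upwards [Metric.ball_mem_nhds (0 : ℂ) hδ] with ζ hζ
    rw [mem_ball_zero_iff] at hζ
    refine ⟨(hball hζ).1.2.1, (hball hζ).1.1, ?_⟩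
    rw [(S.chart p).right_inv (hball hζ).2]
    by_cases h0 : ζ = 0
    · rw [h0, symm_zero, hτp, S.chart_self, neg_zero]
    · have := hval ζ hζ h0
      rwa [hk1, neg_one_mul] at this
  rw [← map_symm_nhds_zero (S := S) p, Filter.eventually_map]
  exact hfinal

/-- The half turn is `ζ ↦ -ζ` in the chart, and `cubeRoot_neg_I` identifies the negative of the
upward ray in one sector with the downward ray in the preceding one. -/
theorem eventually_half_turn_sector [T1Space X] (hτ : S.IsHalfTurn τ) (hp : S.ord p = 2)
    (hS : {x | S.ord x ≠ 0}.Finite) (k : ZMod 3) :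
    ∀ᶠ s : ℝ in 𝓝[>] 0, τ (S.sector p (k + 1) (s * Complex.I)) =
      S.sector p k (-(s * Complex.I)) := by
  obtain ⟨ε, hε, h1, -, -⟩ := exists_sector_radius hS hp
  have hc := continuousAt_sector_zero (S := S) p (k + 1)
  rw [ContinuousAt, sector_zero] at hc
  have h2 := hc.eventually (hτ.chart_eq_neg hp)
  have hI : Filter.Tendsto (fun s : ℝ => (s : ℂ) * Complex.I) (𝓝[>] 0) (𝓝 0) := by
    have : Continuous fun s : ℝ => (s : ℂ) * Complex.I := by fun_prop
    simpa using (this.tendsto 0).mono_left nhdsWithin_le_nhds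
  have h3 : ∀ᶠ z in 𝓝 (0 : ℂ), ‖z‖ < ε := by
    filter_upwards [Metric.ball_mem_nhds (0 : ℂ) hε] with z hz using mem_ball_zero_iff.1 hz
  filter_upwards [hI.eventually h2, hI.eventually h3, self_mem_nhdsWithin] with s h4 h5 h6
  have h7 := h4.2.2
  rw [sector, (S.chart p).right_inv (h1 _ _ h5), cubeUnit_add_one] at h7
  rw [← (S.chart p).left_inv h4.2.1, sector, sector, cubeRoot_neg_I h6, cubeUnit_add_one, h7]
  congr 1; ring

/-- Points near a double zero lie in one of the closed right half discs, or are mapped there by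
the half turn. -/
theorem eventually_mem_sector [T1Space X] (hτ : S.IsHalfTurn τ) (hp : S.ord p = 2)
    {η : ℝ} (hη : 0 < η) :
    ∀ᶠ a in 𝓝 p, ∃ k z, ‖z‖ < η ∧ 0 ≤ z.re ∧
      (a = S.sector p k z ∨ τ a = S.sector p k z) := by
  have hc : ContinuousAt (fun a => S.chart p a ^ 3) p :=
    ((S.chart p).continuousAt (S.mem_source p)).pow 3
  have h1 : ∀ᶠ a in 𝓝 p, ‖S.chart p a ^ 3‖ < η := by
    refine hc.norm.eventually_lt continuousAt_const ?_
    simpa [S.chart_self] using hη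
  filter_upwards [h1, hτ.chart_eq_neg hp] with a h2 h3
  by_cases h4 : 0 ≤ (S.chart p a ^ 3).re
  · obtain ⟨k, hk⟩ := exists_cubeUnit_mul (cubeRoot_pow (S.chart p a ^ 3)).symm
    exact ⟨k, _, h2, h4, Or.inl (by rw [sector, ← hk, (S.chart p).left_inv h3.1])⟩
  · have h5 : S.chart p (τ a) ^ 3 = -(S.chart p a ^ 3) := by
      rw [h3.2.2, Odd.neg_pow (by decide)]
    obtain ⟨k, hk⟩ := exists_cubeUnit_mul (cubeRoot_pow (S.chart p (τ a) ^ 3)).symm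
    refine ⟨k, S.chart p (τ a) ^ 3, by rw [h5, norm_neg]; exact h2, ?_, Or.inr ?_⟩
    · rw [h5, Complex.neg_re]; linarith
    · rw [sector, ← hk, (S.chart p).left_inv h3.2.1]

theorem sector_inj {ε : ℝ}
    (hε : ∀ k z, ‖z‖ < ε → cubeUnit k * cubeRoot z ∈ (S.chart p).target) {k l : ZMod 3} {z : ℂ}
    (hz : ‖z‖ < ε) (hz0 : z ≠ 0) (h : S.sector p k z = S.sector p l z) : k = l := by
  have h1 := (S.chart p).symm.injOn (hε k z hz) (hε l z hz) h
  have h2 : cubeRoot z ≠ 0 := by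
    intro h3; have := cubeRoot_pow z; rw [h3] at this; exact hz0 (by simpa using this.symm)
  exact cubeUnit_injective (mul_right_cancel₀ h2 h1)

theorem mem_slitPlane_of_re_nonneg {z : ℂ} (hz : 0 ≤ z.re) (h0 : z ≠ 0) :
    z ∈ Complex.slitPlane := by
  rw [Complex.mem_slitPlane_iff]
  by_contra h
  push Not at h
  exact h0 (Complex.ext (le_antisymm h.1 hz) h.2)

/-- Along the geodesic the primitive `z ^ 3` grows by `t * I`, so the chart coordinate of `γ t` is a
cube root of `t * I`. The branch `k` is chosen at one time and kept by unique continuation. -/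
theorem exists_sector_of_vertical [T2Space X] (hS : {x | S.ord x ≠ 0}.Finite) {γ : ℝ → X} {ℓ : ℝ}
    (hℓ : 0 < ℓ) (hγ : ContinuousOn γ (Set.Ico 0 ℓ)) (hp : S.ord (γ 0) = 2)
    (hv : S.IsVerticalOn γ (Set.Ioo 0 ℓ)) :
    ∃ k, ∀ᶠ t : ℝ in 𝓝[>] 0, γ t = S.sector (γ 0) k (t * Complex.I) := by
  obtain ⟨ε, hε, h1, -, h3⟩ := exists_sector_radius hS hp
  have hc0 : Filter.Tendsto γ (𝓝[>] 0) (𝓝 (γ 0)) := by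
    have := (hγ 0 ⟨le_rfl, hℓ⟩).mono Set.Ioo_subset_Ico_self
    rwa [ContinuousWithinAt, nhdsWithin_Ioo_eq_nhdsGT hℓ] at this
  obtain ⟨δ, hδ, hsrc⟩ := mem_nhdsGT_iff_exists_Ioo_subset.1 (hc0 (source_mem_nhds (S := S) (γ 0)))
  set δ' := min δ (min ℓ ε)
  have hδ' : 0 < δ' := lt_min hδ (lt_min hℓ hε)
  have hd1 : δ' ≤ δ := min_le_left _ _
  have hd2 : δ' ≤ ℓ := (min_le_right _ _).trans (min_le_left _ _)
  have hd3 : δ' ≤ ε := (min_le_right _ _).trans (min_le_right _ _)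
  set G : ℝ → ℂ := fun t => S.chart (γ 0) (γ t) ^ 3 - t * Complex.I with hG
  have hmid : δ' / 2 ∈ Set.Ioo 0 δ' := ⟨by linarith, by linarith⟩
  have hconst : ∀ t ∈ Set.Ioo 0 δ', G t = G (δ' / 2) := by
    refine isPreconnected_Ioo.forall_of_eventually_iff (fun t ht => ?_) hmid rfl
    have hvt : S.IsVertAt γ t := hv t ⟨ht.1, ht.2.trans_le hd2⟩
    have := hvt.pow_eq (p := γ 0) (hsrc ⟨ht.1, ht.2.trans_le hd1⟩)
    rw [hp] at this
    filter_upwards [nhdsWithin_le_nhds this] with s hs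
    have : G s = G t := hs
    rw [this]
  have hlim : Filter.Tendsto G (𝓝[>] 0) (𝓝 0) := by
    have h4 := ((S.chart (γ 0)).continuousAt (S.mem_source (γ 0))).tendsto.comp hc0
    have h5 : Filter.Tendsto (fun t : ℝ => (t : ℂ) * Complex.I) (𝓝[>] 0) (𝓝 0) := by
      have : Continuous fun s : ℝ => (s : ℂ) * Complex.I := by fun_prop
      simpa using (this.tendsto 0).mono_left nhdsWithin_le_nhds
    simpa [S.chart_self] using (h4.pow 3).sub h5
  have hG0 : G (δ' / 2) = 0 := by
    refine tendsto_nhds_unique (tendsto_const_nhds.congr' ?_) hlim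
    filter_upwards [Ioo_mem_nhdsGT hδ'] with t ht using (hconst t ht).symm
  have hpow : S.chart (γ 0) (γ (δ' / 2)) ^ 3 = cubeRoot (((δ' / 2 : ℝ) : ℂ) * Complex.I) ^ 3 := by
    rw [cubeRoot_pow]
    exact sub_eq_zero.1 hG0
  obtain ⟨k, hk⟩ := exists_cubeUnit_mul hpow
  refine ⟨k, ?_⟩
  have heq : ∀ t ∈ Set.Ioo 0 δ', γ t = S.sector (γ 0) k (t * Complex.I) := by
    refine IsVertAt.eqOn (S := S) isPreconnected_Ioo (fun t ht => hv t ⟨ht.1, ht.2.trans_le hd2⟩)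
      (fun t ht => ?_) hmid ?_
    · have := IsTransAt.isVertAt (S := S) (f := S.sector (γ 0) k) (c := 0) (t := t) (h3 k _ ?_ ?_)
      · simpa using this
      · simp [abs_of_pos ht.1]; linarith [ht.2]
      · apply mem_slitPlane_of_re_nonneg <;> simp [ht.1.ne']
    · rw [sector, ← hk, (S.chart (γ 0)).left_inv]
      exact hsrc ⟨hmid.1, hmid.2.trans_le hd1⟩
  filter_upwards [Ioo_mem_nhdsGT hδ'] with t ht using heq t ht

end TranslationSurface

/-! ### Vertical rays, saddle connections and their labelling by separatrices -/

namespace TranslationSurface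

variable {X : Type*} [TopologicalSpace X] {S : TranslationSurface X} {f : ℂ → X} {p : X}
  {τ : X → X}

/-- A vertical geodesic emanating upwards from a singularity. -/
structure IsRay (S : TranslationSurface X) (γ : ℝ → X) (a : ℝ) : Prop where
  pos : 0 < a
  cont : ContinuousOn γ (Set.Ico 0 a)
  sing : S.ord (γ 0) ≠ 0
  vert : S.IsVerticalOn γ (Set.Ioo 0 a)

theorem IsVerticalSaddle.isRay {γ : ℝ → X} {ℓ : ℝ} (h : S.IsVerticalSaddle γ ℓ) : S.IsRay γ ℓ :=
  ⟨h.1, h.2.1.mono Set.Ico_subset_Icc_self, h.2.2.1, h.2.2.2.2⟩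

theorem IsRay.tendsto_zero {γ : ℝ → X} {a : ℝ} (h : S.IsRay γ a) :
    Filter.Tendsto γ (𝓝[>] 0) (𝓝 (γ 0)) := by
  have := (h.cont 0 ⟨le_rfl, h.pos⟩).mono Set.Ioo_subset_Ico_self
  rwa [ContinuousWithinAt, nhdsWithin_Ioo_eq_nhdsGT h.pos] at this

theorem IsVerticalSaddle.tendsto_end {γ : ℝ → X} {ℓ : ℝ} (h : S.IsVerticalSaddle γ ℓ) :
    Filter.Tendsto γ (𝓝[<] ℓ) (𝓝 (γ ℓ)) := by
  have := (h.2.1 ℓ ⟨h.1.le, le_rfl⟩).mono Set.Ioo_subset_Icc_self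
  rwa [ContinuousWithinAt, nhdsWithin_Ioo_eq_nhdsLT h.1] at this

section Rays

variable [T2Space X]

/-- If the second ray met the first at a later time, following both backwards would identify the
singular origin of the first with a regular point of the second. -/
theorem IsRay.le_of_eq {γ δ : ℝ → X} {a b : ℝ} (hγ : S.IsRay γ a) (hδ : S.IsRay δ b) {t s : ℝ}
    (ht : t ∈ Set.Ioo 0 a) (hs : s ∈ Set.Ioo 0 b) (h : γ t = δ s) : s ≤ t := by
  by_contra hlt
  push Not at hlt
  have heq : ∀ u ∈ Set.Ioo (-t) (min (a - t) (b - s)), γ (u + t) = δ (u + s) := by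
    refine IsVertAt.eqOn (S := S) (γ := fun u => γ (u + t)) (δ := fun u => δ (u + s))
      isPreconnected_Ioo (fun u hu => ?_) (fun u hu => ?_) (t₀ := 0) ?_ (by simpa using h)
    · exact IsVertAt.comp_add (hγ.vert _ ⟨by linarith [hu.1], by
        linarith [hu.2, min_le_left (a - t) (b - s)]⟩)
    · exact IsVertAt.comp_add (hδ.vert _ ⟨by linarith [hu.1], by
        linarith [hu.2, min_le_right (a - t) (b - s)]⟩)
    · exact ⟨by linarith [ht.1], lt_min (by linarith [ht.2]) (by linarith [hs.2])⟩
  have h1 : Filter.Tendsto γ (𝓝[>] 0) (𝓝 (δ (s - t))) := by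
    have hv : S.IsVertAt δ (s - t) := hδ.vert _ ⟨by linarith, by linarith [hs.2, ht.1]⟩
    have h2 : Filter.Tendsto (fun v : ℝ => v + (s - t)) (𝓝[>] 0) (𝓝 (s - t)) := by
      have : Continuous fun v : ℝ => v + (s - t) := by fun_prop
      simpa using (this.tendsto 0).mono_left nhdsWithin_le_nhds
    refine (hv.continuousAt.tendsto.comp h2).congr' ?_
    have hpos : 0 < min a (b - (s - t)) := lt_min hγ.pos (by linarith [hs.2, ht.1])
    filter_upwards [Ioo_mem_nhdsGT hpos] with v hv
    have := heq (v - t) ⟨by linarith [hv.1], lt_min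
      (by linarith [hv.2, min_le_left a (b - (s - t))])
      (by linarith [hv.2, min_le_right a (b - (s - t))])⟩
    simp only [sub_add_cancel] at this
    rw [this, Function.comp]; congr 1; ring
  have h2 := tendsto_nhds_unique hγ.tendsto_zero h1
  have h3 := hδ.vert (s - t) ⟨by linarith, by linarith [hs.2, ht.1]⟩
  rw [← h2] at h3
  exact hγ.sing h3.1

theorem IsRay.eqOn {γ δ : ℝ → X} {a b : ℝ} (hγ : S.IsRay γ a) (hδ : S.IsRay δ b) {t s : ℝ}
    (ht : t ∈ Set.Ioo 0 a) (hs : s ∈ Set.Ioo 0 b) (h : γ t = δ s) :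
    t = s ∧ ∀ u ∈ Set.Ico 0 (min a b), γ u = δ u := by
  obtain rfl : t = s := le_antisymm (hδ.le_of_eq hγ hs ht h.symm) (hγ.le_of_eq hδ ht hs h)
  have heq : ∀ u ∈ Set.Ioo 0 (min a b), γ u = δ u := by
    refine IsVertAt.eqOn (S := S) isPreconnected_Ioo (fun u hu => hγ.vert u ⟨hu.1, ?_⟩)
      (fun u hu => hδ.vert u ⟨hu.1, ?_⟩) (t₀ := t) ⟨ht.1, lt_min ht.2 hs.2⟩ h
    · exact hu.2.trans_le (min_le_left _ _)
    · exact hu.2.trans_le (min_le_right _ _)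
  refine ⟨rfl, fun u hu => ?_⟩
  rcases hu.1.eq_or_lt with h0 | h0
  · rw [← h0]
    refine tendsto_nhds_unique hγ.tendsto_zero (hδ.tendsto_zero.congr' ?_)
    filter_upwards [Ioo_mem_nhdsGT (lt_min hγ.pos hδ.pos)] with v hv using (heq v hv).symm
  · exact heq u ⟨h0, hu.2⟩

/-- A longer ray would pass through the singular end of the saddle connection at a regular point. -/
theorem IsVerticalSaddle.length_le {γ δ : ℝ → X} {a b : ℝ} (hγ : S.IsVerticalSaddle γ a)
    (hδ : S.IsRay δ b) (h : ∀ u ∈ Set.Ico 0 (min a b), γ u = δ u) : b ≤ a := by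
  by_contra hlt
  push Not at hlt
  rw [min_eq_left hlt.le] at h
  have hv : S.IsVertAt δ a := hδ.vert a ⟨hγ.1, hlt⟩
  have h1 : Filter.Tendsto γ (𝓝[<] a) (𝓝 (δ a)) := by
    refine (hv.continuousAt.tendsto.mono_left nhdsWithin_le_nhds).congr' ?_
    filter_upwards [Ioo_mem_nhdsLT hγ.1] with v hv using (h v ⟨hv.1.le, hv.2⟩).symm
  have := tendsto_nhds_unique hγ.tendsto_end h1
  apply hγ.2.2.2.1
  rw [this]; exact hv.1

theorem IsVerticalSaddle.eqOn {γ δ : ℝ → X} {a b : ℝ} (hγ : S.IsVerticalSaddle γ a)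
    (hδ : S.IsVerticalSaddle δ b) {t s : ℝ} (ht : t ∈ Set.Ioo 0 a) (hs : s ∈ Set.Ioo 0 b)
    (h : γ t = δ s) : a = b ∧ t = s ∧ ∀ u ∈ Set.Icc 0 a, γ u = δ u := by
  obtain ⟨h1, h2⟩ := hγ.isRay.eqOn hδ.isRay ht hs h
  obtain rfl : a = b := le_antisymm
    (hδ.length_le hγ.isRay fun u hu => (h2 u (by rwa [min_comm])).symm) (hγ.length_le hδ.isRay h2)
  rw [min_self] at h2
  refine ⟨rfl, h1, fun u hu => ?_⟩
  rcases hu.2.eq_or_lt with h0 | h0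
  · rw [h0]
    refine tendsto_nhds_unique hγ.tendsto_end (hδ.tendsto_end.congr' ?_)
    filter_upwards [Ioo_mem_nhdsLT hγ.1] with v hv using (h2 v ⟨hv.1.le, hv.2⟩).symm
  · exact h2 u ⟨hu.1, h0⟩

theorem line_eqOn {δ : ℝ → X} {I : Set ℝ} (hI : IsPreconnected I) (hδ : ∀ t ∈ I, S.IsVertAt δ t)
    {w h : ℝ} (hf : S.IsCylinderMap f w h) {z : ℂ} (hz : z ∈ openStrip w) {t : ℝ} (ht : t ∈ I)
    (h0 : δ t = f z) : ∀ s ∈ I, δ s = f ((z - t * Complex.I) + s * Complex.I) := by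
  refine IsVertAt.eqOn (S := S) hI hδ (fun s hs => ?_) ht (by simpa using h0)
  exact (hf.trans (by simpa [mem_openStrip] using hz)).isVertAt

/-- A geodesic ending in a singularity does not meet any cylinder. -/
theorem IsCylinderMap.notMem_of_tendsto {δ : ℝ → X} {I : Set ℝ} (hI : IsPreconnected I)
    (hδ : ∀ t ∈ I, S.IsVertAt δ t) {w h : ℝ} (hf : S.IsCylinderMap f w h) {b : ℝ}
    {l : Filter ℝ} [l.NeBot] (hl : l ≤ 𝓝 b) (hlI : I ∈ l) (hlim : Filter.Tendsto δ l (𝓝 p))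
    (hp : S.ord p ≠ 0) {t : ℝ} (ht : t ∈ I) : δ t ∉ f '' openStrip w := by
  rintro ⟨z, hz, hzt⟩
  have h1 := line_eqOn hI hδ hf hz ht hzt.symm
  have h2 : S.IsTransAt f ((z - t * Complex.I) + b * Complex.I) :=
    hf.trans (by simpa [mem_openStrip] using hz)
  have h3 : Continuous fun s : ℝ => (z - t * Complex.I) + s * Complex.I := by fun_prop
  have h4 := h2.continuousAt.tendsto.comp ((h3.tendsto b).mono_left hl)
  have h5 : Filter.Tendsto δ l (𝓝 (f ((z - t * Complex.I) + b * Complex.I))) := by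
    refine h4.congr' ?_
    filter_upwards [hlI] with s hs using (h1 s hs).symm
  rw [tendsto_nhds_unique hlim h5] at hp
  exact hp h2.1

theorem IsRay.notMem_cylinder {γ : ℝ → X} {a : ℝ} (hγ : S.IsRay γ a) {w h : ℝ}
    (hf : S.IsCylinderMap f w h) {t : ℝ} (ht : t ∈ Set.Ioo 0 a) : γ t ∉ f '' openStrip w :=
  hf.notMem_of_tendsto isPreconnected_Ioo hγ.vert nhdsWithin_le_nhds (Ioo_mem_nhdsGT hγ.pos)
    hγ.tendsto_zero hγ.sing ht

end Rays

/-- A half turn on a surface with a nonempty finite set of singularities, all double zeros,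
for which the vertical direction is completely periodic. -/
structure IsPeriodicHalfTurn (S : TranslationSurface X) (τ : X → X) : Prop where
  halfTurn : S.IsHalfTurn τ
  finite : {x | S.ord x ≠ 0}.Finite
  ord_eq : ∀ p, S.ord p ≠ 0 → S.ord p = 2
  nonempty : ∃ p, S.ord p ≠ 0
  periodic : S.IsVerticallyCompletelyPeriodic

/-- The upward vertical separatrices. -/
abbrev Separatrix (S : TranslationSurface X) := {p : X // S.ord p ≠ 0} × ZMod 3

/-- The path `γ` starts along the separatrix `e`. -/
def StartsAlong (S : TranslationSurface X) (γ : ℝ → X) (e : S.Separatrix) : Prop :=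
  ∀ᶠ t : ℝ in 𝓝[>] 0, γ t = S.sector e.1 e.2 (t * Complex.I)

theorem sector_isRay {k : ZMod 3} {ε : ℝ} (hε : 0 < ε) (hp : S.ord p = 2)
    (h : ∀ z, ‖z‖ < ε → z ∈ Complex.slitPlane → S.IsTransAt (S.sector p k) z) :
    S.IsRay (fun t : ℝ => S.sector p k (t * Complex.I)) ε := by
  have hv : ∀ t ∈ Set.Ioo 0 ε, S.IsVertAt (fun t : ℝ => S.sector p k (t * Complex.I)) t := by
    intro t ht
    have := IsTransAt.isVertAt (S := S) (f := S.sector p k) (c := 0) (t := t) (h _ ?_ ?_)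
    · simpa using this
    · simp [abs_of_pos ht.1]; linarith [ht.2]
    · apply mem_slitPlane_of_re_nonneg <;> simp [ht.1.ne']
  refine ⟨hε, fun t ht => ?_, by simp [sector_zero, hp], hv⟩
  rcases ht.1.eq_or_lt with h0 | h0
  · subst h0
    refine ContinuousAt.continuousWithinAt ?_
    exact (continuousAt_sector_zero p k).comp_of_eq (f := fun t : ℝ => (t : ℂ) * Complex.I)
      (by fun_prop) (by simp)
  · exact (hv t ⟨h0, ht.2⟩).continuousAt.continuousWithinAt

section Saddles

variable [T2Space X]

theorem StartsAlong.zero_eq {γ : ℝ → X} {a : ℝ} {e : S.Separatrix} (h : S.StartsAlong γ e)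
    (hγ : S.IsRay γ a) : γ 0 = e.1 := by
  have h1 : Filter.Tendsto (fun t : ℝ => S.sector e.1 e.2 (t * Complex.I)) (𝓝[>] 0)
      (𝓝 (e.1 : X)) := by
    have : ContinuousAt (fun t : ℝ => S.sector e.1 e.2 (t * Complex.I)) 0 :=
      (continuousAt_sector_zero (e.1 : X) e.2).comp_of_eq (f := fun t : ℝ => (t : ℂ) * Complex.I)
        (by fun_prop) (by simp)
    simpa [ContinuousAt, sector_zero] using this.tendsto.mono_left (nhdsWithin_le_nhds (s := Set.Ioi 0))
  exact tendsto_nhds_unique hγ.tendsto_zero (h1.congr' (h.mono fun _ h => h.symm))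

theorem StartsAlong.unique (hS : {x | S.ord x ≠ 0}.Finite) {γ : ℝ → X} {a : ℝ}
    {e e' : S.Separatrix} (h2 : S.ord e.1 = 2) (h : S.StartsAlong γ e) (h' : S.StartsAlong γ e')
    (hγ : S.IsRay γ a) : e = e' := by
  have h0 : e.1 = e'.1 := Subtype.ext ((h.zero_eq hγ).symm.trans (h'.zero_eq hγ))
  obtain ⟨ε, hε, h1, -, -⟩ := exists_sector_radius hS h2
  obtain ⟨t, ht, ht1, ht2⟩ := (Filter.Eventually.and (Ioo_mem_nhdsGT hε) (h.and h')).exists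
  rw [ht1, ← h0] at ht2
  exact Prod.ext h0 (sector_inj h1 (by simpa [abs_of_pos ht.1] using ht.2)
    (by simp [ht.1.ne']) ht2)

theorem IsPeriodicHalfTurn.exists_startsAlong (hP : S.IsPeriodicHalfTurn τ) {γ : ℝ → X} {a : ℝ} (hγ : S.IsRay γ a) :
    ∃ e, S.StartsAlong γ e := by
  obtain ⟨k, hk⟩ := exists_sector_of_vertical hP.finite hγ.pos hγ.cont (hP.ord_eq _ hγ.sing) hγ.vert
  exact ⟨(⟨γ 0, hγ.sing⟩, k), hk⟩

/-- A point on a short initial piece of the separatrix is regular and in no cylinder, so complete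
periodicity puts it on a saddle connection. Two rays that meet coincide from their origins on. -/
theorem IsPeriodicHalfTurn.exists_saddle (hP : S.IsPeriodicHalfTurn τ) (e : S.Separatrix) :
    ∃ γ ℓ, S.IsVerticalSaddle γ ℓ ∧ S.StartsAlong γ e := by
  have h2 := hP.ord_eq _ e.1.2
  obtain ⟨ε, hε, h1, h0, h3⟩ := exists_sector_radius hP.finite h2
  have hray := sector_isRay hε h2 (h3 e.2)
  have hm : ε / 2 ∈ Set.Ioo 0 ε := ⟨by linarith, by linarith⟩
  rcases hP.periodic _ (hray.vert _ hm).1 with ⟨C, hC, hx⟩ | ⟨γ, ℓ, hγ, t, ht, hx⟩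
  · obtain ⟨f, w, h, hf, rfl⟩ := hC.prop
    exact absurd hx (hray.notMem_cylinder hf hm)
  · refine ⟨γ, ℓ, hγ, ?_⟩
    have := (hγ.isRay.eqOn hray ht hm hx).2
    filter_upwards [Ioo_mem_nhdsGT (lt_min hγ.1 hε)] with u hu using this u ⟨hu.1.le, hu.2⟩

theorem StartsAlong.saddle_eqOn {γ δ : ℝ → X} {a b : ℝ} {e : S.Separatrix}
    (h : S.StartsAlong γ e) (h' : S.StartsAlong δ e) (hγ : S.IsVerticalSaddle γ a)
    (hδ : S.IsVerticalSaddle δ b) : a = b ∧ ∀ u ∈ Set.Icc 0 a, γ u = δ u := by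
  obtain ⟨t, ht, ht1, ht2⟩ := (Filter.Eventually.and (Ioo_mem_nhdsGT (lt_min hγ.1 hδ.1)) (h.and h')).exists
  have := hγ.eqOn hδ ⟨ht.1, ht.2.trans_le (min_le_left _ _)⟩
    ⟨ht.1, ht.2.trans_le (min_le_right _ _)⟩ (ht1.trans ht2.symm)
  exact ⟨this.1, this.2.2⟩

end Saddles

theorem IsVerticalSaddle.reverse (hτ : S.IsHalfTurn τ) {γ : ℝ → X} {ℓ : ℝ}
    (h : S.IsVerticalSaddle γ ℓ) : S.IsVerticalSaddle (fun t => τ (γ (ℓ - t))) ℓ := by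
  refine ⟨h.1, ?_, ?_, ?_, fun t ht => ?_⟩
  · refine hτ.continuous.comp_continuousOn (h.2.1.comp (by fun_prop) ?_)
    intro t ht
    exact ⟨by linarith [ht.2], by linarith [ht.1]⟩
  · simpa [hτ.ord_eq] using h.2.2.2.1
  · simpa [hτ.ord_eq] using h.2.2.1
  · exact IsVertAt.anti hτ (h.2.2.2.2 _ ⟨by linarith [ht.2], by linarith [ht.1]⟩)

/-- The vertical saddle connections, labelled by the separatrices along which they start, and the
action of the half turn on them. -/
structure SaddleSystem (S : TranslationSurface X) (τ : X → X) where
  path : S.Separatrix → ℝ → X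
  len : S.Separatrix → ℝ
  inv : Equiv.Perm S.Separatrix
  saddle : ∀ e, S.IsVerticalSaddle (path e) (len e)
  starts : ∀ e, S.StartsAlong (path e) e
  inv_inv : ∀ e, inv (inv e) = e
  len_inv : ∀ e, len (inv e) = len e
  path_inv : ∀ e, ∀ t ∈ Set.Icc 0 (len e), τ (path e t) = path (inv e) (len e - t)

/-- The half turn followed backwards along a saddle connection is again an upward saddle connection.
The separatrix along which it starts defines the involution. -/
theorem IsPeriodicHalfTurn.exists_saddleSystem [T2Space X] (hP : S.IsPeriodicHalfTurn τ) :
    Nonempty (S.SaddleSystem τ) := by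
  choose γ ℓ hγ hs using hP.exists_saddle
  have hrev : ∀ e, ∃ e', S.StartsAlong (fun t => τ (γ e (ℓ e - t))) e' := fun e =>
    hP.exists_startsAlong ((hγ e).reverse hP.halfTurn).isRay
  choose ι hι using hrev
  have h1 : ∀ e, ℓ e = ℓ (ι e) ∧ ∀ u ∈ Set.Icc 0 (ℓ e), τ (γ e (ℓ e - u)) = γ (ι e) u := fun e =>
    (hι e).saddle_eqOn (hs (ι e)) ((hγ e).reverse hP.halfTurn) (hγ (ι e))
  have hinv : ∀ e, ι (ι e) = e := by
    intro e
    refine StartsAlong.unique hP.finite (hP.ord_eq _ (ι (ι e)).1.2) (hι (ι e)) ?_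
      ((hγ (ι e)).reverse hP.halfTurn).isRay
    have := hs e
    filter_upwards [this, Ioo_mem_nhdsGT (hγ e).1] with t ht ht'
    rw [← ht, ← (h1 e).1, ← (h1 e).2 _ ⟨by linarith [ht'.2], by linarith [ht'.1]⟩,
      hP.halfTurn.involutive, sub_sub_cancel]
  exact ⟨⟨γ, ℓ, ⟨ι, ι, hinv, hinv⟩, hγ, hs, hinv, fun e => (h1 e).1.symm, fun e t ht => by
    have := (h1 e).2 (ℓ e - t) ⟨by linarith [ht.2], by linarith [ht.1]⟩
    rwa [sub_sub_cancel] at this⟩⟩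

namespace SaddleSystem

variable (D : S.SaddleSystem τ)

/-- The saddle connection that follows `e` on the left boundary of the cylinder to the right
of `e`. -/
def next : Equiv.Perm S.Separatrix :=
  -- The upper end of `e` is the image of the start of `inv e`. If the latter starts in sector `k`,
  -- then `e` ends along the downward ray of sector `k - 1`, and the right half disc of that sector
  -- is bounded above by its own upward ray.
  D.inv.trans ((Equiv.refl _).prodCongr (Equiv.subRight 1))

theorem next_apply (e : S.Separatrix) : D.next e = ((D.inv e).1, (D.inv e).2 - 1) := rfl

theorem len_pos (e : S.Separatrix) : 0 < D.len e := (D.saddle e).1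

theorem isVertAt {e : S.Separatrix} {t : ℝ} (ht : t ∈ Set.Ioo 0 (D.len e)) :
    S.IsVertAt (D.path e) t := (D.saddle e).2.2.2.2 t ht

variable [T2Space X]

theorem path_zero (e : S.Separatrix) : D.path e 0 = e.1 :=
  (D.starts e).zero_eq (D.saddle e).isRay

theorem path_len (hτ : S.IsHalfTurn τ) (e : S.Separatrix) :
    D.path e (D.len e) = (D.next e).1 := by
  have := D.path_inv e (D.len e) ⟨(D.len_pos e).le, le_rfl⟩
  rw [sub_self, path_zero, hτ.fix _ (D.saddle e).2.2.2.1] at this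
  exact this

theorem disjoint (hP : S.IsPeriodicHalfTurn τ) {e e' : S.Separatrix} {t t' : ℝ}
    (ht : t ∈ Set.Ioo 0 (D.len e))
    (ht' : t' ∈ Set.Ioo 0 (D.len e')) (h : D.path e t = D.path e' t') : e = e' ∧ t = t' := by
  have h1 := (D.saddle e).eqOn (D.saddle e') ht ht' h
  refine ⟨?_, h1.2.1⟩
  refine StartsAlong.unique hP.finite (hP.ord_eq _ e.1.2) (D.starts e) ?_ (D.saddle e).isRay
  filter_upwards [D.starts e', Ioo_mem_nhdsGT (D.len_pos e)] with u hu hu'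
  rw [← hu, h1.2.2 u ⟨hu'.1.le, hu'.2.le⟩]

theorem cover (hP : S.IsPeriodicHalfTurn τ) {x : X} (hx : S.ord x = 0) :
    (∃ C, S.IsVerticalCylinder C ∧ x ∈ C) ∨ ∃ e, ∃ t ∈ Set.Ioo 0 (D.len e), x = D.path e t := by
  rcases hP.periodic x hx with h | ⟨γ, ℓ, hγ, t, ht, rfl⟩
  · exact Or.inl h
  · right
    obtain ⟨e, he⟩ := hP.exists_startsAlong hγ.isRay
    obtain ⟨h1, h2⟩ := he.saddle_eqOn (D.starts e) hγ (D.saddle e)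
    exact ⟨e, t, by rwa [← h1], h2 t ⟨ht.1.le, ht.2.le⟩⟩

theorem ends_along (hP : S.IsPeriodicHalfTurn τ) (e : S.Separatrix) :
    ∀ᶠ s : ℝ in 𝓝[>] 0, D.path e (D.len e - s) =
      S.sector (D.next e).1 (D.next e).2 (-(s * Complex.I)) := by
  have h1 := eventually_half_turn_sector hP.halfTurn (hP.ord_eq _ (D.inv e).1.2) hP.finite
    ((D.inv e).2 - 1)
  filter_upwards [h1, D.starts (D.inv e), Ioo_mem_nhdsGT (D.len_pos e)] with s h2 h3 h4
  rw [next_apply, ← h2, sub_add_cancel, ← h3,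
    D.path_inv (D.inv e) s ⟨h4.1.le, by rw [D.len_inv]; exact h4.2.le⟩, D.inv_inv, D.len_inv]

end SaddleSystem

end TranslationSurface

/-! ### The cylinder to the right of a saddle connection -/

theorem isPreconnected_halfDisc (δ w : ℝ) :
    IsPreconnected {z : ℂ | ‖z‖ < δ ∧ z ∈ openStrip w} := by
  have h1 : {z : ℂ | ‖z‖ < δ ∧ z ∈ openStrip w} =
      Metric.ball 0 δ ∩ Complex.reLm ⁻¹' Set.Ioo 0 w := by
    ext z; simp [mem_openStrip]
  rw [h1]
  exact ((convex_ball 0 δ).inter ((convex_Ioo 0 w).linear_preimage Complex.reLm)).isPreconnected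

theorem exists_mem_halfDisc {c : ℂ} (hc : c.re = 0) {w : ℝ} (hw : 0 < w) {P : ℂ → Prop}
    (hP : ∀ᶠ z in 𝓝 c, 0 < z.re → P z) : ∃ z, z ∈ openStrip w ∧ P z := by
  have h1 : Filter.Tendsto (fun x : ℝ => c + x) (𝓝[>] 0) (𝓝 c) := by
    have : Continuous fun x : ℝ => c + (x : ℂ) := by fun_prop
    simpa using (this.tendsto 0).mono_left nhdsWithin_le_nhds
  obtain ⟨x, hx, hx'⟩ := ((h1.eventually hP).and (Ioo_mem_nhdsGT hw)).exists
  refine ⟨c + x, ?_, hx ?_⟩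
  · rw [mem_openStrip]; simpa [hc] using hx'
  · simpa [hc] using hx'.1

namespace TranslationSurface

variable {X : Type*} [TopologicalSpace X] {S : TranslationSurface X} {f g : ℂ → X} {p : X}
  {τ : X → X} {w h : ℝ}

theorem IsCylinderMap.shift (hf : S.IsCylinderMap f w h) {c : ℂ} (hc : c.re = 0) :
    S.IsCylinderMap (fun z => f (z + c)) w h ∧
      (fun z => f (z + c)) '' openStrip w = f '' openStrip w := by
  have hadd : ∀ z, z + c ∈ openStrip w ↔ z ∈ openStrip w := by
    intro z; simp [mem_openStrip, hc]
  refine ⟨⟨hf.1, hf.2.1, fun z hz => (hf.trans ((hadd z).2 hz)).comp_add, fun z hz z' hz' => ?_⟩, ?_⟩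
  · rw [hf.2.2.2 _ ((hadd z).2 hz) _ ((hadd z').2 hz')]
    refine exists_congr fun n => ⟨fun h => by linear_combination h, fun h => by rw [h]; ring⟩
  · ext x; constructor
    · rintro ⟨z, hz, rfl⟩; exact ⟨z + c, (hadd z).2 hz, rfl⟩
    · rintro ⟨z, hz, rfl⟩
      exact ⟨z - c, by rw [← hadd, sub_add_cancel]; exact hz, by simp⟩

theorem IsCylinderMap.congr (hf : S.IsCylinderMap f w h) (hfg : ∀ z ∈ openStrip w, f z = g z) :
    S.IsCylinderMap g w h := by
  refine ⟨hf.1, hf.2.1, fun z hz => (hf.trans hz).congr ?_, fun z hz z' hz' => ?_⟩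
  · filter_upwards [(isOpen_openStrip w).mem_nhds hz] with u hu using hfg u hu
  · rw [← hfg z hz, ← hfg z' hz']; exact hf.2.2.2 z hz z' hz'

theorem IsCylinderMap.anti (hτ : S.IsHalfTurn τ) (hf : S.IsCylinderMap f w h) :
    S.IsCylinderMap (fun z => τ (f (w - z))) w h ∧
      (fun z => τ (f (w - z))) '' openStrip w = τ '' (f '' openStrip w) := by
  have hsub : ∀ z, (w : ℂ) - z ∈ openStrip w ↔ z ∈ openStrip w := by
    intro z; simp only [mem_openStrip, Complex.sub_re, Complex.ofReal_re]
    constructor <;> rintro ⟨h1, h2⟩ <;> constructor <;> linarith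
  refine ⟨⟨hf.1, hf.2.1, fun z hz => IsTransAt.anti hτ (hf.trans ((hsub z).2 hz)),
    fun z hz z' hz' => ?_⟩, ?_⟩
  · rw [hτ.involutive.injective.eq_iff, hf.2.2.2 _ ((hsub z).2 hz) _ ((hsub z').2 hz')]
    constructor
    · rintro ⟨n, hn⟩; exact ⟨-n, by push_cast; linear_combination -hn⟩
    · rintro ⟨n, rfl⟩; exact ⟨-n, by push_cast; ring⟩
  · ext x; constructor
    · rintro ⟨z, hz, rfl⟩; exact ⟨_, ⟨_, (hsub z).2 hz, rfl⟩, rfl⟩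
    · rintro ⟨_, ⟨z, hz, rfl⟩, rfl⟩
      exact ⟨w - z, (hsub z).2 hz, by simp⟩

theorem IsVerticalCylinder.anti (hτ : S.IsHalfTurn τ) {C : Set X} (hC : S.IsVerticalCylinder C) :
    S.IsVerticalCylinder (τ '' C) := by
  obtain ⟨f, w, h, hf, rfl⟩ := hC.prop
  refine ⟨⟨_, w, h, (hf.anti hτ).1, (hf.anti hτ).2.symm⟩, ?_⟩
  rintro _ ⟨g, w', h', hg, rfl⟩ hle
  have h1 : f '' openStrip w ⊆ τ '' (g '' openStrip w') := by
    intro x hx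
    exact ⟨τ x, hle ⟨x, hx, rfl⟩, hτ.involutive x⟩
  have h2 := hC.eq_of_subset ⟨_, w', h', (hg.anti hτ).1, (hg.anti hτ).2.symm⟩ h1
  rw [h2]
  intro x hx
  exact ⟨τ x, ⟨x, hx, rfl⟩, hτ.involutive x⟩

/-- On a half disc, a partially defined translation map that agrees with `g` near one point of
the diameter agrees with it everywhere. -/
theorem halfDisc_iff [T2Space X] {δ : ℝ} (hw : 0 < w) {b : ℂ}
    (hf : ∀ z ∈ openStrip w, S.IsTransAt f (z + b))
    (hg : ∀ z : ℂ, ‖z‖ < δ → 0 < z.re → S.IsTransAt g z) {c : ℂ} (hc : c.re = 0)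
    (hcδ : ‖c‖ < δ) :
    (∀ᶠ z in 𝓝 c, 0 < z.re → f (z + b) = g z) ↔
      ∀ z ∈ openStrip w, ‖z‖ < δ → f (z + b) = g z := by
  have hnear : ∀ᶠ z in 𝓝 c, ‖z‖ < δ ∧ z.re < w :=
    (continuous_norm.continuousAt.eventually_lt continuousAt_const hcδ).and
      (Complex.continuous_re.continuousAt.eventually_lt continuousAt_const (by rwa [hc]))
  constructor
  · intro h z hz hzδ
    obtain ⟨z₀, hz₀, h1, h2, h3⟩ := exists_mem_halfDisc hc hw
      (P := fun z => f (z + b) = g z ∧ ‖z‖ < δ ∧ z.re < w) (by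
        filter_upwards [h, hnear] with z h1 h2 h3 using ⟨h1 h3, h2⟩)
    exact IsTransAt.eqOn (S := S) (f := fun z => f (z + b)) (isPreconnected_halfDisc δ w)
      (fun z hz => (hf z hz.2).comp_add) (fun z hz => hg z hz.1 hz.2.1) (z₀ := z₀)
      ⟨h2, hz₀⟩ h1 z ⟨hzδ, hz⟩
  · intro h
    filter_upwards [hnear] with z h1 h2 using h z ⟨h2, h1.2⟩ h1.1

/-- The map `f`, defined to the right of the imaginary axis, extends along the path `γ`. -/
def ExtendsAlong (S : TranslationSurface X) (f : ℂ → X) (γ : ℝ → X) (t : ℝ) : Prop :=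
  ∀ᶠ z in 𝓝 (0 : ℂ), 0 < z.re → f (z + t * Complex.I) = (S.chart (γ t)).symm z

theorem exists_trans_ball (hS : IsClosed {x | S.ord x ≠ 0}) (hp : S.ord p = 0) :
    ∃ δ > 0, ∀ z : ℂ, ‖z‖ < δ → S.IsTransAt (S.chart p).symm z := by
  obtain ⟨δ, hδ, h⟩ := Metric.eventually_nhds_iff.1 ((isTransAt_symm hp).eventually hS)
  exact ⟨δ, hδ, fun z hz => h (by simpa using hz)⟩

/-- Change of chart: near a regular point the standard chart may be replaced by any translation map
through that point, such as a sector at a zero. -/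
theorem extendsAlong_iff_of_eq {γ : ℝ → X} {t c : ℝ} (hγ : S.ord (γ t) = 0)
    (hg : S.IsTransAt g (c * Complex.I)) (h : γ t = g (c * Complex.I)) :
    S.ExtendsAlong f γ t ↔ ∀ᶠ z in 𝓝 ((c : ℂ) * Complex.I), 0 < z.re →
      f (z + (((t - c : ℝ) : ℂ) * Complex.I)) = g z := by
  have h1 := (isTransAt_symm hγ).local_eq hg (by rw [symm_zero, h])
  have h2 : 𝓝 ((c : ℂ) * Complex.I) = Filter.map (fun z => z + (c : ℂ) * Complex.I) (𝓝 0) := by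
    have := (Homeomorph.addRight ((c : ℂ) * Complex.I)).map_nhds_eq 0
    simpa using this.symm
  rw [h2, Filter.eventually_map, ExtendsAlong]
  refine Filter.eventually_congr ?_
  filter_upwards [h1] with z hz
  rw [zero_add] at hz
  rw [hz]
  have e1 : z + (c : ℂ) * Complex.I + ((t - c : ℝ) : ℂ) * Complex.I = z + t * Complex.I := by
    push_cast; ring
  rw [e1]
  simp [add_comm]

theorem ExtendsAlong.all [T2Space X] (hS : IsClosed {x | S.ord x ≠ 0}) (hw : 0 < w)
    (hf : ∀ z ∈ openStrip w, S.IsTransAt f z) {γ : ℝ → X} {I : Set ℝ} (hI : IsPreconnected I)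
    (hγ : ∀ t ∈ I, S.IsVertAt γ t) {t₀ : ℝ} (ht₀ : t₀ ∈ I) (h : S.ExtendsAlong f γ t₀) :
    ∀ t ∈ I, S.ExtendsAlong f γ t := by
  refine hI.forall_of_eventually_iff (fun t ht => ?_) ht₀ h
  obtain ⟨δ, hδ, hg⟩ := exists_trans_ball hS (hγ t ht).1
  have h1 := (hγ t ht).eventually_eq
  have h2 : ∀ᶠ s in 𝓝 t, |s - t| < δ := by
    have : Continuous fun s : ℝ => |s - t| := by fun_prop
    exact this.continuousAt.eventually_lt continuousAt_const (by simpa using hδ)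
  have hf' : ∀ z ∈ openStrip w, S.IsTransAt f (z + (t : ℂ) * Complex.I) := fun z hz =>
    hf _ (by simpa [mem_openStrip] using hz)
  have key := fun (c : ℂ) (hc : c.re = 0) (hcδ : ‖c‖ < δ) => halfDisc_iff (S := S) (f := f)
    (g := (S.chart (γ t)).symm) (δ := δ) hw hf' (fun z hz _ => hg z hz) hc hcδ
  filter_upwards [nhdsWithin_le_nhds h1, nhdsWithin_le_nhds h2, self_mem_nhdsWithin] with s hs hs2 hsI
  have hn : ‖((s - t : ℝ) : ℂ) * Complex.I‖ < δ := by
    simpa only [norm_mul, Complex.norm_I, mul_one, Complex.norm_real, Real.norm_eq_abs] using hs2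
  rw [extendsAlong_iff_of_eq (hγ s hsI).1 (hg _ hn) hs, sub_sub_cancel, key _ (by simp) hn]
  rw [← key 0 (by simp) (by simpa using hδ)]
  rfl

namespace SaddleSystem

variable (D : S.SaddleSystem τ) {e : S.Separatrix}

/-- The map `f`, defined to the right of the imaginary axis, extends along the saddle
connection `e`. -/
def RightOf (f : ℂ → X) (e : S.Separatrix) : Prop :=
  ∀ t ∈ Set.Ioo 0 (D.len e), S.ExtendsAlong f (D.path e) t

variable [T2Space X] {D}

theorem rightOf_of_extendsAlong (hP : S.IsPeriodicHalfTurn τ) (hw : 0 < w)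
    (hf : ∀ z ∈ openStrip w, S.IsTransAt f z) {t : ℝ} (ht : t ∈ Set.Ioo 0 (D.len e))
    (h : S.ExtendsAlong f (D.path e) t) : D.RightOf f e :=
  ExtendsAlong.all hP.finite.isClosed hw hf isPreconnected_Ioo (fun _ ht => D.isVertAt ht) ht h

theorem sector_I_mem {ε s : ℝ} (hs : s ≠ 0) (hsε : |s| < ε) :
    ‖(s : ℂ) * Complex.I‖ < ε ∧ (s : ℂ) * Complex.I ∈ Complex.slitPlane := by
  constructor
  · simpa using hsε
  · apply mem_slitPlane_of_re_nonneg <;> simp [hs]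

/-- Lying to the right of a saddle connection can be tested at its singular origin: the half disc of
the sector at the zero also touches the beginning of `e`, and agreement near one point of the
diameter spreads over the half disc. -/
theorem rightOf_iff (hP : S.IsPeriodicHalfTurn τ) (hw : 0 < w)
    (hf : ∀ z ∈ openStrip w, S.IsTransAt f z) :
    D.RightOf f e ↔ ∀ᶠ z in 𝓝 (0 : ℂ), 0 < z.re → f z = S.sector e.1 e.2 z := by
  obtain ⟨ε, hε, -, -, h3⟩ := exists_sector_radius hP.finite (hP.ord_eq _ e.1.2)
  obtain ⟨t, ⟨ht, ht'⟩, hst⟩ := (Filter.Eventually.and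
    (Ioo_mem_nhdsGT (lt_min (D.len_pos e) hε)) (D.starts e)).exists
  rw [lt_min_iff] at ht'
  have hmem := sector_I_mem ht.ne' (ε := ε) (by rw [abs_of_pos ht]; exact ht'.2)
  have h4 := extendsAlong_iff_of_eq (S := S) (f := f) (γ := D.path e) (t := t) (c := t)
    (g := S.sector e.1 e.2) (D.isVertAt ⟨ht, ht'.1⟩).1 (h3 _ _ hmem.1 hmem.2) hst
  have key := fun (c : ℂ) (hc : c.re = 0) (hcδ : ‖c‖ < ε) => halfDisc_iff (S := S) (f := f)
    (g := S.sector e.1 e.2) (δ := ε) (b := 0) hw (by simpa using hf)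
    (fun z hz hz' => h3 _ z hz (mem_slitPlane_of_re_nonneg hz'.le (by rintro rfl; simp at hz')))
    hc hcδ
  have h5 : S.ExtendsAlong f (D.path e) t ↔
      ∀ᶠ z in 𝓝 (0 : ℂ), 0 < z.re → f z = S.sector e.1 e.2 z := by
    have k1 := key _ (by simp) hmem.1
    have k2 := key 0 (by simp) (by simpa using hε)
    simp only [add_zero] at k1 k2
    rw [h4, k2, ← k1]; simp
  rw [← h5]
  exact ⟨fun h => h t ⟨ht, ht'.1⟩, fun h => rightOf_of_extendsAlong hP hw hf ⟨ht, ht'.1⟩ h⟩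

/-- The half disc at the upper end of `e` has the end of `e` as its lower radius and the beginning
of the next saddle connection as its upper radius. Agreement passes from one to the other through
this half disc. -/
theorem RightOf.next (hP : S.IsPeriodicHalfTurn τ) (hw : 0 < w)
    (hf : ∀ z ∈ openStrip w, S.IsTransAt f z) (h : D.RightOf f e) :
    D.RightOf (fun z => f (z + D.len e * Complex.I)) (D.next e) := by
  have hf' : ∀ z ∈ openStrip w, S.IsTransAt f (z + (D.len e : ℂ) * Complex.I) := fun z hz =>
    hf _ (by simpa [mem_openStrip] using hz)
  rw [rightOf_iff hP hw (fun z hz => (hf' z hz).comp_add)]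
  obtain ⟨ε, hε, -, -, h3⟩ := exists_sector_radius hP.finite (hP.ord_eq _ (D.next e).1.2)
  obtain ⟨s, ⟨hs, hs'⟩, hst⟩ := (Filter.Eventually.and
    (Ioo_mem_nhdsGT (lt_min (D.len_pos e) hε)) (D.ends_along hP e)).exists
  rw [lt_min_iff] at hs'
  have hmem := sector_I_mem (neg_ne_zero.2 hs.ne') (ε := ε)
    (by rw [abs_neg, abs_of_pos hs]; exact hs'.2)
  have hI : D.len e - s ∈ Set.Ioo 0 (D.len e) := ⟨by linarith, by linarith⟩
  have h4 := (extendsAlong_iff_of_eq (S := S) (f := f) (γ := D.path e) (t := D.len e - s) (c := -s)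
    (g := S.sector (D.next e).1 (D.next e).2) (D.isVertAt hI).1 (h3 _ _ hmem.1 hmem.2)
    (by rw [hst]; congr 1; push_cast; ring)).1 (h _ hI)
  have key := fun (c : ℂ) (hc : c.re = 0) (hcδ : ‖c‖ < ε) => halfDisc_iff (S := S) (f := f)
    (g := S.sector (D.next e).1 (D.next e).2) (δ := ε) hw hf'
    (fun z hz hz' => h3 _ z hz (mem_slitPlane_of_re_nonneg hz'.le (by rintro rfl; simp at hz')))
    hc hcδ
  rw [key 0 (by simp) (by simpa using hε), ← key _ (by simp) hmem.1]
  simpa using h4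

/-- Near the interior points of a saddle connection, there are no points of saddle connections
to the right. -/
theorem eventually_notMem (hP : S.IsPeriodicHalfTurn τ) (hp : S.ord p = 0) :
    ∀ᶠ x : ℝ in 𝓝[>] 0, ∀ e, ∀ t ∈ Set.Icc 0 (D.len e), (S.chart p).symm x ≠ D.path e t := by
  have : Finite {p : X // S.ord p ≠ 0} := hP.finite.to_subtype
  rw [Filter.eventually_all]
  intro e
  have hc : Continuous fun x : ℝ => (x : ℂ) := by fun_prop
  have hsymm : ContinuousAt (fun x : ℝ => (S.chart p).symm x) 0 :=
    (continuousAt_symm_zero p).comp_of_eq hc.continuousAt (by simp)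
  have hinj : ∀ᶠ z in 𝓝 (0 : ℂ), z ∈ (S.chart p).target :=
    (S.chart p).open_target.mem_nhds (zero_mem_target p)
  have key : ∀ t ∈ Set.Icc 0 (D.len e), ∀ᶠ z : ℝ × ℝ in 𝓝 0 ×ˢ 𝓝[Set.Icc 0 (D.len e)] t,
      0 < z.1 → (S.chart p).symm z.1 ≠ D.path e z.2 := by
    intro t ht
    by_cases htp : D.path e t = p
    -- Where the saddle connection passes through `p`, its nearby points have purely imaginary
    -- coordinates, whereas the point in question has a positive real one.
    · have ht' : t ∈ Set.Ioo 0 (D.len e) := by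
        refine ⟨lt_of_le_of_ne ht.1 ?_, lt_of_le_of_ne ht.2 ?_⟩
        · rintro rfl; exact (D.saddle e).2.2.1 (htp ▸ hp)
        · rintro rfl; exact (D.saddle e).2.2.2.1 (htp ▸ hp)
      have h1 := (D.isVertAt ht').eventually_eq
      rw [htp] at h1
      have h2 : ∀ᶠ s in 𝓝 t, (((s - t : ℝ) : ℂ) * Complex.I) ∈ (S.chart p).target := by
        have : Continuous fun s : ℝ => (((s - t : ℝ) : ℂ) * Complex.I) := by fun_prop
        have := this.tendsto t
        rw [sub_self, Complex.ofReal_zero, zero_mul] at this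
        exact this.eventually hinj
      have h3 : ∀ᶠ x : ℝ in 𝓝 0, (x : ℂ) ∈ (S.chart p).target := by
        have := hc.tendsto 0
        rw [Complex.ofReal_zero] at this
        exact this.eventually hinj
      have h4 := Filter.Eventually.prod_mk h3 (nhdsWithin_le_nhds (s := Set.Icc 0 (D.len e)) (h1.and h2))
      filter_upwards [h4] with z hz hz0 heq
      rw [hz.2.1] at heq
      have := congrArg Complex.re ((S.chart p).symm.injOn hz.1 hz.2.2 heq)
      simp at this
      exact hz0.ne' this
    · have h5 : Filter.Tendsto (fun z : ℝ × ℝ => ((S.chart p).symm z.1, D.path e z.2))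
          (𝓝 0 ×ˢ 𝓝[Set.Icc 0 (D.len e)] t) (𝓝 (p, D.path e t)) := by
        rw [nhds_prod_eq]
        refine Filter.Tendsto.prodMk ?_ ?_
        · have := hsymm.tendsto.comp (Filter.tendsto_fst (f := 𝓝 (0:ℝ))
            (g := 𝓝[Set.Icc 0 (D.len e)] t))
          simpa [symm_zero, Function.comp_def] using this
        · exact Filter.Tendsto.comp ((D.saddle e).2.1 t ht) Filter.tendsto_snd
      have h6 := h5.eventually (isClosed_diagonal.isOpen_compl.mem_nhds (Ne.symm htp))
      filter_upwards [h6] with z hz _ heq using hz heq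
  have h7 : ∀ᶠ x : ℝ in 𝓝 0, ∀ t ∈ Set.Icc 0 (D.len e), 0 < x →
      (S.chart p).symm x ≠ D.path e t := by
    -- Compactness of the closed saddle connection makes the local bounds on `x` uniform in `t`.
    have h8 := IsCompact.eventually_forall_of_forall_eventually (x₀ := (0 : ℝ))
      (K := (Set.univ : Set (Set.Icc 0 (D.len e)))) isCompact_univ
      (P := fun x t => 0 < x → (S.chart p).symm x ≠ D.path e t) fun t _ => by
        rw [nhds_prod_eq]
        exact (Filter.tendsto_id.prodMap (tendsto_nhdsWithin_iff.2
          ⟨continuous_subtype_val.tendsto t, .of_forall Subtype.prop⟩)).eventually (key t t.2)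
    filter_upwards [h8] with x hx t ht using hx ⟨t, ht⟩ trivial
  filter_upwards [nhdsWithin_le_nhds h7, self_mem_nhdsWithin] with x hx hx0 t ht using hx t ht hx0

/-- Points just to the right of an interior point of `e` are on no saddle connection, so they lie in
maximal cylinders. It remains to see that the left edge of such a cylinder is exactly `e`. -/
theorem exists_rightOf [CompactSpace X] [ConnectedSpace X] (hP : S.IsPeriodicHalfTurn τ)
    (e : S.Separatrix) : ∃ f w h, S.IsCylinderMap f w h ∧
      S.IsVerticalCylinder (f '' openStrip w) ∧ D.RightOf f e := by
  obtain ⟨t, ht⟩ : ∃ t, t ∈ Set.Ioo 0 (D.len e) := Set.nonempty_Ioo.2 (D.len_pos e)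
  obtain ⟨m, hm⟩ : ∃ m, m = D.path e t := ⟨_, rfl⟩
  have hm0 : S.ord m = 0 := hm ▸ (D.isVertAt ht).1
  obtain ⟨δ, hδ, hg⟩ := exists_trans_ball hP.finite.isClosed hm0
  obtain ⟨g, hgdef⟩ : ∃ g : ℂ → X, g = (S.chart m).symm := ⟨_, rfl⟩
  rw [← hgdef] at hg
  have hg0 : g 0 = m := by rw [hgdef, symm_zero]
  have hev := (D.eventually_notMem hP hm0).and (Ioo_mem_nhdsGT hδ)
  obtain ⟨η, hη, hηs⟩ := mem_nhdsGT_iff_exists_Ioo_subset.1 hev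
  rw [Set.mem_Ioi] at hη
  have hcyl : ∀ x ∈ Set.Ioo 0 η, ∃ C, S.IsVerticalCylinder C ∧ g x ∈ C := by
    intro x hx
    have hxη := hηs hx
    have hreg : S.ord (g x) = 0 := (hg x (by
      rw [Complex.norm_real, Real.norm_eq_abs, abs_of_pos hx.1]; exact hxη.2.2)).1
    rcases D.cover hP hreg with h | ⟨e', t', ht', h⟩
    · exact h
    · exact absurd (by rwa [hgdef] at h) (hxη.1 e' t' ⟨ht'.1.le, ht'.2.le⟩)
  have hηδ : η ≤ δ := by
    by_contra hlt
    push Not at hlt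
    have := (hηs (a := (δ + η) / 2) ⟨by linarith, by linarith⟩).2.2
    linarith
  obtain ⟨x₀, hx₀⟩ : ∃ x, x ∈ Set.Ioo 0 η := Set.nonempty_Ioo.2 hη
  obtain ⟨C, hC, hx₀C⟩ := hcyl x₀ hx₀
  obtain ⟨f, w, h, hf, rfl⟩ := hC.prop
  obtain ⟨z₀, hz₀, hfz₀⟩ := hx₀C
  have hw := hf.1
  have hnorm : ∀ x : ℝ, 0 ≤ x → x < η → ‖(x : ℂ)‖ < δ := by
    intro x hx hxη
    rw [Complex.norm_real, Real.norm_eq_abs, abs_of_nonneg hx]; exact hxη.trans_le hηδ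
  have heq : ∀ z : ℂ, ‖z‖ < δ → z + (z₀ - x₀) ∈ openStrip w → g z = f (z + (z₀ - x₀)) := by
    intro z hz hz'
    have hpre : IsPreconnected (Metric.ball (0 : ℂ) δ ∩
        Complex.reLm ⁻¹' Set.Ioo (-(z₀.re - x₀)) (w - (z₀.re - x₀))) :=
      ((convex_ball 0 δ).inter ((convex_Ioo _ _).linear_preimage Complex.reLm)).isPreconnected
    have hmem : ∀ u : ℂ, u ∈ Metric.ball (0 : ℂ) δ ∩
        Complex.reLm ⁻¹' Set.Ioo (-(z₀.re - x₀)) (w - (z₀.re - x₀)) ↔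
        ‖u‖ < δ ∧ u + (z₀ - x₀) ∈ openStrip w := by
      intro u
      simp only [Set.mem_inter_iff, mem_ball_zero_iff, Set.mem_preimage, Complex.reLm_coe,
        Set.mem_Ioo, mem_openStrip, Complex.add_re, Complex.sub_re, Complex.ofReal_re]
      constructor <;> rintro ⟨h1, h2, h3⟩ <;> refine ⟨h1, ?_, ?_⟩ <;> linarith
    exact IsTransAt.eqOn (S := S) (f := g) (g := fun z => f (z + (z₀ - x₀))) hpre
      (fun u hu => hg u ((hmem u).1 hu).1) (fun u hu => (hf.trans ((hmem u).1 hu).2).comp_add)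
      (z₀ := x₀) ((hmem _).2 ⟨hnorm _ hx₀.1.le hx₀.2, by simpa using hz₀⟩) (by simpa using hfz₀.symm)
      z ((hmem z).2 ⟨hz, hz'⟩)
  -- If `z₀.re < x₀`, the left edge passes through a point strictly to the right of `e`. That point
  -- lies in a maximal cylinder, which meets and hence equals the given one, against
  -- `boundary_notMem`. If `z₀.re > x₀`, the point of `e` would itself lie in the cylinder.
  have hre : z₀.re = x₀ := by
    rcases lt_trichotomy z₀.re x₀ with hlt | heq' | hgt
    · exfalso
      have hz₀' := hz₀.1
      set x₁ := x₀ - z₀.re with hx₁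
      have hx₁mem : x₁ ∈ Set.Ioo 0 η := ⟨by linarith, by linarith [hx₀.2]⟩
      obtain ⟨C₁, hC₁, hxC₁⟩ := hcyl x₁ hx₁mem
      set b : ℂ := z₀ - x₀ + x₁ with hb
      have hbre : b.re = 0 := by simp [hb, hx₁]
      have hgb : S.IsTransAt (fun z => g (z + (x₀ - z₀))) b := by
        refine IsTransAt.comp_add (hg _ ?_)
        have : b + (x₀ - z₀) = (x₁ : ℝ) := by rw [hb]; ring
        rw [this]; exact hnorm _ hx₁mem.1.le hx₁mem.2
      have hgb' : g (b + (x₀ - z₀)) = g x₁ := by congr 1; rw [hb]; ring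
      have hnear : ∀ᶠ z in 𝓝 b, ‖z + (x₀ - z₀)‖ < δ := by
        have : Continuous fun z : ℂ => ‖z + (x₀ - z₀)‖ := by fun_prop
        refine this.continuousAt.eventually_lt continuousAt_const ?_
        have : b + (x₀ - z₀) = (x₁ : ℝ) := by rw [hb]; ring
        rw [this]; exact hnorm _ hx₁mem.1.le hx₁mem.2
      have hfg : ∀ᶠ z in 𝓝 b, z ∈ openStrip w → f z = g (z + (x₀ - z₀)) := by
        filter_upwards [hnear] with z hz hzw
        have := heq _ hz (by ring_nf; exact hzw)
        rw [this]; congr 1; ring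
      have hnot := hf.boundary_notMem (Or.inl hbre) hgb hfg
      simp only [hgb'] at hnot
      obtain ⟨f₁, w₁, h₁, hf₁, rfl⟩ := hC₁.prop
      have hopen : ∀ᶠ z in 𝓝 b, g (z + (x₀ - z₀)) ∈ f₁ '' openStrip w₁ :=
        hgb.continuousAt.eventually (hf₁.isOpen_image.mem_nhds (by simpa only [hgb'] using hxC₁))
      obtain ⟨z, hz, hz1, hz2, hz3⟩ := exists_mem_halfDisc hbre hw (P := fun z =>
        (z ∈ openStrip w → f z = g (z + (x₀ - z₀))) ∧ g (z + (x₀ - z₀)) ∈ f₁ '' openStrip w₁ ∧ True)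
        (by filter_upwards [hfg, hopen] with z h1 h2 _ using ⟨h1, h2, trivial⟩)
      have := hC.eq_of_inter hP.nonempty hC₁ ⟨z, hz, hz1 hz⟩ hz2
      exact hnot (this ▸ hxC₁)
    · exact heq'
    · exfalso
      have h1 := heq 0 (by simpa using hδ) (by
        rw [mem_openStrip] at *; simp; constructor <;> linarith [hz₀.2, hx₀.1])
      refine (D.saddle e).isRay.notMem_cylinder hf ht ?_
      rw [← hm, ← hg0, h1]
      exact ⟨_, by rw [mem_openStrip] at *; simp; constructor <;> linarith [hz₀.2, hx₀.1], rfl⟩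
  obtain ⟨c, hc⟩ : ∃ c : ℂ, c = z₀ - x₀ - t * Complex.I := ⟨_, rfl⟩
  have hcre : c.re = 0 := by simp [hc, hre]
  obtain ⟨hfc, him⟩ := hf.shift hcre
  refine ⟨_, w, h, hfc, by rw [him]; exact hC, rightOf_of_extendsAlong hP hw
    (fun z hz => hfc.trans hz) ht ?_⟩
  have h1 : ∀ᶠ z in 𝓝 (0 : ℂ), ‖z‖ < δ ∧ z.re < w :=
    (continuous_norm.continuousAt.eventually_lt continuousAt_const (by simpa using hδ)).and
      (Complex.continuous_re.continuousAt.eventually_lt continuousAt_const (by simpa using hw))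
  filter_upwards [h1] with z hz hz0
  rw [← hm, ← hgdef, heq z hz.1 (by rw [mem_openStrip]; simp [hre]; exact ⟨hz0, hz.2⟩), hc]
  congr 1; ring

end SaddleSystem

end TranslationSurface

/-! ### Every maximal cylinder lies to the right of some saddle connection -/

namespace TranslationSurface

variable {X : Type*} [TopologicalSpace X] {S : TranslationSurface X} {f g : ℂ → X} {p : X}
  {τ : X → X} {w h : ℝ}

theorem tendsto_of_half_germ {G : ℂ → X} {b : ℂ} {x : X} (hG : Filter.Tendsto G (𝓝 0) (𝓝 x))
    (h : ∀ᶠ z in 𝓝 (0 : ℂ), 0 < z.re → f (z + b) = G z) (hb : b.re = 0) :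
    Filter.Tendsto f (𝓝[openStrip w] b) (𝓝 x) := by
  have h1 : Filter.Tendsto (fun z => z - b) (𝓝[openStrip w] b) (𝓝 0) := by
    have : Continuous fun z : ℂ => z - b := by fun_prop
    simpa using (this.tendsto b).mono_left nhdsWithin_le_nhds
  refine (hG.comp h1).congr' ?_
  filter_upwards [h1.eventually h, self_mem_nhdsWithin] with z hz hzw
  have := hz (by simpa [hb] using hzw.1)
  rw [Function.comp, ← this, sub_add_cancel]

/-- The maximal cylinders to the right of the saddle connections. -/
structure CylinderSystem (D : S.SaddleSystem τ) where
  map : S.Separatrix → ℂ → X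
  width : S.Separatrix → ℝ
  height : S.Separatrix → ℝ
  cyl : ∀ e, S.IsCylinderMap (map e) (width e) (height e)
  vert : ∀ e, S.IsVerticalCylinder (map e '' openStrip (width e))
  right : ∀ e, D.RightOf (map e) e

theorem IsPeriodicHalfTurn.exists_cylinderSystem [T2Space X] [CompactSpace X] [ConnectedSpace X]
    (hP : S.IsPeriodicHalfTurn τ) (D : S.SaddleSystem τ) : Nonempty (CylinderSystem D) := by
  choose f w h h1 h2 h3 using fun e => SaddleSystem.exists_rightOf (D := D) hP e
  exact ⟨⟨f, w, h, h1, h2, h3⟩⟩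

namespace CylinderSystem

variable {D : S.SaddleSystem τ} (Y : CylinderSystem D) {e : S.Separatrix}

/-- The cylinder to the right of the saddle connection `e`. -/
def image (e : S.Separatrix) : Set X := Y.map e '' openStrip (Y.width e)

theorem trans {z : ℂ} (hz : z ∈ openStrip (Y.width e)) : S.IsTransAt (Y.map e) z :=
  (Y.cyl e).trans hz

theorem width_pos (e : S.Separatrix) : 0 < Y.width e := (Y.cyl e).1

theorem height_pos (e : S.Separatrix) : 0 < Y.height e := (Y.cyl e).2.1

variable [T2Space X] [CompactSpace X] [ConnectedSpace X]

/-- Both parametrizations agree near the origin of `e`, so their maximal cylinders meet and are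
equal. By `rigid` they differ by a translation, which is zero since they agree at a point. -/
theorem eq_of_rightOf (hP : S.IsPeriodicHalfTurn τ) (hf : S.IsCylinderMap f w h)
    (hv : S.IsVerticalCylinder (f '' openStrip w)) (hr : D.RightOf f e) :
    w = Y.width e ∧ h = Y.height e ∧ ∀ z ∈ openStrip w, f z = Y.map e z := by
  have h1 := (SaddleSystem.rightOf_iff hP hf.1 fun z hz => hf.trans hz).1 hr
  have h2 := (SaddleSystem.rightOf_iff hP (Y.width_pos e) fun z hz => Y.trans hz).1 (Y.right e)
  obtain ⟨z, hz, hz1⟩ := exists_mem_halfDisc (c := 0) rfl (lt_min hf.1 (Y.width_pos e))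
    (P := fun z => f z = Y.map e z)
    (by filter_upwards [h1, h2] with z h1 h2 hz using (h1 hz).trans (h2 hz).symm)
  have hz2 : z ∈ openStrip w := ⟨hz.1, hz.2.trans_le (min_le_left _ _)⟩
  have hz3 : z ∈ openStrip (Y.width e) := ⟨hz.1, hz.2.trans_le (min_le_right _ _)⟩
  have him := hv.eq_of_inter hP.nonempty (Y.vert e) ⟨z, hz2, rfl⟩ ⟨z, hz3, hz1.symm⟩
  obtain ⟨k1, k2, -, k3⟩ := hf.rigid (Y.cyl e) him hz2 hz3 hz1
  exact ⟨k1, k2, by simpa using k3⟩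

theorem map_next (hP : S.IsPeriodicHalfTurn τ) (e : S.Separatrix) :
    Y.width e = Y.width (D.next e) ∧ Y.height e = Y.height (D.next e) ∧
    ∀ z ∈ openStrip (Y.width e), Y.map e (z + D.len e * Complex.I) = Y.map (D.next e) z := by
  obtain ⟨h1, h2⟩ := (Y.cyl e).shift (c := D.len e * Complex.I) (by simp)
  exact Y.eq_of_rightOf hP h1 (h2 ▸ Y.vert e)
    ((Y.right e).next hP (Y.width_pos e) fun z hz => Y.trans hz)

theorem tendsto_left (hP : S.IsPeriodicHalfTurn τ) {t : ℝ} (ht : t ∈ Set.Icc 0 (D.len e)) :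
    Filter.Tendsto (Y.map e) (𝓝[openStrip (Y.width e)] (t * Complex.I)) (𝓝 (D.path e t)) := by
  have hsec : ∀ e : S.Separatrix, Filter.Tendsto (S.sector e.1 e.2) (𝓝 0) (𝓝 e.1) := by
    intro e
    simpa [ContinuousAt, sector_zero] using continuousAt_sector_zero (S := S) (e.1 : X) e.2
  rcases ht.1.eq_or_lt with h0 | h0
  · rw [← h0, D.path_zero]
    refine tendsto_of_half_germ (hsec e) ?_ (by simp)
    simpa using (SaddleSystem.rightOf_iff hP (Y.width_pos e) fun z hz => Y.trans hz).1 (Y.right e)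
  rcases ht.2.eq_or_lt with h1 | h1
  · rw [h1, D.path_len hP.halfTurn]
    refine tendsto_of_half_germ (hsec (D.next e)) ?_ (by simp)
    have h2 := (Y.right e).next hP (Y.width_pos e) fun z hz => Y.trans hz
    exact (SaddleSystem.rightOf_iff hP (Y.width_pos e) fun z hz => ((Y.trans (by
      simpa [mem_openStrip] using hz)).comp_add)).1 h2
  · refine tendsto_of_half_germ ?_ (Y.right e t ⟨h0, h1⟩) (by simp)
    simpa [symm_zero, ContinuousAt] using continuousAt_symm_zero (S := S) (D.path e t)

theorem exists_len_le (hP : S.IsPeriodicHalfTurn τ) (D : S.SaddleSystem τ) :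
    ∃ m > 0, ∀ e, m ≤ D.len e := by
  have : Finite {p : X // S.ord p ≠ 0} := hP.finite.to_subtype
  obtain ⟨p, hp⟩ := hP.nonempty
  have : Nonempty S.Separatrix := ⟨(⟨p, hp⟩, 0)⟩
  obtain ⟨e, he⟩ := Finite.exists_min D.len
  exact ⟨D.len e, D.len_pos e, he⟩

/-- A left boundary point at any height is reached by climbing from one saddle connection to the
next; the induction gains at least the minimal length `m` in each step. Negative heights are first
raised by a multiple of the period. -/
theorem exists_tendsto_left (hP : S.IsPeriodicHalfTurn τ) (e : S.Separatrix) {b : ℂ}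
    (hb : b.re = 0) :
    ∃ x, Filter.Tendsto (Y.map e) (𝓝[openStrip (Y.width e)] b) (𝓝 x) := by
  have hshift : ∀ (e : S.Separatrix) (c : ℂ) (f : ℂ → X) (b : ℂ) (x : X), c.re = 0 →
      (∀ z ∈ openStrip (Y.width e), Y.map e (z + c) = f z) →
      Filter.Tendsto f (𝓝[openStrip (Y.width e)] b) (𝓝 x) →
      Filter.Tendsto (Y.map e) (𝓝[openStrip (Y.width e)] (b + c)) (𝓝 x) := by
    intro e c f b x hc hf hlim
    have h1 : Filter.Tendsto (fun z => z - c) (𝓝[openStrip (Y.width e)] (b + c))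
        (𝓝[openStrip (Y.width e)] b) := by
      refine tendsto_nhdsWithin_iff.2 ⟨?_, ?_⟩
      · have : Continuous fun z : ℂ => z - c := by fun_prop
        simpa using (this.tendsto (b + c)).mono_left nhdsWithin_le_nhds
      · filter_upwards [self_mem_nhdsWithin] with z hz
        simpa [mem_openStrip, hc] using hz
    refine (hlim.comp h1).congr' ?_
    filter_upwards [self_mem_nhdsWithin] with z hz
    rw [Function.comp, ← hf _ (by simpa [mem_openStrip, hc] using hz), sub_add_cancel]
  obtain ⟨m, hm, hml⟩ := exists_len_le hP D
  have key : ∀ n : ℕ, ∀ e, ∀ y : ℝ, 0 ≤ y → y ≤ n * m →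
      ∃ x, Filter.Tendsto (Y.map e) (𝓝[openStrip (Y.width e)] (y * Complex.I)) (𝓝 x) := by
    intro n
    induction n with
    | zero =>
      intro e y h0 h1
      exact ⟨_, Y.tendsto_left hP ⟨h0, by have := D.len_pos e; simp at h1; linarith⟩⟩
    | succ n ih =>
      intro e y h0 h1
      by_cases hy : y ≤ D.len e
      · exact ⟨_, Y.tendsto_left hP ⟨h0, hy⟩⟩
      · push_cast at h1
        obtain ⟨x, hx⟩ := ih (D.next e) (y - D.len e) (by linarith) (by linarith [hml e])
        obtain ⟨k1, -, k3⟩ := Y.map_next hP e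
        rw [← k1] at hx
        refine ⟨x, ?_⟩
        have := hshift e (D.len e * Complex.I) _ _ x (by simp) k3 hx
        convert this using 2
        push_cast; ring_nf
  obtain ⟨y, rfl⟩ : ∃ y : ℝ, b = y * Complex.I := ⟨b.im, Complex.ext (by simp [hb]) (by simp)⟩
  have hh := Y.height_pos e
  obtain ⟨k, hk⟩ : ∃ k : ℕ, -y ≤ k * Y.height e := by
    obtain ⟨k, hk⟩ := exists_nat_ge (-y / Y.height e)
    exact ⟨k, by rwa [div_le_iff₀ hh] at hk⟩
  obtain ⟨n, hn⟩ : ∃ n : ℕ, y + k * Y.height e ≤ n * m := by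
    obtain ⟨n, hn⟩ := exists_nat_ge ((y + k * Y.height e) / m)
    exact ⟨n, by rwa [div_le_iff₀ hm] at hn⟩
  obtain ⟨x, hx⟩ := key n e (y + k * Y.height e) (by linarith) hn
  refine ⟨x, ?_⟩
  have := hshift e (((-k : ℤ) : ℂ) * (Y.height e * Complex.I)) _ _ x (by simp)
    (fun z hz => (Y.cyl e).periodic hz (-k)) hx
  convert this using 2
  push_cast; ring_nf

theorem notMem_image {e : S.Separatrix} {t : ℝ}
    (ht : t ∈ Set.Ioo 0 (D.len e)) (hf : S.IsCylinderMap f w h) :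
    D.path e t ∉ f '' openStrip w :=
  (D.saddle e).isRay.notMem_cylinder hf ht

/-- Points that are singular, on a saddle connection, or at distance less than `η` to the right of
a saddle connection. -/
def nearRight (η : ℝ) : Set X :=
  {x | S.ord x ≠ 0 ∨ (∃ e, ∃ t ∈ Set.Ioo 0 (D.len e), x = D.path e t) ∨
    ∃ e, ∃ u ∈ openStrip (Y.width e), u.re < η ∧ x = Y.map e u}

theorem eventually_nearRight_saddle {t : ℝ}
    (ht : t ∈ Set.Ioo 0 (D.len e)) {η : ℝ} (hη : 0 < η) :
    ∀ᶠ z in 𝓝 (0 : ℂ), 0 ≤ z.re → (S.chart (D.path e t)).symm z ∈ Y.nearRight η := by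
  have h1 := Y.right e t ht
  have h2 : ∀ᶠ z in 𝓝 (0 : ℂ), z.re < min η (Y.width e) :=
    Complex.continuous_re.continuousAt.eventually_lt continuousAt_const
      (by simpa using ⟨hη, Y.width_pos e⟩)
  have h3 : ∀ᶠ z in 𝓝 (0 : ℂ), t + z.im ∈ Set.Ioo 0 (D.len e) ∧
      D.path e (t + z.im) = (S.chart (D.path e t)).symm ((z.im : ℂ) * Complex.I) := by
    have : Continuous fun z : ℂ => t + z.im := by fun_prop
    have := this.tendsto 0
    simp only [Complex.zero_im, add_zero] at this
    have h4 := this.eventually (Filter.Eventually.and (isOpen_Ioo.mem_nhds ht)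
      (D.isVertAt ht).eventually_eq)
    simpa using h4
  filter_upwards [h1, h2, h3] with z h1 h2 h3 hz
  rcases hz.eq_or_lt with h0 | h0
  · refine Or.inr (Or.inl ⟨e, t + z.im, h3.1, ?_⟩)
    rw [h3.2]; congr 1
    exact Complex.ext (by simp [← h0]) (by simp)
  · refine Or.inr (Or.inr ⟨e, z + t * Complex.I, ?_, ?_, (h1 h0).symm⟩)
    · rw [mem_openStrip]; simp; exact ⟨h0, h2.trans_le (min_le_right _ _)⟩
    · simp; exact h2.trans_le (min_le_left _ _)

/-- In the closed right half disc of a sector the upper radius lies on `e`. The lower radius is the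
image under `τ` of the beginning of the separatrix in the next sector, so it lies on a saddle
connection too. -/
theorem eventually_nearRight_sector (hP : S.IsPeriodicHalfTurn τ) (e : S.Separatrix) {η : ℝ}
    (hη : 0 < η) :
    ∀ᶠ z in 𝓝 (0 : ℂ), 0 ≤ z.re → S.sector e.1 e.2 z ∈ Y.nearRight η := by
  have h1 := (SaddleSystem.rightOf_iff hP (Y.width_pos e) fun z hz => Y.trans hz).1 (Y.right e)
  have h2 : ∀ᶠ z in 𝓝 (0 : ℂ), z.re < min η (Y.width e) :=
    Complex.continuous_re.continuousAt.eventually_lt continuousAt_const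
      (by simpa using ⟨hη, Y.width_pos e⟩)
  obtain ⟨δ, hδ, h3⟩ := mem_nhdsGT_iff_exists_Ioo_subset.1
    (Filter.Eventually.and (D.starts e) (Ioo_mem_nhdsGT (D.len_pos e)))
  have h4 := eventually_half_turn_sector hP.halfTurn (hP.ord_eq _ e.1.2) hP.finite e.2
  obtain ⟨δ', hδ', h5⟩ := mem_nhdsGT_iff_exists_Ioo_subset.1
    (h4.and (Filter.Eventually.and (D.starts (e.1, e.2 + 1))
      (Ioo_mem_nhdsGT (D.len_pos (e.1, e.2 + 1)))))
  have h6 : ∀ᶠ z in 𝓝 (0 : ℂ), |z.im| < min δ δ' := by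
    have : Continuous fun z : ℂ => |z.im| := by fun_prop
    exact this.continuousAt.eventually_lt continuousAt_const (by simpa using ⟨hδ, hδ'⟩)
  filter_upwards [h1, h2, h6] with z h1 h2 h6 hz
  rw [lt_min_iff] at h6
  rcases hz.eq_or_lt with h0 | h0
  · have hzI : z = (z.im : ℂ) * Complex.I := Complex.ext (by simp [← h0]) (by simp)
    rcases lt_trichotomy z.im 0 with hneg | hzero | hpos
    · have h7 := h5 (a := -z.im) ⟨by linarith, by rw [abs_of_neg hneg] at h6; exact h6.2⟩
      obtain ⟨h8, h9, h10⟩ := h7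
      rw [Complex.ofReal_neg, neg_mul, neg_neg, ← hzI] at h8
      simp only at h9
      rw [Complex.ofReal_neg, neg_mul, ← hzI] at h9
      rw [← h8, ← h9, D.path_inv _ _ ⟨h10.1.le, h10.2.le⟩]
      refine Or.inr (Or.inl ⟨_, _, ?_, rfl⟩)
      rw [D.len_inv]
      exact ⟨by linarith [h10.2], by linarith [h10.1]⟩
    · have : z = 0 := by rw [hzI, hzero]; simp
      rw [this, sector_zero]
      exact Or.inl e.1.2
    · have h7 := h3 (a := z.im) ⟨hpos, by rw [abs_of_pos hpos] at h6; exact h6.1⟩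
      obtain ⟨h8, h9⟩ := h7
      rw [← hzI] at h8
      exact Or.inr (Or.inl ⟨_, _, h9, h8.symm⟩)
  · refine Or.inr (Or.inr ⟨e, z, ⟨h0, h2.trans_le (min_le_right _ _)⟩,
      h2.trans_le (min_le_left _ _), (h1 h0).symm⟩)

/-- Right half discs are covered directly; the half turn carries left half discs to right ones. -/
theorem eventually_nearRight (hP : S.IsPeriodicHalfTurn τ)
    (hp : S.ord p ≠ 0 ∨ ∃ e, ∃ t ∈ Set.Ioo 0 (D.len e), p = D.path e t) {η : ℝ} (hη : 0 < η) :
    ∀ᶠ a in 𝓝 p, a ∈ Y.nearRight η ∨ τ a ∈ Y.nearRight η := by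
  rcases hp with hp | ⟨e, t, ht, rfl⟩
  · have h1 : ∀ᶠ z in 𝓝 (0 : ℂ), ∀ k, 0 ≤ z.re → S.sector p k z ∈ Y.nearRight η := by
      rw [Filter.eventually_all]
      exact fun k => Y.eventually_nearRight_sector hP (⟨p, hp⟩, k) hη
    obtain ⟨δ, hδ, h2⟩ := Metric.eventually_nhds_iff.1 h1
    filter_upwards [eventually_mem_sector hP.halfTurn (hP.ord_eq p hp) hδ] with a ha
    obtain ⟨k, z, hz, hz', h | h⟩ := ha
    · left; rw [h]; exact h2 (by simpa using hz) k hz'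
    · right; rw [h]; exact h2 (by simpa using hz) k hz'
  · have h1 := Y.eventually_nearRight_saddle ht hη
    have ht' : D.len e - t ∈ Set.Ioo 0 (D.len (D.inv e)) := by
      rw [D.len_inv]; exact ⟨by linarith [ht.2], by linarith [ht.1]⟩
    have h2 := Y.eventually_nearRight_saddle ht' hη
    have h3 : S.IsTransAt (fun z => τ ((S.chart (D.path e t)).symm (0 - z))) 0 :=
      IsTransAt.anti hP.halfTurn (by simpa using isTransAt_symm (D.isVertAt ht).1)
    have h4 := h3.eventually_eq
    simp only [sub_zero, zero_sub, symm_zero, D.path_inv e t ⟨ht.1.le, ht.2.le⟩] at h4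
    have h5 : ∀ᶠ z in 𝓝 (0 : ℂ), (S.chart (D.path e t)).symm z ∈ Y.nearRight η ∨
        τ ((S.chart (D.path e t)).symm z) ∈ Y.nearRight η := by
      have hneg : Filter.Tendsto (fun z : ℂ => -z) (𝓝 0) (𝓝 0) := by
        simpa using (continuous_neg (G := ℂ)).tendsto 0
      filter_upwards [h1, hneg.eventually h2, hneg.eventually h4] with z k1 k2 k3
      rw [neg_neg] at k3
      rcases le_or_gt 0 z.re with h0 | h0
      · exact Or.inl (k1 h0)
      · right; rw [k3]; exact k2 (by simpa using h0.le)
    rw [← map_symm_nhds_zero (S := S) (D.path e t), Filter.eventually_map]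
    exact h5

/-- Otherwise the closure of the left half would be a compact set covered by the increasing open
sets of points with real part above `1 / (n + 1)`. One of them would contain it, but the left half
contains points arbitrarily close to the edge. -/
theorem exists_boundary_point (hf : S.IsCylinderMap f w h) :
    ∃ x ∈ closure (f '' {z | 0 < z.re ∧ z.re < w / 2}), x ∉ f '' openStrip w := by
  by_contra hcon
  push Not at hcon
  have hw := hf.1
  set U : ℕ → Set X := fun n => f '' {z | 1 / ((n : ℝ) + 1) < z.re ∧ z.re < w} with hU
  have hsub : ∀ n : ℕ, {z : ℂ | 1 / ((n : ℝ) + 1) < z.re ∧ z.re < w} ⊆ openStrip w := by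
    intro n z hz
    exact ⟨lt_trans (by positivity) hz.1, hz.2⟩
  have hUo : ∀ n, IsOpen (U n) := by
    intro n
    rw [isOpen_iff_mem_nhds]
    rintro _ ⟨z, hz, rfl⟩
    rw [← (hf.trans (hsub n hz)).map_nhds]
    exact Filter.image_mem_map ((isOpen_reStrip _ _).mem_nhds hz)
  have hcov : closure (f '' {z | 0 < z.re ∧ z.re < w / 2}) ⊆ ⋃ n, U n := by
    intro x hx
    obtain ⟨z, hz, rfl⟩ := hcon x hx
    obtain ⟨n, hn⟩ := exists_nat_one_div_lt hz.1
    exact Set.mem_iUnion.2 ⟨n, z, ⟨hn, hz.2⟩, rfl⟩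
  obtain ⟨n, hn⟩ := isClosed_closure.isCompact.elim_directed_cover U hUo hcov (by
    refine Monotone.directed_le fun m n hmn => Set.image_mono fun z hz => ⟨lt_of_le_of_lt ?_ hz.1, hz.2⟩
    exact Nat.one_div_le_one_div hmn)
  obtain ⟨r, hr0, hr⟩ : ∃ r : ℝ, 0 < r ∧ r < min (w / 2) (1 / ((n : ℝ) + 1)) :=
    exists_between (lt_min (by linarith) (by positivity))
  rw [lt_min_iff] at hr
  have h1 : f (r : ℂ) ∈ U n := hn (subset_closure ⟨(r : ℂ), by simpa using ⟨hr0, hr.1⟩, rfl⟩)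
  obtain ⟨z, hz, hzr⟩ := h1
  have := hf.re_eq (hsub n hz) (z' := (r : ℂ)) (by rw [mem_openStrip]; simp; constructor <;> linarith) hzr
  simp at this
  linarith [hz.1]

/-- Rigidity applied to the rotated parametrization `z ↦ τ (f (w - z))`: left and right distances
are exchanged, whence the formula for the real part. -/
theorem anti (hP : S.IsPeriodicHalfTurn τ) {e : S.Separatrix} (hf : S.IsCylinderMap f w h)
    {u z : ℂ} (hu : u ∈ openStrip (Y.width e)) (hz : z ∈ openStrip w)
    (hv : S.IsVerticalCylinder (f '' openStrip w)) (h0 : τ (f z) = Y.map e u) :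
    w = Y.width e ∧ h = Y.height e ∧ z.re = w - u.re ∧
      ∀ v ∈ openStrip w, τ (f (w - v)) = Y.map e (v + (u - (w - z))) := by
  obtain ⟨h1, h2⟩ := hf.anti hP.halfTurn
  have hz' : (w : ℂ) - z ∈ openStrip w := by
    rw [mem_openStrip] at *; simp; constructor <;> linarith
  have h3 : (fun z => τ (f (w - z))) '' openStrip w = Y.map e '' openStrip (Y.width e) := by
    rw [h2]
    refine (hv.anti hP.halfTurn).eq_of_inter hP.nonempty (Y.vert e) ⟨f z, ⟨z, hz, rfl⟩, rfl⟩ ?_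
    exact ⟨u, hu, h0.symm⟩
  obtain ⟨k1, k2, k3, k4⟩ := h1.rigid (Y.cyl e) h3 hz' hu (by simpa using h0)
  refine ⟨k1, k2, ?_, k4⟩
  simp at k3; linarith

/-- A boundary point approached from the left half of the cylinder is a zero or lies on a saddle
connection, so nearby points of the cylinder, or their images under `τ`, are close to the right of a
saddle connection. -/
theorem exists_eq_image (hP : S.IsPeriodicHalfTurn τ) {C : Set X} (hC : S.IsVerticalCylinder C) :
    ∃ e, C = Y.image e := by
  obtain ⟨f, w, h, hf, rfl⟩ := hC.prop
  obtain ⟨p, hpcl, hpC⟩ := exists_boundary_point hf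
  have hsub : {z : ℂ | 0 < z.re ∧ z.re < w / 2} ⊆ openStrip w :=
    fun z hz => ⟨hz.1, by linarith [hz.2, hf.1]⟩
  have hp : S.ord p ≠ 0 ∨ ∃ e, ∃ t ∈ Set.Ioo 0 (D.len e), p = D.path e t := by
    by_contra hcon
    push Not at hcon
    rcases D.cover hP hcon.1 with ⟨C', hC', hpC'⟩ | ⟨e, t, ht, hx⟩
    · obtain ⟨f', w', h', hf', rfl⟩ := hC'.prop
      obtain ⟨_, hx, z, hz, rfl⟩ := mem_closure_iff.1 hpcl _ hf'.isOpen_image hpC'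
      have := hC.eq_of_inter hP.nonempty hC' ⟨z, hsub hz, rfl⟩ hx
      exact hpC (this ▸ hpC')
    · exact hcon.2 e t ht hx
  have hev := Y.eventually_nearRight hP hp (η := w / 2) (by linarith [hf.1])
  obtain ⟨U, hU, hUo, hpU⟩ := eventually_nhds_iff.1 hev
  obtain ⟨_, hx, z, hz, rfl⟩ := mem_closure_iff.1 hpcl _ hUo hpU
  have hzs := hsub hz
  rcases hU _ hx with h1 | h1
  · rcases h1 with h1 | ⟨e, t, ht, h1⟩ | ⟨e, u, hu, -, h1⟩
    · exact absurd (hf.trans hzs).1 h1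
    · exact absurd ⟨z, hzs, h1⟩ (notMem_image ht hf)
    · exact ⟨e, hC.eq_of_inter hP.nonempty (Y.vert e) ⟨z, hzs, rfl⟩ ⟨u, hu, h1.symm⟩⟩
  · rcases h1 with h1 | ⟨e, t, ht, h1⟩ | ⟨e, u, hu, hu2, h1⟩
    · rw [hP.halfTurn.ord_eq] at h1
      exact absurd (hf.trans hzs).1 h1
    · have h2 := D.path_inv e t ⟨ht.1.le, ht.2.le⟩
      rw [← h1, hP.halfTurn.involutive] at h2
      refine absurd ⟨z, hzs, h2⟩ (notMem_image (e := D.inv e) (t := D.len e - t) ?_ hf)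
      rw [D.len_inv]; exact ⟨by linarith [ht.2], by linarith [ht.1]⟩
    -- Here the image of the point is within `w / 2` of a left edge, so the point itself is within
    -- `w / 2` of the right edge, although it was taken from the left half.
    · obtain ⟨-, -, h2, -⟩ := Y.anti hP hf hu hzs hC h1
      exfalso; linarith [hz.2]

end CylinderSystem

end TranslationSurface

/-! ### Closed cylinders, their boundary cycles and their heights -/

theorem closedStrip_subset_closure {w : ℝ} (hw : 0 < w) : closedStrip w ⊆ closure (openStrip w) := by
  have h1 : openStrip w = Set.Ioo 0 w ×ℂ Set.univ := by
    ext z; simp [mem_openStrip, Complex.mem_reProdIm]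
  intro z hz
  rw [h1, Complex.closure_reProdIm, closure_Ioo hw.ne, closure_univ, Complex.mem_reProdIm]
  exact ⟨hz, trivial⟩

theorem eqOn_closedStrip {X : Type*} [TopologicalSpace X] [T2Space X] {f g : ℂ → X} {w : ℝ}
    (hw : 0 < w) (hf : ContinuousOn f (closedStrip w)) (hg : ContinuousOn g (closedStrip w))
    (h : ∀ z ∈ openStrip w, f z = g z) : ∀ z ∈ closedStrip w, f z = g z :=
  Set.EqOn.of_subset_closure h hf hg (openStrip_subset_closedStrip w) (closedStrip_subset_closure hw)

theorem continuousOn_comp_add {X : Type*} [TopologicalSpace X] {f : ℂ → X} {w : ℝ} {c : ℂ}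
    (hf : ContinuousOn f (closedStrip w)) (hc : c.re = 0) :
    ContinuousOn (fun z => f (z + c)) (closedStrip w) :=
  hf.comp (by fun_prop) fun z hz => by simpa [mem_closedStrip, hc] using hz

theorem continuousOn_comp_sub {X : Type*} [TopologicalSpace X] {f : ℂ → X} {w : ℝ}
    (hf : ContinuousOn f (closedStrip w)) :
    ContinuousOn (fun z => f (w - z)) (closedStrip w) :=
  hf.comp (by fun_prop) fun z hz => by
    rw [mem_closedStrip] at *; simp; constructor <;> linarith [hz.1, hz.2]

namespace TranslationSurface

variable {X : Type*} [TopologicalSpace X] {S : TranslationSurface X} {f g : ℂ → X} {p : X}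
  {τ : X → X} {w h : ℝ}

theorem ExtendsAlong.congr {γ : ℝ → X} {t : ℝ} (hf : S.ExtendsAlong f γ t) (hw : 0 < w)
    (hfg : ∀ z ∈ openStrip w, f z = g z) : S.ExtendsAlong g γ t := by
  have h1 : ∀ᶠ z in 𝓝 (0 : ℂ), z.re < w :=
    Complex.continuous_re.continuousAt.eventually_lt continuousAt_const (by simpa using hw)
  filter_upwards [hf, h1] with z h2 h3 h4
  rw [← hfg _ (by rw [mem_openStrip]; simp; exact ⟨h4, h3⟩), h2 h4]

/-- The maximal cylinders to the right of the saddle connections, with their boundaries. -/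
structure ClosedCylinderSystem (D : S.SaddleSystem τ) extends CylinderSystem D where
  cont : ∀ e, ContinuousOn (map e) (closedStrip (width e))
  left : ∀ e, ∀ t ∈ Set.Icc 0 (D.len e), map e (t * Complex.I) = D.path e t

section

variable [T2Space X] [CompactSpace X] [ConnectedSpace X] {D : S.SaddleSystem τ}

theorem CylinderSystem.exists_anti (Y : CylinderSystem D) (hP : S.IsPeriodicHalfTurn τ)
    {e e' : S.Separatrix} (h : τ '' Y.image e = Y.image e') :
    Y.width e = Y.width e' ∧ Y.height e = Y.height e' ∧ ∃ c : ℝ, ∀ v ∈ openStrip (Y.width e),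
      Y.map e (Y.width e - v) = τ (Y.map e' (v + c * Complex.I)) := by
  have hw := Y.width_pos e
  set z : ℂ := ((Y.width e / 2 : ℝ) : ℂ)
  have hz : z ∈ openStrip (Y.width e) := by rw [mem_openStrip]; simp [z]; linarith
  obtain ⟨u, hu, hu'⟩ : τ (Y.map e z) ∈ Y.image e' := h ▸ ⟨_, ⟨z, hz, rfl⟩, rfl⟩
  obtain ⟨h1, h2, h3, h4⟩ := Y.anti hP (Y.cyl e) hu hz (Y.vert e) hu'.symm
  refine ⟨h1, h2, (u - (Y.width e - z)).im, fun v hv => ?_⟩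
  have h5 : (((u - (Y.width e - z)).im : ℝ) : ℂ) * Complex.I = u - (Y.width e - z) :=
    Complex.ext (by simp; linarith) (by simp)
  rw [h5, ← h4 v hv, hP.halfTurn.involutive]

/-- Limits at the right edge come from limits at the left edge of the image cylinder under the half
turn. -/
theorem CylinderSystem.exists_tendsto (Y : CylinderSystem D) (hP : S.IsPeriodicHalfTurn τ)
    (e : S.Separatrix) {z : ℂ} (hz : z ∈ closedStrip (Y.width e)) :
    ∃ x, Filter.Tendsto (Y.map e) (𝓝[openStrip (Y.width e)] z) (𝓝 x) := by
  rcases hz.1.eq_or_lt with h0 | h0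
  · exact Y.exists_tendsto_left hP e h0.symm
  rcases hz.2.eq_or_lt with h1 | h1
  · obtain ⟨e', he'⟩ := Y.exists_eq_image hP ((Y.vert e).anti hP.halfTurn)
    obtain ⟨hw, -, c, hc⟩ := Y.exists_anti hP he'
    obtain ⟨x, hx⟩ := Y.exists_tendsto_left hP e' (b := Y.width e - z + c * Complex.I) (by simp [h1])
    refine ⟨τ x, ?_⟩
    have h2 : Filter.Tendsto (fun u : ℂ => Y.width e - u + c * Complex.I)
        (𝓝[openStrip (Y.width e)] z)
        (𝓝[openStrip (Y.width e')] (Y.width e - z + c * Complex.I)) := by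
      refine tendsto_nhdsWithin_iff.2 ⟨?_, ?_⟩
      · have : Continuous fun u : ℂ => Y.width e - u + c * Complex.I := by fun_prop
        exact (this.tendsto z).mono_left nhdsWithin_le_nhds
      · filter_upwards [self_mem_nhdsWithin] with u hu
        rw [← hw]
        rw [mem_openStrip] at *; simp; constructor <;> linarith [hu.1, hu.2]
    refine ((hP.halfTurn.continuous.tendsto x).comp (hx.comp h2)).congr' ?_
    filter_upwards [self_mem_nhdsWithin] with u hu
    have := hc (Y.width e - u) (by
      rw [mem_openStrip] at *; simp; constructor <;> linarith [hu.1, hu.2])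
    rw [sub_sub_cancel] at this
    exact this.symm
  · exact ⟨_, ((Y.trans ⟨h0, h1⟩).continuousAt.tendsto).mono_left nhdsWithin_le_nhds⟩

theorem CylinderSystem.exists_closed (Y : CylinderSystem D) (hP : S.IsPeriodicHalfTurn τ) :
    Nonempty (ClosedCylinderSystem D) := by
  set F : S.Separatrix → ℂ → X := fun e => extendFrom (openStrip (Y.width e)) (Y.map e) with hF
  have hFeq : ∀ e, ∀ z ∈ openStrip (Y.width e), Y.map e z = F e z := by
    intro e z hz
    exact (extendFrom_eq (subset_closure hz)
      ((Y.trans hz).continuousAt.tendsto.mono_left nhdsWithin_le_nhds)).symm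
  have him : ∀ e, F e '' openStrip (Y.width e) = Y.map e '' openStrip (Y.width e) := fun e =>
    Set.image_congr fun z hz => (hFeq e z hz).symm
  refine ⟨⟨⟨F, Y.width, Y.height, fun e => (Y.cyl e).congr (hFeq e), fun e => ?_, fun e t ht => ?_⟩,
    fun e => ?_, fun e t ht => ?_⟩⟩
  · rw [him]; exact Y.vert e
  · exact (Y.right e t ht).congr (Y.width_pos e) (hFeq e)
  · exact continuousOn_extendFrom (closedStrip_subset_closure (Y.width_pos e))
      fun z hz => Y.exists_tendsto hP e hz
  · exact extendFrom_eq (closedStrip_subset_closure (Y.width_pos e)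
      ⟨by simp, by simpa using (Y.width_pos e).le⟩) (Y.tendsto_left hP ht)

end

namespace ClosedCylinderSystem

variable {D : S.SaddleSystem τ} (Y : ClosedCylinderSystem D)

variable [T2Space X] [CompactSpace X] [ConnectedSpace X]

theorem map_next (hP : S.IsPeriodicHalfTurn τ) (e : S.Separatrix) :
    Y.width e = Y.width (D.next e) ∧ Y.height e = Y.height (D.next e) ∧
    ∀ z ∈ closedStrip (Y.width e), Y.map e (z + D.len e * Complex.I) = Y.map (D.next e) z := by
  obtain ⟨h1, h2, h3⟩ := Y.toCylinderSystem.map_next hP e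
  refine ⟨h1, h2, eqOn_closedStrip (Y.width_pos e) (continuousOn_comp_add (Y.cont e) (by simp)) ?_ h3⟩
  rw [h1]; exact Y.cont _

theorem map_period (e : S.Separatrix) (n : ℤ) :
    ∀ z ∈ closedStrip (Y.width e),
      Y.map e (z + (n : ℂ) * (Y.height e * Complex.I)) = Y.map e z :=
  eqOn_closedStrip (Y.width_pos e) (continuousOn_comp_add (Y.cont e) (by simp)) (Y.cont e)
    fun _ hz => (Y.cyl e).periodic hz n

theorem exists_anti (hP : S.IsPeriodicHalfTurn τ)
    {e e' : S.Separatrix} (h : τ '' Y.image e = Y.image e') :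
    Y.width e = Y.width e' ∧ Y.height e = Y.height e' ∧ ∃ c : ℝ, ∀ v ∈ closedStrip (Y.width e),
      Y.map e (Y.width e - v) = τ (Y.map e' (v + c * Complex.I)) := by
  obtain ⟨h1, h2, c, h3⟩ := Y.toCylinderSystem.exists_anti hP h
  refine ⟨h1, h2, c, eqOn_closedStrip (Y.width_pos e) (continuousOn_comp_sub (Y.cont e)) ?_ h3⟩
  rw [h1]
  exact hP.halfTurn.continuous.comp_continuousOn (continuousOn_comp_add (Y.cont e') (by simp))

/-- The height of the lower end of the `k`-th saddle connection above `e` on the left boundary. -/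
def pos (D : S.SaddleSystem τ) (e : S.Separatrix) (k : ℕ) : ℝ :=
  ∑ j ∈ Finset.range k, D.len ((D.next ^ j) e)

theorem pos_succ (D : S.SaddleSystem τ) (e : S.Separatrix) (k : ℕ) :
    pos D e (k + 1) = pos D e k + D.len ((D.next ^ k) e) := Finset.sum_range_succ _ _

theorem pos_strictMono (D : S.SaddleSystem τ) (e : S.Separatrix) : StrictMono (pos D e) :=
  strictMono_nat_of_lt_succ fun k => by rw [pos_succ]; linarith [D.len_pos ((D.next ^ k) e)]

theorem map_pos (hP : S.IsPeriodicHalfTurn τ) (e : S.Separatrix) (k : ℕ) :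
    Y.width e = Y.width ((D.next ^ k) e) ∧ Y.height e = Y.height ((D.next ^ k) e) ∧
    ∀ z ∈ closedStrip (Y.width e),
      Y.map e (z + pos D e k * Complex.I) = Y.map ((D.next ^ k) e) z := by
  induction k with
  | zero => simp [pos]
  | succ k ih =>
    obtain ⟨h1, h2, h3⟩ := ih
    obtain ⟨k1, k2, k3⟩ := Y.map_next hP ((D.next ^ k) e)
    rw [pow_succ', Equiv.Perm.mul_apply]
    refine ⟨h1.trans k1, h2.trans k2, fun z hz => ?_⟩
    rw [← k3 z (h1 ▸ hz), ← h3 _ (by simpa [mem_closedStrip] using hz), pos_succ]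
    congr 1; push_cast; ring

theorem zero_I_mem (e : S.Separatrix) (t : ℝ) : (t : ℂ) * Complex.I ∈ closedStrip (Y.width e) :=
  ⟨by simp, by simpa using (Y.width_pos e).le⟩

/-- At height `c` the left boundary passes through the origin of `e'`, a zero. Interior points of
saddle connections are regular, so `c` is one of the partial sums `pos D e k`. The saddle
connections `next ^ k e` and `e'` then start alike, hence are equal. -/
theorem exists_pow_of_shift (hP : S.IsPeriodicHalfTurn τ) {e e' : S.Separatrix} {c : ℝ}
    (hc : 0 ≤ c) (hw : Y.width e = Y.width e')
    (h : ∀ z ∈ openStrip (Y.width e), Y.map e (z + c * Complex.I) = Y.map e' z) :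
    ∃ k : ℕ, pos D e k = c ∧ (D.next ^ k) e = e' := by
  have hcl := eqOn_closedStrip (Y.width_pos e) (continuousOn_comp_add (Y.cont e) (by simp))
    (hw ▸ Y.cont e') h
  have hex : ∃ k : ℕ, c < pos D e (k + 1) := by
    obtain ⟨m, hm, hml⟩ := CylinderSystem.exists_len_le hP D
    obtain ⟨n, hn⟩ := exists_nat_ge (c / m)
    rw [div_le_iff₀ hm] at hn
    have : ∀ k : ℕ, (k : ℝ) * m ≤ pos D e k := by
      intro k
      induction k with
      | zero => simp [pos]
      | succ k ih => rw [pos_succ, Nat.cast_succ, add_mul]; linarith [hml ((D.next ^ k) e)]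
    refine ⟨n, lt_of_le_of_lt hn (lt_of_lt_of_le ?_ (this (n + 1)))⟩
    rw [Nat.cast_succ, add_mul]; linarith
  classical
  obtain ⟨k, hk1, hk2⟩ : ∃ k, pos D e k ≤ c ∧ c < pos D e (k + 1) := by
    refine ⟨Nat.find hex, ?_, Nat.find_spec hex⟩
    rcases Nat.eq_zero_or_pos (Nat.find hex) with h0 | h0
    · rw [h0]; simpa [pos] using hc
    · have := Nat.find_min hex (Nat.sub_lt h0 one_pos)
      rw [show Nat.find hex - 1 + 1 = Nat.find hex by omega] at this
      exact not_lt.1 this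
  rw [pos_succ] at hk2
  obtain ⟨h1, -, h3⟩ := Y.map_pos hP e k
  have hval : Y.map e (c * Complex.I) = D.path ((D.next ^ k) e) (c - pos D e k) := by
    rw [← Y.left _ _ ⟨by linarith, by linarith⟩, ← h3 _ (Y.zero_I_mem e _)]
    congr 1; push_cast; ring
  have hsing : S.ord (Y.map e (c * Complex.I)) ≠ 0 := by
    have h4 := hcl 0 (by simpa using Y.zero_I_mem e 0)
    have h5 := Y.left e' 0 ⟨le_rfl, (D.len_pos e').le⟩
    simp only [zero_add, Complex.ofReal_zero, zero_mul] at h4 h5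
    rw [h4, h5]; exact (D.saddle e').2.2.1
  have hck : pos D e k = c := by
    refine le_antisymm hk1 (not_lt.1 fun hlt => hsing ?_)
    rw [hval]
    exact (D.isVertAt ⟨by linarith, by linarith⟩).1
  refine ⟨k, hck, ?_⟩
  have hstart : S.StartsAlong (D.path ((D.next ^ k) e)) e' := by
    filter_upwards [D.starts e',
      Ioo_mem_nhdsGT (lt_min (D.len_pos e') (D.len_pos ((D.next ^ k) e)))] with t ht ht'
    have ht1 := ht'.2.trans_le (min_le_left _ _)
    have ht2 := ht'.2.trans_le (min_le_right _ _)
    rw [← ht, ← Y.left _ t ⟨ht'.1.le, ht1.le⟩, ← Y.left _ t ⟨ht'.1.le, ht2.le⟩,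
      ← h3 _ (Y.zero_I_mem e t), ← hcl _ (Y.zero_I_mem e t), hck]
  exact StartsAlong.unique hP.finite (hP.ord_eq _ ((D.next ^ k) e).1.2) (D.starts _) hstart
    (D.saddle _).isRay

theorem exists_shift {e e' : S.Separatrix}
    (h : Y.image e = Y.image e') : Y.width e = Y.width e' ∧ Y.height e = Y.height e' ∧
      ∃ c : ℝ, 0 ≤ c ∧ ∀ z ∈ openStrip (Y.width e), Y.map e (z + c * Complex.I) = Y.map e' z := by
  have hw := Y.width_pos e'
  set z : ℂ := ((Y.width e' / 2 : ℝ) : ℂ)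
  have hz : z ∈ openStrip (Y.width e') := by rw [mem_openStrip]; simp [z]; linarith
  obtain ⟨u, hu, hu'⟩ : Y.map e' z ∈ Y.image e := h ▸ ⟨z, hz, rfl⟩
  obtain ⟨h1, h2, h3, h4⟩ := (Y.cyl e').rigid (Y.cyl e) h.symm hz hu hu'.symm
  refine ⟨h1.symm, h2.symm, ?_⟩
  have hh := Y.height_pos e
  obtain ⟨n, hn⟩ := exists_nat_ge (-(u - z).im / Y.height e)
  rw [div_le_iff₀ hh] at hn
  -- A multiple of the period is added to make the shift nonnegative, as `exists_pow_of_shift`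
  -- requires.
  refine ⟨(u - z).im + n * Y.height e, by linarith, fun v hv => ?_⟩
  have h5 : (((u - z).im : ℝ) : ℂ) * Complex.I = u - z :=
    Complex.ext (by simpa using h3.symm) (by simp)
  have h6 : v + (u - z) ∈ closedStrip (Y.width e) := by
    rw [mem_closedStrip, Complex.add_re, h3, add_zero]; exact ⟨hv.1.le, hv.2.le⟩
  rw [h4 v (h1 ▸ hv), ← Y.map_period e n _ h6]
  congr 1; push_cast; linear_combination h5

theorem image_eq_iff (hP : S.IsPeriodicHalfTurn τ) {e e' : S.Separatrix} :
    Y.image e = Y.image e' ↔ ∃ k : ℕ, (D.next ^ k) e = e' := by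
  constructor
  · intro h
    obtain ⟨h1, -, c, hc, h2⟩ := Y.exists_shift h
    obtain ⟨k, -, hk⟩ := Y.exists_pow_of_shift hP hc h1 h2
    exact ⟨k, hk⟩
  · rintro ⟨k, rfl⟩
    obtain ⟨h1, -, h3⟩ := Y.map_pos hP e k
    have h4 := ((Y.cyl e).shift (c := pos D e k * Complex.I) (by simp)).2
    rw [CylinderSystem.image, CylinderSystem.image, ← h4, ← h1]
    exact Set.image_congr fun z hz => h3 z (openStrip_subset_closedStrip _ hz)

/-- Shifting by the height fixes the parametrization, so the height is a partial sum at some return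
time, which is at least `n`. Conversely `pos D e n` is a period, hence at least the height. -/
theorem height_eq (hP : S.IsPeriodicHalfTurn τ) {e : S.Separatrix} {n : ℕ} (hn : 0 < n)
    (h : (D.next ^ n) e = e) (hmin : ∀ k, 0 < k → k < n → (D.next ^ k) e ≠ e) :
    Y.height e = pos D e n := by
  obtain ⟨k, hk, hk'⟩ := Y.exists_pow_of_shift hP (e := e) (e' := e) (Y.height_pos e).le rfl
    (fun z hz => by simpa using Y.map_period e 1 z (openStrip_subset_closedStrip _ hz))
  have hk0 : 0 < k := by
    rcases Nat.eq_zero_or_pos k with rfl | h0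
    · have := Y.height_pos e; simp [pos] at hk; linarith
    · exact h0
  have hnk : n ≤ k := by
    by_contra hlt
    exact hmin k hk0 (not_le.1 hlt) hk'
  refine le_antisymm ?_ (hk ▸ (pos_strictMono D e).monotone hnk)
  have hw := Y.width_pos e
  set z : ℂ := ((Y.width e / 2 : ℝ) : ℂ)
  have hz : z ∈ openStrip (Y.width e) := by rw [mem_openStrip]; simp [z]; linarith
  obtain ⟨-, -, h3⟩ := Y.map_pos hP e n
  have h4 := h3 z (openStrip_subset_closedStrip _ hz)
  rw [h] at h4
  obtain ⟨m, hm⟩ := ((Y.cyl e).2.2.2 z hz _ (by simpa [mem_openStrip] using hz)).1 h4.symm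
  have h5 := congrArg Complex.im hm
  simp at h5
  have h6 : 0 < pos D e n := by
    have := pos_strictMono D e hn
    simpa [pos] using this
  have hh := Y.height_pos e
  have : 0 < (m : ℝ) := by
    by_contra hneg
    push Not at hneg
    nlinarith
  have : (1 : ℝ) ≤ m := by exact_mod_cast (by exact_mod_cast this : 0 < m)
  nlinarith

end ClosedCylinderSystem

end TranslationSurface

/-! ### Ribbon data, fixed points of the half turn, and realizations of configurations -/

/-- The predicate `P a e` is the invariant carried along the boundary: at time `a` the boundary is
about to enter `e`. -/
theorem runsAlong_iterate {X ι : Type*} {β : ℝ → X} {γ : ι → ℝ → X} {ℓ : ι → ℝ} {nx : ι → ι}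
    {P : ℝ → ι → Prop}
    (h : ∀ a e, P a e → (∀ t ∈ Set.Icc 0 (ℓ e), β (a + t) = γ e t) ∧ P (a + ℓ e) (nx e)) (n : ℕ) :
    ∀ a e, P a e → RunsAlong β γ ℓ a (List.iterate nx e n) := by
  induction n with
  | zero => intro a e _; exact trivial
  | succ n ih => intro a e hP; exact ⟨(h a e hP).1, ih _ _ (h a e hP).2⟩

theorem sum_map_iterate {ι : Type*} (ℓ : ι → ℝ) (nx : ι → ι) (n : ℕ) (e : ι) :
    ((List.iterate nx e n).map ℓ).sum = ∑ k ∈ Finset.range n, ℓ (nx^[k] e) := by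
  induction n generalizing e with
  | zero => simp
  | succ n ih =>
    rw [List.iterate, List.map_cons, List.sum_cons, ih, Finset.sum_range_succ', add_comm]
    simp

theorem List.getElem_of_eq_iterate {α : Type*} {L : List α} {nx : α → α} {a : α} {n : ℕ}
    (h : L = List.iterate nx a n) (k : ℕ) (hk : k < L.length) : L[k] = nx^[k] a := by
  subst h; simp

namespace Configuration

/-- `ρ` rotates the saddle connections about their lower ends, by the angle `2π`; the lists of
saddle connections on the boundaries of the cylinders are those given by the ribbon structure
determined by `ρ` and the involution. -/
structure IsRibbon (K : Configuration) (ρ : Fin K.numSad → Fin K.numSad)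
    (hd hd' : Fin K.numCyl → Fin K.numSad) : Prop where
  left_eq : ∀ j, K.left j = List.iterate (fun e => ρ (ρ (K.sadInv e))) (hd j) (K.left j).length
  left_ne : ∀ j, K.left j ≠ []
  left_cycle : ∀ j, (fun e => ρ (ρ (K.sadInv e)))^[(K.left j).length] (hd j) = hd j
  left_nodup : ∀ j, (K.left j).Nodup
  right_eq : ∀ j, K.right j = List.iterate (fun e => ρ (K.sadInv e)) (hd' j) (K.right j).length
  right_perm : ∀ j, ((K.right j).map K.sadInv).Perm (K.left (K.cylInv j))
  cover : ∀ e, ∃ j, e ∈ K.left j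
  disjoint : ∀ j j', hd j' ∈ K.left j → j' = j

end Configuration

namespace TranslationSurface

variable {X : Type*} [TopologicalSpace X] {S : TranslationSurface X} {f g : ℂ → X} {p : X}
  {τ : X → X} {w h : ℝ}

section FixedPoints

theorem IsCylinderMap.exists_half_turn [T2Space X] (hτ : S.IsHalfTurn τ)
    (hf : S.IsCylinderMap f w h) (him : τ '' (f '' openStrip w) = f '' openStrip w) :
    ∃ y : ℝ, ∀ z ∈ openStrip w, τ (f z) = f (w - z + y * Complex.I) := by
  obtain ⟨h1, h2⟩ := hf.anti hτ
  rw [him] at h2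
  have hw := hf.1
  have hz : ((w / 2 : ℝ) : ℂ) ∈ openStrip w := by rw [mem_openStrip]; simp; linarith
  obtain ⟨u, hu, hu'⟩ : τ (f (w - ((w / 2 : ℝ) : ℂ))) ∈ f '' openStrip w := h2 ▸ ⟨_, hz, rfl⟩
  obtain ⟨-, -, h3, h4⟩ := h1.rigid hf h2 hz hu hu'.symm
  refine ⟨(u - ((w / 2 : ℝ) : ℂ)).im, fun z hz => ?_⟩
  have h5 : (((u - ((w / 2 : ℝ) : ℂ)).im : ℝ) : ℂ) * Complex.I = u - ((w / 2 : ℝ) : ℂ) :=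
    Complex.ext (by simp at h3; simp; linarith) (by simp)
  have := h4 (w - z) (by rw [mem_openStrip] at *; simp; constructor <;> linarith [hz.1, hz.2])
  rw [sub_sub_cancel] at this
  rw [h5, this]

theorem IsCylinderMap.exists_fixed [T2Space X] (hτ : S.IsHalfTurn τ)
    (hf : S.IsCylinderMap f w h) (him : τ '' (f '' openStrip w) = f '' openStrip w) :
    ∃ q : Bool → X, Function.Injective q ∧ (∀ b, q b ∈ f '' openStrip w) ∧
      ∀ x ∈ f '' openStrip w, τ x = x ↔ ∃ b, x = q b := by
  obtain ⟨y, hy⟩ := hf.exists_half_turn hτ him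
  have hw := hf.1
  have hh := hf.2.1
  -- The two centres of the rotation: on the core curve, half a period apart.
  set c : Bool → ℂ := fun b => (w / 2 : ℝ) + ((y + (if b then h else 0)) / 2 : ℝ) * Complex.I
    with hc
  have hcm : ∀ b, c b ∈ openStrip w := by
    intro b; rw [mem_openStrip]; simp [hc]; linarith
  refine ⟨fun b => f (c b), ?_, fun b => ⟨_, hcm b, rfl⟩, ?_⟩
  · have hne : f (c true) ≠ f (c false) := by
      intro heq
      obtain ⟨n, hn⟩ := (hf.2.2.2 _ (hcm true) _ (hcm false)).1 heq
      have := congrArg Complex.im hn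
      simp [hc] at this
      have h2 : (2 * n + 1 : ℝ) * h = 0 := by linarith
      have h3 : (2 * n + 1 : ℝ) = 0 := (mul_eq_zero.1 h2).resolve_right hh.ne'
      have h4 : (2 * n + 1 : ℤ) = 0 := by exact_mod_cast h3
      omega
    intro a b hab
    cases a <;> cases b <;> first | rfl | exact absurd hab hne | exact absurd hab.symm hne
  · rintro _ ⟨z, hz, rfl⟩
    have hz' : (w : ℂ) - z + y * Complex.I ∈ openStrip w := by
      rw [mem_openStrip] at *; simp; constructor <;> linarith [hz.1, hz.2]
    rw [hy z hz, hf.2.2.2 _ hz' _ hz]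
    constructor
    · rintro ⟨n, hn⟩
      rcases Int.even_or_odd' n with ⟨k, rfl | rfl⟩
      · refine ⟨false, (hf.2.2.2 _ hz _ (hcm false)).2 ⟨-k, ?_⟩⟩
        simp only [hc, Bool.false_eq_true, if_false]
        push_cast at hn ⊢
        linear_combination hn / (-2)
      · refine ⟨true, (hf.2.2.2 _ hz _ (hcm true)).2 ⟨-k, ?_⟩⟩
        simp only [hc, if_true]
        push_cast at hn ⊢
        linear_combination hn / (-2)
    · rintro ⟨b, hb⟩
      obtain ⟨n, hn⟩ := (hf.2.2.2 _ hz _ (hcm b)).1 hb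
      cases b
      · refine ⟨-2 * n, ?_⟩
        simp only [hc, Bool.false_eq_true, if_false] at hn
        push_cast at hn ⊢
        linear_combination (-2) * hn
      · refine ⟨-2 * n + 1, ?_⟩
        simp only [hc, if_true] at hn
        push_cast at hn ⊢
        linear_combination (-2) * hn

/-- The number of fixed points of a half turn in terms of a cylinder decomposition. -/
theorem IsHalfTurn.encard_fixedPoints [T2Space X] (hτ : S.IsHalfTurn τ) {ι κ : Type*}
    {γ : κ → ℝ → X} {ℓ : κ → ℝ} {f : ι → ℂ → X} {w h : ι → ℝ} {σ : κ → κ} {π : ι → ι}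
    (hγ : ∀ e, S.IsVerticalSaddle (γ e) (ℓ e))
    (hdis : ∀ e e', ∀ t ∈ Set.Ioo 0 (ℓ e), ∀ t' ∈ Set.Ioo 0 (ℓ e'),
      γ e t = γ e' t' → e = e' ∧ t = t')
    (hf : ∀ j, S.IsCylinderMap (f j) (w j) (h j))
    (hfd : ∀ j j', j ≠ j' → Disjoint (f j '' openStrip (w j)) (f j' '' openStrip (w j')))
    (hcov : ∀ p, S.ord p = 0 → (∃ j, p ∈ f j '' openStrip (w j)) ∨
      ∃ e, p ∈ γ e '' Set.Ioo 0 (ℓ e))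
    (hπ : ∀ j, τ '' (f j '' openStrip (w j)) = f (π j) '' openStrip (w (π j)))
    (hlen : ∀ e, ℓ (σ e) = ℓ e)
    (hσ : ∀ e, ∀ t ∈ Set.Icc 0 (ℓ e), τ (γ e t) = γ (σ e) (ℓ e - t)) :
    (Function.fixedPoints τ).encard = {p | S.ord p ≠ 0}.encard +
      (ENat.card {e // σ e = e} + 2 * ENat.card {j // π j = j}) := by
  have hq : ∀ j : {j // π j = j}, ∃ q : Bool → X, Function.Injective q ∧
      (∀ b, q b ∈ f j '' openStrip (w j)) ∧
      ∀ x ∈ f j '' openStrip (w j), τ x = x ↔ ∃ b, x = q b := fun j =>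
    (hf j).exists_fixed hτ (by rw [hπ, j.2])
  choose q hq1 hq2 hq3 using hq
  have hmid : ∀ e, ℓ e / 2 ∈ Set.Ioo 0 (ℓ e) := fun e =>
    ⟨by linarith [(hγ e).1], by linarith [(hγ e).1]⟩
  set F : {p // S.ord p ≠ 0} ⊕ ({e // σ e = e} ⊕ ({j // π j = j} × Bool)) → X :=
    Sum.elim (fun p => p) (Sum.elim (fun e => γ e (ℓ e / 2)) (fun jb => q jb.1 jb.2)) with hF
  have hreg : ∀ e, ∀ t ∈ Set.Ioo 0 (ℓ e), S.ord (γ e t) = 0 := fun e t ht =>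
    ((hγ e).2.2.2.2 t ht).1
  have hregq : ∀ j b, S.ord (q j b) = 0 := by
    intro j b
    obtain ⟨z, hz, hzq⟩ := hq2 j b
    rw [← hzq]; exact ((hf j).trans hz).1
  have hnot : ∀ e, ∀ t ∈ Set.Ioo 0 (ℓ e), ∀ j, γ e t ∉ f j '' openStrip (w j) := fun e t ht j =>
    (hγ e).isRay.notMem_cylinder (hf j) ht
  have hinj : Function.Injective F := by
    rintro (p | e | ⟨j, b⟩) (p' | e' | ⟨j', b'⟩) hEq <;>
      simp only [hF, Sum.elim_inl, Sum.elim_inr] at hEq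
    · rw [Subtype.ext hEq]
    · exact absurd (hreg _ _ (hmid e')) (hEq ▸ p.2)
    · exact absurd (hregq j' b') (hEq ▸ p.2)
    · exact absurd (hreg _ _ (hmid e)) (hEq ▸ p'.2)
    · rw [Subtype.ext (hdis _ _ _ (hmid e) _ (hmid e') hEq).1]
    · exact absurd (hEq ▸ hq2 j' b') (hnot _ _ (hmid e) j')
    · exact absurd (hregq j b) (hEq ▸ p'.2)
    · exact absurd (hEq ▸ hq2 j b) (hnot _ _ (hmid e') j)
    · obtain rfl : j = j' := by
        by_contra hne
        exact Set.disjoint_left.1 (hfd j j' fun h => hne (Subtype.ext h)) (hq2 j b)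
          (hEq ▸ hq2 j' b')
      rw [hq1 j hEq]
  have hrange : Set.range F = Function.fixedPoints τ := by
    apply Set.Subset.antisymm
    · rintro _ ⟨p | e | ⟨j, b⟩, rfl⟩
      · exact hτ.fix _ p.2
      · have := hσ e _ ⟨(hmid e).1.le, (hmid e).2.le⟩
        rw [e.2, sub_half] at this
        exact this
      · exact (hq3 j _ (hq2 j b)).2 ⟨b, rfl⟩
    · intro x hx
      by_cases hx0 : S.ord x = 0
      · rcases hcov x hx0 with ⟨j, hj⟩ | ⟨e, t, ht, rfl⟩
        · have hπj : π j = j := by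
            by_contra hne
            refine Set.disjoint_left.1 (hfd _ _ hne) ?_ hj
            rw [← hπ j]
            exact ⟨x, hj, hx⟩
          obtain ⟨b, hb⟩ := (hq3 ⟨j, hπj⟩ x hj).1 hx
          exact ⟨Sum.inr (Sum.inr (⟨j, hπj⟩, b)), hb.symm⟩
        · have h1 := hσ e t ⟨ht.1.le, ht.2.le⟩
          rw [hx] at h1
          obtain ⟨h2, h3⟩ := hdis e (σ e) t ht _
            (by rw [hlen]; exact ⟨by linarith [ht.2], by linarith [ht.1]⟩) h1
          refine ⟨Sum.inr (Sum.inl ⟨e, h2.symm⟩), ?_⟩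
          simp only [hF, Sum.elim_inl, Sum.elim_inr]
          congr 1; linarith
      · exact ⟨Sum.inl ⟨x, hx0⟩, rfl⟩
  rw [← hrange, ← Set.image_univ, hinj.encard_image, Set.encard_univ, ENat.card_sum, ENat.card_sum, ENat.card_prod]
  congr 2
  rw [mul_comm]; congr 1
  simp

end FixedPoints

namespace ClosedCylinderSystem

variable {D : S.SaddleSystem τ} (Y : ClosedCylinderSystem D)

variable [T2Space X] [CompactSpace X] [ConnectedSpace X]

/-- Following the left boundary is iterating `next`. Following the right boundary of a cylinder is
following the left boundary of its image under `τ` backwards, which is where the action on cylinders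
enters. -/
theorem exists_realization (hP : S.IsPeriodicHalfTurn τ) {K : Configuration}
    {ρ : Fin K.numSad → Fin K.numSad} {hd hd' : Fin K.numCyl → Fin K.numSad}
    (hK : K.IsRibbon ρ hd hd') (φ : Fin K.numSad ≃ S.Separatrix)
    (hρ : ∀ e, φ (ρ e) = ((φ e).1, (φ e).2 + 1)) (hs : ∀ e, φ (K.sadInv e) = D.inv (φ e))
    (hc : ∀ j, τ '' Y.image (φ (hd j)) = Y.image (φ (hd (K.cylInv j)))) :
    Nonempty (S.Realization τ K) := by
  -- Turning twice by `2π` is turning once backwards, the total angle being `6π`.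
  have hnx : ∀ e, φ (ρ (ρ (K.sadInv e))) = D.next (φ e) := by
    intro e
    have h3 : ∀ k : ZMod 3, k + 1 + 1 = k - 1 := by decide
    rw [hρ, hρ, hs, SaddleSystem.next_apply, h3]
  have hnxk : ∀ k e, φ ((fun e => ρ (ρ (K.sadInv e)))^[k] e) = (D.next ^ k) (φ e) := by
    intro k
    induction k with
    | zero => intro e; rfl
    | succ k ih => intro e; rw [Function.iterate_succ_apply, ih, hnx, pow_succ, Equiv.Perm.mul_apply]
  -- On a right boundary the successor of `e` is `ρ (sadInv e)`: its image under the involution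
  -- precedes that of `e` on a left boundary.
  have hpx : ∀ e, D.next (D.inv (φ (ρ (K.sadInv e)))) = D.inv (φ e) := by
    intro e
    rw [SaddleSystem.next_apply, D.inv_inv, hρ, hs]
    simp
  have hmem : ∀ j e, e ∈ K.left j ↔ Y.image (φ (hd j)) = Y.image (φ e) := by
    intro j e
    rw [Y.image_eq_iff hP, hK.left_eq j, List.mem_iterate]
    constructor
    · rintro ⟨m, -, rfl⟩; exact ⟨m, (hnxk m _).symm⟩
    · rintro ⟨k, hk⟩
      rw [← hnxk] at hk
      refine ⟨k % (K.left j).length, Nat.mod_lt _ (List.length_pos_iff.2 (hK.left_ne j)), ?_⟩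
      rw [← φ.injective hk]
      exact (Function.IsPeriodicPt.iterate_mod_apply (hK.left_cycle j) k).symm
  have hlh : ∀ j, ((K.left j).map fun e => D.len (φ e)).sum = Y.height (φ (hd j)) := by
    intro j
    have hlen := List.length_pos_iff.2 (hK.left_ne j)
    rw [Y.height_eq hP hlen]
    · conv_lhs => rw [hK.left_eq j]
      rw [sum_map_iterate (fun e => D.len (φ e))]
      exact Finset.sum_congr rfl fun k _ => by rw [hnxk]
    · rw [← hnxk, hK.left_cycle]
    · intro k hk hkn hkk
      rw [← hnxk] at hkk
      have hkk' := φ.injective hkk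
      have h1 := hK.left_nodup j
      have e0 := List.getElem_of_eq_iterate (hK.left_eq j) 0 hlen
      have ek := List.getElem_of_eq_iterate (hK.left_eq j) k hkn
      rw [hkk'] at ek
      exact hk.ne' (h1.getElem_inj_iff.1 (ek.trans e0.symm))
  have hdanti : ∀ j, Y.width (φ (hd j)) = Y.width (D.inv (φ (hd' j))) ∧
      Y.height (φ (hd j)) = Y.height (φ (hd (K.cylInv j))) ∧
      ∃ c : ℝ, ∀ v ∈ closedStrip (Y.width (φ (hd j))), Y.map (φ (hd j)) (Y.width (φ (hd j)) - v) =
        τ (Y.map (D.inv (φ (hd' j))) (v + c * Complex.I)) := by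
    intro j
    have h1 : hd' j ∈ K.right j := by
      have hne : K.right j ≠ [] := by
        intro h0
        have := hK.right_perm j
        rw [h0, List.map_nil] at this
        exact hK.left_ne _ this.nil_eq.symm
      rw [hK.right_eq j]
      exact List.mem_iterate.2 ⟨0, List.length_pos_iff.2 hne, rfl⟩
    have h2 : K.sadInv (hd' j) ∈ K.left (K.cylInv j) :=
      (hK.right_perm j).subset (List.mem_map_of_mem h1)
    rw [hmem, hs] at h2
    obtain ⟨k1, -, k3⟩ := Y.exists_anti hP (h2 ▸ hc j)
    exact ⟨k1, (Y.exists_anti hP (hc j)).2.1, k3⟩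
  choose hwd hhd c hcc using hdanti
  refine ⟨{
    saddle := fun e => D.path (φ e)
    length := fun e => D.len (φ e)
    cyl := fun j => Y.map (φ (hd j))
    width := fun j => Y.width (φ (hd j))
    height := fun j => Y.height (φ (hd j))
    -- With `v = -y * I` in `hcc`, the right edge at height `y` is the point of `hd' j` at time `y -
    -- c j + len`; so `hd' j` starts at `y = c j - len`.
    twist := fun j => c j - D.len (φ (hd' j))
    saddle_vertical := fun e => D.saddle _
    saddle_disjoint := fun e e' t ht t' ht' h => ?_
    cyl_map := fun j => Y.cyl _
    cyl_continuous := fun j => Y.cont _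
    cyl_disjoint := fun j j' hne => ?_
    cover := fun p hp => ?_
    left_height := hlh
    right_height := fun j => ?_
    left_runs := fun j => ?_
    right_runs := fun j => ?_
    inv_cyl := hc
    inv_length := fun e => by rw [hs, D.len_inv]
    inv_saddle := fun e t ht => by rw [hs, D.path_inv _ _ ht] }⟩
  · obtain ⟨h1, h2⟩ := D.disjoint hP ht ht' h
    exact ⟨φ.injective h1, h2⟩
  · rw [Set.disjoint_left]
    intro x hx hx'
    have h1 := (Y.vert _).eq_of_inter hP.nonempty (Y.vert _) hx hx'
    exact hne (hK.disjoint j j' ((hmem j _).2 h1)).symm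
  · rcases D.cover hP hp with ⟨C, hC, hpC⟩ | ⟨e, t, ht, rfl⟩
    · left
      obtain ⟨e, rfl⟩ := Y.exists_eq_image hP hC
      obtain ⟨j, hj⟩ := hK.cover (φ.symm e)
      rw [hmem, φ.apply_symm_apply] at hj
      exact ⟨j, show p ∈ Y.image _ by rw [hj]; exact hpC⟩
    · right
      exact ⟨φ.symm e, t, by rwa [φ.apply_symm_apply], by rw [φ.apply_symm_apply]⟩
  · rw [hhd j, ← hlh, ← ((hK.right_perm j).map fun e => D.len (φ e)).sum_eq, List.map_map]
    congr 1
    refine List.map_congr_left fun e _ => ?_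
    simp only [Function.comp]
    rw [hs, D.len_inv]
  · rw [hK.left_eq j]
    refine runsAlong_iterate (P := fun a e => Y.width (φ (hd j)) = Y.width (φ e) ∧
      ∀ z ∈ closedStrip (Y.width (φ (hd j))),
        Y.map (φ (hd j)) (z + a * Complex.I) = Y.map (φ e) z) ?_ _ _ _ ⟨rfl, by simp⟩
    rintro a e ⟨h1, h2⟩
    obtain ⟨k1, -, k3⟩ := Y.map_next hP (φ e)
    refine ⟨fun t ht => ?_, ?_, fun z hz => ?_⟩
    · rw [← Y.left _ t ht, ← h2 _ (Y.zero_I_mem _ t)]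
      congr 1; push_cast; ring
    · rw [hnx]; exact h1.trans k1
    · rw [hnx, ← k3 z (h1 ▸ hz), ← h2 _ (by simpa [mem_closedStrip] using hz)]
      congr 1; push_cast; ring
  · rw [hK.right_eq j]
    refine runsAlong_iterate (P := fun a e => Y.width (φ (hd j)) = Y.width (D.inv (φ e)) ∧
      ∀ v ∈ closedStrip (Y.width (φ (hd j))), Y.map (φ (hd j)) (Y.width (φ (hd j)) - v) =
        τ (Y.map (D.inv (φ e)) (v + (a + D.len (φ e) : ℝ) * Complex.I))) ?_ _ _ _
        ⟨hwd j, by simpa using hcc j⟩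
    rintro a e ⟨h1, h2⟩
    obtain ⟨k1, -, k3⟩ := Y.map_next hP (D.inv (φ (ρ (K.sadInv e))))
    rw [hpx] at k1 k3
    refine ⟨fun t ht => ?_, h1.trans k1.symm, fun v hv => ?_⟩
    · have h3 := h2 (-((a + t : ℝ) * Complex.I)) 
        ⟨by simp, by simpa using (Y.width_pos _).le⟩
      have h4 : D.len (φ e) - t ∈ Set.Icc 0 (D.len (D.inv (φ e))) := by
        rw [D.len_inv]; exact ⟨by linarith [ht.2], by linarith [ht.1]⟩
      have h5 : -((a + t : ℝ) * Complex.I) + ((a + D.len (φ e) : ℝ) : ℂ) * Complex.I =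
          ((D.len (φ e) - t : ℝ) : ℂ) * Complex.I := by push_cast; ring
      rw [sub_neg_eq_add, h5, Y.left _ _ h4, D.path_inv _ _ h4, D.inv_inv, D.len_inv,
        sub_sub_cancel] at h3
      exact h3
    · rw [h2 v hv, ← k3 _ (by rw [k1, ← h1]; simpa [mem_closedStrip] using hv)]
      congr 2
      rw [D.len_inv]; push_cast; ring

end ClosedCylinderSystem

end TranslationSurface

/-! ### The finite search over involutions and cylinder actions -/

/-- Functions from `{0, …, 5}` to itself, encoded by their octal digits. -/
def octDigit (c i : ℕ) : ℕ := (c.shiftRight (Nat.mul 3 i)).mod 8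

/-- An initial segment of a function becomes a single number, so that partial assignments in the
search are numerals. -/
def octCode (t : ℕ → ℕ) : ℕ → ℕ
  | 0 => 0
  | k + 1 => (octCode t k).add ((t k).shiftLeft (Nat.mul 3 k))

theorem octCode_lt {t : ℕ → ℕ} (ht : ∀ i, t i < 8) (k : ℕ) : octCode t k < 8 ^ k := by
  induction k with
  | zero => simp [octCode]
  | succ k ih =>
    have h1 : octCode t (k + 1) = octCode t k + t k * 8 ^ k := by
      show octCode t k + (t k) <<< (3 * k) = _
      rw [Nat.shiftLeft_eq, pow_mul]; norm_num
    have := ht k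
    rw [h1, pow_succ]
    nlinarith [pow_pos (show 0 < 8 by norm_num) k]

theorem octDigit_octCode {t : ℕ → ℕ} (ht : ∀ i, t i < 8) {i k : ℕ} (hi : i < k) :
    octDigit (octCode t k) i = t i := by
  have h0 : ∀ c, octDigit c i = c / 8 ^ i % 8 := by
    intro c
    show (c >>> (3 * i)) % 8 = _
    rw [Nat.shiftRight_eq_div_pow, pow_mul]; norm_num
  have hs : ∀ k, octCode t (k + 1) = octCode t k + t k * 8 ^ k := by
    intro k
    show octCode t k + (t k) <<< (3 * k) = _
    rw [Nat.shiftLeft_eq, pow_mul]; norm_num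
  rw [h0]
  induction k, hi using Nat.le_induction with
  | base =>
    rw [hs, Nat.add_mul_div_right _ _ (by positivity), Nat.div_eq_of_lt (octCode_lt ht i), zero_add,
      Nat.mod_eq_of_lt (ht i)]
  | succ k hk ih =>
    obtain ⟨m, rfl⟩ := Nat.exists_eq_add_of_lt hk
    rw [hs, show t (i + m + 1) * 8 ^ (i + m + 1) = (t (i + m + 1) * 8 ^ m * 8) * 8 ^ i by ring,
      Nat.add_mul_div_right _ _ (by positivity), Nat.add_mul_mod_self_right, ih]

theorem natBeq_iff {a b : ℕ} : a.beq b = true ↔ a = b :=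
  ⟨Nat.eq_of_beq_eq_true, fun h => h ▸ Nat.beq_refl a⟩

def sixList : List ℕ := [0, 1, 2, 3, 4, 5]

/-- The upper neighbour in the boundary of a cylinder, if the involution acts by `t`; the octal
code is that of the square of the rotation by `2π` about the two singularities. -/
def sixNext (t : ℕ → ℕ) (e : ℕ) : ℕ := octDigit 0o435102 (t e)

def sixMin (t : ℕ → ℕ) : ℕ → ℕ → ℕ → ℕ
  | 0, m, _ => m
  | n + 1, m, e => sixMin t n (bif m.ble e then m else e) (sixNext t e)

/-- The least element of the orbit of `e` under `sixNext t`. -/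
def sixRep (t : ℕ → ℕ) (e : ℕ) : ℕ := sixMin t 6 e e

/-- How often the boundary with representative `r` meets the pair `{x, t x}`. -/
def sixMult (t r : ℕ → ℕ) (a x : ℕ) : ℕ :=
  (bif (r x).beq a then 1 else 0) + (bif (r (t x)).beq a then 1 else 0)

/-- Depth first search over the sequences `t` of which all initial segments satisfy `ok`. -/
def octSearch (ok : ℕ → ℕ → ℕ → Bool) (final : ℕ → Bool) : ℕ → ℕ → ℕ → Bool
  | 0, _, c => final c
  | n + 1, k, c => sixList.all fun v =>
      !ok k c v || octSearch ok final n k.succ (c.add (v.shiftLeft (Nat.mul 3 k)))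

/-- Only the branch that follows the given sequence `t` is needed: all its initial segments pass
`ok`, so it is explored down to the leaf. -/
theorem octSearch_spec {ok : ℕ → ℕ → ℕ → Bool} {final : ℕ → Bool} {t : ℕ → ℕ}
    (ht : ∀ i, t i < 6) (hok : ∀ k, k < 6 → ok k (octCode t k) (t k)) (n k : ℕ) (hk : n + k = 6)
    (h : octSearch ok final n k (octCode t k)) : final (octCode t 6) := by
  induction n generalizing k with
  | zero => obtain rfl : k = 6 := by omega
            exact h
  | succ n ih =>
    rw [octSearch, List.all_eq_true] at h
    have h1 := h (t k) (by have := ht k; simp only [sixList]; generalize t k = x at *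
                           interval_cases x <;> decide)
    rw [hok k (by omega)] at h1
    rw [Bool.not_true, Bool.false_or] at h1
    exact ih (k + 1) (by omega) h1

/-- The involution, in standard numbering of the saddle connections, and the action on
representatives of the cylinders, for the eleven configurations. -/
def ConfigType.model : ConfigType → ℕ × List (ℕ × ℕ)
  | .a => (0o543201, [(0, 3), (3, 0), (1, 1)])
  | .b => (0o543201, [(0, 0), (1, 3), (3, 1)])
  | .c => (0o201534, [(0, 0), (4, 4), (1, 1)])
  | .d => (0o325401, [(0, 0), (1, 1), (5, 5)])
  | .e => (0o345201, [(0, 5), (3, 3), (5, 0), (1, 1)])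
  | .f => (0o534201, [(0, 0), (1, 5), (3, 3), (5, 1)])
  | .g => (0o345201, [(0, 0), (1, 5), (3, 3), (5, 1)])
  | .h => (0o543210, [(0, 3), (3, 0)])
  | .i => (0o521430, [(0, 0), (1, 1)])
  | .j => (0o501234, [(0, 0), (1, 1)])
  | .k => (0o523401, [(0, 0), (1, 1)])

def ConfigType.all : List ConfigType := [.a, .b, .c, .d, .e, .f, .g, .h, .i, .j, .k]

/-- The permutations of `{0, …, 5}` that commute with the rotation. -/
def sixCentralizer : List ℕ :=
  [0o543210, 0o543021, 0o543102, 0o354210, 0o354021, 0o354102, 0o435210, 0o435021, 0o435102,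
    0o210543, 0o021543, 0o102543, 0o210354, 0o021354, 0o102354, 0o210435, 0o021435, 0o102435]

theorem sixCentralizer_spec : sixCentralizer.all (fun κ =>
    (sixList.all fun i => (octDigit κ i).blt 6 && (octDigit κ (octDigit 0o354021 i)).beq
      (octDigit 0o354021 (octDigit κ i))) &&
      sixList.all fun i => sixList.all fun j => i.beq j || !(octDigit κ i).beq (octDigit κ j)) =
    true := by
  decide +kernel

/-- The involution `t` and the action `p` on representatives of the cylinders are those of one of
the eleven configurations. -/
def sixGood (t r p : ℕ → ℕ) : Bool :=
  ConfigType.all.any fun T => sixCentralizer.any fun κ =>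
    (sixList.all fun i => (octDigit κ (octDigit T.model.1 i)).beq (t (octDigit κ i))) &&
    T.model.2.all fun ab => (r (octDigit κ ab.2)).beq (p (octDigit κ ab.1))

def sixCount (P : ℕ → Bool) : ℕ := sixList.foldr (fun i n => bif P i then n.succ else n) 0

/-- The three clauses are the fixed point count, the presence of a second cylinder, and the height
condition: a cylinder whose multiplicities are dominated by those of its image must have the same
multiplicities. -/
def sixAdmissible (t r p : ℕ → ℕ) : Bool :=
  ((sixCount fun e => (t e).beq e).add
      (Nat.mul 2 (sixCount fun e => (r e).beq e && (p e).beq e))).beq 6 &&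
    (sixList.any fun e => !(r e).beq 0) &&
    sixList.all fun a => !(r a).beq a || !(sixList.all fun x => (sixMult t r a x).ble (sixMult t r (p a) x)) ||
      sixList.all fun x => (sixMult t r (p a) x).ble (sixMult t r a x)

/-- Compatibility of the value `v` at `k` with `t (t i) = i`, as far as the values below `k` decide
it. -/
def okInvol (k c v : ℕ) : Bool :=
  (!v.blt k || (octDigit c v).beq k) &&
    sixList.all fun i => !i.blt k || !(octDigit c i).beq k || v.beq i

/-- The clauses are `p (r k) = p k`, `r (p k) = p k` and `p (p i) = r i`, the last in two forms
according to which of the two values is assigned first. -/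
def okAction (r : ℕ → ℕ) (k c v : ℕ) : Bool :=
  (!(r k).blt k || (octDigit c (r k)).beq v) && (r v).beq v &&
    (!v.blt k || (octDigit c v).beq (r k)) &&
    sixList.all fun i => !i.blt k || !(octDigit c i).beq k || v.beq (r i)

def searchAction (t r : ℕ → ℕ) : Bool :=
  octSearch (okAction r) (fun c => !sixAdmissible t r (octDigit c) || sixGood t r (octDigit c))
    6 0 0

/-- The combinatorial heart: for every involution `t` and every involution `p` of the cycles it
determines, the pair is inadmissible or conjugate to one of the eleven models. -/
theorem searchInvol : octSearch okInvol
    (fun c => searchAction (octDigit c) (octDigit (octCode (sixRep (octDigit c)) 6))) 6 0 0 =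
    true := by
  decide +kernel

theorem octDigit_eq {t : ℕ → ℕ} (ht : ∀ i, t i < 6) (h0 : ∀ i, 6 ≤ i → t i = 0) :
    octDigit (octCode t 6) = t := by
  funext i
  rcases lt_or_ge i 6 with hi | hi
  · exact octDigit_octCode (fun i => (ht i).trans (by norm_num)) hi
  · rw [h0 i hi]
    show (octCode t 6 >>> (3 * i)) % 8 = _
    have h1 := octCode_lt (fun i => (ht i).trans (by norm_num)) 6
    rw [Nat.shiftRight_eq_div_pow, pow_mul, Nat.div_eq_of_lt]
    exact h1.trans_le (Nat.pow_le_pow_right (by norm_num) hi)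

theorem octCode_congr {t t' : ℕ → ℕ} {k : ℕ} (h : ∀ i < k, t i = t' i) :
    octCode t k = octCode t' k := by
  induction k with
  | zero => rfl
  | succ k ih => rw [octCode, octCode, ih fun i hi => h i (hi.trans k.lt_succ_self),
      h k k.lt_succ_self]

theorem sixGood_of_admissible {t r p : ℕ → ℕ} (ht : ∀ i, t i < 6) (ht0 : ∀ i, 6 ≤ i → t i = 0)
    (hr : ∀ i, r i < 6) (hr0 : ∀ i, 6 ≤ i → r i = 0) (hp : ∀ i, p i < 6)
    (hp0 : ∀ i, 6 ≤ i → p i = 0) (hrt : ∀ i < 6, sixRep t i = r i) (htt : ∀ i < 6, t (t i) = i)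
    (hrp : ∀ i < 6, r (p i) = p i) (hpr : ∀ i < 6, p (r i) = p i) (hpp : ∀ i < 6, p (p i) = r i)
    (h : sixAdmissible t r p) : sixGood t r p := by
  have h8 : ∀ {i}, i < 6 → i < 8 := fun h => h.trans (by norm_num)
  have k1 := octSearch_spec ht (fun k hk => ?_) 6 0 rfl searchInvol
  · rw [octDigit_eq ht ht0, octCode_congr hrt, octDigit_eq hr hr0] at k1
    have k2 := octSearch_spec hp (fun k hk => ?_) 6 0 rfl k1
    · rw [octDigit_eq hp hp0, h] at k2
      simpa using k2
    · simp only [okAction, Bool.and_eq_true, Bool.or_eq_true, Bool.not_eq_true', natBeq_iff,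
        Nat.blt_eq, ← Bool.not_eq_true, List.all_eq_true]
      refine ⟨⟨⟨?_, hrp k hk⟩, ?_⟩, fun i _ => ?_⟩
      · by_cases h1 : r k < k
        · right; rw [octDigit_octCode (fun i => h8 (hp i)) h1, hpr k hk]
        · exact Or.inl h1
      · by_cases h1 : p k < k
        · right; rw [octDigit_octCode (fun i => h8 (hp i)) h1, hpp k hk]
        · exact Or.inl h1
      · by_cases h1 : i < k
        · rw [octDigit_octCode (fun i => h8 (hp i)) h1]
          by_cases h2 : p i = k
          · right; rw [← h2, hpp i (h1.trans hk)]
          · exact Or.inl (Or.inr h2)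
        · exact Or.inl (Or.inl h1)
  · simp only [okInvol, Bool.and_eq_true, Bool.or_eq_true, Bool.not_eq_true', natBeq_iff,
      Nat.blt_eq, ← Bool.not_eq_true, List.all_eq_true]
    refine ⟨?_, fun i _ => ?_⟩
    · by_cases h1 : t k < k
      · right; rw [octDigit_octCode (fun i => h8 (ht i)) h1, htt k hk]
      · exact Or.inl h1
    · by_cases h1 : i < k
      · rw [octDigit_octCode (fun i => h8 (ht i)) h1]
        by_cases h2 : t i = k
        · right; rw [← h2, htt i (h1.trans hk)]
        · exact Or.inl (Or.inr h2)
      · exact Or.inl (Or.inl h1)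

/-- Extension of a map of `{0, …, 5}` to the natural numbers. -/
def natFn (F : Fin 6 → Fin 6) (i : ℕ) : ℕ := if h : i < 6 then F ⟨i, h⟩ else 0

@[simp] theorem natFn_coe (F : Fin 6 → Fin 6) (i : Fin 6) : natFn F i = F i := by
  simp [natFn]

theorem sixList_all {P : ℕ → Bool} : sixList.all P = true ↔ ∀ i : Fin 6, P i = true := by
  simp [sixList, Fin.forall_fin_succ]

theorem sixCount_eq (P : ℕ → Bool) :
    sixCount P = (Finset.univ.filter fun i : Fin 6 => P i = true).card := by
  have h : ∀ b n, (bif b then Nat.succ n else n) = (if b = true then 1 else 0) + n := by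
    intro b n; cases b <;> simp [Nat.add_comm]
  simp only [sixCount, sixList, List.foldr, h, Finset.card_filter, Fin.sum_univ_six]
  simp [Nat.add_assoc]

/-- The rotation by `2π` about the two singularities. -/
def sixRot (i : Fin 6) : Fin 6 := Fin.ofNat 6 (octDigit 0o354021 i)

theorem coe_sixRot : ∀ i, (sixRot i : ℕ) = octDigit 0o354021 i := by decide +kernel

theorem sixNext_natFn (t : Fin 6 → Fin 6) (e : Fin 6) :
    sixNext (natFn t) e = sixRot (sixRot (t e)) := by
  have : ∀ i : Fin 6, octDigit 0o435102 i = sixRot (sixRot i) := by decide +kernel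
  rw [sixNext, natFn_coe, this]

/-- Six steps of the successor map visit the whole orbit, so the running minimum is the least
representative. -/
theorem sixRep_natFn {t r : Fin 6 → Fin 6}
    (h1 : ∀ e, ∃ k < 6, (fun i => sixRot (sixRot (t i)))^[k] e = r e)
    (h2 : ∀ e k, r e ≤ (fun i => sixRot (sixRot (t i)))^[k] e) (e : Fin 6) :
    sixRep (natFn t) e = r e := by
  have hmin : ∀ m e : Fin 6, (bif (m : ℕ).ble e then (m : ℕ) else (e : ℕ)) = (min m e : Fin 6) := by
    decide +kernel
  simp only [sixRep, sixMin, sixNext_natFn, hmin]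
  rw [← Fin.ext_iff]
  apply le_antisymm
  · obtain ⟨k, hk, hk'⟩ := h1 e
    rw [← hk']
    interval_cases k <;> simp
  · simp only [le_min_iff]
    exact ⟨⟨⟨⟨⟨⟨h2 e 0, h2 e 0⟩, h2 e 1⟩, h2 e 2⟩, h2 e 3⟩, h2 e 4⟩, h2 e 5⟩

/-- The search result on `Fin 6`. The permutation `κ` renumbers the separatrices while keeping the
rotation about the zeros; such permutations rotate each triple and possibly exchange the two. -/
theorem exists_model {t r p : Fin 6 → Fin 6}
    (h1 : ∀ e, ∃ k < 6, (fun i => sixRot (sixRot (t i)))^[k] e = r e)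
    (h2 : ∀ e k, r e ≤ (fun i => sixRot (sixRot (t i)))^[k] e) (htt : ∀ i, t (t i) = i)
    (hrp : ∀ i, r (p i) = p i) (hpr : ∀ i, p (r i) = p i) (hpp : ∀ i, p (p i) = r i)
    (hcount : (Finset.univ.filter fun i => t i = i).card +
      2 * (Finset.univ.filter fun i => r i = i ∧ p i = i).card = 6)
    (hne : ∃ i, r i ≠ 0)
    (hdom : ∀ a, r a = a → (∀ x, (if r x = a then 1 else 0) + (if r (t x) = a then 1 else 0) ≤
        (if r x = p a then 1 else 0) + (if r (t x) = p a then 1 else 0)) →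
      ∀ x, (if r x = p a then 1 else 0) + (if r (t x) = p a then 1 else 0) ≤
        (if r x = a then 1 else 0) + (if r (t x) = a then 1 else 0)) :
    ∃ (T : ConfigType) (κ : Fin 6 ≃ Fin 6), (∀ i, κ (sixRot i) = sixRot (κ i)) ∧
      (∀ i : Fin 6, κ (Fin.ofNat 6 (octDigit T.model.1 i)) = t (κ i)) ∧
      ∀ ab ∈ T.model.2, r (κ (Fin.ofNat 6 ab.2)) = p (κ (Fin.ofNat 6 ab.1)) := by
  have hlt : ∀ (F : Fin 6 → Fin 6) i, natFn F i < 6 := by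
    intro F i; unfold natFn; split <;> omega
  have h0 : ∀ (F : Fin 6 → Fin 6) i, 6 ≤ i → natFn F i = 0 := by
    intro F i hi; unfold natFn; rw [dif_neg (by omega)]
  have hnat : ∀ {P : ℕ → Prop}, (∀ i : Fin 6, P i) → ∀ i < 6, P i := fun h i hi => h ⟨i, hi⟩
  have key := sixGood_of_admissible (hlt t) (h0 t) (hlt r) (h0 r) (hlt p) (h0 p)
    (hnat fun i => by rw [sixRep_natFn h1 h2, natFn_coe]) (hnat fun i => by simp [htt])
    (hnat fun i => by simp [hrp]) (hnat fun i => by simp [hpr]) (hnat fun i => by simp [hpp]) ?_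
  · simp only [sixGood, List.any_eq_true, Bool.and_eq_true, sixList_all, natBeq_iff] at key
    obtain ⟨T, -, c, hc, k1, k2⟩ := key
    simp only [List.all_eq_true, natBeq_iff] at k2
    have h3 := sixCentralizer_spec
    simp only [List.all_eq_true (l := sixCentralizer)] at h3
    have h3 := h3 c hc
    simp only [Bool.and_eq_true, sixList_all, Bool.or_eq_true, natBeq_iff, Nat.blt_eq,
      Bool.not_eq_true', ← Bool.not_eq_true] at h3
    set κ : Fin 6 → Fin 6 := fun i => ⟨octDigit c i, (h3.1 i).1⟩ with hκ
    have hκc : ∀ i : Fin 6, octDigit c i = κ i := fun i => rfl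
    have hinj : Function.Injective κ := by
      intro i j hij
      refine Fin.ext ((h3.2 i j).resolve_right fun h => h ?_)
      rw [hκc, hκc, hij]
    have hof : ∀ {n : ℕ}, n < 6 → ((Fin.ofNat 6 n : Fin 6) : ℕ) = n := fun h => Nat.mod_eq_of_lt h
    have hm1 : ∀ i : Fin 6, octDigit T.model.1 i < 6 := by cases T <;> decide +kernel
    have hm2 : ∀ ab ∈ T.model.2, ab.1 < 6 ∧ ab.2 < 6 := by cases T <;> decide +kernel
    refine ⟨T, Equiv.ofBijective κ (Finite.injective_iff_bijective.1 hinj), fun i => ?_,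
      fun i => ?_, fun ab hab => ?_⟩
    · apply Fin.ext
      simp only [Equiv.ofBijective_apply]
      rw [← hκc, coe_sixRot, coe_sixRot, (h3.1 i).2, hκc]
    · apply Fin.ext
      simp only [Equiv.ofBijective_apply]
      rw [← hκc, hof (hm1 i), k1 i, hκc, natFn_coe]
    · apply Fin.ext
      have := k2 ab hab
      simp only [Equiv.ofBijective_apply]
      rw [← hof (hm2 ab hab).1, ← hof (hm2 ab hab).2, hκc, hκc, natFn_coe, natFn_coe] at this
      exact this
  · have hb : ∀ a b : ℕ, (bif a.beq b then 1 else 0) = if a = b then 1 else 0 := by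
      intro a b
      by_cases hab : a = b
      · simp [hab]
      · rw [if_neg hab, show a.beq b = false by rw [← Bool.not_eq_true, natBeq_iff]; exact hab]; rfl
    simp only [sixAdmissible, Bool.and_eq_true, sixList_all, natBeq_iff, sixCount_eq,
      natFn_coe, Bool.or_eq_true, Nat.ble_eq, sixMult, hb, natBeq_iff, Fin.val_inj, Bool.not_eq_true',
      ← Bool.not_eq_true]
    refine ⟨⟨by simpa [Fin.val_inj] using hcount, ?_⟩, fun a => ?_⟩
    · obtain ⟨i, hi⟩ := hne
      rw [List.any_eq_true]
      refine ⟨i, (show ∀ i : Fin 6, (i : ℕ) ∈ sixList by decide) i, ?_⟩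
      simp only [natFn_coe, Bool.not_eq_true', ← Bool.not_eq_true, natBeq_iff]
      exact fun h => hi (Fin.ext h)
    · by_cases ha : r a = a
      swap
      · exact Or.inl (Or.inl ha)
      by_cases h : ∀ x, (if r x = a then 1 else 0) + (if r (t x) = a then 1 else 0) ≤
          (if r x = p a then 1 else 0) + (if r (t x) = p a then 1 else 0)
      · exact Or.inr (hdom a ha h)
      · exact Or.inl (Or.inr h)

/-! ### Ribbon data of the eleven configurations -/

def ribbonCheck (K : Configuration) (M : ℕ × List (ℕ × ℕ))
    (ρ : Fin K.numSad → Fin K.numSad) (hd hd' : Fin K.numCyl → Fin K.numSad)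
    (χ : Fin K.numSad → Fin 6) (χ' : Fin 6 → Fin K.numSad) : Bool :=
  decide (((∀ j, K.left j =
        List.iterate (fun e => ρ (ρ (K.sadInv e))) (hd j) (K.left j).length) ∧
      (∀ j, K.left j ≠ []) ∧
      (∀ j, (fun e => ρ (ρ (K.sadInv e)))^[(K.left j).length] (hd j) = hd j) ∧
      (∀ j, (K.left j).Nodup) ∧
      (∀ j, K.right j = List.iterate (fun e => ρ (K.sadInv e)) (hd' j) (K.right j).length) ∧
      (∀ j, ((K.right j).map K.sadInv).Perm (K.left (K.cylInv j))) ∧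
      (∀ e, ∃ j, e ∈ K.left j) ∧ ∀ j j', hd j' ∈ K.left j → j' = j) ∧
    (∀ e, χ' (χ e) = e) ∧ (∀ i, χ (χ' i) = i) ∧ (∀ e, χ (ρ e) = sixRot (χ e)) ∧
    (∀ e, χ (K.sadInv e) = Fin.ofNat 6 (octDigit M.1 (χ e))) ∧
    ∀ j, ∃ ab ∈ M.2, Fin.ofNat 6 ab.1 = χ (hd j) ∧ Fin.ofNat 6 ab.2 = χ (hd (K.cylInv j)))

theorem exists_ribbon_of {K : Configuration} {M : ℕ × List (ℕ × ℕ)}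
    (ρ : Fin K.numSad → Fin K.numSad) (hd hd' : Fin K.numCyl → Fin K.numSad)
    (χ : Fin K.numSad → Fin 6) (χ' : Fin 6 → Fin K.numSad)
    (h : ribbonCheck K M ρ hd hd' χ χ' = true) :
    ∃ ρ hd hd', K.IsRibbon ρ hd hd' ∧ ∃ χ : Fin K.numSad ≃ Fin 6,
      (∀ e, χ (ρ e) = sixRot (χ e)) ∧
      (∀ e, χ (K.sadInv e) = Fin.ofNat 6 (octDigit M.1 (χ e))) ∧
      ∀ j, ∃ ab ∈ M.2, Fin.ofNat 6 ab.1 = χ (hd j) ∧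
        Fin.ofNat 6 ab.2 = χ (hd (K.cylInv j)) := by
  obtain ⟨⟨h1, h2, h3, h4, h5, h6, h7, h8⟩, h9, h10, h11⟩ := of_decide_eq_true h
  exact ⟨ρ, hd, hd', ⟨h1, h2, h3, h4, h5, h6, h7, h8⟩, ⟨χ, χ', h9, h10⟩, h11⟩

/-- The rotation is read off from the right boundaries, where the successor of `e` is `ρ (sadInv
e)`. The heads are the first entries of the lists, and the numbering sends the two cycles of `ρ` to
`{0, 1, 2}` and `{3, 4, 5}`. -/
theorem ConfigType.exists_ribbon (T : ConfigType) :
    ∃ ρ hd hd', T.config.IsRibbon ρ hd hd' ∧ ∃ χ : Fin T.config.numSad ≃ Fin 6,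
      (∀ e, χ (ρ e) = sixRot (χ e)) ∧
      (∀ e, χ (T.config.sadInv e) = Fin.ofNat 6 (octDigit T.model.1 (χ e))) ∧
      ∀ j, ∃ ab ∈ T.model.2, Fin.ofNat 6 ab.1 = χ (hd j) ∧
        Fin.ofNat 6 ab.2 = χ (hd (T.config.cylInv j)) := by
  cases T
  · exact exists_ribbon_of (![4, 2, 3, 1, 5, 0] : Fin 6 → Fin 6) (![0, 1, 4] : Fin 3 → Fin 6)
      (![1, 4, 0] : Fin 3 → Fin 6) (![0, 3, 4, 5, 1, 2] : Fin 6 → Fin 6)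
      (![0, 4, 5, 1, 2, 3] : Fin 6 → Fin 6) (by decide +kernel)
  · exact exists_ribbon_of (![1, 2, 0, 4, 5, 3] : Fin 6 → Fin 6) (![0, 1, 3] : Fin 3 → Fin 6)
      (![1, 3, 0] : Fin 3 → Fin 6) (![0, 1, 2, 3, 4, 5] : Fin 6 → Fin 6)
      (![0, 1, 2, 3, 4, 5] : Fin 6 → Fin 6) (by decide +kernel)
  · exact exists_ribbon_of (![3, 2, 5, 4, 0, 1] : Fin 6 → Fin 6) (![0, 2, 3] : Fin 3 → Fin 6)
      (![2, 0, 1] : Fin 3 → Fin 6) (![0, 3, 4, 1, 2, 5] : Fin 6 → Fin 6)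
      (![0, 3, 4, 1, 2, 5] : Fin 6 → Fin 6) (by decide +kernel)
  · exact exists_ribbon_of (![1, 2, 0, 4, 5, 3] : Fin 6 → Fin 6) (![0, 1, 5] : Fin 3 → Fin 6)
      (![1, 0, 3] : Fin 3 → Fin 6) (![0, 1, 2, 3, 4, 5] : Fin 6 → Fin 6)
      (![0, 1, 2, 3, 4, 5] : Fin 6 → Fin 6) (by decide +kernel)
  · exact exists_ribbon_of (![4, 2, 3, 1, 5, 0] : Fin 6 → Fin 6) (![0, 1, 3, 4] : Fin 4 → Fin 6)
      (![1, 2, 4, 0] : Fin 4 → Fin 6) (![0, 3, 4, 5, 1, 2] : Fin 6 → Fin 6)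
      (![0, 4, 5, 1, 2, 3] : Fin 6 → Fin 6) (by decide +kernel)
  · exact exists_ribbon_of (![1, 2, 0, 5, 3, 4] : Fin 6 → Fin 6) (![0, 1, 3, 4] : Fin 4 → Fin 6)
      (![1, 3, 5, 0] : Fin 4 → Fin 6) (![0, 1, 2, 3, 5, 4] : Fin 6 → Fin 6)
      (![0, 1, 2, 3, 5, 4] : Fin 6 → Fin 6) (by decide +kernel)
  · exact exists_ribbon_of (![1, 2, 0, 4, 5, 3] : Fin 6 → Fin 6) (![0, 1, 3, 5] : Fin 4 → Fin 6)
      (![1, 3, 4, 0] : Fin 4 → Fin 6) (![0, 1, 2, 3, 4, 5] : Fin 6 → Fin 6)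
      (![0, 1, 2, 3, 4, 5] : Fin 6 → Fin 6) (by decide +kernel)
  · exact exists_ribbon_of (![2, 0, 1, 4, 5, 3] : Fin 6 → Fin 6) (![0, 3] : Fin 2 → Fin 6)
      (![3, 0] : Fin 2 → Fin 6) (![0, 2, 1, 3, 4, 5] : Fin 6 → Fin 6)
      (![0, 2, 1, 3, 4, 5] : Fin 6 → Fin 6) (by decide +kernel)
  · exact exists_ribbon_of (![3, 0, 4, 1, 5, 2] : Fin 6 → Fin 6) (![0, 3] : Fin 2 → Fin 6)
      (![0, 1] : Fin 2 → Fin 6) (![0, 2, 3, 1, 4, 5] : Fin 6 → Fin 6)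
      (![0, 3, 1, 2, 4, 5] : Fin 6 → Fin 6) (by decide +kernel)
  · exact exists_ribbon_of (![2, 3, 5, 4, 1, 0] : Fin 6 → Fin 6) (![0, 2] : Fin 2 → Fin 6)
      (![2, 0] : Fin 2 → Fin 6) (![0, 3, 1, 4, 5, 2] : Fin 6 → Fin 6)
      (![0, 2, 5, 1, 3, 4] : Fin 6 → Fin 6) (by decide +kernel)
  · exact exists_ribbon_of (![1, 2, 0, 5, 3, 4] : Fin 6 → Fin 6) (![0, 1] : Fin 2 → Fin 6)
      (![1, 0] : Fin 2 → Fin 6) (![0, 1, 2, 3, 5, 4] : Fin 6 → Fin 6)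
      (![0, 1, 2, 3, 5, 4] : Fin 6 → Fin 6) (by decide +kernel)

/-! ### Classification: every completely periodic surface with at least two cylinders is one of the
eleven -/

namespace TranslationSurface

variable {X : Type*} [TopologicalSpace X] {S : TranslationSurface X} {τ : X → X}

theorem InLocusL.isPeriodicHalfTurn (h : S.InLocusL τ) (hP : S.IsVerticallyCompletelyPeriodic) :
    S.IsPeriodicHalfTurn τ := by
  obtain ⟨⟨p, q, hpq, hp, hq, h0⟩, ⟨h1, h2, h3, -⟩, h4⟩ := h
  have h5 : ∀ x, S.ord x ≠ 0 → x = p ∨ x = q := fun x hx => by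
    by_contra hne
    push Not at hne
    exact hx (h0 x hne.1 hne.2)
  refine ⟨⟨h1, h2, h3, h4⟩, (Set.toFinite {p, q}).subset h5, fun x hx => ?_, ⟨p, by omega⟩, hP⟩
  rcases h5 x hx with rfl | rfl <;> assumption

theorem InStratumTwoTwo.encard (h : S.InStratumTwoTwo) : {x | S.ord x ≠ 0}.encard = 2 := by
  obtain ⟨p, q, hpq, hp, hq, h0⟩ := h
  rw [← Set.encard_pair hpq]
  congr 1
  ext x
  simp only [Set.mem_ofPred_eq, Set.mem_insert_iff, Set.mem_singleton_iff]
  constructor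
  · intro hx
    by_contra hne
    push Not at hne
    exact hx (h0 x hne.1 hne.2)
  · rintro (rfl | rfl) <;> omega

theorem InStratumTwoTwo.exists_numbering (h : S.InStratumTwoTwo) :
    ∃ ψ : Fin 6 ≃ S.Separatrix, ∀ i, ψ (sixRot i) = ((ψ i).1, (ψ i).2 + 1) := by
  obtain ⟨p, q, hpq, hp, hq, h0⟩ := h
  set P : {x // S.ord x ≠ 0} := ⟨p, by omega⟩
  set Q : {x // S.ord x ≠ 0} := ⟨q, by omega⟩
  have hPQ : P ≠ Q := fun h => hpq (congrArg Subtype.val h)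
  set F : Fin 6 → S.Separatrix := ![(P, 0), (P, 1), (P, 2), (Q, 0), (Q, 1), (Q, 2)] with hF
  have hinj : Function.Injective F := by
    have h01 : (0 : ZMod 3) ≠ 1 := by decide
    have h02 : (0 : ZMod 3) ≠ 2 := by decide
    have h12 : (1 : ZMod 3) ≠ 2 := by decide
    intro i j hij
    fin_cases i <;> fin_cases j <;> first
      | rfl
      | (exfalso; simp [hF, hPQ, hPQ.symm, h01, h02, h12, h01.symm, h02.symm, h12.symm] at hij)
  have hsurj : Function.Surjective F := by
    rintro ⟨⟨x, hx⟩, k⟩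
    have hx' : x = p ∨ x = q := by
      by_contra hne
      push Not at hne
      exact hx (h0 x hne.1 hne.2)
    rcases hx' with rfl | rfl
    · refine ⟨![0, 1, 2] k, ?_⟩; fin_cases k <;> rfl
    · refine ⟨![3, 4, 5] k, ?_⟩; fin_cases k <;> rfl
  refine ⟨Equiv.ofBijective F ⟨hinj, hsurj⟩, fun i => ?_⟩
  have hr : ∀ i, sixRot i = (![1, 2, 0, 4, 5, 3] : Fin 6 → Fin 6) i := by decide +kernel
  rw [hr]
  fin_cases i <;> first | rfl | exact Prod.ext rfl (show (0 : ZMod 3) = 2 + 1 by decide)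

variable [T2Space X] [CompactSpace X] [ConnectedSpace X] {D : S.SaddleSystem τ}

/-- The saddle connections with the same cylinder on their right form one cycle of `next`, listed
once by the iterates below the minimal period. -/
theorem ClosedCylinderSystem.height_eq_sum (Y : ClosedCylinderSystem D)
    (hP : S.IsPeriodicHalfTurn τ) (ψ : Fin 6 ≃ S.Separatrix) (a : Fin 6) [DecidableEq (Set X)] :
    Y.height (ψ a) = ∑ x, if Y.image (ψ x) = Y.image (ψ a) then D.len (ψ x) else 0 := by
  have : Finite S.Separatrix := Finite.of_equiv _ ψ
  have hper : ψ a ∈ Function.periodicPts D.next := D.next.injective.mem_periodicPts _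
  have hpos := Function.minimalPeriod_pos_of_mem_periodicPts hper
  have hit : ∀ k, D.next^[k] (ψ a) = (D.next ^ k) (ψ a) := fun k => by
    rw [Equiv.Perm.iterate_eq_pow]
  rw [Y.height_eq hP hpos (by rw [← hit]; exact Function.iterate_minimalPeriod)
    (fun k hk hk' h => by
      rw [← hit] at h
      exact (Function.not_isPeriodicPt_of_pos_of_lt_minimalPeriod hk.ne' hk') h), pos,
    ← Finset.sum_filter]
  refine Finset.sum_bij (fun k _ => ψ.symm ((D.next ^ k) (ψ a))) ?_ ?_ ?_ ?_
  · intro k _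
    simp only [Finset.mem_filter, Finset.mem_univ, true_and, Equiv.apply_symm_apply]
    exact ((Y.image_eq_iff hP).2 ⟨k, rfl⟩).symm
  · intro k hk l hl hkl
    have := ψ.symm.injective hkl
    rw [← hit, ← hit] at this
    exact Function.iterate_injOn_Iio_minimalPeriod (Finset.mem_range.1 hk) (Finset.mem_range.1 hl)
      this
  · intro x hx
    simp only [Finset.mem_filter, Finset.mem_univ, true_and] at hx
    obtain ⟨k, hk⟩ := (Y.image_eq_iff hP).1 hx.symm
    refine ⟨k % Function.minimalPeriod D.next (ψ a), Finset.mem_range.2 (Nat.mod_lt _ hpos), ?_⟩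
    rw [← hit, Function.iterate_mod_minimalPeriod_eq, hit, hk, ψ.symm_apply_apply]
  · intro k _; rw [ψ.apply_symm_apply]

theorem InLocusL.exists_hasConfiguration (h : S.InLocusL τ)
    (hV : S.IsVerticallyCompletelyPeriodic) (hnt : S.verticalCylinders.Nontrivial) :
    ∃ T : ConfigType, S.HasConfiguration τ T.config := by
  classical
  have hP := h.isPeriodicHalfTurn hV
  obtain ⟨D⟩ := hP.exists_saddleSystem
  obtain ⟨Y₀⟩ := hP.exists_cylinderSystem (D := D)
  obtain ⟨Y⟩ := Y₀.exists_closed hP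
  obtain ⟨ψ, hψ⟩ := h.1.exists_numbering
  have least : ∀ A, (∃ e, Y.image (ψ e) = A) →
      ∃ m, Y.image (ψ m) = A ∧ ∀ e, Y.image (ψ e) = A → m ≤ e := by
    rintro A ⟨e, he⟩
    obtain ⟨m, hm, hmin⟩ := WellFounded.has_min (wellFounded_lt (α := Fin 6))
      {m | Y.image (ψ m) = A} ⟨e, he⟩
    exact ⟨m, hm, fun e he => not_lt.1 (hmin e he)⟩
  have himg : ∀ C, S.IsVerticalCylinder C → ∃ e, Y.image (ψ e) = C := fun C hC => by
    obtain ⟨e, rfl⟩ := Y.exists_eq_image hP hC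
    exact ⟨ψ.symm e, by rw [ψ.apply_symm_apply]⟩
  choose r hr hrmin using fun e => least (Y.image (ψ e)) ⟨e, rfl⟩
  choose p hp hpmin using fun e => least (τ '' Y.image (ψ e))
    (himg _ ((Y.vert (ψ e)).anti hP.halfTurn))
  have hinv : ∀ A : Set X, τ '' (τ '' A) = A := fun A => by
    rw [Set.image_image]; simp [hP.halfTurn.involutive _]
  set t : Fin 6 → Fin 6 := fun e => ψ.symm (D.inv (ψ e)) with ht
  have hψt : ∀ e, ψ (t e) = D.inv (ψ e) := fun e => ψ.apply_symm_apply _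
  set nx : Fin 6 → Fin 6 := fun i => sixRot (sixRot (t i)) with hnx
  have hψnx : ∀ e, ψ (nx e) = D.next (ψ e) := by
    intro e
    have h3 : ∀ k : ZMod 3, k + 1 + 1 = k - 1 := by decide
    simp only [hnx, hψ, hψt, SaddleSystem.next_apply, h3]
  have hψk : ∀ k e, ψ (nx^[k] e) = (D.next ^ k) (ψ e) := by
    intro k
    induction k with
    | zero => intro e; rfl
    | succ k ih => intro e; rw [Function.iterate_succ_apply, ih, hψnx, pow_succ,
        Equiv.Perm.mul_apply]
  have hnxinj : Function.Injective nx := fun a b hab => ψ.injective (D.next.injective (by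
    rw [← hψnx, ← hψnx, hab]))
  have hr_iff : ∀ a b, r a = r b ↔ Y.image (ψ a) = Y.image (ψ b) := fun a b =>
    ⟨fun h => by rw [← hr a, ← hr b, h], fun h => le_antisymm
      (hrmin a _ ((hr b).trans h.symm)) (hrmin b _ ((hr a).trans h))⟩
  have hrp : ∀ i, r (p i) = p i := fun i => le_antisymm (hrmin _ _ rfl)
    (hpmin i _ ((hr _).trans (hp i)))
  have hpr : ∀ i, p (r i) = p i := fun i => le_antisymm
    (hpmin _ _ (by rw [hp i, hr i])) (hpmin _ _ (by rw [hp, hr i]))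
  have hpp : ∀ i, p (p i) = r i := fun i => le_antisymm
    (hpmin _ _ (by rw [hr i, hp i, hinv])) (hrmin _ _ (by rw [hp, hp, hinv]))
  have hrr : ∀ i, r (r i) = r i := fun i => (hr_iff _ _).2 (hr i)
  have htt : ∀ i, t (t i) = i := fun i => ψ.injective (by rw [hψt, hψt, D.inv_inv])
  -- The height is counted once over `x` and once over `t x`. These have equal length, so the
  -- multiplicities are those of the pairs `{x, t x}`.
  have hsum : ∀ a, r a = a → 2 * Y.height (ψ a) = ∑ x, D.len (ψ x) *
      (((if r x = a then 1 else 0) + (if r (t x) = a then 1 else 0) : ℕ) : ℝ) := by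
    intro a ha
    have h1 : Y.height (ψ a) = ∑ x, if r x = a then D.len (ψ x) else 0 := by
      rw [Y.height_eq_sum hP]
      refine Finset.sum_congr rfl fun x _ => ?_
      congr 1
      rw [← hr_iff, ha]
    have h2 : ∑ x, (if r x = a then D.len (ψ x) else 0) =
        ∑ x, if r (t x) = a then D.len (ψ x) else 0 := by
      refine Fintype.sum_equiv ⟨t, t, htt, htt⟩ _ _ fun x => ?_
      simp only [Equiv.coe_fn_mk, htt, hψt, D.len_inv]
    rw [two_mul]
    conv_lhs => rw [h1]
    conv_lhs => arg 2; rw [h2]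
    rw [← Finset.sum_add_distrib]
    refine Finset.sum_congr rfl fun x _ => ?_
    split_ifs <;> push_cast <;> ring
  have hcount : (Finset.univ.filter fun i => t i = i).card +
      2 * (Finset.univ.filter fun i => r i = i ∧ p i = i).card = 6 := by
    have h1 := hP.halfTurn.encard_fixedPoints (ι := {e : Fin 6 // r e = e}) (κ := Fin 6)
      (γ := fun e => D.path (ψ e)) (ℓ := fun e => D.len (ψ e)) (f := fun j => Y.map (ψ j))
      (w := fun j => Y.width (ψ j)) (h := fun j => Y.height (ψ j)) (σ := t)
      (π := fun j => ⟨p j, hrp j⟩) (fun e => D.saddle _)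
      (fun e e' s hs s' hs' hss => by
        obtain ⟨k1, k2⟩ := D.disjoint hP hs hs' hss
        exact ⟨ψ.injective k1, k2⟩)
      (fun j => Y.cyl _)
      (fun j j' hne => by
        rw [Set.disjoint_left]
        intro x hx hx'
        have h2 : Y.image (ψ j) = Y.image (ψ j') := (Y.vert _).eq_of_inter hP.nonempty (Y.vert _) hx hx'
        rw [← hr_iff, j.2, j'.2] at h2
        exact hne (Subtype.ext h2))
      (fun x hx => by
        rcases D.cover hP hx with ⟨C, hC, hxC⟩ | ⟨e, s, hs, rfl⟩
        · left
          obtain ⟨e, rfl⟩ := himg C hC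
          refine ⟨⟨r e, hrr e⟩, ?_⟩
          show x ∈ Y.image (ψ (r e))
          rwa [hr e]
        · right
          exact ⟨ψ.symm e, s, by rwa [ψ.apply_symm_apply], by rw [ψ.apply_symm_apply]⟩)
      (fun j => (hp j).symm) (fun e => by rw [hψt, D.len_inv])
      (fun e s hs => by rw [hψt, D.path_inv _ _ hs])
    -- Of the eight fixed points two are the zeros, which leaves six.
    rw [h.2.1.2.2.2, h.1.encard, ENat.card_eq_coe_fintype_card, ENat.card_eq_coe_fintype_card] at h1
    have h2 : Fintype.card {j : {e : Fin 6 // r e = e} // (⟨p j, hrp j⟩ : {e // r e = e}) = j} =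
        (Finset.univ.filter fun i => r i = i ∧ p i = i).card := by
      rw [← Fintype.card_subtype]
      refine Fintype.card_congr ⟨fun j => ⟨j.1.1, j.1.2, congrArg Subtype.val j.2⟩,
        fun i => ⟨⟨i.1, i.2.1⟩, Subtype.ext i.2.2⟩, fun _ => rfl, fun _ => rfl⟩
    rw [h2, Fintype.card_subtype] at h1
    norm_cast at h1
    omega
  have hmodel := exists_model (t := t) (r := r) (p := p) ?_ ?_ htt hrp hpr hpp
    hcount ?_ ?_
  · obtain ⟨T, κ, hκ1, hκ2, hκ3⟩ := hmodel
    obtain ⟨ρ, hd, hd', hK, χ, hχ1, hχ2, hχ3⟩ := T.exists_ribbon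
    refine ⟨T, Y.exists_realization hP hK ((χ.trans κ).trans ψ) (fun e => ?_) (fun e => ?_)
      fun j => ?_⟩
    · simp only [Equiv.trans_apply, hχ1, hκ1, hψ]
    · simp only [Equiv.trans_apply, hχ2, hκ2, hψt]
    · obtain ⟨ab, hab, k1, k2⟩ := hχ3 j
      have := hκ3 ab hab
      rw [k1, k2] at this
      simp only [Equiv.trans_apply]
      show τ '' Y.image (ψ (κ (χ (hd j)))) = Y.image (ψ (κ (χ (hd (T.config.cylInv j)))))
      rw [← hp, ← this, hr]
  · intro e
    obtain ⟨k, hk⟩ := (Y.image_eq_iff hP).1 (hr e).symm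
    rw [← hψk] at hk
    have hper : e ∈ Function.periodicPts nx := hnxinj.mem_periodicPts _
    have hpos := Function.minimalPeriod_pos_of_mem_periodicPts hper
    refine ⟨k % Function.minimalPeriod nx e, (Nat.mod_lt _ hpos).trans_le ?_, ?_⟩
    · simpa using Function.minimalPeriod_le_card (f := nx) (x := e)
    · show nx^[_] e = _
      rw [Function.iterate_mod_minimalPeriod_eq]
      exact ψ.injective hk
  · intro e k
    refine hrmin e _ ?_
    show Y.image (ψ (nx^[k] e)) = _
    rw [hψk]
    exact ((Y.image_eq_iff hP).2 ⟨k, rfl⟩).symm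
  · by_contra hall
    push Not at hall
    obtain ⟨C, hC, C', hC', hne⟩ := hnt
    obtain ⟨e, rfl⟩ := himg C hC
    obtain ⟨e', rfl⟩ := himg C' hC'
    exact hne ((hr_iff _ _).1 (by rw [hall, hall]))
  · intro a ha hle x
    by_contra hlt
    push Not at hlt
    -- The half turn preserves heights, while positive lengths turn domination with one strict
    -- inequality into strictly different heights.
    have h1 : Y.height (ψ a) = Y.height (ψ (p a)) := (Y.exists_anti hP (hp a).symm).2.1
    have h2 := hsum a ha
    rw [h1, hsum (p a) (hrp a)] at h2
    refine absurd h2 (ne_of_gt ?_)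
    refine Finset.sum_lt_sum (fun y _ => ?_) ⟨x, Finset.mem_univ _, ?_⟩
    · exact mul_le_mul_of_nonneg_left (by exact_mod_cast hle y) (D.len_pos _).le
    · exact mul_lt_mul_of_pos_left (by exact_mod_cast hlt) (D.len_pos _)

end TranslationSurface

/-! ### Uniqueness: the configuration is determined by the surface and the half turn -/

namespace TranslationSurface

variable {X : Type*} [TopologicalSpace X] {S : TranslationSurface X} {τ : X → X}
  {K K' : Configuration}

namespace Realization

/-- The open cylinders of a realization. -/
def image (R : S.Realization τ K) (j : Fin K.numCyl) : Set X := R.cyl j '' openStrip (R.width j)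

theorem image_nonempty (R : S.Realization τ K) (j : Fin K.numCyl) : (R.image j).Nonempty := by
  refine ⟨_, ((R.width j / 2 : ℝ) : ℂ), ?_, rfl⟩
  rw [mem_openStrip]
  have := (R.cyl_map j).1
  simp; linarith

theorem image_injective (R : S.Realization τ K) : Function.Injective R.image := by
  intro j j' h
  by_contra hne
  obtain ⟨x, hx⟩ := R.image_nonempty j
  exact Set.disjoint_left.1 (R.cyl_disjoint j j' hne) hx (h ▸ hx : x ∈ R.image j')

variable [T2Space X]

/-- A cylinder avoids all saddle connections, so it is a connected set covered by the disjoint open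
cylinders of the realization, and lies in one of them. -/
theorem exists_subset (R : S.Realization τ K) {g : ℂ → X} {w h : ℝ} (hg : S.IsCylinderMap g w h) :
    ∃ j, g '' openStrip w ⊆ R.image j := by
  have hcov : ∀ x ∈ g '' openStrip w, ∃ j, x ∈ R.image j := by
    rintro x ⟨z, hz, rfl⟩
    rcases R.cover _ (hg.trans hz).1 with h | ⟨e, t, ht, htx⟩
    · exact h
    · exact absurd ⟨z, hz, htx.symm⟩ ((R.saddle_vertical e).isRay.notMem_cylinder hg ht)
  have hopen : ∀ j, IsOpen (R.image j) := fun j => (R.cyl_map j).isOpen_image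
  have hcont : ContinuousOn g (openStrip w) := fun z hz =>
    (hg.trans hz).continuousAt.continuousWithinAt
  have hpre : IsPreconnected (g '' openStrip w) := (isPreconnected_reStrip 0 w).image _ hcont
  have hz : ((w / 2 : ℝ) : ℂ) ∈ openStrip w := by
    rw [mem_openStrip]; have := hg.1; simp; linarith
  obtain ⟨j, hj⟩ := hcov _ ⟨_, hz, rfl⟩
  refine ⟨j, hpre.subset_left_of_subset_union (hopen j)
    (isOpen_iUnion fun j' : {j' // j' ≠ j} => hopen j') ?_ ?_ ⟨_, ⟨_, hz, rfl⟩, hj⟩⟩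
  · rw [Set.disjoint_iUnion_right]
    exact fun j' => R.cyl_disjoint j j' j'.2.symm
  · intro x hx
    obtain ⟨j', hj'⟩ := hcov x hx
    by_cases h : j' = j
    · exact Or.inl (h ▸ hj')
    · exact Or.inr (Set.mem_iUnion.2 ⟨⟨j', h⟩, hj'⟩)

theorem isVerticalCylinder (R : S.Realization τ K) (j : Fin K.numCyl) :
    S.IsVerticalCylinder (R.image j) := by
  refine ⟨⟨_, _, _, R.cyl_map j, rfl⟩, ?_⟩
  rintro _ ⟨g, w, h, hg, rfl⟩ hle
  obtain ⟨j', hj'⟩ := R.exists_subset hg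
  obtain rfl : j = j' := by
    by_contra hne
    obtain ⟨x, hx⟩ := R.image_nonempty j
    exact Set.disjoint_left.1 (R.cyl_disjoint j j' hne) hx (hj' (hle hx))
  exact hj'

theorem range_image (R : S.Realization τ K) : Set.range R.image = S.verticalCylinders := by
  apply Set.Subset.antisymm
  · rintro _ ⟨j, rfl⟩
    exact R.isVerticalCylinder j
  · intro C (hC : S.IsVerticalCylinder C)
    obtain ⟨g, w, h, hg, rfl⟩ := hC.prop
    obtain ⟨j, hj⟩ := R.exists_subset hg
    exact ⟨j, (hC.le_of_ge (R.isVerticalCylinder j).prop hj).antisymm hj⟩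

theorem encard_verticalCylinders (R : S.Realization τ K) :
    S.verticalCylinders.encard = K.numCyl := by
  rw [← R.range_image, ← Set.image_univ, R.image_injective.encard_image, Set.encard_univ]
  simp

theorem isVerticallyCompletelyPeriodic (R : S.Realization τ K) :
    S.IsVerticallyCompletelyPeriodic := fun p hp => by
  rcases R.cover p hp with ⟨j, hj⟩ | ⟨e, he⟩
  · exact Or.inl ⟨_, R.isVerticalCylinder j, hj⟩
  · exact Or.inr ⟨_, _, R.saddle_vertical e, he⟩

/-- The times at which the left boundary passes through a singularity. -/
def leftSing (R : S.Realization τ K) (j : Fin K.numCyl) : Set ℝ :=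
  {y | S.ord (R.cyl j (y * Complex.I)) ≠ 0}

/-- On a half-open interval each saddle connection contributes its lower end and nothing else. -/
theorem finite_ncard_sing {β : ℝ → X} {ι : Type*} {γ : ι → ℝ → X} {ℓ : ι → ℝ}
    (hγ : ∀ e, S.IsVerticalSaddle (γ e) (ℓ e)) (L : List ι) (a : ℝ) (h : RunsAlong β γ ℓ a L) :
    {y | y ∈ Set.Ico a (a + (L.map ℓ).sum) ∧ S.ord (β y) ≠ 0}.Finite ∧
      {y | y ∈ Set.Ico a (a + (L.map ℓ).sum) ∧ S.ord (β y) ≠ 0}.ncard = L.length := by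
  induction L generalizing a with
  | nil => simp
  | cons e L ih =>
    obtain ⟨h1, h2⟩ := h
    obtain ⟨h3, h4⟩ := ih _ h2
    have hs : 0 ≤ (L.map ℓ).sum := List.sum_nonneg fun x hx => by
      obtain ⟨e, -, rfl⟩ := List.mem_map.1 hx
      exact (hγ e).1.le
    have hpos := (hγ e).1
    have heq : {y | y ∈ Set.Ico a (a + ((e :: L).map ℓ).sum) ∧ S.ord (β y) ≠ 0} =
        insert a {y | y ∈ Set.Ico (a + ℓ e) (a + ℓ e + (L.map ℓ).sum) ∧ S.ord (β y) ≠ 0} := by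
      ext y
      simp only [List.map_cons, List.sum_cons, Set.mem_ofPred_eq, Set.mem_insert_iff, Set.mem_Ico]
      constructor
      · rintro ⟨⟨k1, k2⟩, k3⟩
        by_cases hy : a + ℓ e ≤ y
        · exact Or.inr ⟨⟨hy, by linarith⟩, k3⟩
        · left
          by_contra hne
          have h5 := h1 (y - a) ⟨by linarith, by linarith⟩
          rw [add_sub_cancel] at h5
          rw [h5] at k3
          exact k3 ((hγ e).2.2.2.2 _ ⟨sub_pos.2 (lt_of_le_of_ne k1 (Ne.symm hne)), by linarith⟩).1
      · rintro (rfl | ⟨⟨k1, k2⟩, k3⟩)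
        · refine ⟨⟨le_rfl, by linarith⟩, ?_⟩
          have h5 := h1 0 ⟨le_rfl, hpos.le⟩
          rw [add_zero] at h5
          rw [h5]; exact (hγ e).2.2.1
        · exact ⟨⟨by linarith, by linarith⟩, k3⟩
    rw [heq]
    refine ⟨h3.insert a, ?_⟩
    rw [Set.ncard_insert_of_notMem (fun h => absurd h.1.1 (by linarith)) h3, h4, List.length_cons]

theorem closed_periodic (R : S.Realization τ K) (j : Fin K.numCyl) (n : ℤ) {z : ℂ}
    (hz : z ∈ closedStrip (R.width j)) :
    R.cyl j (z + (n : ℂ) * ((R.height j : ℂ) * Complex.I)) = R.cyl j z :=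
  eqOn_closedStrip (R.cyl_map j).1 (continuousOn_comp_add (R.cyl_continuous j) (by simp))
    (R.cyl_continuous j) (fun z hz => (R.cyl_map j).periodic hz n) z hz

theorem zero_I_mem (R : S.Realization τ K) (j : Fin K.numCyl) (y : ℝ) :
    (y : ℂ) * Complex.I ∈ closedStrip (R.width j) :=
  ⟨by simp, by simpa using (R.cyl_map j).1.le⟩

/-- Counting on the circle instead of an interval makes the number independent of the height at
which the parametrization starts. -/
theorem ncard_leftSing (R : S.Realization τ K) (j : Fin K.numCyl) :
    ((fun y : ℝ => (y : AddCircle (R.height j))) '' R.leftSing j).ncard = (K.left j).length := by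
  have hh : 0 < R.height j := (R.cyl_map j).2.1
  have h1 := (finite_ncard_sing R.saddle_vertical _ _ (R.left_runs j)).2
  rw [R.left_height, zero_add] at h1
  rw [← h1]
  have hadd : ∀ (y : ℝ) (n : ℤ), R.cyl j (((y + n * R.height j : ℝ) : ℂ) * Complex.I) =
      R.cyl j ((y : ℂ) * Complex.I) := by
    intro y n
    rw [← R.closed_periodic j n (R.zero_I_mem j y)]
    congr 1; push_cast; ring
  have himg : (fun y : ℝ => (y : AddCircle (R.height j))) '' R.leftSing j =
      (fun y : ℝ => (y : AddCircle (R.height j))) ''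
        {y | y ∈ Set.Ico 0 (R.height j) ∧ S.ord (R.cyl j (y * Complex.I)) ≠ 0} := by
    apply Set.Subset.antisymm
    · rintro _ ⟨y, hy, rfl⟩
      have h2 : y - ⌊y / R.height j⌋ * R.height j = Int.fract (y / R.height j) * R.height j := by
        rw [Int.fract]; field_simp
      refine ⟨y - ⌊y / R.height j⌋ * R.height j, ⟨?_, ?_⟩, ?_⟩
      · rw [h2]
        exact ⟨mul_nonneg (Int.fract_nonneg _) hh.le, by
          have := Int.fract_lt_one (y / R.height j); nlinarith⟩
      · have := hadd y (-⌊y / R.height j⌋)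
        rw [Int.cast_neg, neg_mul, ← sub_eq_add_neg] at this
        rw [this]; exact hy
      · refine (QuotientAddGroup.eq_iff_sub_mem.2 ?_)
        refine AddSubgroup.mem_zmultiples_iff.2 ⟨-⌊y / R.height j⌋, ?_⟩
        simp
    · exact Set.image_mono fun y hy => hy.2
  rw [himg]
  refine Set.InjOn.ncard_image fun x hx y hy hxy => ?_
  obtain ⟨n, hn⟩ := AddSubgroup.mem_zmultiples_iff.1 (QuotientAddGroup.eq_iff_sub_mem.1 hxy)
  rw [zsmul_eq_mul] at hn
  have h3 : (n : ℝ) < 1 := by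
    by_contra hle
    push Not at hle
    nlinarith [hx.1.2, hy.1.1]
  have h4 : (-1 : ℝ) < n := by
    by_contra hle
    push Not at hle
    nlinarith [hx.1.1, hy.1.2]
  have h5 : n = 0 := by
    have : n < 1 := by exact_mod_cast h3
    have : -1 < n := by exact_mod_cast h4
    omega
  rw [h5] at hn
  simp at hn
  linarith

/-- By rigidity the two parametrizations differ by a vertical shift, also on the boundary; it
rotates the circle of heights and preserves the number of zeros on it. -/
theorem length_left_eq (R : S.Realization τ K) (R' : S.Realization τ K') {j : Fin K.numCyl}
    {j' : Fin K'.numCyl} (h : R.image j = R'.image j') :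
    (K.left j).length = (K'.left j').length := by
  obtain ⟨x, z, hz, rfl⟩ := R.image_nonempty j
  obtain ⟨z', hz', hzz⟩ : R.cyl j z ∈ R'.image j' := h ▸ ⟨z, hz, rfl⟩
  obtain ⟨h1, h2, h3, h4⟩ := (R.cyl_map j).rigid (R'.cyl_map j') h hz hz' hzz.symm
  set c : ℂ := z' - z
  have hc : c = (c.im : ℂ) * Complex.I := Complex.ext (by simpa using h3) (by simp)
  have h5 := eqOn_closedStrip (R.cyl_map j).1 (R.cyl_continuous j)
    (continuousOn_comp_add (h1 ▸ R'.cyl_continuous j') h3) h4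
  rw [← R.ncard_leftSing, ← R'.ncard_leftSing, ← h2]
  have h6 : R'.leftSing j' = (fun y => y + c.im) '' R.leftSing j := by
    ext y
    have h7 := h5 _ (R.zero_I_mem j (y - c.im))
    have h8 : ((y - c.im : ℝ) : ℂ) * Complex.I + c = y * Complex.I := by
      conv_lhs => rw [hc]
      simp; ring
    rw [h8] at h7
    constructor
    · intro hy
      refine ⟨y - c.im, ?_, by simp⟩
      show S.ord _ ≠ 0
      rw [h7]; exact hy
    · rintro ⟨u, hu, rfl⟩
      show S.ord _ ≠ 0
      rw [← h7]
      simpa [leftSing] using hu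
  rw [h6, Set.image_image]
  have h9 : (fun y : ℝ => ((y + c.im : ℝ) : AddCircle (R.height j))) '' R.leftSing j =
      (fun q => q + (c.im : AddCircle (R.height j))) ''
        ((fun y : ℝ => (y : AddCircle (R.height j))) '' R.leftSing j) := by
    rw [Set.image_image]; rfl
  rw [h9, Set.ncard_image_of_injective _ (add_left_injective _)]

end Realization

end TranslationSurface

/-- For every cylinder, whether it is fixed and the numbers of saddle connections on the left
boundaries of the cylinder and its image. -/
def Configuration.lengths (K : Configuration) : Multiset (Bool × ℕ × ℕ) :=
  Finset.univ.val.map fun j =>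
    (decide (K.cylInv j = j), (K.left j).length, (K.left (K.cylInv j)).length)

theorem ConfigType.eq_of_lengths {T T' : ConfigType}
    (h : T.config.lengths = T'.config.lengths) : T = T' := by
  cases T <;> cases T' <;> first | rfl | exact absurd h (by decide +kernel)

namespace TranslationSurface

variable {X : Type*} [TopologicalSpace X] [T2Space X] {S : TranslationSurface X} {τ : X → X}
  {K K' : Configuration}

theorem Realization.lengths_eq (R : S.Realization τ K) (R' : S.Realization τ K') :
    K.lengths = K'.lengths := by
  have hex : ∀ j, ∃ j', R'.image j' = R.image j := fun j => by
    have h := R.isVerticalCylinder j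
    exact (R'.range_image.symm ▸ h : R.image j ∈ Set.range R'.image)
  choose θ hθ using hex
  have hbij : Function.Bijective θ := by
    refine ⟨fun a b hab => R.image_injective (by rw [← hθ a, hab, hθ b]), fun j' => ?_⟩
    have h := R'.isVerticalCylinder j'
    have h : R'.image j' ∈ Set.range R.image := R.range_image.symm ▸ h
    obtain ⟨j, hj⟩ := h
    exact ⟨j, R'.image_injective (by rw [hθ, hj])⟩
  have hinv : ∀ j, θ (K.cylInv j) = K'.cylInv (θ j) := fun j => R'.image_injective (by
    rw [hθ]
    exact ((R.inv_cyl j).symm.trans (congrArg (τ '' ·) (hθ j).symm)).trans (R'.inv_cyl (θ j)))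
  have hlen : ∀ j, (K.left j).length = (K'.left (θ j)).length := fun j =>
    R.length_left_eq R' (hθ j).symm
  rw [Configuration.lengths, Configuration.lengths,
    ← Finset.map_univ_equiv (Equiv.ofBijective θ hbij), Finset.map_val, Multiset.map_map]
  refine Multiset.map_congr rfl fun j _ => ?_
  simp only [Function.comp, Equiv.coe_toEmbedding, Equiv.ofBijective_apply]
  rw [← hinv, ← hlen, ← hlen]
  simp only [hbij.1.eq_iff]

theorem InLocusL.main [CompactSpace X] [ConnectedSpace X] (h : S.InLocusL τ)
    (hV : S.IsVerticallyCompletelyPeriodic) :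
    S.verticalCylinders.encard ≤ 4 ∧
      (S.verticalCylinders.Nontrivial → ∃! T : ConfigType, S.HasConfiguration τ T.config) ∧
      (∀ T : ConfigType, S.HasConfiguration τ T.config →
        S.verticalCylinders.encard = T.config.numCyl) := by
  have hcard : ∀ T : ConfigType, S.HasConfiguration τ T.config →
      S.verticalCylinders.encard = T.config.numCyl := fun T ⟨R⟩ => R.encard_verticalCylinders
  refine ⟨?_, fun hnt => ?_, hcard⟩
  · by_cases hnt : S.verticalCylinders.Nontrivial
    · obtain ⟨T, hT⟩ := h.exists_hasConfiguration hV hnt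
      rw [hcard T hT]
      have : T.config.numCyl ≤ 4 := by cases T <;> decide +kernel
      exact_mod_cast this
    · rw [Set.not_nontrivial_iff] at hnt
      exact (Set.encard_le_one_iff_subsingleton.2 hnt).trans (by norm_num)
  · obtain ⟨T, hT⟩ := h.exists_hasConfiguration hV hnt
    obtain ⟨R⟩ := hT
    exact ⟨T, ⟨R⟩, fun T' ⟨R'⟩ => ConfigType.eq_of_lengths (R'.lengths_eq R)⟩

end TranslationSurface

/-! ### Square-tiled surfaces: quarters, corners and their local coordinates -/

/-- A square-tiled surface: `n` squares with gluing permutations `right` and `up`; `vert i` names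
the vertex at the lower left corner of the square `i`. The vertices `0` and `1` have cone angle
`6π`, and `branch` numbers the squares around them; all others have cone angle `2π`. -/
structure Origami (n : ℕ) where
  right : Equiv.Perm (Fin n)
  up : Equiv.Perm (Fin n)
  vert : Fin n → ℕ
  branch : Fin n → ZMod 3
  vert_comm : ∀ i, vert (up (right i)) = vert (right (up i))
  branch_comm : ∀ i, vert (right (up i)) < 2 →
    branch (up (right i)) = branch (right (up i)) + 1
  inj : ∀ i j, vert i = vert j → (vert i < 2 → branch i = branch j) → i = j

namespace Origami

variable {n : ℕ} (O : Origami n)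

/-- A quarter of a square; the flags tell whether it is in the right, resp. upper half. -/
abbrev Quarter (n : ℕ) := Fin n × Bool × Bool

/-- A quarter together with a point of the unit square, onto which it is folded. -/
abbrev Cell (n : ℕ) := Quarter n × (unitInterval × unitInterval)

def wall (b : Bool) : unitInterval := if b then 1 else 0

def sgn (b : Bool) : ℝ := if b then -1 else 1

def flipX : Bool → Quarter n → Quarter n
  | true, (i, bx, bY) => (i, !bx, bY)
  | false, (i, false, bY) => (O.right.symm i, true, bY)
  | false, (i, true, bY) => (O.right i, false, bY)

def flipY : Bool → Quarter n → Quarter n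
  | true, (i, bx, bY) => (i, bx, !bY)
  | false, (i, bx, false) => (O.up.symm i, bx, true)
  | false, (i, bx, true) => (O.up i, bx, false)

/-- The gluing of the quarters along the walls of the unit square. -/
inductive Step : Cell n → Cell n → Prop
  | x (a : Bool) (q : Quarter n) (y : unitInterval) :
      Step (q, (wall a, y)) (O.flipX a q, (wall a, y))
  | y (b : Bool) (q : Quarter n) (x : unitInterval) :
      Step (q, (x, wall b)) (O.flipY b q, (x, wall b))

/-- The square-tiled surface. -/
def Surface : Type := Quot O.Step

instance : TopologicalSpace O.Surface := inferInstanceAs (TopologicalSpace (Quot O.Step))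

instance : CompactSpace O.Surface := inferInstanceAs (CompactSpace (Quot O.Step))

def point (c : Cell n) : O.Surface := Quot.mk _ c

theorem isQuotientMap_point : IsQuotientMap O.point := isQuotientMap_quot_mk

theorem exists_rep (p : O.Surface) : ∃ c, O.point c = p := Quot.exists_rep p

theorem point_flipX (a : Bool) (q : Quarter n) (y : unitInterval) :
    O.point (O.flipX a q, (wall a, y)) = O.point (q, (wall a, y)) := (Quot.sound (Step.x a q y)).symm

theorem point_flipY (b : Bool) (q : Quarter n) (x : unitInterval) :
    O.point (O.flipY b q, (x, wall b)) = O.point (q, (x, wall b)) := (Quot.sound (Step.y b q x)).symm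

/-- The square to the upper right of the corner `(a, b)` of a quarter. -/
def base (a b : Bool) (q : Quarter n) : Fin n :=
  (if q.2.1 && !a then O.right else 1) ((if q.2.2 && !b then O.up else 1) q.1)

/-- The name of the corner `(a, b)` of a quarter. -/
def node (a b : Bool) (q : Quarter n) : Fin n ⊕ ℕ :=
  if a || b then Sum.inl (O.base a b q) else Sum.inr (O.vert (O.base a b q))

def IsSing : Fin n ⊕ ℕ → Prop
  | Sum.inl _ => False
  | Sum.inr k => k < 2

instance : DecidablePred (IsSing (n := n)) := fun s => by
  cases s
  · exact inferInstanceAs (Decidable False)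
  · exact inferInstanceAs (Decidable (_ < _))

theorem isSing_node {a b : Bool} {q : Quarter n} : IsSing (O.node a b q) ↔
    a = false ∧ b = false ∧ O.vert (O.base false false q) < 2 := by
  cases a <;> cases b <;> simp [node, IsSing]

/-- The sector in which a quarter lies at a singularity. -/
def kappa (q : Quarter n) : ZMod 3 :=
  O.branch (O.base false false q) - if q.2.1 then 1 else 0

theorem flipX_bits (a : Bool) (q : Quarter n) : (O.flipX a q).2 = (!q.2.1, q.2.2) := by
  rcases q with ⟨i, bx, bY⟩
  cases a <;> cases bx <;> rfl

theorem flipY_bits (b : Bool) (q : Quarter n) : (O.flipY b q).2 = (q.2.1, !q.2.2) := by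
  rcases q with ⟨i, bx, bY⟩
  cases b <;> cases bY <;> rfl

theorem node_flipX (a b : Bool) (q : Quarter n) : O.node a b (O.flipX a q) = O.node a b q := by
  rcases q with ⟨i, bx, bY⟩
  have h1 := O.vert_comm (O.right.symm i)
  have h2 := O.vert_comm i
  rw [O.right.apply_symm_apply] at h1
  cases a <;> cases b <;> cases bx <;> cases bY <;> simp [node, base, flipX, h1, h2]

theorem node_flipY (a b : Bool) (q : Quarter n) : O.node a b (O.flipY b q) = O.node a b q := by
  rcases q with ⟨i, bx, bY⟩
  cases a <;> cases b <;> cases bx <;> cases bY <;> simp [node, base, flipY]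

theorem kappa_flipY (q : Quarter n) : O.kappa (O.flipY false q) = O.kappa q := by
  rcases q with ⟨i, bx, bY⟩
  cases bx <;> cases bY <;> simp [kappa, base, flipY]

/-- Crossing the vertical line through a singular vertex moves to the adjacent half plane. The sign
tells whether the crossing is above or below the vertex and in which direction; on one of the two
sides `branch_comm` is what is used. -/
theorem kappa_flipX {q : Quarter n} (h : O.vert (O.base false false q) < 2) :
    O.kappa (O.flipX false q) = O.kappa q + if q.2.1 = q.2.2 then -1 else 1 := by
  rcases q with ⟨i, bx, bY⟩
  have h1 := O.branch_comm (O.right.symm i)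
  have h2 := O.branch_comm i
  have h3 := O.vert_comm (O.right.symm i)
  rw [O.right.apply_symm_apply] at h1 h3
  have e1 : ∀ k : ZMod 3, k - 1 = k + 1 + 1 := by decide
  have e2 : ∀ k : ZMod 3, k + 1 = k - 1 + -1 := by decide
  cases bx <;> cases bY <;>
    simp only [kappa, base, flipX, Bool.and_true, Bool.not_false, Bool.false_eq_true,
      if_true, if_false, Equiv.Perm.one_apply, Equiv.apply_symm_apply, sub_zero, reduceCtorEq, Bool.and_self] at h ⊢
  · ring
  · rw [h1 (by rw [← h3]; exact h)]; exact e1 _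
  · ring
  · rw [h2 h]; exact e2 _

/-- The star of the corner `(a, b)`, in the unit square. -/
def Region (a b : Bool) (z : unitInterval × unitInterval) : Prop :=
  z.1 ≠ wall (!a) ∧ z.2 ≠ wall (!b)

theorem wall_ne {a a' : Bool} (h : wall a' ≠ wall (!a)) : a' = a := by
  cases a <;> cases a' <;> simp_all [wall]

/-- The developed coordinate in the star of a corner. -/
def dev (a b : Bool) (c : Cell n) : ℂ :=
  ⟨sgn c.1.2.1 * (c.2.1 - wall a : ℝ), sgn c.1.2.2 * (c.2.2 - wall b : ℝ)⟩

theorem dev_flipX (a b : Bool) (q : Quarter n) (y : unitInterval) :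
    dev a b (O.flipX a q, (wall a, y)) = dev a b (q, (wall a, y)) := by
  simp [dev, flipX_bits]

theorem dev_flipY (a b : Bool) (q : Quarter n) (x : unitInterval) :
    dev a b (O.flipY b q, (x, wall b)) = dev a b (q, (x, wall b)) := by
  simp [dev, flipY_bits]

open Classical in
/-- The coordinate in the star of a corner. -/
noncomputable def zeta (a b : Bool) (c : Cell n) : ℂ :=
  if IsSing (O.node a b c.1) then
    -- The sign carries the quarter into the closed right half plane, where the principal root is
    -- continuous, and the same sign in front undoes this, since a sign is its own cube.
    sgn c.1.2.1 * (cubeUnit (O.kappa c.1) * cubeRoot (sgn c.1.2.1 * dev a b c))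
  else dev a b c

theorem sgn_mul_self (b : Bool) : sgn b * sgn b = 1 := by cases b <;> simp [sgn]

theorem sgn_not (b : Bool) : sgn (!b) = -sgn b := by cases b <;> simp [sgn]

theorem zeta_pow {a b : Bool} {c : Cell n} (h : IsSing (O.node a b c.1)) :
    O.zeta a b c ^ 3 = dev a b c := by
  have h1 : ((sgn c.1.2.1 : ℝ) : ℂ) * sgn c.1.2.1 = 1 := by exact_mod_cast sgn_mul_self _
  rw [zeta, if_pos h, mul_pow, mul_pow, cubeUnit_pow, cubeRoot_pow]
  linear_combination (sgn c.1.2.1 * sgn c.1.2.1 + 1) * dev a b c * h1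

theorem zeta_of_not {a b : Bool} {c : Cell n} (h : ¬IsSing (O.node a b c.1)) :
    O.zeta a b c = dev a b c := if_neg h

theorem zeta_flipY (a b : Bool) (q : Quarter n) (x : unitInterval) :
    O.zeta a b (O.flipY b q, (x, wall b)) = O.zeta a b (q, (x, wall b)) := by
  by_cases h : IsSing (O.node a b q)
  · obtain ⟨rfl, rfl, h'⟩ := O.isSing_node.1 h
    rw [zeta, zeta, dev_flipY]
    simp only [node_flipY, flipY_bits, kappa_flipY]
  · rw [zeta_of_not (c := (q, _)) _ h, zeta_of_not _ (by rwa [node_flipY]), dev_flipY]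

/-- Matching of the root on a right half plane with the root on the neighbouring left one along
their common vertical ray. -/
theorem cubeRoot_glue (k : ZMod 3) {s : ℝ} (hs : 0 ≤ s) :
    cubeUnit (k + 1) * cubeRoot (s * Complex.I) = -(cubeUnit k * cubeRoot (-(s * Complex.I))) := by
  rcases hs.eq_or_lt with rfl | hs
  · simp [cubeRoot_zero]
  · rw [cubeRoot_neg_I hs, cubeUnit_add_one]; ring

theorem zeta_flipX (a b : Bool) (q : Quarter n) (y : unitInterval) :
    O.zeta a b (O.flipX a q, (wall a, y)) = O.zeta a b (q, (wall a, y)) := by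
  by_cases h : IsSing (O.node a b q)
  · obtain ⟨rfl, rfl, h'⟩ := O.isSing_node.1 h
    have hd : dev false false (q, (wall false, y)) = ((sgn q.2.2 * (y : ℝ) : ℝ) : ℂ) * Complex.I :=
      Complex.ext (by simp [dev]) (by simp [dev, wall])
    rw [zeta, zeta, dev_flipX, hd]
    simp only [node_flipX, flipX_bits, O.kappa_flipX h', if_pos h]
    have hy : (0 : ℝ) ≤ y := y.2.1
    have e1 := cubeRoot_glue (O.kappa q - 1) hy
    have e2 := cubeRoot_glue (O.kappa q) hy
    rw [sub_add_cancel] at e1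
    rcases q with ⟨i, _ | _, _ | _⟩
    all_goals
      simp only [sgn, if_true, if_false, Bool.not_true, Bool.not_false, Bool.false_eq_true,
        reduceCtorEq, ← sub_eq_add_neg] at e1 e2 ⊢
      push_cast
      simp only [one_mul, neg_mul, neg_neg]
      simp only [e1, e2, neg_neg]
  · rw [zeta_of_not (c := (q, _)) _ h, zeta_of_not _ (by rwa [node_flipX]), dev_flipX]

open Classical in
/-- The corner `(a, b)` in the star of which a point lies. -/
noncomputable def starNode (a b : Bool) : O.Surface → Option (Fin n ⊕ ℕ) :=
  Quot.lift (fun c => if Region a b c.2 then some (O.node a b c.1) else none) (by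
    rintro _ _ (⟨a', q, y⟩ | ⟨b', q, x⟩)
    · by_cases h : Region a b (wall a', y)
      · obtain rfl := wall_ne h.1
        simp only [node_flipX]
      · simp only [h, if_false]
    · by_cases h : Region a b (x, wall b')
      · obtain rfl := wall_ne h.2
        simp only [node_flipY]
      · simp only [h, if_false])

open Classical in
/-- The coordinate on the star of the corner `(a, b)`. -/
noncomputable def starCoord (a b : Bool) : O.Surface → ℂ :=
  Quot.lift (fun c => if Region a b c.2 then O.zeta a b c else 0) (by
    rintro _ _ (⟨a', q, y⟩ | ⟨b', q, x⟩)
    · by_cases h : Region a b (wall a', y)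
      · obtain rfl := wall_ne h.1
        simp only [zeta_flipX]
      · simp only [h, if_false]
    · by_cases h : Region a b (x, wall b')
      · obtain rfl := wall_ne h.2
        simp only [zeta_flipY]
      · simp only [h, if_false])

theorem starNode_point {a b : Bool} {c : Cell n} {ν : Fin n ⊕ ℕ} :
    O.starNode a b (O.point c) = some ν ↔ Region a b c.2 ∧ O.node a b c.1 = ν := by
  classical
  show (if Region a b c.2 then some (O.node a b c.1) else none) = some ν ↔ _
  by_cases h : Region a b c.2 <;> simp [h]

theorem starCoord_point {a b : Bool} {c : Cell n} (h : Region a b c.2) :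
    O.starCoord a b (O.point c) = O.zeta a b c := if_pos h

end Origami

/-! ### The star coordinates are open embeddings -/

/-- The part of `K` outside an open neighbourhood of `x` is compact, and by injectivity its closed
image misses `f x`; removing it from the neighbourhood `f '' K` leaves a neighbourhood. -/
theorem ContinuousOn.image_mem_nhds_of_isCompact {X Y : Type*} [TopologicalSpace X]
    [TopologicalSpace Y] [T2Space Y] {f : X → Y} {K : Set X} (hf : ContinuousOn f K)
    (hK : IsCompact K) (hinj : Set.InjOn f K) {x : X} (hx : x ∈ K) (hxK : f '' K ∈ 𝓝 (f x))
    {U : Set X} (hU : U ∈ 𝓝 x) : f '' (U ∩ K) ∈ 𝓝 (f x) := by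
  obtain ⟨V, hVU, hV, hxV⟩ := mem_nhds_iff.1 hU
  have h1 : IsCompact (f '' (K \ V)) :=
    (hK.diff hV).image_of_continuousOn (hf.mono Set.sdiff_subset)
  have h2 : f x ∉ f '' (K \ V) := by
    rintro ⟨y, ⟨hy, hyV⟩, hxy⟩
    exact hyV (hinj hy hx hxy ▸ hxV)
  filter_upwards [hxK, h1.isClosed.isOpen_compl.mem_nhds h2]
  rintro _ ⟨y, hy, rfl⟩ hy'
  by_cases h : y ∈ V
  · exact ⟨y, ⟨hVU h, hy⟩, rfl⟩
  · exact absurd ⟨y, ⟨hy, h⟩, rfl⟩ hy'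

namespace Origami

variable {n : ℕ} (O : Origami n)

/-- A full turn around a singularity. -/
def turn (q : Quarter n) : Quarter n :=
  O.flipY false (O.flipX false (O.flipY false (O.flipX false q)))

theorem turn_bits (q : Quarter n) : (O.turn q).2 = q.2 := by
  simp [turn, flipX_bits, flipY_bits]

theorem node_turn (q : Quarter n) : O.node false false (O.turn q) = O.node false false q := by
  simp [turn, node_flipX, node_flipY]

theorem point_turn (q : Quarter n) :
    O.point (O.turn q, (wall false, wall false)) = O.point (q, (wall false, wall false)) := by
  simp [turn, point_flipX, point_flipY]

theorem kappa_turn {q : Quarter n} (h : IsSing (O.node false false q)) :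
    O.kappa (O.turn q) = O.kappa q + if q.2.1 = q.2.2 then 1 else -1 := by
  have h1 := (O.isSing_node.1 h).2.2
  have h2 : O.vert (O.base false false (O.flipY false (O.flipX false q))) < 2 :=
    (O.isSing_node.1 (by rw [node_flipY, node_flipX]; exact h)).2.2
  rw [turn, kappa_flipY, O.kappa_flipX h2, kappa_flipY, O.kappa_flipX h1]
  have e1 : ∀ k : ZMod 3, k + -1 + -1 = k + 1 := by decide
  have e2 : ∀ k : ZMod 3, k + 1 + 1 = k + -1 := by decide
  have e3 : ((!q.2.1) = !q.2.2) ↔ q.2.1 = q.2.2 := by cases q.2.1 <;> cases q.2.2 <;> simp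
  simp only [flipX_bits, flipY_bits, e3]
  split_ifs
  · exact e1 _
  · exact e2 _

/-- Each full turn changes the sector by the same sign modulo 3, so at most two turns reach any
sector. -/
theorem exists_turn {q : Quarter n} (h : IsSing (O.node false false q)) (k : ZMod 3) :
    ∃ q' : Quarter n, q'.2 = q.2 ∧ O.node false false q' = O.node false false q ∧ O.kappa q' = k ∧
      O.point (q', (wall false, wall false)) = O.point (q, (wall false, wall false)) := by
  have h1 := O.kappa_turn h
  have h2 := O.kappa_turn (q := O.turn q) (by rwa [node_turn])
  rw [turn_bits, h1] at h2
  have e : ∀ c k : ZMod 3, ∀ P : Prop, (P ∨ ¬P) → [Decidable P] → k = c ∨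
      k = c + (if P then 1 else -1) ∨
      k = c + (if P then 1 else -1) + (if P then 1 else -1) := by
    intro c k P _ _
    split_ifs
    · revert c k; decide
    · revert c k; decide
  rcases e (O.kappa q) k (q.2.1 = q.2.2) (em _) with hk | hk | hk
  · exact ⟨q, rfl, rfl, hk.symm, rfl⟩
  · exact ⟨O.turn q, O.turn_bits q, O.node_turn q, h1.trans hk.symm, O.point_turn q⟩
  · exact ⟨O.turn (O.turn q), by rw [turn_bits, turn_bits], by rw [node_turn, node_turn],
      h2.trans hk.symm, by rw [point_turn, point_turn]⟩

theorem exists_bits (a b : Bool) (q : Quarter n) (bb : Bool × Bool) :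
    ∃ q' : Quarter n, q'.2 = bb ∧ O.node a b q' = O.node a b q := by
  have hx : ∀ q : Quarter n, ∃ q' : Quarter n, q'.2 = (bb.1, q.2.2) ∧
      O.node a b q' = O.node a b q := fun q => by
    by_cases h : q.2.1 = bb.1
    · exact ⟨q, by rw [← h], rfl⟩
    · refine ⟨O.flipX a q, ?_, O.node_flipX a b q⟩
      rw [flipX_bits, ← Bool.eq_not.2 (Ne.symm h)]
  obtain ⟨q₁, h1, h2⟩ := hx q
  by_cases h : q₁.2.2 = bb.2
  · exact ⟨q₁, by rw [Prod.ext_iff, h, h1]; simp, h2⟩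
  · refine ⟨O.flipY b q₁, ?_, (O.node_flipY a b q₁).trans h2⟩
    rw [flipY_bits, ← Bool.eq_not.2 (Ne.symm h), h1]

theorem quarter_ext {a b : Bool} {q q' : Quarter n} (h : q.2 = q'.2)
    (hn : O.node a b q = O.node a b q')
    (hk : IsSing (O.node a b q) → O.kappa q = O.kappa q') : q = q' := by
  obtain ⟨i, bx, bY⟩ := q
  obtain ⟨i', bx', bY'⟩ := q'
  obtain ⟨rfl, rfl⟩ := Prod.mk.inj h
  have key : O.base a b (i, bx, bY) = O.base a b (i', bx, bY) := by
    by_cases hab : (a || b) = true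
    · simpa only [node, hab, if_true, Sum.inl.injEq] using hn
    · have hn' := hn
      simp only [node, hab, if_false, Sum.inr.injEq, Bool.false_eq_true] at hn'
      refine O.inj _ _ hn' fun hlt => ?_
      simp only [Bool.or_eq_true, not_or, Bool.not_eq_true] at hab
      obtain ⟨rfl, rfl⟩ := hab
      have := hk (O.isSing_node.2 ⟨rfl, rfl, hlt⟩)
      simpa [kappa] using this
  simp only [base] at key
  rw [Equiv.injective _ (Equiv.injective _ key)]

theorem coord_eq {a b b' : Bool} {x x' : unitInterval}
    (h : sgn b * ((x : ℝ) - wall a) = sgn b' * (x' - wall a)) :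
    x = x' ∧ (b = b' ∨ x = wall a) := by
  have h1 := x.2.1
  have h2 := x.2.2
  have h3 := x'.2.1
  have h4 := x'.2.2
  suffices h : (x : ℝ) = x' ∧ (b = b' ∨ (x : ℝ) = wall a) from
    ⟨Subtype.ext h.1, h.2.imp_right Subtype.ext⟩
  cases a <;> cases b <;> cases b' <;> simp [sgn, wall] at h ⊢ <;> first
    | exact h
    | linarith
    | exact ⟨by linarith, Subtype.ext (by simp only [Set.Icc.coe_zero, Set.Icc.coe_one]; linarith)⟩

theorem dev_eq_of_zeta {a b : Bool} {c c' : Cell n}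
    (hn : O.node a b c.1 = O.node a b c'.1) (h : O.zeta a b c = O.zeta a b c') :
    dev a b c = dev a b c' := by
  by_cases hs : IsSing (O.node a b c.1)
  · rw [← O.zeta_pow hs, h, O.zeta_pow (hn ▸ hs)]
  · rwa [O.zeta_of_not hs, O.zeta_of_not (hn ▸ hs)] at h

/-- The coordinate determines the folded position and, off the walls, the half squares. On a wall
the quarter may be replaced by its neighbour across it. At a singular vertex the remaining ambiguity
is the sector, which is detected by the cube root, or at the vertex itself removed by full turns. -/
theorem point_eq {a b : Bool} {c c' : Cell n} (hn : O.node a b c.1 = O.node a b c'.1)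
    (h : O.zeta a b c = O.zeta a b c') : O.point c = O.point c' := by
  obtain ⟨q, x, y⟩ := c
  obtain ⟨q', x', y'⟩ := c'
  have hd := O.dev_eq_of_zeta hn h
  obtain ⟨rfl, hbx⟩ := coord_eq (congrArg Complex.re hd)
  obtain ⟨rfl, hbY⟩ := coord_eq (congrArg Complex.im hd)
  simp only at hbx hbY hn
  obtain ⟨q₁, h1, h2, h3, h4⟩ : ∃ q₁ : Quarter n, q₁.2 = (q.2.1, q'.2.2) ∧
      O.node a b q₁ = O.node a b q' ∧ O.zeta a b (q₁, (x, y)) = O.zeta a b (q', (x, y)) ∧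
      O.point (q₁, (x, y)) = O.point (q', (x, y)) := by
    by_cases hb : q.2.1 = q'.2.1
    · exact ⟨q', by rw [hb], rfl, rfl, rfl⟩
    · obtain rfl := hbx.resolve_left hb
      exact ⟨O.flipX a q', by rw [flipX_bits, Bool.eq_not.2 hb], O.node_flipX a b q',
        O.zeta_flipX a b q' y, O.point_flipX a q' y⟩
  obtain ⟨q₂, k1, k2, k3, k4⟩ : ∃ q₂ : Quarter n, q₂.2 = q.2 ∧
      O.node a b q₂ = O.node a b q₁ ∧ O.zeta a b (q₂, (x, y)) = O.zeta a b (q₁, (x, y)) ∧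
      O.point (q₂, (x, y)) = O.point (q₁, (x, y)) := by
    by_cases hb : q.2.2 = q'.2.2
    · exact ⟨q₁, by rw [h1, ← hb], rfl, rfl, rfl⟩
    · obtain rfl := hbY.resolve_left hb
      exact ⟨O.flipY b q₁, by rw [flipY_bits, h1, ← Bool.eq_not.2 hb], O.node_flipY a b q₁,
        O.zeta_flipY a b q₁ x, O.point_flipY b q₁ x⟩
  have hn2 : O.node a b q = O.node a b q₂ := by rw [k2, h2, hn]
  have hz2 : O.zeta a b (q, (x, y)) = O.zeta a b (q₂, (x, y)) := by rw [k3, h3, h]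
  rw [← h4, ← k4]
  by_cases hs : IsSing (O.node a b q)
  swap
  · rw [O.quarter_ext k1.symm hn2 fun h => absurd h hs]
  obtain ⟨rfl, rfl, -⟩ := O.isSing_node.1 hs
  by_cases hd0 : dev false false (q, (x, y)) = 0
  · have hx : x = wall false := by
      have := congrArg Complex.re hd0
      simp only [dev, Complex.zero_re] at this
      exact Subtype.ext (sub_eq_zero.1 ((mul_eq_zero.1 this).resolve_left
        (by cases q.2.1 <;> simp [sgn])))
    have hy : y = wall false := by
      have := congrArg Complex.im hd0
      simp only [dev, Complex.zero_im] at this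
      exact Subtype.ext (sub_eq_zero.1 ((mul_eq_zero.1 this).resolve_left
        (by cases q.2.2 <;> simp [sgn])))
    subst hx hy
    obtain ⟨q₃, l1, l2, l3, l4⟩ := O.exists_turn (hn2 ▸ hs) (O.kappa q)
    rw [← l4, O.quarter_ext (l1.trans k1).symm (hn2.trans l2.symm) fun _ => l3.symm]
  · have hs2 := hs
    rw [hn2] at hs2
    have hdd : dev false false (q₂, (x, y)) = dev false false (q, (x, y)) := by
      simp only [dev, k1]
    have hne : ((sgn q.2.1 : ℝ) : ℂ) ≠ 0 := by cases q.2.1 <;> simp [sgn]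
    rw [zeta, zeta, if_pos hs, if_pos hs2] at hz2
    simp only [hdd, k1] at hz2
    have h5 := mul_left_cancel₀ hne hz2
    have h6 : cubeRoot (sgn q.2.1 * dev false false (q, (x, y))) ≠ 0 := by
      intro h0
      have := cubeRoot_pow (sgn q.2.1 * dev false false (q, (x, y)))
      rw [h0] at this
      exact mul_ne_zero hne hd0 (by rw [← this]; norm_num)
    rw [O.quarter_ext k1.symm hn2 fun _ => cubeUnit_injective (mul_right_cancel₀ h6 h5)]

/-- The star of a corner. -/
def star (a b : Bool) (ν : Fin n ⊕ ℕ) : Set O.Surface := {p | O.starNode a b p = some ν}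

theorem mem_star {a b : Bool} {ν : Fin n ⊕ ℕ} {c : Cell n} :
    O.point c ∈ O.star a b ν ↔ Region a b c.2 ∧ O.node a b c.1 = ν := O.starNode_point

theorem injOn_starCoord (a b : Bool) (ν : Fin n ⊕ ℕ) :
    Set.InjOn (O.starCoord a b) (O.star a b ν) := by
  intro p hp p' hp' h
  obtain ⟨c, rfl⟩ := O.exists_rep p
  obtain ⟨c', rfl⟩ := O.exists_rep p'
  rw [mem_star] at hp hp'
  rw [O.starCoord_point hp.1, O.starCoord_point hp'.1] at h
  exact O.point_eq (hp.2.trans hp'.2.symm) h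

theorem isOpen_region (a b : Bool) : IsOpen {z | Region a b z} :=
  (isOpen_ne_fun continuous_fst continuous_const).inter
    (isOpen_ne_fun continuous_snd continuous_const)

theorem isOpen_star (a b : Bool) (ν : Fin n ⊕ ℕ) : IsOpen (O.star a b ν) := by
  rw [← O.isQuotientMap_point.isOpen_preimage]
  have : O.point ⁻¹' O.star a b ν = {q | O.node a b q = ν} ×ˢ {z | Region a b z} := by
    ext c
    rw [Set.mem_preimage, mem_star, and_comm]; rfl
  rw [this]
  exact (isOpen_discrete _).prod (isOpen_region a b)

theorem continuous_dev (a b : Bool) : Continuous (dev (n := n) a b) := by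
  have h : dev (n := n) a b = fun c => ((sgn c.1.2.1 * (c.2.1 - wall a) : ℝ) : ℂ) +
      ((sgn c.1.2.2 * (c.2.2 - wall b) : ℝ) : ℂ) * Complex.I := by
    funext c; exact Complex.ext (by simp [dev]) (by simp [dev])
  have hs : Continuous sgn := continuous_of_discreteTopology
  rw [h]
  fun_prop

theorem continuousAt_cubeRoot_of_nonneg {z : ℂ} (hz : 0 ≤ z.re) : ContinuousAt cubeRoot z := by
  by_cases h : z = 0
  · rw [h]; exact continuousAt_cubeRoot_zero
  · exact continuousAt_cubeRoot (TranslationSurface.mem_slitPlane_of_re_nonneg hz h)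

theorem continuous_zeta (a b : Bool) : Continuous (O.zeta a b) := by
  rw [continuous_iff_continuousAt]
  intro c
  have hloc : ∀ᶠ c' in 𝓝 c, c'.1 = c.1 := by
    have h1 : Continuous fun c' : Cell n => c'.1 := continuous_fst
    exact h1.continuousAt.eventually (isOpen_discrete {c.1} |>.mem_nhds rfl)
  by_cases hs : IsSing (O.node a b c.1)
  · have h1 : ContinuousAt (fun c' => (sgn c.1.2.1 : ℂ) *
        (cubeUnit (O.kappa c.1) * cubeRoot (sgn c.1.2.1 * dev a b c'))) c := by
      refine continuousAt_const.mul (continuousAt_const.mul ?_)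
      refine ContinuousAt.comp (g := cubeRoot) (f := fun c' => (sgn c.1.2.1 : ℂ) * dev a b c')
        (continuousAt_cubeRoot_of_nonneg ?_)
        (continuousAt_const.mul (continuous_dev a b).continuousAt)
      obtain ⟨rfl, rfl, -⟩ := O.isSing_node.1 hs
      rw [Complex.re_ofReal_mul]
      simp only [dev]
      rw [← mul_assoc, sgn_mul_self, one_mul]
      simpa [wall] using c.2.1.2.1
    refine h1.congr ?_
    filter_upwards [hloc] with c' hc'
    rw [zeta, hc', if_pos hs]
  · refine (continuous_dev a b).continuousAt.congr ?_
    filter_upwards [hloc] with c' hc'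
    rw [O.zeta_of_not (by rwa [hc'])]

theorem continuousOn_starCoord (a b : Bool) (ν : Fin n ⊕ ℕ) :
    ContinuousOn (O.starCoord a b) (O.star a b ν) := by
  rw [O.isQuotientMap_point.continuousOn_isOpen_iff (O.isOpen_star a b ν)]
  refine (O.continuous_zeta a b).continuousOn.congr fun c hc => ?_
  exact O.starCoord_point (O.mem_star.1 hc).1

/-- A compact part of the star of a corner. -/
def closedStar (a b : Bool) (ν : Fin n ⊕ ℕ) (r : ℝ) : Set O.Surface :=
  O.point '' {c | O.node a b c.1 = ν ∧ |(c.2.1 - wall a : ℝ)| ≤ r ∧ |(c.2.2 - wall b : ℝ)| ≤ r}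

theorem isCompact_closedStar (a b : Bool) (ν : Fin n ⊕ ℕ) (r : ℝ) :
    IsCompact (O.closedStar a b ν r) := by
  refine IsCompact.image ?_ O.isQuotientMap_point.continuous
  have h1 : IsClosed {c : Cell n | O.node a b c.1 = ν} :=
    (isClosed_discrete {q | O.node a b q = ν}).preimage continuous_fst
  have h2 : IsClosed {c : Cell n | |(c.2.1 - wall a : ℝ)| ≤ r} :=
    isClosed_le (by fun_prop) continuous_const
  have h3 : IsClosed {c : Cell n | |(c.2.2 - wall b : ℝ)| ≤ r} :=
    isClosed_le (by fun_prop) continuous_const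
  exact (h1.inter (h2.inter h3)).isCompact

theorem ne_wall {a : Bool} {x : unitInterval} : x ≠ wall (!a) ↔ |(x - wall a : ℝ)| < 1 := by
  have h1 := x.2.1
  have h2 := x.2.2
  rw [abs_lt, Ne, Subtype.ext_iff]
  cases a <;> simp [wall]
  · constructor
    · intro h; exact ⟨by linarith, lt_of_le_of_ne h2 h⟩
    · rintro ⟨-, h⟩; exact h.ne
  · constructor
    · intro h; exact ⟨lt_of_le_of_ne h1 (Ne.symm h), by linarith⟩
    · rintro ⟨h, -⟩; exact h.ne'

theorem closedStar_subset {a b : Bool} {ν : Fin n ⊕ ℕ} {r : ℝ} (hr : r < 1) :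
    O.closedStar a b ν r ⊆ O.star a b ν := by
  rintro _ ⟨c, ⟨h1, h2, h3⟩, rfl⟩
  exact O.mem_star.2 ⟨⟨ne_wall.2 (h2.trans_lt hr), ne_wall.2 (h3.trans_lt hr)⟩, h1⟩

theorem exists_coord {a : Bool} {s : ℝ} (hs : |s| ≤ 1) :
    ∃ (b : Bool) (x : unitInterval), sgn b * ((x : ℝ) - wall a) = s ∧
      |((x : ℝ) - wall a)| = |s| ∧ (a = false → 0 ≤ sgn b * s) := by
  rw [abs_le] at hs
  rcases le_total 0 s with h | h <;> cases a
  · exact ⟨false, ⟨s, h, hs.2⟩, by simp [sgn, wall], by simp [wall], fun _ => by simpa [sgn]⟩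
  · exact ⟨true, ⟨1 - s, by linarith, by linarith⟩, by simp [sgn, wall],
      by simp [wall], by simp⟩
  · exact ⟨true, ⟨-s, by linarith, by linarith⟩, by simp [sgn, wall], by simp [wall],
      fun _ => by simpa [sgn]⟩
  · exact ⟨false, ⟨1 + s, by linarith, by linarith⟩, by simp [sgn, wall], by simp [wall], by simp⟩

/-- The signs of the developed coordinate select the quarter; at a singularity the sector is then
selected by turning, so that the prescribed cube root comes out. -/
theorem mem_image_closedStar {a b : Bool} {q : Quarter n} {r : ℝ} (hr : r < 1) {ζ w : ℂ}
    (hw : IsSing (O.node a b q) → ζ ^ 3 = w) (hw' : ¬IsSing (O.node a b q) → ζ = w)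
    (h1 : |w.re| ≤ r) (h2 : |w.im| ≤ r) :
    ζ ∈ O.starCoord a b '' O.closedStar a b (O.node a b q) r := by
  obtain ⟨bx, x, hx, hx', hx0⟩ := exists_coord (a := a) (h1.trans hr.le)
  obtain ⟨bY, y, hy, hy', -⟩ := exists_coord (a := b) (h2.trans hr.le)
  obtain ⟨q₁, e1, e2⟩ := O.exists_bits a b q (bx, bY)
  have hdev : ∀ q₂ : Quarter n, q₂.2 = (bx, bY) → dev a b (q₂, (x, y)) = w := fun q₂ h =>
    Complex.ext (by simp [dev, h, hx]) (by simp [dev, h, hy])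
  by_cases hs : IsSing (O.node a b q)
  · obtain ⟨rfl, rfl, -⟩ := O.isSing_node.1 hs
    have hss : ((sgn bx : ℝ) : ℂ) * sgn bx = 1 := by exact_mod_cast sgn_mul_self bx
    have h3 : ((sgn bx : ℝ) * ζ) ^ 3 = cubeRoot (sgn bx * w) ^ 3 := by
      rw [cubeRoot_pow, mul_pow, hw hs]
      linear_combination (sgn bx : ℂ) * w * hss
    obtain ⟨k, hk⟩ := exists_cubeUnit_mul h3
    obtain ⟨q₂, l1, l2, l3, -⟩ := O.exists_turn (e2 ▸ hs) k
    refine ⟨O.point (q₂, (x, y)), ⟨_, ⟨l2.trans e2, hx'.trans_le h1, hy'.trans_le h2⟩, rfl⟩, ?_⟩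
    rw [O.starCoord_point ⟨ne_wall.2 ((hx'.trans_le h1).trans_lt hr),
      ne_wall.2 ((hy'.trans_le h2).trans_lt hr)⟩, zeta, if_pos (by rw [l2, e2]; exact hs),
      hdev q₂ (l1.trans e1)]
    simp only [l1, e1, l3]
    rw [← hk]
    linear_combination ζ * hss
  · refine ⟨O.point (q₁, (x, y)), ⟨_, ⟨e2, hx'.trans_le h1, hy'.trans_le h2⟩, rfl⟩, ?_⟩
    rw [O.starCoord_point ⟨ne_wall.2 ((hx'.trans_le h1).trans_lt hr),
      ne_wall.2 ((hy'.trans_le h2).trans_lt hr)⟩, O.zeta_of_not (by rw [e2]; exact hs),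
      hdev q₁ e1, hw' hs]

theorem image_starCoord_mem_nhds {a b : Bool} {ν : Fin n ⊕ ℕ} {p : O.Surface}
    (hp : p ∈ O.star a b ν) {U : Set O.Surface} (hU : U ∈ 𝓝 p) :
    O.starCoord a b '' (U ∩ O.star a b ν) ∈ 𝓝 (O.starCoord a b p) := by
  obtain ⟨⟨q, x, y⟩, rfl⟩ := O.exists_rep p
  obtain ⟨hreg, rfl⟩ := O.mem_star.1 hp
  obtain ⟨r, hr1, hr2⟩ := exists_between (max_lt (ne_wall.1 hreg.1) (ne_wall.1 hreg.2))
  rw [max_lt_iff] at hr1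
  have hK : O.point (q, x, y) ∈ O.closedStar a b (O.node a b q) r :=
    ⟨_, ⟨rfl, hr1.1.le, hr1.2.le⟩, rfl⟩
  have hsub := O.closedStar_subset (a := a) (b := b) (ν := O.node a b q) hr2
  have hsgn : ∀ b, |sgn b| = 1 := fun b => by cases b <;> simp [sgn]
  refine Filter.mem_of_superset (((O.continuousOn_starCoord a b _).mono
    hsub).image_mem_nhds_of_isCompact (O.isCompact_closedStar _ _ _ r)
    ((O.injOn_starCoord a b _).mono hsub) hK ?_ hU)
    (Set.image_mono (Set.inter_subset_inter_right _ hsub))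
  set F : ℂ → ℂ := fun ζ => if IsSing (O.node a b q) then ζ ^ 3 else ζ with hF
  have hFc : Continuous F := by
    by_cases h : IsSing (O.node a b q)
    · simp only [hF, h, if_true]; fun_prop
    · simp only [hF, h, if_false]; fun_prop
  have hF0 : F (O.starCoord a b (O.point (q, x, y))) = dev a b (q, (x, y)) := by
    rw [O.starCoord_point hreg, hF]
    by_cases h : IsSing (O.node a b q)
    · simp only [h, if_true]; exact O.zeta_pow h
    · simp only [h, if_false]; exact O.zeta_of_not h
  have hopen : IsOpen {ζ | |(F ζ).re| < r ∧ |(F ζ).im| < r} :=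
    (isOpen_lt (Complex.continuous_re.comp hFc).abs continuous_const).inter
      (isOpen_lt (Complex.continuous_im.comp hFc).abs continuous_const)
  refine Filter.mem_of_superset (hopen.mem_nhds ?_) fun ζ hζ => ?_
  · simp only [Set.mem_ofPred_eq, hF0, dev, abs_mul, hsgn, one_mul]
    exact hr1
  · exact O.mem_image_closedStar hr2 (w := F ζ) (fun h => by simp [hF, h])
      (fun h => by simp [hF, h]) hζ.1.le hζ.2.le

end Origami

/-! ### The translation structure of a square-tiled surface -/

namespace Origami

variable {n : ℕ} (O : Origami n) [NeZero n]

instance : Nonempty O.Surface := ⟨O.point ((0, false, false), (0, 0))⟩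

/-- The chart on the star of a corner. -/
noncomputable def starHomeo (a b : Bool) (ν : Fin n ⊕ ℕ) : OpenPartialHomeomorph O.Surface ℂ :=
  OpenPartialHomeomorph.ofContinuousOpenRestrict
    ((O.injOn_starCoord a b ν).toPartialEquiv _ _) (O.continuousOn_starCoord a b ν) (by
      rw [isOpenMap_iff_nhds_le]
      rintro ⟨p, hp⟩ s hs
      obtain ⟨U, hU, hUs⟩ := mem_nhds_subtype _ _ _ |>.1 (Filter.mem_map.1 hs)
      refine Filter.mem_of_superset (O.image_starCoord_mem_nhds hp hU) ?_
      rintro _ ⟨y, ⟨hyU, hy⟩, rfl⟩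
      exact hUs (show (⟨y, hy⟩ : O.star a b ν) ∈ Subtype.val ⁻¹' U from hyU)) (O.isOpen_star a b ν)

/-- The images of a point in the unit square. -/
def coordX : O.Surface → unitInterval :=
  Quot.lift (fun c => c.2.1) (by rintro _ _ (_ | _) <;> rfl)

def coordY : O.Surface → unitInterval :=
  Quot.lift (fun c => c.2.2) (by rintro _ _ (_ | _) <;> rfl)

theorem continuous_coordX : Continuous O.coordX := by
  rw [O.isQuotientMap_point.continuous_iff]
  exact continuous_fst.comp continuous_snd

theorem continuous_coordY : Continuous O.coordY := by
  rw [O.isQuotientMap_point.continuous_iff]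
  exact continuous_snd.comp continuous_snd

open Classical in
noncomputable def nonzero (x : unitInterval) : Bool := decide (x ≠ wall false)

theorem ne_wall_nonzero (x : unitInterval) : x ≠ wall (!nonzero x) := by
  by_cases h : x = wall false
  · simp only [nonzero, ne_eq, h, not_true_eq_false, decide_false, Bool.not_false]
    exact fun h' => by simp [wall] at h'
  · simp [nonzero, h]

theorem nonzero_eq_false {x : unitInterval} : nonzero x = false ↔ x = wall false := by
  simp [nonzero]

/-- The corner in the star of which the standard chart at a point is defined. -/
noncomputable def nodeAt (p : O.Surface) : Fin n ⊕ ℕ :=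
  (O.starNode (nonzero (O.coordX p)) (nonzero (O.coordY p)) p).getD (Sum.inr 2)

theorem nodeAt_point (c : Cell n) :
    O.nodeAt (O.point c) = O.node (nonzero c.2.1) (nonzero c.2.2) c.1 := by
  have h := (O.starNode_point (a := nonzero c.2.1) (b := nonzero c.2.2) (c := c)).2
    ⟨⟨ne_wall_nonzero _, ne_wall_nonzero _⟩, rfl⟩
  show (O.starNode (nonzero c.2.1) (nonzero c.2.2) (O.point c)).getD (Sum.inr 2) = _
  rw [h]; rfl

theorem mem_star_self (p : O.Surface) :
    p ∈ O.star (nonzero (O.coordX p)) (nonzero (O.coordY p)) (O.nodeAt p) := by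
  obtain ⟨c, rfl⟩ := O.exists_rep p
  exact O.mem_star.2 ⟨⟨ne_wall_nonzero _, ne_wall_nonzero _⟩, (O.nodeAt_point c).symm⟩

/-- Points with different folded coordinates are separated by these. With equal ones, both points
lie in stars of the same kind of corner; stars of different nodes are disjoint, and within one star
the injective coordinate separates. -/
instance : T2Space O.Surface := by
  refine ⟨fun p p' hne => ?_⟩
  by_cases hx : O.coordX p = O.coordX p'
  swap
  · exact separated_by_continuous O.continuous_coordX hx
  by_cases hy : O.coordY p = O.coordY p'
  swap
  · exact separated_by_continuous O.continuous_coordY hy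
  have h1 := O.mem_star_self p
  have h2 := O.mem_star_self p'
  rw [← hx, ← hy] at h2
  generalize nonzero (O.coordX p) = a at h1 h2
  generalize nonzero (O.coordY p) = b at h1 h2
  by_cases hν : O.nodeAt p = O.nodeAt p'
  · rw [← hν] at h2
    have h3 : O.starCoord a b p ≠ O.starCoord a b p' := fun h =>
      hne (O.injOn_starCoord a b _ h1 h2 h)
    obtain ⟨U, V, hU, hV, hpU, hpV, hUV⟩ := t2_separation h3
    refine ⟨_, _, (O.continuousOn_starCoord a b _).isOpen_inter_preimage (O.isOpen_star a b _) hU,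
      (O.continuousOn_starCoord a b _).isOpen_inter_preimage (O.isOpen_star a b _) hV, ⟨h1, hpU⟩,
      ⟨h2, hpV⟩, ?_⟩
    rw [Set.disjoint_left]
    exact fun y hy hy' => Set.disjoint_left.1 hUV hy.2 hy'.2
  · refine ⟨_, _, O.isOpen_star a b _, O.isOpen_star a b _, h1, h2, ?_⟩
    rw [Set.disjoint_left]
    exact fun y hy hy' => hν (Option.some.inj (hy.symm.trans hy'))

theorem connectedSpace (h : ∀ i, Relation.ReflTransGen
    (fun i j => j = O.right i ∨ j = O.up i) 0 i) : ConnectedSpace O.Surface := by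
  set R : Quarter n → Quarter n → Prop := fun q q' =>
    (∃ a, q' = O.flipX a q) ∨ ∃ b, q' = O.flipY b q with hR
  set s : Quarter n → Set O.Surface := fun q => O.point '' ({q} ×ˢ Set.univ) with hs
  have hpre : ∀ q, IsPreconnected (s q) := fun q =>
    (isPreconnected_singleton.prod isPreconnected_univ).image _
      O.isQuotientMap_point.continuous.continuousOn
  have hmem : ∀ q z, O.point (q, z) ∈ s q := fun q z => ⟨(q, z), by simp, rfl⟩
  have hinter : ∀ q q', R q q' → (s q ∩ s q').Nonempty := by
    rintro q _ (⟨a, rfl⟩ | ⟨b, rfl⟩)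
    · exact ⟨O.point (q, (wall a, 0)), hmem _ _, O.point_flipX a q 0 ▸ hmem _ _⟩
    · exact ⟨O.point (q, (0, wall b)), hmem _ _, O.point_flipY b q 0 ▸ hmem _ _⟩
  have hsq : ∀ (i : Fin n) (c c' : Bool × Bool), Relation.ReflTransGen R (i, c) (i, c') := by
    have hx : ∀ i bx bY, R (i, bx, bY) (i, !bx, bY) := fun i bx bY => Or.inl ⟨true, rfl⟩
    have hy : ∀ i bx bY, R (i, bx, bY) (i, bx, !bY) := fun i bx bY => Or.inr ⟨true, rfl⟩
    rintro i ⟨bx, bY⟩ ⟨bx', bY'⟩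
    have h1 : Relation.ReflTransGen R (i, bx, bY) (i, bx', bY) := by
      by_cases hb : bx = bx'
      · rw [hb]
      · rw [Bool.eq_not.2 (Ne.symm hb)]; exact .single (hx _ _ _)
    by_cases hb : bY = bY'
    · rwa [← hb]
    · rw [Bool.eq_not.2 (Ne.symm hb)]; exact h1.tail (hy _ _ _)
  have hall : ∀ i c, Relation.ReflTransGen R (0, false, false) (i, c) := by
    intro i
    induction h i with
    | refl => exact fun c => hsq _ _ _
    | tail _ hij ih =>
      rcases hij with rfl | rfl
      · exact fun c => ((ih (true, false)).tail (Or.inl ⟨false, rfl⟩)).trans (hsq _ _ c)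
      · exact fun c => ((ih (false, true)).tail (Or.inr ⟨false, rfl⟩)).trans (hsq _ _ c)
  have hT : ∀ q, Relation.ReflTransGen R (0, false, false) q →
      ∃ T, IsPreconnected T ∧ s (0, false, false) ⊆ T ∧ s q ⊆ T := by
    intro q hq
    induction hq with
    | refl => exact ⟨_, hpre _, le_rfl, le_rfl⟩
    | tail _ hqq ih =>
      obtain ⟨T, h1, h2, h3⟩ := ih
      exact ⟨_, h1.union' ((hinter _ _ hqq).mono (Set.inter_subset_inter_left _ h3)) (hpre _),
        h2.trans Set.subset_union_left, Set.subset_union_right⟩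
  have : PreconnectedSpace O.Surface := ⟨by
    refine isPreconnected_of_forall (O.point ((0, false, false), (0, 0))) fun p _ => ?_
    obtain ⟨⟨⟨i, c⟩, z⟩, rfl⟩ := O.exists_rep p
    obtain ⟨T, h1, h2, h3⟩ := hT (i, c) (hall i c)
    exact ⟨T, Set.subset_univ _, h2 (hmem _ _), h3 (hmem _ _), h1⟩⟩
  exact ⟨inferInstance⟩

open Classical in
/-- The developed coordinate on the star of a corner. -/
noncomputable def starDev (a b : Bool) : O.Surface → ℂ :=
  Quot.lift (fun c => if Region a b c.2 then dev a b c else 0) (by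
    rintro _ _ (⟨a', q, y⟩ | ⟨b', q, x⟩)
    · by_cases h : Region a b (wall a', y)
      · obtain rfl := wall_ne h.1
        simp only [dev_flipX]
      · simp only [h, if_false]
    · by_cases h : Region a b (x, wall b')
      · obtain rfl := wall_ne h.2
        simp only [dev_flipY]
      · simp only [h, if_false])

theorem starDev_point {a b : Bool} {c : Cell n} (h : Region a b c.2) :
    O.starDev a b (O.point c) = dev a b c := if_pos h

/-- The difference of two developed coordinates depends only on the quarter, and in a direction
where the corners agree it vanishes. So it survives the gluings inside both stars and is locally
constant. -/
theorem starDev_locally {a b a' b' : Bool} {ν ν' : Fin n ⊕ ℕ} {p : O.Surface}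
    (hp : p ∈ O.star a b ν) (hp' : p ∈ O.star a' b' ν') :
    ∃ c, ∀ᶠ y in 𝓝 p, O.starDev a b y = O.starDev a' b' y + c := by
  obtain ⟨c₀, rfl⟩ := O.exists_rep p
  set D : Quarter n → ℂ := fun q =>
    ⟨if a = a' then 0 else sgn q.2.1 * (wall a' - wall a : ℝ),
      if b = b' then 0 else sgn q.2.2 * (wall b' - wall b : ℝ)⟩ with hD
  set Q : O.Surface → Prop := Quot.lift
    (fun c => Region a b c.2 ∧ Region a' b' c.2 ∧ D c.1 = D c₀.1) (by
      rintro _ _ (⟨α, q, y⟩ | ⟨β, q, x⟩)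
      · refine propext (and_congr_right fun h1 => and_congr_right fun h2 => ?_)
        obtain rfl := wall_ne h1.1
        obtain rfl := wall_ne h2.1
        simp only [hD, flipX_bits, if_true]
      · refine propext (and_congr_right fun h1 => and_congr_right fun h2 => ?_)
        obtain rfl := wall_ne h1.2
        obtain rfl := wall_ne h2.2
        simp only [hD, flipY_bits, if_true]) with hQ
  have hopen : IsOpen {y | Q y} := by
    rw [← O.isQuotientMap_point.isOpen_preimage]
    exact ((isOpen_region a b).preimage continuous_snd).inter
      (((isOpen_region a' b').preimage continuous_snd).inter
        ((isOpen_discrete {q | D q = D c₀.1}).preimage continuous_fst))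
  refine ⟨D c₀.1, ?_⟩
  filter_upwards [hopen.mem_nhds
    (show Q (O.point c₀) from ⟨(O.mem_star.1 hp).1, (O.mem_star.1 hp').1, rfl⟩)] with y hy
  obtain ⟨c, rfl⟩ := O.exists_rep y
  obtain ⟨h1, h2, h3⟩ : Region a b c.2 ∧ Region a' b' c.2 ∧ D c.1 = D c₀.1 := hy
  rw [O.starDev_point h1, O.starDev_point h2, ← h3]
  apply Complex.ext
  · simp only [dev, hD, Complex.add_re]
    split_ifs with h
    · rw [h]; ring
    · ring
  · simp only [dev, hD, Complex.add_im]
    split_ifs with h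
    · rw [h]; ring
    · ring

theorem eq_wall_of_isSing {p : O.Surface} (h : IsSing (O.nodeAt p)) :
    O.coordX p = wall false ∧ O.coordY p = wall false := by
  obtain ⟨c, rfl⟩ := O.exists_rep p
  rw [nodeAt_point, isSing_node] at h
  exact ⟨nonzero_eq_false.1 h.1, nonzero_eq_false.1 h.2.1⟩

theorem zeta_corner {q : Quarter n} (h : IsSing (O.node false false q)) :
    O.zeta false false (q, (wall false, wall false)) = 0 := by
  have h1 := O.zeta_pow (c := (q, (wall false, wall false))) h
  have h2 : dev false false (q, (wall false, wall false)) = 0 := by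
    apply Complex.ext <;> simp [dev]
  rw [h2] at h1
  simpa using h1

theorem point_corner_eq {q q' : Quarter n} (h : IsSing (O.node false false q))
    (hn : O.node false false q = O.node false false q') :
    O.point (q, (wall false, wall false)) = O.point (q', (wall false, wall false)) :=
  O.point_eq hn (by rw [O.zeta_corner h, O.zeta_corner (hn ▸ h)])

/-- The chart at a point. -/
noncomputable def localChart (p : O.Surface) : OpenPartialHomeomorph O.Surface ℂ :=
  (O.starHomeo (nonzero (O.coordX p)) (nonzero (O.coordY p)) (O.nodeAt p)).transHomeomorph
    (Homeomorph.addRight (-O.starCoord (nonzero (O.coordX p)) (nonzero (O.coordY p)) p))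

theorem localChart_apply (p y : O.Surface) : O.localChart p y =
    O.starCoord (nonzero (O.coordX p)) (nonzero (O.coordY p)) y -
      O.starCoord (nonzero (O.coordX p)) (nonzero (O.coordY p)) p := (sub_eq_add_neg _ _).symm

theorem localChart_source (p : O.Surface) : (O.localChart p).source =
    O.star (nonzero (O.coordX p)) (nonzero (O.coordY p)) (O.nodeAt p) := rfl

/-- The developed coordinate is a local primitive of the differential: the chart is its cube root at
a singular vertex and equals it up to a constant elsewhere. -/
theorem localChart_pow {p y : O.Surface} (hy : y ∈ (O.localChart p).source) :
    O.localChart p y ^ ((if IsSing (O.nodeAt p) then 2 else 0) + 1) =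
      O.starDev (nonzero (O.coordX p)) (nonzero (O.coordY p)) y -
      O.starDev (nonzero (O.coordX p)) (nonzero (O.coordY p)) p := by
  rw [localChart_apply]
  rw [localChart_source] at hy
  have hp := O.mem_star_self p
  by_cases hs : IsSing (O.nodeAt p)
  · obtain ⟨hx, hy'⟩ := O.eq_wall_of_isSing hs
    rw [if_pos hs]
    rw [nonzero_eq_false.2 hx, nonzero_eq_false.2 hy'] at *
    obtain ⟨c, rfl⟩ := O.exists_rep y
    obtain ⟨⟨q, x', y'⟩, rfl⟩ := O.exists_rep p
    obtain rfl : x' = wall false := hx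
    obtain rfl : y' = wall false := hy'
    obtain ⟨h1, h2⟩ := O.mem_star.1 hy
    obtain ⟨h3, h4⟩ := O.mem_star.1 hp
    have h5 : dev false false (q, (wall false, wall false)) = 0 := by
      apply Complex.ext <;> simp [dev]
    rw [O.starDev_point h1, O.starDev_point h3, O.starCoord_point h1, O.starCoord_point h3,
      O.zeta_corner (h4 ▸ hs), h5, sub_zero, sub_zero, O.zeta_pow (h2 ▸ hs)]
  · rw [if_neg hs, zero_add, pow_one]
    obtain ⟨c, rfl⟩ := O.exists_rep y
    obtain ⟨c', rfl⟩ := O.exists_rep p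
    obtain ⟨h1, h2⟩ := O.mem_star.1 hy
    obtain ⟨h3, h4⟩ := O.mem_star.1 hp
    rw [O.starDev_point h1, O.starDev_point h3, O.starCoord_point h1, O.starCoord_point h3,
      O.zeta_of_not (h2 ▸ hs), O.zeta_of_not (h4 ▸ hs)]

/-- The translation surface of an origami. -/
noncomputable def surface : TranslationSurface O.Surface where
  ord p := if IsSing (O.nodeAt p) then 2 else 0
  chart p := O.localChart p
  mem_source p := O.mem_star_self p
  chart_self p := by rw [localChart_apply, sub_self]
  compat p q x hp hq := by
    obtain ⟨c, hc⟩ := O.starDev_locally hp hq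
    refine ⟨O.starDev (nonzero (O.coordX q)) (nonzero (O.coordY q)) q -
      O.starDev (nonzero (O.coordX p)) (nonzero (O.coordY p)) p + c, ?_⟩
    filter_upwards [hc, (O.localChart p).open_source.mem_nhds hp,
      (O.localChart q).open_source.mem_nhds hq] with y h1 h2 h3
    rw [O.localChart_pow h2, O.localChart_pow h3, h1]
    ring

theorem surface_ord_ne {p : O.Surface} : O.surface.ord p ≠ 0 ↔ IsSing (O.nodeAt p) := by
  show (if IsSing (O.nodeAt p) then 2 else 0) ≠ 0 ↔ _
  by_cases h : IsSing (O.nodeAt p) <;> simp [h]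

theorem surface_ord_eq {p : O.Surface} (h : IsSing (O.nodeAt p)) : O.surface.ord p = 2 := if_pos h

theorem surface_pow {p y : O.Surface} (hy : y ∈ (O.surface.chart p).source) :
    O.surface.chart p y ^ (O.surface.ord p + 1) =
      O.starDev (nonzero (O.coordX p)) (nonzero (O.coordY p)) y -
      O.starDev (nonzero (O.coordX p)) (nonzero (O.coordY p)) p := O.localChart_pow hy

theorem inStratumTwoTwo (h : ∀ k < 2, ∃ i, O.vert i = k) : O.surface.InStratumTwoTwo := by
  obtain ⟨i, hi⟩ := h 0 (by norm_num)
  obtain ⟨j, hj⟩ := h 1 (by norm_num)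
  have hz : nonzero (wall false) = false := nonzero_eq_false.2 rfl
  set P : Fin n → O.Surface := fun i => O.point ((i, false, false), (wall false, wall false))
  have hnode : ∀ i, O.nodeAt (P i) = Sum.inr (O.vert i) := fun i => by
    rw [nodeAt_point]; simp only [hz]; rfl
  refine ⟨P i, P j, fun hij => ?_, O.surface_ord_eq ?_, O.surface_ord_eq ?_, fun x hx hx' => ?_⟩
  · have := congrArg O.nodeAt hij
    rw [hnode, hnode, Sum.inr.injEq] at this
    omega
  · rw [hnode, hi]; exact (by norm_num : 0 < 2)
  · rw [hnode, hj]; exact (by norm_num : 1 < 2)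
  · by_contra hne
    have hs := O.surface_ord_ne.1 hne
    obtain ⟨h1, h2⟩ := O.eq_wall_of_isSing hs
    obtain ⟨⟨q, x', y'⟩, rfl⟩ := O.exists_rep x
    obtain rfl : x' = wall false := h1
    obtain rfl : y' = wall false := h2
    rw [nodeAt_point] at hs
    simp only [hz] at hs
    have hk := (O.isSing_node.1 hs).2.2
    have hq : ∀ i, O.vert (O.base false false q) = O.vert i →
        O.point (q, (wall false, wall false)) = P i := fun i hi =>
      O.point_corner_eq hs (congrArg Sum.inr hi)
    have : O.vert (O.base false false q) = 0 ∨ O.vert (O.base false false q) = 1 := by omega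
    rcases this with h0 | h0
    · exact hx (hq i (h0.trans hi.symm))
    · exact hx' (hq j (h0.trans hj.symm))

end Origami

/-! ### Half turns of square-tiled surfaces -/

namespace Origami

variable {n : ℕ} (O : Origami n) [NeZero n]

/-- A rotation by `π` of an origami that fixes the vertices `0` and `1`. -/
structure HalfTurn where
  half : Fin n → Fin n
  half_half : ∀ i, half (half i) = i
  half_right : ∀ i, half (O.right i) = O.right.symm (half i)
  half_up : ∀ i, half (O.up i) = O.up.symm (half i)
  vert_half : ∀ i, O.vert i < 2 → O.vert (O.right (O.up (half i))) = O.vert i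

namespace HalfTurn

variable {O} (H : O.HalfTurn)

def quarter (q : Quarter n) : Quarter n := (H.half q.1, !q.2.1, !q.2.2)

theorem half_right_symm (i : Fin n) : H.half (O.right.symm i) = O.right (H.half i) := by
  have := H.half_right (O.right.symm i)
  rw [O.right.apply_symm_apply] at this
  rw [this, O.right.apply_symm_apply]

theorem half_up_symm (i : Fin n) : H.half (O.up.symm i) = O.up (H.half i) := by
  have := H.half_up (O.up.symm i)
  rw [O.up.apply_symm_apply] at this
  rw [this, O.up.apply_symm_apply]

theorem quarter_flipX (a : Bool) (q : Quarter n) :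
    H.quarter (O.flipX a q) = O.flipX a (H.quarter q) := by
  rcases q with ⟨i, bx, bY⟩
  cases a <;> cases bx <;> simp [quarter, flipX, half_right, half_right_symm]

theorem quarter_flipY (b : Bool) (q : Quarter n) :
    H.quarter (O.flipY b q) = O.flipY b (H.quarter q) := by
  rcases q with ⟨i, bx, bY⟩
  cases b <;> cases bY <;> simp [quarter, flipY, half_up, half_up_symm]

/-- The half-turn on the surface. -/
def toFun : O.Surface → O.Surface :=
  Quot.map (fun c => (H.quarter c.1, c.2)) (by
    rintro _ _ (⟨a, q, y⟩ | ⟨b, q, x⟩)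
    · rw [quarter_flipX]; exact Step.x a _ y
    · rw [quarter_flipY]; exact Step.y b _ x)

theorem toFun_point (c : Cell n) : H.toFun (O.point c) = O.point (H.quarter c.1, c.2) := rfl

theorem coordX_toFun (p : O.Surface) : O.coordX (H.toFun p) = O.coordX p := by
  obtain ⟨c, rfl⟩ := O.exists_rep p
  rfl

theorem coordY_toFun (p : O.Surface) : O.coordY (H.toFun p) = O.coordY p := by
  obtain ⟨c, rfl⟩ := O.exists_rep p
  rfl

theorem continuous_toFun : Continuous H.toFun := by
  rw [O.isQuotientMap_point.continuous_iff]
  have : Continuous H.quarter := continuous_of_discreteTopology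
  exact O.isQuotientMap_point.continuous.comp
    ((this.comp continuous_fst).prodMk continuous_snd)

theorem starDev_toFun (a b : Bool) (p : O.Surface) :
    O.starDev a b (H.toFun p) = -O.starDev a b p := by
  classical
  obtain ⟨c, rfl⟩ := O.exists_rep p
  rw [toFun_point]
  by_cases h : Region a b c.2
  · rw [O.starDev_point h, O.starDev_point (c := (H.quarter c.1, c.2)) h]
    apply Complex.ext <;> simp [dev, quarter, sgn_not]
  · show (if Region a b c.2 then _ else _) = -(if Region a b c.2 then _ else _)
    rw [if_neg h, if_neg h, neg_zero]

/-- The map keeps folded coordinates and exchanges halves in both directions, so it negates every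
developed coordinate. `vert_half` says that the upper right vertex of the rotated square is the
original lower left one, which fixes the singular vertices. -/
theorem isHalfTurn : O.surface.IsHalfTurn H.toFun := by
  refine ⟨H.continuous_toFun, fun p => ?_, fun p => ?_, fun p hp => ?_⟩
  · obtain ⟨⟨⟨i, bx, bY⟩, z⟩, rfl⟩ := O.exists_rep p
    simp [toFun_point, quarter, H.half_half]
  · filter_upwards [(O.surface.chart p).open_source.mem_nhds (O.surface.mem_source p),
      H.continuous_toFun.continuousAt.preimage_mem_nhds
        ((O.surface.chart (H.toFun p)).open_source.mem_nhds (O.surface.mem_source _))] with y h1 h2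
    rw [O.surface_pow h1, O.surface_pow h2, coordX_toFun, coordY_toFun, starDev_toFun,
      starDev_toFun]
    ring
  · have hs := O.surface_ord_ne.1 hp
    obtain ⟨h1, h2⟩ := O.eq_wall_of_isSing hs
    obtain ⟨⟨q, x', y'⟩, rfl⟩ := O.exists_rep p
    obtain rfl : x' = wall false := h1
    obtain rfl : y' = wall false := h2
    have hz : nonzero (wall false) = false := nonzero_eq_false.2 rfl
    rw [nodeAt_point] at hs
    simp only [hz] at hs
    obtain ⟨q₁, h3, h4⟩ := O.exists_bits false false q (false, false)
    rw [← O.point_corner_eq (h4 ▸ hs) h4, toFun_point]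
    obtain ⟨i, _⟩ := q₁
    obtain rfl := h3
    have h5 := (O.isSing_node.1 (h4 ▸ hs)).2.2
    refine (O.point_corner_eq (h4 ▸ hs) ?_).symm
    simpa [node, base, quarter] using (H.vert_half i (by simpa [base] using h5)).symm

end HalfTurn

end Origami

/-! ### Developing maps of vertical strips of squares -/

namespace Origami

variable {n : ℕ} (O : Origami n) [NeZero n]

/-- The side length of a square is `2`; this folds one half of the side onto the unit interval. -/
noncomputable def fold (b : Bool) (t : ℝ) : unitInterval :=
  Set.projIcc 0 1 zero_le_one (if b then 2 - t else t)

theorem continuous_fold (b : Bool) : Continuous (fold b) :=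
  continuous_projIcc.comp (by cases b <;> simp <;> fun_prop)

theorem coe_fold {b : Bool} {t : ℝ} (h : if b then 1 ≤ t ∧ t ≤ 2 else 0 ≤ t ∧ t ≤ 1) :
    (fold b t : ℝ) = if b then 2 - t else t := by
  rw [fold, Set.projIcc_of_mem]
  cases b <;> simp at h ⊢
  · exact h
  · exact ⟨h.2, by linarith⟩

theorem fold_false_zero : fold false 0 = wall false := by
  apply Subtype.ext; rw [coe_fold] <;> simp [wall]

theorem fold_true_two : fold true 2 = wall false := by
  apply Subtype.ext; rw [coe_fold] <;> norm_num [wall]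

theorem fold_one (b : Bool) : fold b 1 = wall true := by
  apply Subtype.ext; rw [coe_fold] <;> cases b <;> norm_num [wall]

theorem fold_not (b : Bool) (t : ℝ) : fold (!b) (2 - t) = fold b t := by
  cases b <;> simp [fold]

/-- The point with coordinates `(x, t)` of a square, seen from one of its quarters. -/
noncomputable def square (i : Fin n) (bx bY : Bool) (x t : ℝ) : O.Surface :=
  O.point ((i, bx, bY), (fold bx x, fold bY t))

theorem square_one_fst (i : Fin n) (bx bY : Bool) (t : ℝ) :
    O.square i (!bx) bY 1 t = O.square i bx bY 1 t := by
  simp only [square, fold_one]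
  exact O.point_flipX true (i, bx, bY) _

theorem square_one_snd (i : Fin n) (bx bY : Bool) (x : ℝ) :
    O.square i bx (!bY) x 1 = O.square i bx bY x 1 := by
  simp only [square, fold_one]
  exact O.point_flipY true (i, bx, bY) _

theorem square_right (i : Fin n) (bY : Bool) (t : ℝ) :
    O.square (O.right i) false bY 0 t = O.square i true bY 2 t := by
  simp only [square, fold_false_zero, fold_true_two]
  exact O.point_flipX false (i, true, bY) _

theorem square_up (i : Fin n) (bx : Bool) (x : ℝ) :
    O.square (O.up i) bx false x 0 = O.square i bx true x 2 := by
  simp only [square, fold_false_zero, fold_true_two]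
  exact O.point_flipY false (i, bx, true) _

theorem continuous_square (i : Fin n) (bx bY : Bool) :
    Continuous fun z : ℝ × ℝ => O.square i bx bY z.1 z.2 :=
  O.isQuotientMap_point.continuous.comp (continuous_const.prodMk
    (((continuous_fold bx).comp continuous_fst).prodMk ((continuous_fold bY).comp continuous_snd)))

/-- The coordinate `t` lies in the half of `[0, 2]` named by `b`. -/
def InHalf (b : Bool) (t : ℝ) : Prop := if b then 1 ≤ t ∧ t ≤ 2 else 0 ≤ t ∧ t ≤ 1

theorem InHalf.not {b : Bool} {t : ℝ} (h : InHalf b t) : InHalf (!b) (2 - t) := by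
  cases b <;> simp [InHalf] at h ⊢ <;> constructor <;> linarith

theorem InHalf.nonneg {b : Bool} {t : ℝ} (h : InHalf b t) : 0 ≤ t := by
  cases b <;> simp [InHalf] at h <;> linarith

theorem InHalf.le_two {b : Bool} {t : ℝ} (h : InHalf b t) : t ≤ 2 := by
  cases b <;> simp [InHalf] at h <;> linarith

theorem exists_inHalf {t : ℝ} (h0 : 0 ≤ t) (h2 : t ≤ 2) : ∃ b, InHalf b t := by
  rcases le_total t 1 with h | h
  · exact ⟨false, h0, h⟩
  · exact ⟨true, h, h2⟩

open Classical in
/-- The developing map of the vertical strip that starts with a given square. -/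
noncomputable def strip (i : Fin n) (z : ℂ) : O.Surface :=
  O.square ((O.up ^ ⌊z.im / 2⌋) i) (decide (1 < z.re)) (decide (1 < z.im - 2 * ⌊z.im / 2⌋))
    z.re (z.im - 2 * ⌊z.im / 2⌋)

/-- The definition picks one quarter by rounding; on a side common to two quarters the gluing makes
the choice irrelevant. -/
theorem strip_eq_square (i : Fin n) {z : ℂ} {bx bY : Bool} {m : ℤ} (hx : InHalf bx z.re)
    (hy : InHalf bY (z.im - 2 * m)) :
    O.strip i z = O.square ((O.up ^ m) i) bx bY z.re (z.im - 2 * m) := by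
  have key : ∀ (j : Fin n) (cY : Bool) (x t : ℝ), InHalf bx x →
      O.square j (decide (1 < x)) cY x t = O.square j bx cY x t := by
    intro j cY x t h
    rcases lt_trichotomy 1 x with h1 | rfl | h1
    · cases bx
      · exact absurd h.2 (not_le.2 h1)
      · simp [h1]
    · cases bx
      · simp
      · simpa using O.square_one_fst j true cY t
    · cases bx
      · simp [h1.not_gt]
      · exact absurd h.1 (not_le.2 h1)
  rw [strip, key _ _ _ _ hx]
  have h0 := hy.nonneg
  rcases hy.le_two.lt_or_eq with h2 | h2
  · have hm : ⌊z.im / 2⌋ = m := by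
      rw [Int.floor_eq_iff]; constructor <;> linarith
    rw [hm]
    generalize z.im - 2 * m = t at hy
    rcases lt_trichotomy 1 t with h1 | rfl | h1
    · cases bY
      · exact absurd hy.2 (not_le.2 h1)
      · simp [h1]
    · cases bY
      · simp
      · simpa using O.square_one_snd _ bx true z.re
    · cases bY
      · simp [h1.not_gt]
      · exact absurd hy.1 (not_le.2 h1)
  · have hm : ⌊z.im / 2⌋ = m + 1 := by
      rw [Int.floor_eq_iff]; push_cast; constructor <;> linarith
    have hz : z.im - 2 * ((m + 1 : ℤ) : ℝ) = 0 := by push_cast; linarith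
    rw [hm, hz, h2]
    cases bY
    · exact absurd hy.2 (by rw [h2]; norm_num)
    · rw [show decide ((1 : ℝ) < 0) = false by simp, add_comm m 1, zpow_add, zpow_one,
        Equiv.Perm.mul_apply, square_up]

/-- Every point of a closed strip lies in some quarter. -/
theorem exists_quarter {z : ℂ} (hz : z ∈ closedStrip 2) :
    ∃ bx bY, ∃ m : ℤ, InHalf bx z.re ∧ InHalf bY (z.im - 2 * m) := by
  obtain ⟨bx, hx⟩ := exists_inHalf hz.1 hz.2
  have h1 := Int.floor_le (z.im / 2)
  have h2 := Int.lt_floor_add_one (z.im / 2)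
  obtain ⟨bY, hy⟩ := exists_inHalf (t := z.im - 2 * ⌊z.im / 2⌋) (by linarith) (by linarith)
  exact ⟨bx, bY, _, hx, hy⟩

theorem strip_add (i : Fin n) (k : ℤ) {z z' : ℂ} (hz : z ∈ closedStrip 2)
    (h : z' = z + (2 * k : ℝ) * Complex.I) : O.strip i z' = O.strip ((O.up ^ k) i) z := by
  obtain ⟨bx, bY, m, hx, hy⟩ := exists_quarter hz
  have hre : z'.re = z.re := by rw [h]; simp
  have him : z'.im - 2 * ((m + k : ℤ) : ℝ) = z.im - 2 * m := by
    rw [h]; simp; ring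
  rw [O.strip_eq_square _ hx hy, O.strip_eq_square i (m := m + k) (z := z') (hre ▸ hx)
    (him ▸ hy), hre, him, zpow_add, Equiv.Perm.mul_apply]

theorem strip_right (i : Fin n) {k : ℤ} {y : ℝ} (h0 : 2 * k ≤ y) (h2 : y ≤ 2 * k + 2) :
    O.strip i (2 + y * Complex.I) =
      O.strip (O.right ((O.up ^ k) i)) ((y - 2 * k : ℝ) * Complex.I) := by
  obtain ⟨bY, hy⟩ := exists_inHalf (t := y - 2 * k) (by linarith) (by linarith)
  rw [O.strip_eq_square (bx := true) (bY := bY) (m := k), O.strip_eq_square (bx := false)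
    (bY := bY) (m := 0)]
  · simp [square_right]
  · simp [InHalf]
  · simpa using hy
  · simp [InHalf]
  · simpa using hy

/-- The closed quarters form a locally finite cover of the strip, and on each of them the map is
that of a single quarter. -/
theorem continuousOn_strip (i : Fin n) : ContinuousOn (O.strip i) (closedStrip 2) := by
  have h1 : closedStrip 2 ⊆ ⋃ p : Bool × Bool × ℤ,
      {z : ℂ | InHalf p.1 z.re ∧ InHalf p.2.1 (z.im - 2 * p.2.2)} := fun z hz => by
    obtain ⟨bx, bY, m, hx, hy⟩ := exists_quarter hz
    exact Set.mem_iUnion.2 ⟨(bx, bY, m), hx, hy⟩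
  have hcl : ∀ b, IsClosed {t | InHalf b t} := fun b => by
    cases b
    · exact isClosed_Icc (a := (0 : ℝ)) (b := 1)
    · exact isClosed_Icc (a := (1 : ℝ)) (b := 2)
  refine ContinuousOn.mono ?_ h1
  refine LocallyFinite.continuousOn_iUnion ?_ (fun p => ?_) fun p => ?_
  · intro z
    refine ⟨{u | |u.im - z.im| < 1}, ?_, ?_⟩
    · exact (isOpen_lt (by fun_prop) continuous_const).mem_nhds (by simp)
    · have hfin : (Set.univ ×ˢ Set.univ ×ˢ Set.Icc (⌊z.im / 2⌋ - 2) (⌊z.im / 2⌋ + 2) :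
          Set (Bool × Bool × ℤ)).Finite :=
        Set.finite_univ.prod (Set.finite_univ.prod (Set.finite_Icc _ _))
      refine hfin.subset ?_
      rintro ⟨bx, bY, m⟩ ⟨u, ⟨-, hu⟩, hu'⟩
      have e1 := hu.nonneg
      have e2 := hu.le_two
      simp only [Set.mem_ofPred_eq, abs_lt] at hu' e1 e2
      have e3 := Int.floor_le (z.im / 2)
      have e4 := Int.lt_floor_add_one (z.im / 2)
      refine ⟨trivial, trivial, ?_, ?_⟩
      · have : (⌊z.im / 2⌋ : ℝ) < (m + 2 : ℤ) := by push_cast; linarith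
        have := Int.cast_lt.1 this
        show ⌊z.im / 2⌋ - 2 ≤ m
        omega
      · have : (m : ℝ) < (⌊z.im / 2⌋ + 2 : ℤ) := by push_cast; linarith
        have := Int.cast_lt.1 this
        show m ≤ ⌊z.im / 2⌋ + 2
        omega
  · exact ((hcl p.1).preimage Complex.continuous_re).inter
      ((hcl p.2.1).preimage (by fun_prop : Continuous fun z : ℂ => z.im - 2 * p.2.2))
  · refine ContinuousOn.congr (Continuous.continuousOn ?_) fun z hz =>
      O.strip_eq_square i hz.1 hz.2
    exact (O.continuous_square _ _ _).comp (Complex.continuous_re.prodMk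
      (by fun_prop : Continuous fun z : ℂ => z.im - 2 * p.2.2))

/-- The corner `(a, b)` at the lower left quarter of a square. -/
def corner (a b : Bool) (j : Fin n) : Fin n ⊕ ℕ := if a || b then Sum.inl j else Sum.inr (O.vert j)

def bit (a : Bool) : ℝ := if a then 1 else 0

/-- Corner kinds with `a = false` lie on the left side of the strip and those with `a = true` on its
core. When the point is below a vertex, its square is one lower than the square naming that vertex,
hence the correction of `m` to `k`. -/
theorem strip_mem_star (i : Fin n) {a b : Bool} {k : ℤ} {z : ℂ} (hz : z ∈ closedStrip 2)
    (hx : |z.re - bit a| < 1) (hy : |z.im - (2 * k + bit b)| < 1) :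
    O.strip i z ∈ O.star a b (O.corner a b ((O.up ^ k) i)) ∧
      O.starDev a b (O.strip i z) = z - (bit a + (2 * k + bit b : ℝ) * Complex.I) := by
  obtain ⟨bx, hbx, hbx'⟩ : ∃ bx, InHalf bx z.re ∧ (a = false → bx = false) := by
    cases a
    · rw [abs_lt] at hx
      exact ⟨false, ⟨hz.1, by simpa [bit] using hx.2.le⟩, fun _ => rfl⟩
    · obtain ⟨bx, h⟩ := exists_inHalf hz.1 hz.2
      exact ⟨bx, h, by simp⟩
  rw [abs_lt] at hx hy
  obtain ⟨bY, m, hbY, hm⟩ : ∃ bY, ∃ m : ℤ, InHalf bY (z.im - 2 * m) ∧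
      m + (if bY && !b then 1 else 0) = k := by
    cases b
    · simp only [bit, Bool.false_eq_true, if_false] at hy
      rcases le_total (2 * (k : ℝ)) z.im with h | h
      · exact ⟨false, k, ⟨by linarith, by linarith⟩, by simp⟩
      · refine ⟨true, k - 1, ⟨?_, ?_⟩, by simp⟩ <;> push_cast <;> linarith
    · simp only [bit, if_true] at hy
      obtain ⟨bY, h⟩ := exists_inHalf (t := z.im - 2 * k) (by linarith) (by linarith)
      exact ⟨bY, k, h, by simp⟩
  have hfx := coe_fold hbx
  have hfy := coe_fold hbY
  have hreg : Region a b (fold bx z.re, fold bY (z.im - 2 * m)) := by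
    constructor <;> rw [ne_wall, abs_lt]
    · simp only [hfx]
      cases a <;> cases bx <;> simp [bit, wall] at hx hbx' ⊢ <;> constructor <;> linarith [hbx.1]
    · simp only [hfy]
      rw [← hm] at hy
      cases b <;> cases bY <;> simp [bit, wall] at hy ⊢ <;> constructor <;> linarith
  rw [O.strip_eq_square i hbx hbY, square]
  refine ⟨O.mem_star.2 ⟨hreg, ?_⟩, ?_⟩
  · have hbase : O.base a b ((O.up ^ m) i, bx, bY) = (O.up ^ k) i := by
      have : (bx && !a) = false := by cases a <;> simp_all
      rw [← hm, add_comm, zpow_add]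
      cases hb : (bY && !b) <;> simp [base, this, hb]
    simp only [node, corner, hbase]
  · rw [O.starDev_point hreg]
    apply Complex.ext
    · simp only [dev, hfx]
      cases a <;> cases bx <;> simp [bit, wall, sgn] at hbx' ⊢ <;> ring
    · simp only [dev, hfy, ← hm]
      cases b <;> cases bY <;> simp [bit, wall, sgn] <;> ring

theorem coordY_strip (i : Fin n) {z : ℂ} {b : Bool} (h : O.coordY (O.strip i z) ≠ wall (!b)) :
    ∃ k : ℤ, |z.im - (2 * k + bit b)| < 1 := by
  have h1 := Int.floor_le (z.im / 2)
  have h2 := Int.lt_floor_add_one (z.im / 2)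
  change fold (decide (1 < z.im - 2 * ⌊z.im / 2⌋)) (z.im - 2 * ⌊z.im / 2⌋) ≠ wall (!b) at h
  obtain ⟨t, ht⟩ : ∃ t, z.im - 2 * ⌊z.im / 2⌋ = t := ⟨_, rfl⟩
  rw [ht] at h
  have ht0 : 0 ≤ t := by linarith
  have ht2 : t < 2 := by linarith
  cases b
  · rcases lt_trichotomy 1 t with h3 | rfl | h3
    · exact ⟨⌊z.im / 2⌋ + 1, by rw [abs_lt]; push_cast; constructor <;> simp [bit] <;> linarith⟩
    · exact absurd (fold_one _) h
    · exact ⟨⌊z.im / 2⌋, by rw [abs_lt]; constructor <;> simp [bit] <;> linarith⟩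
  · rcases ht0.eq_or_lt with rfl | h3
    · exact absurd (by rw [show decide ((1 : ℝ) < 0) = false by simp]; exact fold_false_zero) h
    · exact ⟨⌊z.im / 2⌋, by rw [abs_lt]; constructor <;> simp [bit] <;> linarith⟩

/-- A point of an open strip determines its position up to the vertical translations. -/
theorem strip_eq_strip {i i' : Fin n} {z z' : ℂ} (hz : z ∈ openStrip 2) (hz' : z' ∈ openStrip 2)
    (h : O.strip i z = O.strip i' z') :
    ∃ k k' : ℤ, (O.up ^ k) i = (O.up ^ k') i' ∧ z' = z + (2 * (k' - k) : ℝ) * Complex.I := by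
  have hb := ne_wall_nonzero (O.coordY (O.strip i z))
  generalize nonzero (O.coordY (O.strip i z)) = b at hb
  obtain ⟨k, hk⟩ := O.coordY_strip i hb
  obtain ⟨k', hk'⟩ := O.coordY_strip i' (h ▸ hb)
  have hre : ∀ {z : ℂ}, z ∈ openStrip 2 → |z.re - bit true| < 1 := fun hz => by
    rw [abs_lt]; constructor <;> simp [bit] <;> linarith [hz.1, hz.2]
  obtain ⟨h1, h2⟩ := O.strip_mem_star i ⟨hz.1.le, hz.2.le⟩ (hre hz) hk
  obtain ⟨h3, h4⟩ := O.strip_mem_star i' ⟨hz'.1.le, hz'.2.le⟩ (hre hz') hk'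
  rw [h] at h1 h2
  refine ⟨k, k', ?_, ?_⟩
  · simpa [corner] using h1.symm.trans h3
  · have h5 := h2.symm.trans h4
    push_cast at h5 ⊢
    linear_combination -h5

end Origami

/-! ### Vertical geodesics on square-tiled surfaces and tilings by a configuration -/

namespace Origami

variable {n : ℕ} (O : Origami n) [NeZero n]

theorem ord_eq_zero {p : O.Surface} {a b : Bool} {ν : Fin n ⊕ ℕ} (hp : p ∈ O.star a b ν)
    (hν : ¬IsSing ν) : O.surface.ord p = 0 := by
  by_contra h
  have hs := O.surface_ord_ne.1 h
  obtain ⟨h1, h2⟩ := O.eq_wall_of_isSing hs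
  obtain ⟨⟨q, x, y⟩, rfl⟩ := O.exists_rep p
  obtain rfl : x = wall false := h1
  obtain rfl : y = wall false := h2
  obtain ⟨⟨h3, h4⟩, h5⟩ := O.mem_star.1 hp
  obtain rfl : false = a := wall_ne h3
  obtain rfl : false = b := wall_ne h4
  rw [nodeAt_point] at hs
  simp only [show nonzero (wall false) = false from nonzero_eq_false.2 rfl] at hs
  exact hν (h5 ▸ hs)

theorem chart_pow_starDev {p : O.Surface} {a b : Bool} {ν : Fin n ⊕ ℕ} (hp : p ∈ O.star a b ν) :
    ∀ᶠ y in 𝓝 p, y ∈ (O.surface.chart p).source ∧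
      O.surface.chart p y ^ (O.surface.ord p + 1) = O.starDev a b y - O.starDev a b p := by
  obtain ⟨c, hc⟩ := O.starDev_locally (O.mem_star_self p) hp
  have h0 := hc.self_of_nhds
  filter_upwards [hc, (O.surface.chart p).open_source.mem_nhds (O.surface.mem_source p)] with y h1 h2
  refine ⟨h2, ?_⟩
  rw [O.surface_pow h2, h1, h0]
  ring

/-- On the open strip corners of the core, `a = true`, suffice; they are never singular, and there
the developed coordinate is `z` up to a constant. -/
theorem isTransAt_strip (i : Fin n) {z : ℂ} (hz : z ∈ openStrip 2) :
    O.surface.IsTransAt (O.strip i) z := by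
  have hb := ne_wall_nonzero (O.coordY (O.strip i z))
  generalize nonzero (O.coordY (O.strip i z)) = b at hb
  obtain ⟨k, hk⟩ := O.coordY_strip i hb
  have hre : ∀ {z : ℂ}, z ∈ openStrip 2 → |z.re - bit true| < 1 := fun hz => by
    rw [abs_lt]; constructor <;> simp [bit] <;> linarith [hz.1, hz.2]
  have hsub : openStrip 2 ⊆ closedStrip 2 := fun z hz => ⟨hz.1.le, hz.2.le⟩
  obtain ⟨h1, h2⟩ := O.strip_mem_star i (hsub hz) (hre hz) hk
  have hopen : openStrip 2 ∈ 𝓝 z :=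
    ((isOpen_lt continuous_const Complex.continuous_re).inter
      (isOpen_lt Complex.continuous_re continuous_const)).mem_nhds hz
  have hcont : ContinuousAt (O.strip i) z :=
    (O.continuousOn_strip i).continuousAt (Filter.mem_of_superset hopen hsub)
  have hord := O.ord_eq_zero h1 (by simp [corner, IsSing])
  refine ⟨hord, ?_⟩
  have hk' : ∀ᶠ u : ℂ in 𝓝 z, |u.im - (2 * k + bit b)| < 1 :=
    (isOpen_lt (by fun_prop) continuous_const).mem_nhds hk
  filter_upwards [hopen, hk', hcont.eventually (O.chart_pow_starDev h1)] with u h3 h4 h5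
  refine ⟨h5.1, ?_⟩
  have h6 := h5.2
  rw [hord, zero_add, pow_one] at h6
  rw [h6, h2, (O.strip_mem_star i (hsub h3) (hre h3) h4).2]
  ring

theorem starDev_im_eq_zero {p : O.Surface} {a : Bool} (h : O.coordY p = wall false) :
    (O.starDev a false p).im = 0 := by
  classical
  obtain ⟨⟨q, x, y⟩, rfl⟩ := O.exists_rep p
  obtain rfl : y = wall false := h
  show (if Region a false (x, wall false) then _ else _ : ℂ).im = 0
  split_ifs
  · simp [dev]
  · rfl

theorem strip_add_nat (i : Fin n) (k : ℕ) {z z' : ℂ} (hz : z ∈ closedStrip 2)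
    (h : z' = z + (2 * k : ℝ) * Complex.I) : O.strip i z' = O.strip (O.up^[k] i) z := by
  rw [O.strip_add i k hz (by exact_mod_cast h), zpow_natCast, Equiv.Perm.iterate_eq_pow]

theorem mul_I_mem (t : ℝ) : (t : ℂ) * Complex.I ∈ closedStrip 2 := by
  constructor <;> simp

/-- The sequence `g` of squares runs from time `A` on along the saddle connections in a list. -/
def Runs {n : ℕ} {ι : Type*} (u : Fin n → Fin n) (sad : ι → Fin n) (len : ι → ℕ) (g : ℕ → Fin n) : ℕ → List ι → Prop
  | _, [] => True
  | A, e :: L => (∀ k < len e, g (A + k) = u^[k] (sad e)) ∧ Runs u sad len g (A + len e) L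

/-- A combinatorial presentation of a configuration on an origami: the saddle connection `e` is the
left side of the squares `sad e, up (sad e), …`, and the cylinder `j` consists of the squares
`cyl j, up (cyl j), …`. -/
structure Tiling (H : O.HalfTurn) (K : Configuration) where
  sad : Fin K.numSad → Fin n
  len : Fin K.numSad → ℕ
  cyl : Fin K.numCyl → Fin n
  height : Fin K.numCyl → ℕ
  twist : Fin K.numCyl → ℕ
  len_pos : ∀ e, 0 < len e
  height_pos : ∀ j, 0 < height j
  exists_sad : ∀ i, ∃ e, ∃ k < len e, O.up^[k] (sad e) = i
  sad_unique : ∀ e e', ∀ k < len e, ∀ k' < len e', O.up^[k] (sad e) = O.up^[k'] (sad e') →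
    e = e' ∧ k = k'
  exists_cyl : ∀ i, ∃ j, ∃ k < height j, O.up^[k] (cyl j) = i
  cyl_unique : ∀ j j', ∀ k < height j, ∀ k' < height j',
    O.up^[k] (cyl j) = O.up^[k'] (cyl j') → j = j' ∧ k = k'
  iterate_height : ∀ j, O.up^[height j] (cyl j) = cyl j
  vert_sad : ∀ e, O.vert (sad e) < 2
  vert_end : ∀ e, O.vert (O.up^[len e] (sad e)) < 2
  vert_mid : ∀ e, ∀ k < len e, 0 < k → 2 ≤ O.vert (O.up^[k] (sad e))
  left_height : ∀ j, ((K.left j).map len).sum = height j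
  right_height : ∀ j, ((K.right j).map len).sum = height j
  left_runs : ∀ j, Runs O.up sad len (fun k => O.up^[k] (cyl j)) 0 (K.left j)
  right_runs : ∀ j, Runs O.up sad len (fun k => O.right (O.up^[k] (cyl j))) (twist j) (K.right j)
  inv_cyl : ∀ j, ∃ k < height j, O.up^[k] (cyl (K.cylInv j)) = H.half (cyl j)
  inv_len : ∀ e, len (K.sadInv e) = len e
  inv_sad : ∀ e, ∀ k < len e, O.right (H.half (O.up^[k] (sad e))) =
    O.up^[len e - 1 - k] (sad (K.sadInv e))

end Origami

/-! ### From a tiling to a geometric realization -/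

namespace Origami

variable {n : ℕ} {O : Origami n} [NeZero n]

/-- Squares have side 2, so the rotation about the centre of a square is `z ↦ 2 + 2 * I - z`; it
reverses the order of the squares above one another. -/
theorem HalfTurn.toFun_strip (H : O.HalfTurn) (i : Fin n) {z z' : ℂ} (hz : z ∈ closedStrip 2)
    (h : z' = 2 + 2 * Complex.I - z) : H.toFun (O.strip i z) = O.strip (H.half i) z' := by
  obtain ⟨bx, bY, m, hx, hy⟩ := exists_quarter hz
  have hre : z'.re = 2 - z.re := by rw [h]; simp
  have him : z'.im - 2 * ((-m : ℤ) : ℝ) = 2 - (z.im - 2 * m) := by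
    rw [h]; simp; ring
  have hpow : ∀ m : ℕ, ∀ i, H.half ((O.up ^ m) i) = (O.up⁻¹ ^ m) (H.half i) := by
    intro m
    induction m with
    | zero => simp
    | succ m ih =>
      intro i
      rw [pow_succ, pow_succ', Equiv.Perm.mul_apply, Equiv.Perm.mul_apply, ih, H.half_up]
      rw [← Equiv.Perm.mul_apply, ← Equiv.Perm.mul_apply]
      congr 1
      exact (Commute.refl (O.up⁻¹)).pow_left m
  have hpow' : ∀ m : ℕ, ∀ i, H.half ((O.up⁻¹ ^ m) i) = (O.up ^ m) (H.half i) := by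
    intro m i
    have := hpow m ((O.up⁻¹ ^ m) i)
    rw [← Equiv.Perm.mul_apply, inv_pow, mul_inv_cancel, Equiv.Perm.one_apply] at this
    rw [this, inv_pow, ← Equiv.Perm.mul_apply, mul_inv_cancel, Equiv.Perm.one_apply]
  have hhalf : H.half ((O.up ^ m) i) = (O.up ^ (-m)) (H.half i) := by
    obtain ⟨k, rfl | rfl⟩ := m.eq_nat_or_neg
    · rw [zpow_natCast, hpow, zpow_neg, zpow_natCast, inv_pow]
    · rw [neg_neg, zpow_natCast, ← hpow', zpow_neg, zpow_natCast, inv_pow]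
  rw [O.strip_eq_square i hx hy, O.strip_eq_square (bx := !bx) (bY := !bY) (m := -m) _
    (hre ▸ hx.not) (him ▸ hy.not), hre, him, square, square, fold_not, fold_not, ← hhalf]
  rfl

namespace Tiling

variable {H : O.HalfTurn} {K : Configuration} (T : O.Tiling H K)

/-- The saddle connections of a tiling. -/
noncomputable def path (e : Fin K.numSad) (t : ℝ) : O.Surface :=
  O.strip (T.sad e) (t * Complex.I)

theorem path_eq (e : Fin K.numSad) (k : ℕ) (t : ℝ) :
    T.path e t = O.strip (O.up^[k] (T.sad e)) ((t - 2 * k : ℝ) * Complex.I) :=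
  O.strip_add_nat _ k (mul_I_mem _) (by push_cast; ring)

theorem continuous_path (e : Fin K.numSad) : Continuous (T.path e) :=
  (O.continuousOn_strip _).comp_continuous (by fun_prop) mul_I_mem

theorem ord_even {i : Fin n} (k : ℕ) (h : O.vert (O.up^[k] i) < 2) :
    O.surface.ord (O.strip i ((2 * k : ℝ) * Complex.I)) ≠ 0 := by
  rw [O.strip_add_nat i k (z := 0) (by simp [closedStrip]) (by simp), surface_ord_ne,
    O.strip_eq_square (bx := false) (bY := false) (m := 0)]
  · have hz : nonzero (wall false) = false := nonzero_eq_false.2 rfl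
    simp only [square, nodeAt_point, Complex.zero_re, Complex.zero_im, Int.cast_zero, mul_zero,
      sub_zero, fold_false_zero, hz]
    simpa [node, base, IsSing] using h
  · simp [InHalf]
  · simp [InHalf]

theorem isSing_corner {b : Bool} {j : Fin n} :
    IsSing (O.corner false b j) ↔ b = false ∧ O.vert j < 2 := by
  cases b <;> simp [corner, IsSing]

/-- Either the point is the midpoint level of a side or near it, where the corner is regular, or its
height is an even number `2 * k` strictly inside, where `vert_mid` excludes a singular vertex. -/
theorem path_mem_star {e : Fin K.numSad} {t : ℝ} (ht : t ∈ Set.Ioo 0 (2 * T.len e : ℝ)) :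
    ∃ b, b = nonzero (O.coordY (T.path e t)) ∧ ∃ k < T.len e,
      ¬IsSing (O.corner false b (O.up^[k] (T.sad e))) ∧ |t - (2 * k + bit b)| < 1 := by
  refine ⟨_, rfl, ?_⟩
  have hb := ne_wall_nonzero (O.coordY (T.path e t))
  obtain ⟨b, hb'⟩ : ∃ b, b = nonzero (O.coordY (T.path e t)) := ⟨_, rfl⟩
  rw [← hb'] at hb ⊢
  obtain ⟨k, hk⟩ := O.coordY_strip (T.sad e) hb
  simp only [Complex.mul_im, Complex.ofReal_re, Complex.I_im, mul_one, Complex.ofReal_im,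
    Complex.I_re, mul_zero, add_zero] at hk
  cases b
  · have hc := nonzero_eq_false.1 hb'.symm
    obtain ⟨-, h2⟩ := O.strip_mem_star (T.sad e) (z := t * Complex.I) (a := false) (b := false)
      (k := k) (mul_I_mem t) (by simp [bit]) (by simpa using hk)
    have h3 := congrArg Complex.im h2
    change (O.starDev false false (T.path e t)).im = _ at h3
    rw [O.starDev_im_eq_zero hc] at h3
    have htk : t = 2 * k := by simp [bit] at h3; linarith
    rw [htk] at ht
    have hk0 : (0 : ℝ) < k := by linarith [ht.1]
    lift k to ℕ using by exact_mod_cast hk0.le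
    have hk1 : k < T.len e := by
      have := ht.2
      simp only [Int.cast_natCast] at this
      exact_mod_cast (by linarith : (k : ℝ) < T.len e)
    refine ⟨k, hk1, ?_, by simpa using hk⟩
    rw [isSing_corner]
    have := T.vert_mid e k hk1 (by exact_mod_cast hk0)
    omega
  · simp only [bit, if_true, abs_lt] at hk
    have hk0 : 0 ≤ k := by
      have : (-1 : ℝ) < k := by linarith [ht.1]
      have : -1 < k := by exact_mod_cast this
      omega
    lift k to ℕ using hk0
    simp only [Int.cast_natCast] at hk
    refine ⟨k, ?_, by simp [isSing_corner], by simpa [bit, abs_lt] using hk⟩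
    exact_mod_cast (by linarith [ht.2] : (k : ℝ) < T.len e)

theorem path_star (e : Fin K.numSad) {k : ℕ} {b : Bool} {t : ℝ} (ht : |t - (2 * k + bit b)| < 1) :
    T.path e t ∈ O.star false b (O.corner false b (O.up^[k] (T.sad e))) ∧
      O.starDev false b (T.path e t) = (t - (2 * k + bit b) : ℝ) * Complex.I := by
  obtain ⟨h1, h2⟩ := O.strip_mem_star (T.sad e) (z := t * Complex.I) (a := false) (b := b)
    (k := k) (mul_I_mem t) (by simp [bit]) (by simpa using ht)
  rw [zpow_natCast, ← Equiv.Perm.iterate_eq_pow] at h1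
  refine ⟨h1, h2.trans ?_⟩
  simp [bit]
  ring

theorem isVerticalSaddle_path (e : Fin K.numSad) :
    O.surface.IsVerticalSaddle (T.path e) (2 * T.len e) := by
  have hpos := T.len_pos e
  refine ⟨by positivity, (T.continuous_path e).continuousOn, ?_, ?_, fun t ht => ?_⟩
  · have := ord_even 0 (i := T.sad e) (T.vert_sad e)
    simpa [path] using this
  · have := ord_even (T.len e) (T.vert_end e)
    simpa [path] using this
  · obtain ⟨b, -, k, -, hs, hk⟩ := T.path_mem_star ht
    obtain ⟨h1, h2⟩ := T.path_star e hk
    have hord := O.ord_eq_zero h1 hs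
    refine ⟨hord, ?_⟩
    have hk' : ∀ᶠ u : ℝ in 𝓝 t, |u - (2 * k + bit b)| < 1 :=
      (isOpen_lt (by fun_prop) continuous_const).mem_nhds hk
    filter_upwards [hk', (T.continuous_path e).continuousAt.eventually (O.chart_pow_starDev h1)]
      with u h3 h4
    refine ⟨h4.1, ?_⟩
    have h5 := h4.2
    rw [hord, zero_add, pow_one] at h5
    rw [h5, h2, (T.path_star e h3).2]
    push_cast
    ring

theorem path_injective (e e' : Fin K.numSad) {t t' : ℝ} (ht : t ∈ Set.Ioo 0 (2 * T.len e : ℝ))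
    (ht' : t' ∈ Set.Ioo 0 (2 * T.len e' : ℝ)) (h : T.path e t = T.path e' t') :
    e = e' ∧ t = t' := by
  obtain ⟨b, hb, k, hk, hs, hkt⟩ := T.path_mem_star ht
  obtain ⟨b', hb', k', hk', hs', hkt'⟩ := T.path_mem_star ht'
  obtain rfl : b = b' := by rw [hb, hb', h]
  obtain ⟨h1, h2⟩ := T.path_star e hkt
  obtain ⟨h3, h4⟩ := T.path_star e' hkt'
  rw [h] at h1 h2
  have hc : O.corner false b (O.up^[k] (T.sad e)) = O.corner false b (O.up^[k'] (T.sad e')) :=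
    Option.some.inj (h1.symm.trans h3)
  have hsq : O.up^[k] (T.sad e) = O.up^[k'] (T.sad e') := by
    rw [isSing_corner] at hs
    cases b
    · simp only [corner, Bool.or_self, Bool.false_eq_true, if_false, Sum.inr.injEq] at hc
      exact O.inj _ _ hc fun hlt => absurd ⟨rfl, hlt⟩ hs
    · simpa [corner] using hc
  obtain ⟨rfl, rfl⟩ := T.sad_unique _ _ _ hk _ hk' hsq
  refine ⟨rfl, ?_⟩
  have := congrArg Complex.im (h2.symm.trans h4)
  simpa using this

theorem zpow_cyl (j : Fin K.numCyl) (k : ℤ) :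
    ∃ r < T.height j, (O.up ^ k) (T.cyl j) = O.up^[r] (T.cyl j) ∧ (r : ℤ) = k % T.height j := by
  have hpos : (0 : ℤ) < T.height j := by exact_mod_cast T.height_pos j
  have h0 := Int.emod_nonneg k hpos.ne'
  have h1 := Int.emod_lt_of_pos k hpos
  lift k % T.height j to ℕ using h0 with r hr
  refine ⟨r, by exact_mod_cast h1, ?_, rfl⟩
  have h2 : (O.up ^ (T.height j : ℤ)) (T.cyl j) = T.cyl j := by
    rw [zpow_natCast, ← Equiv.Perm.iterate_eq_pow, T.iterate_height]
  have h3 := Equiv.Perm.zpow_apply_eq_self_of_apply_eq_self h2 (k / T.height j)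
  conv_lhs => rw [← Int.emod_add_mul_ediv k (T.height j), ← hr, zpow_add, zpow_mul,
    Equiv.Perm.mul_apply, h3, zpow_natCast, ← Equiv.Perm.iterate_eq_pow]

theorem zpow_cyl_eq {j j' : Fin K.numCyl} {k k' : ℤ}
    (h : (O.up ^ k) (T.cyl j) = (O.up ^ k') (T.cyl j')) :
    j = j' ∧ (T.height j : ℤ) ∣ k' - k := by
  obtain ⟨r, h1, h2, h3⟩ := T.zpow_cyl j k
  obtain ⟨r', h1', h2', h3'⟩ := T.zpow_cyl j' k'
  obtain ⟨rfl, rfl⟩ := T.cyl_unique _ _ _ h1 _ h1' (h2.symm.trans (h.trans h2'))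
  exact ⟨rfl, Int.ModEq.dvd (h3.symm.trans h3')⟩

/-- Points with equal image in the open strip come from the same square up to powers of `up`; as the
squares of the cylinder form a cycle of exact length `height j`, the shift is a multiple of the
period. -/
theorem isCylinderMap (j : Fin K.numCyl) :
    O.surface.IsCylinderMap (O.strip (T.cyl j)) 2 (2 * T.height j) := by
  have hpos := T.height_pos j
  refine ⟨by norm_num, by positivity, fun z hz => O.isTransAt_strip _ hz, fun z hz z' hz' => ?_⟩
  constructor
  · intro h
    obtain ⟨k, k', h1, h2⟩ := O.strip_eq_strip hz hz' h
    obtain ⟨-, m, hm⟩ := T.zpow_cyl_eq h1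
    refine ⟨m, h2.trans ?_⟩
    have hm' : (k' : ℂ) - k = T.height j * m := by exact_mod_cast hm
    push_cast
    rw [hm']
    ring
  · rintro ⟨m, rfl⟩
    refine ((O.strip_add (T.cyl j) (T.height j * m) ⟨hz.1.le, hz.2.le⟩
      (by push_cast; ring)).trans ?_).symm
    rw [zpow_mul, Equiv.Perm.zpow_apply_eq_self_of_apply_eq_self]
    rw [zpow_natCast, ← Equiv.Perm.iterate_eq_pow, T.iterate_height]

theorem runsAlong {β : ℝ → O.Surface} {g : ℕ → Fin n} (hβ : ∀ (k : ℕ) (y : ℝ), 2 * k ≤ y →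
    y ≤ 2 * k + 2 → β y = O.strip (g k) ((y - 2 * k : ℝ) * Complex.I))
    (L : List (Fin K.numSad)) (A : ℕ) (h : Runs O.up T.sad T.len g A L) :
    RunsAlong β T.path (fun e => 2 * (T.len e : ℝ)) (2 * A) L := by
  induction L generalizing A with
  | nil => trivial
  | cons e L ih =>
    refine ⟨fun t ht => ?_, ?_⟩
    · obtain ⟨k, hk, h1, h2⟩ : ∃ k < T.len e, 2 * (k : ℝ) ≤ t ∧ t ≤ 2 * k + 2 := by
        have hpos := T.len_pos e
        rcases ht.2.lt_or_eq with h2 | h2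
        · have h3 := Nat.floor_le (show 0 ≤ t / 2 by linarith [ht.1])
          have h4 := Nat.lt_floor_add_one (t / 2)
          refine ⟨⌊t / 2⌋₊, ?_, by linarith, by linarith⟩
          exact_mod_cast (by linarith : (⌊t / 2⌋₊ : ℝ) < T.len e)
        · refine ⟨T.len e - 1, by omega, ?_, ?_⟩ <;> rw [h2] <;> push_cast [Nat.cast_sub hpos] <;>
            linarith
      rw [hβ (A + k) _ (by push_cast; linarith) (by push_cast; linarith), h.1 k hk,
        T.path_eq e k]
      congr 2
      push_cast
      ring
    · have := ih (A + T.len e) h.2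
      rwa [show (2 * ((A + T.len e : ℕ) : ℝ)) = 2 * A + 2 * T.len e by push_cast; ring] at this

/-- Inside a square the point lies in a cylinder. On a left side it lies on a saddle connection,
strictly inside since it is regular, and a right side is the left side of the neighbouring square.
-/
theorem cover (p : O.Surface) (hp : O.surface.ord p = 0) :
    (∃ j, p ∈ O.strip (T.cyl j) '' openStrip 2) ∨
      ∃ e, p ∈ T.path e '' Set.Ioo 0 (2 * T.len e : ℝ) := by
  have hfold : ∀ (b : Bool) (x : unitInterval), ∃ t, InHalf b t ∧ fold b t = x := fun b x => by
    cases b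
    · exact ⟨x, x.2, Subtype.ext (by rw [coe_fold] <;> simp [x.2.1, x.2.2])⟩
    · have h1 := x.2.1
      have h2 := x.2.2
      refine ⟨2 - x, ⟨by linarith, by linarith⟩, Subtype.ext ?_⟩
      rw [coe_fold]
      · simp
      · exact ⟨by linarith, by linarith⟩
  obtain ⟨⟨⟨i, bx, bY⟩, X, Y⟩, rfl⟩ := O.exists_rep p
  obtain ⟨x, hx, rfl⟩ := hfold bx X
  obtain ⟨t, ht, rfl⟩ := hfold bY Y
  have hi : O.point ((i, bx, bY), (fold bx x, fold bY t)) = O.strip i ⟨x, t⟩ := by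
    rw [O.strip_eq_square (m := 0) i hx (by simpa using ht)]
    simp [square]
  have haxis : ∀ i, O.surface.ord (O.strip i (t * Complex.I)) = 0 →
      ∃ e, O.strip i (t * Complex.I) ∈ T.path e '' Set.Ioo 0 (2 * T.len e : ℝ) := by
    intro i h
    obtain ⟨e, k, hk, rfl⟩ := T.exists_sad i
    have hpk : O.strip (O.up^[k] (T.sad e)) (t * Complex.I) = T.path e (t + 2 * k) := by
      rw [T.path_eq e k]; congr 2; push_cast; ring
    have hs := T.isVerticalSaddle_path e
    rw [hpk] at h ⊢
    have hk' : (k : ℝ) + 1 ≤ T.len e := by exact_mod_cast hk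
    refine ⟨e, _, ⟨lt_of_le_of_ne ?_ fun h' => hs.2.2.1 (h' ▸ h),
      lt_of_le_of_ne ?_ fun h' => hs.2.2.2.1 (h' ▸ h)⟩, rfl⟩
    · have := ht.nonneg
      positivity
    · linarith [ht.le_two]
  rw [hi] at hp ⊢
  rcases hx.nonneg.eq_or_lt with rfl | h0
  · have : (⟨0, t⟩ : ℂ) = t * Complex.I := Complex.ext (by simp) (by simp)
    rw [this] at hp ⊢
    exact Or.inr (haxis i hp)
  rcases hx.le_two.lt_or_eq with h2 | rfl
  · obtain ⟨j, k, -, rfl⟩ := T.exists_cyl i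
    refine Or.inl ⟨j, ⟨x, t⟩ + (2 * k : ℝ) * Complex.I, ?_, ?_⟩
    · simpa [openStrip] using ⟨h0, h2⟩
    · exact O.strip_add_nat _ k ⟨hx.nonneg, hx.le_two⟩ rfl
  · have h3 : (⟨2, t⟩ : ℂ) = 2 + t * Complex.I := Complex.ext (by simp) (by simp)
    rw [h3, O.strip_right i (k := 0) (by simpa using ht.nonneg) (by simpa using ht.le_two)] at hp ⊢
    simp only [zpow_zero, Equiv.Perm.one_apply, Int.cast_zero, mul_zero, sub_zero] at hp ⊢
    exact Or.inr (haxis _ hp)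

theorem image_strip_iterate (i : Fin n) (k : ℕ) :
    O.strip (O.up^[k] i) '' openStrip 2 = O.strip i '' openStrip 2 := by
  have hre : ∀ (z : ℂ) (s : ℝ), (z + s * Complex.I).re = z.re := fun z s => by simp
  ext p
  constructor
  · rintro ⟨z, hz, rfl⟩
    refine ⟨z + (2 * k : ℝ) * Complex.I, ?_, O.strip_add_nat i k ⟨hz.1.le, hz.2.le⟩ rfl⟩
    rwa [openStrip, Set.mem_ofPred_eq, hre]
  · rintro ⟨z, hz, rfl⟩
    refine ⟨z + (-(2 * k) : ℝ) * Complex.I, ?_, ?_⟩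
    · rwa [openStrip, Set.mem_ofPred_eq, hre]
    · refine (O.strip_add_nat i k ?_ (by push_cast; ring)).symm
      exact ⟨(hre z _).symm ▸ hz.1.le, (hre z _).symm ▸ hz.2.le⟩

theorem image_toFun (j : Fin K.numCyl) : H.toFun '' (O.strip (T.cyl j) '' openStrip 2) =
    O.strip (T.cyl (K.cylInv j)) '' openStrip 2 := by
  obtain ⟨k, -, hk⟩ := T.inv_cyl j
  rw [← image_strip_iterate (T.cyl (K.cylInv j)) k, hk, Set.image_image]
  have hmem : ∀ z ∈ openStrip 2, 2 + 2 * Complex.I - z ∈ openStrip 2 := fun z hz => by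
    constructor <;> simp <;> linarith [hz.1, hz.2]
  ext p
  constructor
  · rintro ⟨z, hz, rfl⟩
    exact ⟨_, hmem z hz, (H.toFun_strip _ ⟨hz.1.le, hz.2.le⟩ rfl).symm⟩
  · rintro ⟨z, hz, rfl⟩
    exact ⟨_, hmem z hz, H.toFun_strip _ ⟨(hmem z hz).1.le, (hmem z hz).2.le⟩ (by ring)⟩

theorem toFun_path (e : Fin K.numSad) {t : ℝ} (ht : t ∈ Set.Icc 0 (2 * T.len e : ℝ)) :
    H.toFun (T.path e t) = T.path (K.sadInv e) (2 * T.len e - t) := by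
  obtain ⟨k, hk, h1, h2⟩ : ∃ k < T.len e, 2 * (k : ℝ) ≤ t ∧ t ≤ 2 * k + 2 := by
    have hpos := T.len_pos e
    rcases ht.2.lt_or_eq with h2 | h2
    · have h3 := Nat.floor_le (show 0 ≤ t / 2 by linarith [ht.1])
      have h4 := Nat.lt_floor_add_one (t / 2)
      refine ⟨⌊t / 2⌋₊, ?_, by linarith, by linarith⟩
      exact_mod_cast (by linarith : (⌊t / 2⌋₊ : ℝ) < T.len e)
    -- The upper end belongs to the last square, not to the one after it.
    · refine ⟨T.len e - 1, by omega, ?_, ?_⟩ <;> rw [h2] <;> push_cast [Nat.cast_sub hpos] <;>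
        linarith
  rw [T.path_eq e k, H.toFun_strip (z' := 2 + (2 - (t - 2 * k) : ℝ) * Complex.I) _ (mul_I_mem _)
    (by push_cast; ring), O.strip_right (k := 0) _ (by push_cast; linarith)
    (by push_cast; linarith), zpow_zero, Equiv.Perm.one_apply, T.inv_sad e k hk,
    T.path_eq _ (T.len e - 1 - k)]
  congr 2
  rw [Nat.cast_sub (by omega), Nat.cast_sub (by omega)]
  push_cast
  ring

/-- The geometric realization given by a tiling. -/
noncomputable def realization : O.surface.Realization H.toFun K where
  saddle := T.path
  length e := 2 * T.len e
  cyl j := O.strip (T.cyl j)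
  width _ := 2
  height j := 2 * T.height j
  twist j := 2 * T.twist j
  saddle_vertical := T.isVerticalSaddle_path
  saddle_disjoint e e' t ht t' ht' h := T.path_injective e e' ht ht' h
  cyl_map := T.isCylinderMap
  cyl_continuous j := O.continuousOn_strip _
  cyl_disjoint j j' hj := by
    rw [Set.disjoint_left]
    rintro _ ⟨z, hz, rfl⟩ ⟨z', hz', h⟩
    obtain ⟨k, k', h1, -⟩ := O.strip_eq_strip hz hz' h.symm
    exact hj (T.zpow_cyl_eq h1).1
  cover := T.cover
  left_height j := by
    rw [← T.left_height j, List.sum_map_mul_left]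
    push_cast [List.map_map]
    rfl
  right_height j := by
    rw [← T.right_height j, List.sum_map_mul_left]
    push_cast [List.map_map]
    rfl
  left_runs j := by
    have := T.runsAlong (β := fun y : ℝ => O.strip (T.cyl j) (y * Complex.I))
      (fun k y _ _ => O.strip_add_nat _ k (mul_I_mem _) (by push_cast; ring)) _ _ (T.left_runs j)
    simpa using this
  right_runs j := by
    refine T.runsAlong (β := fun y : ℝ => O.strip (T.cyl j) ((2 : ℝ) + y * Complex.I))
      (fun k y h0 h2 => ?_) _ _ (T.right_runs j)
    have := O.strip_right (T.cyl j) (k := k) (y := y) (by exact_mod_cast h0) (by exact_mod_cast h2)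
    rw [zpow_natCast, ← Equiv.Perm.iterate_eq_pow] at this
    simpa using this
  inv_cyl := T.image_toFun
  inv_length e := by rw [T.inv_len]
  inv_saddle e t ht := T.toFun_path e ht

end Tiling

end Origami

/-! ### Finite verification of explicit square-tiled examples -/

namespace Origami

instance decidableRuns {n : ℕ} {ι : Type*} (u : Fin n → Fin n) (sad : ι → Fin n) (len : ι → ℕ)
    (g : ℕ → Fin n) : ∀ (A : ℕ) (L : List ι), Decidable (Runs u sad len g A L)
  | _, [] => isTrue trivial
  | A, e :: L => by
    have := decidableRuns u sad len g (A + len e) L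
    exact inferInstanceAs (Decidable ((∀ k < len e, g (A + k) = u^[k] (sad e)) ∧ _))

/-- The configuration `K` occurs on a surface of the locus. -/
def _root_.Configuration.Occurs (K : Configuration) : Prop :=
  ∃ (X : Type) (_ : TopologicalSpace X) (_ : CompactSpace X) (_ : T2Space X)
    (_ : ConnectedSpace X) (S : TranslationSurface X) (τ : X → X),
    S.InLocusL τ ∧ S.IsVerticallyCompletelyPeriodic ∧ S.HasConfiguration τ K

/-- The hypothesis `hc` lets every square be reached from square 0, whence connectedness, and `hK`
gives the eight fixed points through `encard_fixedPoints`. -/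
theorem Tiling.occurs {n : ℕ} [NeZero n] {O : Origami n} {H : O.HalfTurn} {K : Configuration}
    (T : O.Tiling H K) (hv : ∀ k < 2, ∃ i, O.vert i = k)
    (hc : ∀ i, i ≠ 0 → ∃ j < i, i = O.right j ∨ i = O.up j)
    (hK : (Finset.univ.filter fun e => K.sadInv e = e).card + 2 * K.numFixed = 6) :
    K.Occurs := by
  have hconn : ∀ i, Relation.ReflTransGen (fun i j => j = O.right i ∨ j = O.up i) 0 i := by
    intro i
    induction i using WellFoundedLT.induction with
    | ind i ih =>
      by_cases hi : i = 0
      · rw [hi]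
      · obtain ⟨j, hj, h⟩ := hc i hi
        exact (ih j hj).tail h
  have hS := O.inStratumTwoTwo hv
  have R := T.realization
  have hH := H.isHalfTurn
  refine ⟨O.Surface, inferInstance, inferInstance, inferInstance, O.connectedSpace hconn,
    O.surface, H.toFun, ⟨hS, ⟨hH.continuous, hH.involutive, hH.anti, ?_⟩, hH.fix⟩,
    R.isVerticallyCompletelyPeriodic, ⟨R⟩⟩
  rw [hH.encard_fixedPoints R.saddle_vertical R.saddle_disjoint R.cyl_map R.cyl_disjoint R.cover
    R.inv_cyl R.inv_length R.inv_saddle, hS.encard, ENat.card_eq_coe_fintype_card,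
    ENat.card_eq_coe_fintype_card, Fintype.card_subtype, Fintype.card_subtype]
  rw [Configuration.numFixed] at hK
  norm_cast
  omega

/-- The segments `start e, u (start e), …` of lengths `len e` form a partition. -/
def IsPartition {n s : ℕ} (u : Fin n → Fin n) (start : Fin s → Fin n) (len : Fin s → ℕ) : Prop :=
  (∀ i, ∃ e, ∃ k < len e, u^[k] (start e) = i) ∧
  ∀ e e', ∀ k < len e, ∀ k' < len e', u^[k] (start e) = u^[k'] (start e') → e = e' ∧ k = k'

instance {n s : ℕ} (u : Fin n → Fin n) (start : Fin s → Fin n) (len : Fin s → ℕ) :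
    Decidable (IsPartition u start len) := by unfold IsPartition; infer_instance

/-- The raw data of an origami with a half-turn and a tiling. -/
structure Blueprint (n : ℕ) (K : Configuration) where
  right : Fin n → Fin n
  right_symm : Fin n → Fin n
  up : Fin n → Fin n
  up_symm : Fin n → Fin n
  half : Fin n → Fin n
  vert : Fin n → ℕ
  branch : Fin n → ZMod 3
  sad : Fin K.numSad → Fin n
  len : Fin K.numSad → ℕ
  cyl : Fin K.numCyl → Fin n
  height : Fin K.numCyl → ℕ
  twist : Fin K.numCyl → ℕ

namespace Blueprint

variable {n : ℕ} {K : Configuration} (B : Blueprint n K)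

/-- The data define an origami with a half-turn. -/
def ValidOrigami : Prop :=
  (∀ i, B.right_symm (B.right i) = i) ∧ (∀ i, B.right (B.right_symm i) = i) ∧
  (∀ i, B.up_symm (B.up i) = i) ∧ (∀ i, B.up (B.up_symm i) = i) ∧
  (∀ i, B.vert (B.up (B.right i)) = B.vert (B.right (B.up i))) ∧
  (∀ i, B.vert (B.right (B.up i)) < 2 →
    B.branch (B.up (B.right i)) = B.branch (B.right (B.up i)) + 1) ∧
  (∀ i j, B.vert i = B.vert j → (B.vert i < 2 → B.branch i = B.branch j) → i = j) ∧
  (∀ i, B.half (B.half i) = i) ∧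
  (∀ i, B.half (B.right i) = B.right_symm (B.half i)) ∧
  (∀ i, B.half (B.up i) = B.up_symm (B.half i)) ∧
  ∀ i, B.vert i < 2 → B.vert (B.right (B.up (B.half i))) = B.vert i

/-- The squares are distributed over saddle connections and cylinders. -/
def ValidSquares : Prop :=
  (∀ e, 0 < B.len e) ∧ (∀ j, 0 < B.height j) ∧
  IsPartition B.up B.sad B.len ∧ IsPartition B.up B.cyl B.height ∧
  (∀ j, B.up^[B.height j] (B.cyl j) = B.cyl j) ∧
  (∀ e, B.vert (B.sad e) < 2) ∧
  (∀ e, B.vert (B.up^[B.len e] (B.sad e)) < 2) ∧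
  ∀ e, ∀ k < B.len e, 0 < k → 2 ≤ B.vert (B.up^[k] (B.sad e))

/-- The cylinders have the prescribed boundaries, and the half-turn acts as prescribed. -/
def ValidBoundary : Prop :=
  (∀ j, ((K.left j).map B.len).sum = B.height j) ∧
  (∀ j, ((K.right j).map B.len).sum = B.height j) ∧
  (∀ j, Runs B.up B.sad B.len (fun k => B.up^[k] (B.cyl j)) 0 (K.left j)) ∧
  (∀ j, Runs B.up B.sad B.len (fun k => B.right (B.up^[k] (B.cyl j))) (B.twist j) (K.right j)) ∧
  (∀ j, ∃ k < B.height j, B.up^[k] (B.cyl (K.cylInv j)) = B.half (B.cyl j)) ∧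
  (∀ e, B.len (K.sadInv e) = B.len e) ∧
  ∀ e, ∀ k < B.len e, B.right (B.half (B.up^[k] (B.sad e))) =
    B.up^[B.len e - 1 - k] (B.sad (K.sadInv e))

/-- The data define a connected surface in the locus. -/
def ValidLocus [NeZero n] : Prop :=
  (∀ k < 2, ∃ i, B.vert i = k) ∧ (∀ i, i ≠ 0 → ∃ j < i, i = B.right j ∨ i = B.up j) ∧
  (Finset.univ.filter fun e => K.sadInv e = e).card + 2 * K.numFixed = 6

instance : Decidable B.ValidOrigami := by unfold ValidOrigami; infer_instance

instance : Decidable B.ValidSquares := by unfold ValidSquares; infer_instance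

instance : Decidable B.ValidBoundary := by unfold ValidBoundary; infer_instance

instance [NeZero n] : Decidable B.ValidLocus := by unfold ValidLocus; infer_instance

theorem occurs [NeZero n] 
    (h : B.ValidOrigami ∧ B.ValidSquares ∧ B.ValidBoundary ∧ B.ValidLocus) : K.Occurs := by
  obtain ⟨⟨h1, h2, h3, h4, h5, h6, h7, h8, h9, h10, h11⟩, ⟨k1, k2, ⟨k3, k4⟩, ⟨k5, k6⟩, k7, k8, k9,
    k10⟩, ⟨k11, k12, k13, k14, k15, k16, k17⟩, l1, l2, l3⟩ := h
  set O : Origami n := ⟨⟨B.right, B.right_symm, h1, h2⟩, ⟨B.up, B.up_symm, h3, h4⟩, B.vert,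
    B.branch, h5, h6, h7⟩
  set H : O.HalfTurn := ⟨B.half, h8, h9, h10, h11⟩
  have T : O.Tiling H K := ⟨B.sad, B.len, B.cyl, B.height, B.twist, k1, k2, k3, k4, k5, k6, k7, k8,
    k9, k10, k11, k12, k13, k14, k15, k16, k17⟩
  exact T.occurs l1 l2 l3

end Blueprint

end Origami

open Origami in
-- In types a, b and g some cylinder has boundaries with different numbers of saddle connections, so
-- the lengths cannot all be equal; the other eight examples have six squares and unit lengths.
theorem ConfigType.occurs (T : ConfigType) : T.config.Occurs := by
  cases T
  · exact Blueprint.occurs (n := 10) ⟨(![1, 3, 5, 6, 8, 9, 4, 7, 0, 2] : Fin 10 → Fin 10),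
      (![8, 0, 9, 1, 6, 2, 3, 7, 4, 5] : Fin 10 → Fin 10),
      (![2, 4, 6, 7, 5, 1, 0, 8, 9, 3] : Fin 10 → Fin 10),
      (![6, 5, 0, 9, 1, 4, 2, 3, 7, 8] : Fin 10 → Fin 10),
      (![1, 0, 5, 8, 6, 2, 4, 7, 3, 9] : Fin 10 → Fin 10),
      (![0, 1, 2, 5, 1, 1, 3, 0, 0, 4] : Fin 10 → ℕ),
      (![0, 0, 0, 0, 2, 1, 0, 2, 1, 0] : Fin 10 → ZMod 3), (![0, 1, 5, 4, 8, 7] : Fin 6 → Fin 10),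
      (![3, 1, 1, 1, 3, 1] : Fin 6 → ℕ), (![0, 1, 8] : Fin 3 → Fin 10), (![3, 3, 4] : Fin 3 → ℕ),
      (![0, 1, 0] : Fin 3 → ℕ)⟩ (by decide +kernel)
  · exact Blueprint.occurs (n := 7) ⟨(![1, 2, 0, 5, 3, 6, 4] : Fin 7 → Fin 7),
      (![2, 0, 1, 4, 6, 3, 5] : Fin 7 → Fin 7), (![0, 3, 4, 6, 5, 2, 1] : Fin 7 → Fin 7),
      (![0, 6, 5, 1, 2, 4, 3] : Fin 7 → Fin 7), (![0, 2, 1, 5, 6, 3, 4] : Fin 7 → Fin 7),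
      (![0, 0, 1, 0, 1, 1, 2] : Fin 7 → ℕ), (![0, 1, 0, 2, 2, 1, 0] : Fin 7 → ZMod 3),
      (![0, 1, 3, 2, 5, 4] : Fin 6 → Fin 7), (![1, 1, 2, 1, 1, 1] : Fin 6 → ℕ),
      (![0, 1, 2] : Fin 3 → Fin 7), (![1, 3, 3] : Fin 3 → ℕ),
      (![0, 0, 0] : Fin 3 → ℕ)⟩ (by decide +kernel)
  · exact Blueprint.occurs (n := 6) ⟨(![1, 0, 4, 5, 2, 3] : Fin 6 → Fin 6),
      (![1, 0, 4, 5, 2, 3] : Fin 6 → Fin 6), (![2, 3, 0, 1, 5, 4] : Fin 6 → Fin 6),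
      (![2, 3, 0, 1, 5, 4] : Fin 6 → Fin 6), (![0, 1, 2, 3, 4, 5] : Fin 6 → Fin 6),
      (![0, 1, 1, 0, 0, 1] : Fin 6 → ℕ), (![0, 1, 0, 2, 1, 2] : Fin 6 → ZMod 3),
      (![0, 2, 1, 4, 3, 5] : Fin 6 → Fin 6), (![1, 1, 1, 1, 1, 1] : Fin 6 → ℕ),
      (![0, 1, 4] : Fin 3 → Fin 6), (![2, 2, 2] : Fin 3 → ℕ),
      (![0, 0, 0] : Fin 3 → ℕ)⟩ (by decide +kernel)
  · exact Blueprint.occurs (n := 6) ⟨(![1, 0, 2, 4, 3, 5] : Fin 6 → Fin 6),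
      (![1, 0, 2, 4, 3, 5] : Fin 6 → Fin 6), (![0, 2, 3, 5, 4, 1] : Fin 6 → Fin 6),
      (![0, 5, 1, 2, 4, 3] : Fin 6 → Fin 6), (![0, 1, 5, 3, 4, 2] : Fin 6 → Fin 6),
      (![0, 0, 0, 1, 1, 1] : Fin 6 → ℕ), (![0, 1, 2, 0, 2, 1] : Fin 6 → ZMod 3),
      (![0, 1, 2, 3, 5, 4] : Fin 6 → Fin 6), (![1, 1, 1, 1, 1, 1] : Fin 6 → ℕ),
      (![0, 1, 4] : Fin 3 → Fin 6), (![1, 4, 1] : Fin 3 → ℕ),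
      (![0, 0, 0] : Fin 3 → ℕ)⟩ (by decide +kernel)
  · exact Blueprint.occurs (n := 6) ⟨(![1, 2, 3, 4, 0, 5] : Fin 6 → Fin 6),
      (![4, 0, 1, 2, 3, 5] : Fin 6 → Fin 6), (![0, 2, 1, 3, 5, 4] : Fin 6 → Fin 6),
      (![0, 2, 1, 3, 5, 4] : Fin 6 → Fin 6), (![3, 2, 1, 0, 4, 5] : Fin 6 → Fin 6),
      (![0, 1, 1, 1, 0, 0] : Fin 6 → ℕ), (![0, 0, 1, 2, 1, 2] : Fin 6 → ZMod 3),
      (![0, 1, 2, 3, 4, 5] : Fin 6 → Fin 6), (![1, 1, 1, 1, 1, 1] : Fin 6 → ℕ),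
      (![0, 1, 3, 4] : Fin 4 → Fin 6), (![1, 2, 1, 2] : Fin 4 → ℕ),
      (![0, 0, 0, 0] : Fin 4 → ℕ)⟩ (by decide +kernel)
  · exact Blueprint.occurs (n := 6) ⟨(![1, 2, 4, 5, 0, 3] : Fin 6 → Fin 6),
      (![4, 0, 1, 5, 2, 3] : Fin 6 → Fin 6), (![0, 3, 2, 1, 5, 4] : Fin 6 → Fin 6),
      (![0, 3, 2, 1, 5, 4] : Fin 6 → Fin 6), (![0, 4, 2, 5, 1, 3] : Fin 6 → Fin 6),
      (![0, 0, 1, 0, 1, 1] : Fin 6 → ℕ), (![0, 1, 0, 2, 1, 2] : Fin 6 → ZMod 3),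
      (![0, 1, 3, 2, 5, 4] : Fin 6 → Fin 6), (![1, 1, 1, 1, 1, 1] : Fin 6 → ℕ),
      (![0, 1, 2, 5] : Fin 4 → Fin 6), (![1, 2, 1, 2] : Fin 4 → ℕ),
      (![0, 0, 0, 1] : Fin 4 → ℕ)⟩ (by decide +kernel)
  · exact Blueprint.occurs (n := 8) ⟨(![1, 2, 4, 5, 6, 7, 0, 3] : Fin 8 → Fin 8),
      (![6, 0, 1, 7, 2, 3, 4, 5] : Fin 8 → Fin 8), (![0, 3, 5, 1, 2, 4, 7, 6] : Fin 8 → Fin 8),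
      (![0, 3, 4, 1, 5, 2, 7, 6] : Fin 8 → Fin 8), (![0, 6, 4, 7, 2, 5, 1, 3] : Fin 8 → Fin 8),
      (![0, 0, 1, 0, 1, 2, 3, 1] : Fin 8 → ℕ), (![0, 1, 0, 2, 1, 0, 0, 2] : Fin 8 → ZMod 3),
      (![0, 1, 3, 2, 4, 7] : Fin 6 → Fin 8), (![1, 1, 1, 2, 1, 2] : Fin 6 → ℕ),
      (![0, 1, 2, 7] : Fin 4 → Fin 8), (![1, 2, 3, 2] : Fin 4 → ℕ),
      (![0, 0, 0, 1] : Fin 4 → ℕ)⟩ (by decide +kernel)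
  · exact Blueprint.occurs (n := 6) ⟨(![1, 0, 4, 5, 2, 3] : Fin 6 → Fin 6),
      (![1, 0, 4, 5, 2, 3] : Fin 6 → Fin 6), (![2, 3, 5, 4, 1, 0] : Fin 6 → Fin 6),
      (![5, 4, 0, 1, 3, 2] : Fin 6 → Fin 6), (![1, 0, 4, 5, 2, 3] : Fin 6 → Fin 6),
      (![0, 1, 0, 1, 1, 0] : Fin 6 → ℕ), (![0, 0, 2, 2, 1, 1] : Fin 6 → ZMod 3),
      (![0, 2, 5, 1, 4, 3] : Fin 6 → Fin 6), (![1, 1, 1, 1, 1, 1] : Fin 6 → ℕ),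
      (![0, 1] : Fin 2 → Fin 6), (![3, 3] : Fin 2 → ℕ), (![0, 0] : Fin 2 → ℕ)⟩ (by decide +kernel)
  · exact Blueprint.occurs (n := 6) ⟨(![0, 2, 1, 5, 4, 3] : Fin 6 → Fin 6),
      (![0, 2, 1, 5, 4, 3] : Fin 6 → Fin 6), (![1, 3, 4, 0, 5, 2] : Fin 6 → Fin 6),
      (![3, 0, 5, 1, 2, 4] : Fin 6 → Fin 6), (![0, 3, 5, 1, 4, 2] : Fin 6 → Fin 6),
      (![0, 0, 0, 1, 1, 1] : Fin 6 → ℕ), (![0, 2, 1, 0, 2, 1] : Fin 6 → ZMod 3),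
      (![0, 1, 3, 2, 5, 4] : Fin 6 → Fin 6), (![1, 1, 1, 1, 1, 1] : Fin 6 → ℕ),
      (![0, 2] : Fin 2 → Fin 6), (![3, 3] : Fin 2 → ℕ), (![0, 0] : Fin 2 → ℕ)⟩ (by decide +kernel)
  · exact Blueprint.occurs (n := 6) ⟨(![1, 0, 4, 3, 2, 5] : Fin 6 → Fin 6),
      (![1, 0, 4, 3, 2, 5] : Fin 6 → Fin 6), (![2, 3, 0, 4, 5, 1] : Fin 6 → Fin 6),
      (![2, 5, 0, 1, 3, 4] : Fin 6 → Fin 6), (![2, 4, 0, 3, 1, 5] : Fin 6 → Fin 6),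
      (![0, 0, 1, 1, 1, 0] : Fin 6 → ℕ), (![0, 1, 0, 2, 1, 2] : Fin 6 → ZMod 3),
      (![0, 2, 1, 4, 3, 5] : Fin 6 → Fin 6), (![1, 1, 1, 1, 1, 1] : Fin 6 → ℕ),
      (![0, 1] : Fin 2 → Fin 6), (![2, 4] : Fin 2 → ℕ), (![0, 0] : Fin 2 → ℕ)⟩ (by decide +kernel)
  · exact Blueprint.occurs (n := 6) ⟨(![1, 0, 2, 4, 3, 5] : Fin 6 → Fin 6),
      (![1, 0, 2, 4, 3, 5] : Fin 6 → Fin 6), (![0, 2, 3, 4, 5, 1] : Fin 6 → Fin 6),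
      (![0, 5, 1, 2, 3, 4] : Fin 6 → Fin 6), (![0, 1, 5, 4, 3, 2] : Fin 6 → Fin 6),
      (![0, 0, 0, 1, 1, 1] : Fin 6 → ℕ), (![0, 1, 2, 0, 2, 1] : Fin 6 → ZMod 3),
      (![0, 1, 2, 3, 4, 5] : Fin 6 → Fin 6), (![1, 1, 1, 1, 1, 1] : Fin 6 → ℕ),
      (![0, 1] : Fin 2 → Fin 6), (![1, 5] : Fin 2 → ℕ), (![0, 0] : Fin 2 → ℕ)⟩ (by decide +kernel)

theorem mainTheorem4 :
    -- a completely periodic surface of the locus with at least two cylinders has exactly one of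
    -- the eleven configurations
    (∀ (X : Type*) [TopologicalSpace X] [CompactSpace X] [T2Space X] [ConnectedSpace X]
        (S : TranslationSurface X) (τ : X → X),
        S.InLocusL τ → S.IsVerticallyCompletelyPeriodic →
        S.verticalCylinders.encard ≤ 4 ∧
        (S.verticalCylinders.Nontrivial →
          ∃! T : ConfigType, S.HasConfiguration τ T.config) ∧
        (∀ T : ConfigType, S.HasConfiguration τ T.config →
          S.verticalCylinders.encard = T.config.numCyl)) ∧
    -- each of the eleven configurations occurs
    (∀ T : ConfigType, ∃ (X : Type) (_ : TopologicalSpace X) (_ : CompactSpace X)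
        (_ : T2Space X) (_ : ConnectedSpace X) (S : TranslationSurface X) (τ : X → X),
        S.InLocusL τ ∧ S.IsVerticallyCompletelyPeriodic ∧ S.HasConfiguration τ T.config) ∧
    -- numbers of cylinders, of fixed, of simple and of fixed simple cylinders
    (ConfigType.h.profile = (2, 0, 0, 0) ∧ ConfigType.i.profile = (2, 2, 0, 0) ∧
      ConfigType.j.profile = (2, 2, 0, 0) ∧ ConfigType.k.profile = (2, 2, 1, 1) ∧
      ConfigType.a.profile = (3, 1, 0, 0) ∧ ConfigType.b.profile = (3, 1, 1, 1) ∧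
      ConfigType.c.profile = (3, 3, 0, 0) ∧ ConfigType.d.profile = (3, 3, 2, 2) ∧
      ConfigType.e.profile = (4, 2, 2, 0) ∧ ConfigType.f.profile = (4, 2, 2, 2) ∧
      ConfigType.g.profile = (4, 2, 1, 1)) :=
  ⟨fun _ _ _ _ _ _ _ h hV => h.main hV, ConfigType.occurs, by decide +kernel⟩
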